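/- **Setting.** Let $d\ge1$, $0<s_{\min}\le s_{\max}$ and $s_{\max}>d/2$. Write $\mathcal F g(\xi)=(2\pi)^{-d/2}\int g(x)e^{-i\langle x,\xi\rangle}dx$ for the unitary Fourier transform, $\|g\|_{H^t(\mathbb R^d)}^2=\int(1+|\xi|^2)^t|\mathcal F g(\xi)|^2d\xi$, and $\|f\|_{H^t([0,1]^d)}=\inf\{\|g\|_{H^t(\mathbb R^d)}: g|_{[0,1]^d}=f \text{ a.e.}\}$. Let $\mathcal H^s(L)=\{f:\|f\|_{H^s([0,1]^d)}\le L\}$. A Sobolev extension operator (up to order $s_{\max}$) is a linear map $T$ from $L^2([0,1]^d)$ to $L^2(\mathbb R^d)$ (real functions) with $Tf=f$ a.e. on $[0,1]^d$ which is bounded from $H^t([0,1]^d)$ to $H^t(\mathbb R^d)$ for every $t\in[0,s_{\max}]$. **Model.** The data $\mathcal D_n=(X_i,Y_i)_{i\le n}$ satisfy $Y_i=f^*(X_i)+\xi_i$. The $X_i$ are i.i.d. on $[0,1]^d$ with a density $p$ satisfying $c_X\le p\le C_X$, where $c_X>0$. The noise variables $\xi_i$ are i.i.d., independent of the $X_i$,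 have mean zero, and satisfy $\mathbb E e^{\lambda\xi_i}\le e^{\lambda^2\sigma^2/2}$ for all $\lambda\in\mathbb R$. For $r\ge0$, put $B(x,r)=\{x'\in[0,1]^d:|x'-x|\le r\}$ and $$R_A(\hat f,f^*)=\mathbb E_{\mathcal D_n,X}\sup_{x'\in B(X,r)}|\hat f(x')-f^*(X)|^2,$$ where $X$ has density $p$ and is independent of $\mathcal D_n$. **Estimator.** Let $$\hat f_v=\operatorname*{argmin}_{g\in H^{s_{\max}}([0,1]^d)}\Big\{\frac1n\sum_{i=1}^n(Y_i-g(X_i))^2+\frac1v\|g\|^2_{H^{s_{\max}}([0,1]^d)}\Big\}$$ (continuous representatives), $v_i=2^{i-1}n^{\frac{2s_{\max}}{2s_{\max}+d}}$ for $1\le i\le K$, and $K=\big\lceil\log_2\big(n^{\frac{2s_{\max}}{2s_{\min}+d}}/n^{\frac{2s_{\max}}{2s_{\max}+d}}\big)\big\rceil+1$. Let $v^*$ be the smallest $v_i$ such that $$\|\hat f_{v_i}-\hat f_{v_j}\|_{L^2([0,1]^d)}\le\log^2(n)\,\frac{v_j^{d/(4s_{\max})}}{\sqrt n}\quad\text{for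 all } i<j\le K.$$ Let $\chi(\xi)=1-g\big(\tfrac{4|\xi|^2-1}{3}\big)$ with $g(t)=\frac{\varphi(t)}{\varphi(t)+\varphi(1-t)}$, where $\varphi(t)=e^{-1/t}$ for $t>0$ and $\varphi(t)=0$ for $t\le0$. Given a Sobolev extension operator $T$, let $\hat f_0$ be the restriction to $[0,1]^d$ of $\mathcal F^{-1}\big(\mathcal F(T\hat f_{v^*})\,\chi(r\,\cdot)\big)$. Put $\hat f=\hat f_0$ if $$\int_{[0,1]^d}\sup_{x'\in B(x,r)}|\hat f_0(x')-\hat f_0(x)|^2dx+\|\hat f_0\|_{L^2([0,1]^d)}\le\log n,$$ and $\hat f=0$ otherwise. **Theorem.** Sobolev extension operators up to order $s_{\max}$ exist. For each of them, and for all $s\in[s_{\min},s_{\max}]$, $L>0$, $\sigma\ge0$, $c_X>0$ and $C_X$, there is a constant $C>0$ such that for every density $p$ and noise law as above, every $n\ge2$ and every $r\ge0$, $$\sup_{f^*\in\mathcal H^s(L)}R_A(\hat f,f^*)\le C\Big(r^{2\min(1,s)}+n^{-\frac{2s}{2s+d}}\Big)\log^5 n.$$ The estimator does not depend on $s$, so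 it is adaptive to the unknown smoothness up to logarithmic factors. -/

import Mathlib

open MeasureTheory ProbabilityTheory Set
open scoped ENNReal NNReal

noncomputable section

namespace AdvKRR

/-- The closed unit cube `[0,1]^d` in Euclidean space. As a type it carries the Euclidean distance
and (as a subtype) the restriction of Lebesgue measure. -/
def cube (d : ℕ) : Set (EuclideanSpace ℝ (Fin d)) := {x | ∀ i, x i ∈ Icc (0 : ℝ) 1}

instance (d : ℕ) : MeasureSpace (cube d) := Measure.Subtype.measureSpace

/-! ### Fourier transform and Sobolev spaces -/

/-- The unitary Fourier transform
`(2π)^(-d/2) ∫ g x * exp (-i ⟪x, ξ⟫) dx` of a real function in `L²(ℝ^d)`.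
Mathlib's `L²` transform uses the phase `exp (-2πi ⟪x, w⟫)`, hence the dilation `w = ξ / (2π)`. -/
def fourierL2 {d : ℕ} (g : Lp ℝ 2 (volume : Measure (EuclideanSpace ℝ (Fin d))))
    (ξ : EuclideanSpace ℝ (Fin d)) : ℂ :=
  (((2 * Real.pi) ^ (-(d : ℝ) / 2) : ℝ) : ℂ) *
    (FourierTransform.fourier (Complex.ofRealCLM.compLp g) :
      Lp ℂ 2 (volume : Measure (EuclideanSpace ℝ (Fin d)))) ((2 * Real.pi)⁻¹ • ξ)

/-- The inverse unitary Fourier transform of an integrable function, as a genuine function. -/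
def invFourier {d : ℕ} (h : EuclideanSpace ℝ (Fin d) → ℂ) (x : EuclideanSpace ℝ (Fin d)) : ℂ :=
  (((2 * Real.pi) ^ (-(d : ℝ) / 2) : ℝ) : ℂ) *
    ∫ ξ, h ξ * Complex.exp (Complex.I * ((inner ℝ x ξ : ℝ) : ℂ))

/-- The norm of `H^s(ℝ^d)`, with value `∞` for functions of `L²` outside `H^s`. -/
def sobolevNorm {d : ℕ} (s : ℝ) (g : Lp ℝ 2 (volume : Measure (EuclideanSpace ℝ (Fin d)))) :
    ℝ≥0∞ :=
  (∫⁻ ξ, ENNReal.ofReal ((1 + ‖ξ‖ ^ 2) ^ s) * ‖fourierL2 g ξ‖ₑ ^ 2) ^ (1 / 2 : ℝ)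

/-- The quotient norm of `H^s([0,1]^d)`: the infimum of the `H^s(ℝ^d)` norms of all extensions
(`∞` for functions outside `H^s([0,1]^d)`). -/
def cubeSobolevNorm {d : ℕ} (s : ℝ) (f : cube d → ℝ) : ℝ≥0∞ :=
  ⨅ (g : Lp ℝ 2 (volume : Measure (EuclideanSpace ℝ (Fin d))))
    (_ : (fun x : cube d ↦ g (x : EuclideanSpace ℝ (Fin d))) =ᵐ[volume] f), sobolevNorm s g

/-- The Sobolev ball `ℋ^s(L)` on the cube. -/
def sobolevBall (d : ℕ) (s L : ℝ) : Set (cube d → ℝ) :=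
  {f | cubeSobolevNorm s f ≤ ENNReal.ofReal L}

/-- `T` is a Sobolev extension operator up to order `S`: it is linear from `L²([0,1]^d)` to
`L²(ℝ^d)`, extends functions, and is bounded from `H^t([0,1]^d)` to `H^t(ℝ^d)` for every order
`0 ≤ t ≤ S`. -/
structure IsSobolevExtension {d : ℕ} (S : ℝ)
    (T : Lp ℝ 2 (volume : Measure (cube d)) →ₗ[ℝ]
      Lp ℝ 2 (volume : Measure (EuclideanSpace ℝ (Fin d)))) : Prop where
  extends_self : ∀ f : Lp ℝ 2 (volume : Measure (cube d)),
    (fun x : cube d ↦ T f (x : EuclideanSpace ℝ (Fin d))) =ᵐ[volume] f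
  bounded : ∀ t ∈ Icc (0 : ℝ) S, ∃ B : ℝ≥0, ∀ f : Lp ℝ 2 (volume : Measure (cube d)),
    sobolevNorm t (T f) ≤ B * cubeSobolevNorm t f

open Classical in
/-- The class in `L²([0,1]^d)` of a square-integrable function on the cube. -/
def toL2 {d : ℕ} (f : cube d → ℝ) : Lp ℝ 2 (volume : Measure (cube d)) :=
  if h : MemLp f 2 (volume : Measure (cube d)) then h.toLp f else 0

/-! ### Adversarial risk -/

/-- The law of one noisy observation `(X, f X + ξ)`, with `X ∼ P` and `ξ ∼ ν` independent. -/
def sampleLaw {d : ℕ} (P : Measure (cube d)) (ν : Measure ℝ) (f : cube d → ℝ) :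
    Measure (cube d × ℝ) :=
  (P.prod ν).map (fun p ↦ (p.1, f p.1 + p.2))

/-- The adversarial risk: the expectation over `n` i.i.d. observations and an independent test
point `x ∼ P` of the largest squared error over perturbations of `x` of size at most `r`. -/
def advRisk {d n : ℕ} (P : Measure (cube d)) (ν : Measure ℝ) (r : ℝ)
    (fhat : (Fin n → cube d × ℝ) → cube d → ℝ) (f : cube d → ℝ) : ℝ≥0∞ :=
  ∫⁻ D, ∫⁻ x, (⨆ (x' : cube d) (_ : dist x' x ≤ r), ENNReal.ofReal (|fhat D x' - f x| ^ 2)) ∂P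
    ∂(Measure.pi fun _ : Fin n ↦ sampleLaw P ν f)

/-! ### The estimator -/

/-- The space `H^S([0,1]^d)` as a space of continuous functions; for `S > d/2` every class has
exactly one continuous representative. -/
def rkhs (d : ℕ) (S : ℝ) : Set (cube d → ℝ) := {g | Continuous g ∧ cubeSobolevNorm S g ≠ ∞}

/-- The regularized empirical risk with regularization parameter `1 / v`. -/
def krrObjective {d n : ℕ} (S v : ℝ) (D : Fin n → cube d × ℝ) (g : cube d → ℝ) : ℝ :=
  1 / (n : ℝ) * ∑ i, ((D i).2 - g (D i).1) ^ 2 + 1 / v * (cubeSobolevNorm S g).toReal ^ 2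

/-- Kernel ridge regression: the minimizer of the regularized empirical risk over
`H^S([0,1]^d)`. -/
def krr {d n : ℕ} (S v : ℝ) (D : Fin n → cube d × ℝ) : cube d → ℝ :=
  Classical.epsilon fun g ↦ g ∈ rkhs d S ∧ IsMinOn (krrObjective S v D) (rkhs d S) g

/-- The grid values `v_i = 2^(i-1) n^(2 smax / (2 smax + d))`, for `i ≥ 1`. -/
def gridValue (d n : ℕ) (smax : ℝ) (i : ℕ) : ℝ :=
  2 ^ (i - 1) * (n : ℝ) ^ (2 * smax / (2 * smax + d))

/-- The number of grid values. -/
def gridSize (d n : ℕ) (smin smax : ℝ) : ℕ :=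
  ⌈Real.logb 2 ((n : ℝ) ^ (2 * smax / (2 * smin + d)) / (n : ℝ) ^ (2 * smax / (2 * smax + d)))⌉₊
    + 1

/-- The parameter selected by the balancing principle: the smallest admissible grid value (the
largest grid value is always admissible, so this is the minimum of a finite non-empty set). -/
def lepskiValue {d n : ℕ} (smin smax : ℝ) (D : Fin n → cube d × ℝ) : ℝ :=
  sInf {v | ∃ i ∈ Finset.Icc 1 (gridSize d n smin smax), v = gridValue d n smax i ∧
    ∀ j ∈ Finset.Icc 1 (gridSize d n smin smax), i < j →
      eLpNorm (fun x ↦ krr smax (gridValue d n smax i) D x - krr smax (gridValue d n smax j) D x)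
          2 volume ≤
        ENNReal.ofReal (Real.log n ^ 2 *
          (gridValue d n smax j ^ ((d : ℝ) / (4 * smax)) / Real.sqrt n))}

/-- The radial cut-off: `1` for `‖ξ‖ ≤ 1/2`, `0` for `‖ξ‖ ≥ 1`, smooth in between. Here
`Real.smoothTransition t = φ t / (φ t + φ (1 - t))` with `φ t = exp (-1/t)` for `t > 0` and
`φ t = 0` for `t ≤ 0`. -/
def cutoff {d : ℕ} (ξ : EuclideanSpace ℝ (Fin d)) : ℝ :=
  1 - Real.smoothTransition ((4 * ‖ξ‖ ^ 2 - 1) / 3)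

/-- Frequency truncation: the function on the cube with Fourier transform `F(g) χ(r ·)`. The
inverse transform is real since `g` is real and the cut-off is even. -/
def freqTruncate {d : ℕ} (r : ℝ) (g : Lp ℝ 2 (volume : Measure (EuclideanSpace ℝ (Fin d))))
    (x : cube d) : ℝ :=
  (invFourier (fun ξ ↦ fourierL2 g ξ * (cutoff (r • ξ) : ℂ)) x).re

open Classical in
/-- The final check: `f` is kept if its local oscillation plus its norm is at most `log n`, and is
replaced by `0` otherwise. -/
def boundCheck {d : ℕ} (n : ℕ) (r : ℝ) (f : cube d → ℝ) : cube d → ℝ :=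
  if (∫⁻ x, ⨆ (x' : cube d) (_ : dist x' x ≤ r), ENNReal.ofReal (|f x' - f x| ^ 2)) +
      eLpNorm f 2 volume ≤ ENNReal.ofReal (Real.log n) then f else 0

/-- The adaptive estimator. It depends on `smin`, `smax`, `r` and the extension operator `T`, but
not on the smoothness or the norm of the regression function, nor on the noise level. -/
def adaptiveEstimator {d n : ℕ} (smin smax r : ℝ)
    (T : Lp ℝ 2 (volume : Measure (cube d)) →ₗ[ℝ]
      Lp ℝ 2 (volume : Measure (EuclideanSpace ℝ (Fin d))))
    (D : Fin n → cube d × ℝ) : cube d → ℝ :=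
  boundCheck n r (freqTruncate r (T (toL2 (krr smax (lepskiValue smin smax D) D))))

end AdvKRR

end

/-! The adversarial error at a point is at most the oscillation of the estimator over the ball of
radius `r` plus the ordinary error, so the risk is controlled by the integrated squared oscillation
and the squared L² error (`lintegral_sup_le`). The cut-off at frequency 1/r handles the oscillation.
On the surviving frequencies r|w| is bounded, and a plane wave of frequency w varies over the ball
by at most a multiple of r|w|. Split the extended ridge estimate into the extension of f* and a
difference: the difference costs no more than its squared L² norm, and the extension of f* costs
r^(2a) times its squared Sobolev norm, with a = min(1, s). The bias of the cut-off has the same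
size, and the boundedness of `T` in L² and in H^s passes between the cube and the whole space. Hence
only the L² error of the ridge estimate matters (`exists_freqTruncate_bounds`). The supremum under
the integral is removed by expanding a plane wave on the unit ball into plane waves with explicit
coefficients, followed by Plancherel (`exists_oscillation_majorant`).

Write S for s_max. For a fixed v the ridge estimate is compared with a low-frequency approximation
f₀ of f*, cut at frequency v^(1/(2S)); squared bias and penalty are then both of order v^(-s/S). The
cross term of the basic inequality is the pairing of the error with an empirical signed measure. On
the Fourier side, Cauchy-Schwarz with the weight (1 + δ|w|)^(2S), δ = v^(-1/(2S)), separates it into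
the ridge norm of the error and a random quantity of order v^(d/(2S))/n up to logarithms
(`sq_pairing_le`); no supremum over a function class is needed. The noise part of that quantity is
controlled by moments of order log n. The part coming from f* - f₀ is controlled by Chebyshev, which
leaves a failure probability of order v^(-s/S). The empirical norm dominates the L² norm up to the
penalty, because every small cell contains its share of design points and the oscillation of an H^S
function inside a cell is absorbed (`exists_sampling_inequality`).

For the choice of v, the oracle value n^(2S/(2s+d)) lies within a factor two of a grid point. From
there on the bias is dominated by the stochastic error, and for large n the extra logarithm in the
threshold makes every error at most half of the threshold. The balancing principle then picks a
value not above the oracle and loses only a constant (`lepski_error_le`), which gives log⁴ n times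
the rate. The exceptional event has probability at most a multiple of log n times the rate, and the
final check bounds the risk there by a multiple of log² n; this is why such a weak tail bound is
enough.

An extension operator is built by higher-order reflections across the faces, one axis at a time,
localized by a cut-off that forms a partition of unity with its mirror image. Boundedness in an
integer Sobolev space is tested on iterated differences: across a face by matching derivatives, and
in the other directions because the operators commute with translations. Orders in between follow
from real interpolation, where the K-functional is explicit on the Fourier side. The resulting
operator reads only the values on the cube, so the bound against one extension is a bound against
the quotient norm (`exists_isSobolevExtension`). -/

open MeasureTheory ProbabilityTheory Set
open scoped ENNReal NNReal

noncomputable section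

namespace AdvKRR

open FourierTransform

/-! ### The Fourier transform on L² and real-valued functions -/

section FourierL2

variable {E : Type*} [NormedAddCommGroup E] [InnerProductSpace ℝ E] [FiniteDimensional ℝ E]
  [MeasurableSpace E] [BorelSpace E]

/-- The inverse Fourier integral against a Schwartz function can be moved to that function. -/
theorem integral_schwartz_mul_fourierInv (φ : SchwartzMap E ℂ) {h : E → ℂ} (h1 : Integrable h) :
    ∫ x, φ x • 𝓕⁻ h x = ∫ w, (𝓕⁻ φ) w • h w := by
  have := VectorFourier.integral_fourierIntegral_smul_eq_flip (L := -(innerₗ E))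
    Real.continuous_fourierChar (by simpa using! continuous_inner.neg) φ.integrable (μ := volume) (ν := volume) h1
  simp only [SchwartzMap.fourierInv_coe]
  convert! this.symm using 2
  · ext x
    simp [Real.fourierInv_eq, VectorFourier.fourierIntegral, real_inner_comm]

theorem continuous_fourierInv_integral {h : E → ℂ} (h1 : Integrable h) : Continuous (𝓕⁻ h) := by
  have : 𝓕⁻ h = VectorFourier.fourierIntegral Real.fourierChar volume (-(innerₗ E)) h := by
    ext x
    simp [Real.fourierInv_eq, VectorFourier.fourierIntegral]
  rw [this]
  exact VectorFourier.fourierIntegral_continuous Real.continuous_fourierChar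
    (by simpa using! continuous_inner.neg) h1

/-- Both sides are locally integrable and define the same tempered distribution. Testing against
smooth compactly supported functions, regarded as Schwartz functions, moves the transform onto the
test function in either case. -/
theorem fourierInv_toLp_ae {h : E → ℂ} (h1 : Integrable h) (h2 : MemLp h 2) :
    (𝓕⁻ (h2.toLp h) : Lp ℂ 2 (volume : Measure E)) =ᵐ[volume] 𝓕⁻ h := by
  refine ae_eq_of_integral_contDiff_smul_eq ?_ ?_ ?_
  · exact (Lp.memLp _).locallyIntegrable (by norm_num)
  · exact (continuous_fourierInv_integral h1).locallyIntegrable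
  · intro g hg hgc
    have hg' : ContDiff ℝ (↑(⊤ : ℕ∞)) (fun x ↦ (g x : ℂ)) := Complex.ofRealCLM.contDiff.comp hg
    have hgc' : HasCompactSupport (fun x ↦ (g x : ℂ)) := hgc.comp_left (g := fun t : ℝ ↦ (t : ℂ)) rfl
    set φ : SchwartzMap E ℂ := hgc'.toSchwartzMap hg' with hφ
    have hφx : ∀ x, φ x = (g x : ℂ) := fun x ↦ rfl
    have e1 := congrArg (fun T ↦ T φ) (Lp.fourierInv_toTemperedDistribution_eq (h2.toLp h))
    simp only [TemperedDistribution.fourierInv_apply, Lp.toTemperedDistribution_apply] at e1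
    have e2 := integral_schwartz_mul_fourierInv φ h1
    have e3 : ∫ w, (𝓕⁻ φ) w • (h2.toLp h) w = ∫ w, (𝓕⁻ φ) w • h w := by
      refine integral_congr_ae ?_
      filter_upwards [h2.coeFn_toLp] with w hw
      rw [hw]
    rw [e3, ← e2] at e1
    simpa [hφx] using e1.symm

theorem eLpNorm_fourierInv {h : E → ℂ} (h1 : Integrable h) (h2 : MemLp h 2) :
    eLpNorm (𝓕⁻ h) 2 volume = eLpNorm h 2 volume := by
  rw [← eLpNorm_congr_ae (fourierInv_toLp_ae h1 h2), ← eLpNorm_congr_ae h2.coeFn_toLp,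
    ← Lp.enorm_def, ← Lp.enorm_def]
  have := (Lp.fourierTransformₗᵢ E ℂ).symm.norm_map (h2.toLp h)
  rw [enorm_eq_iff_norm_eq]
  exact this

theorem sq_eLpNorm_two {α F : Type*} {mα : MeasurableSpace α} {μ : Measure α} [NormedAddCommGroup F]
    (f : α → F) : eLpNorm f 2 μ ^ 2 = ∫⁻ x, ‖f x‖ₑ ^ 2 ∂μ := by
  rw [eLpNorm_eq_lintegral_rpow_enorm_toReal (by norm_num) (by norm_num), ← ENNReal.rpow_natCast,
    ← ENNReal.rpow_mul]
  simp

theorem lintegral_fourierInv_sq {h : E → ℂ} (h1 : Integrable h) (h2 : MemLp h 2) :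
    ∫⁻ x, ‖𝓕⁻ h x‖ₑ ^ 2 = ∫⁻ w, ‖h w‖ₑ ^ 2 := by
  rw [← sq_eLpNorm_two, ← sq_eLpNorm_two, eLpNorm_fourierInv h1 h2]

/-- Complex conjugation on `L²`. -/
def conjLp : Lp ℂ 2 (volume : Measure E) →L[ℝ] Lp ℂ 2 (volume : Measure E) :=
  ContinuousLinearMap.compLpL 2 volume (Complex.conjCLE : ℂ →L[ℝ] ℂ)

theorem conjLp_ae (u : Lp ℂ 2 (volume : Measure E)) :
    conjLp u =ᵐ[volume] fun x ↦ starRingEnd ℂ (u x) := by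
  filter_upwards [ContinuousLinearMap.coeFn_compLpL (p := 2) (μ := volume)
    (Complex.conjCLE : ℂ →L[ℝ] ℂ) u] with x hx
  rw [conjLp, hx]
  rfl

theorem continuous_reflect :
    Continuous (Lp.compMeasurePreserving (fun x : E ↦ -x)
      (Measure.measurePreserving_neg volume) : Lp ℂ 2 (volume : Measure E) → _) :=
  (Lp.isometry_compMeasurePreserving _).continuous

theorem fourier_conj_schwartz (φ : SchwartzMap E ℂ) (w : E) :
    𝓕 (fun x ↦ starRingEnd ℂ (φ x)) w = starRingEnd ℂ (𝓕 (φ : E → ℂ) (-w)) := by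
  rw [Real.fourier_eq, Real.fourier_eq, ← integral_conj]
  congr 1
  ext x
  simp [Circle.smul_def, Real.fourierChar_apply, ← Complex.exp_conj, Complex.conj_ofNat]

/-- Both sides are continuous in `u`, so it suffices to treat Schwartz functions, where the
transform is an integral and conjugating the integrand reflects the frequency. -/
theorem fourier_conjLp (u : Lp ℂ 2 (volume : Measure E)) :
    𝓕 (conjLp u) = conjLp (Lp.compMeasurePreserving (fun x : E ↦ -x)
      (Measure.measurePreserving_neg volume) (𝓕 u)) := by
  refine DenseRange.induction_on (p := fun u : Lp ℂ 2 (volume : Measure E) ↦ 𝓕 (conjLp u) =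
    conjLp (Lp.compMeasurePreserving (fun x : E ↦ -x)
      (Measure.measurePreserving_neg volume) (𝓕 u)))
    (SchwartzMap.denseRange_toLpCLM (p := 2) (E := E) (F := ℂ) (μ := volume) ENNReal.ofNat_ne_top) u ?_ ?_
  · refine isClosed_eq ?_ ?_
    · exact (Lp.fourierTransformₗᵢ E ℂ).continuous.comp conjLp.continuous
    · exact conjLp.continuous.comp (continuous_reflect.comp (Lp.fourierTransformₗᵢ E ℂ).continuous)
  · intro φ
    have hψ : ∃ ψ : SchwartzMap E ℂ, ∀ x, ψ x = starRingEnd ℂ (φ x) :=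
      ⟨SchwartzMap.postcompCLM (𝕜 := ℝ) (Complex.conjCLE : ℂ →L[ℝ] ℂ) φ, fun x ↦ rfl⟩
    obtain ⟨ψ, hψ⟩ := hψ
    have h1 : conjLp (φ.toLp 2) = ψ.toLp 2 := by
      apply Lp.ext
      filter_upwards [conjLp_ae (φ.toLp 2), φ.coeFn_toLp 2 volume, ψ.coeFn_toLp 2 volume] with x a b c
      rw [a, b, c, hψ]
    change 𝓕 (conjLp (φ.toLp 2)) = conjLp (Lp.compMeasurePreserving (fun x : E ↦ -x)
      (Measure.measurePreserving_neg volume) (𝓕 (φ.toLp 2)))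
    rw [h1, SchwartzMap.toLp_fourier_eq, SchwartzMap.toLp_fourier_eq]
    apply Lp.ext
    have hm := Measure.measurePreserving_neg (volume : Measure E)
    filter_upwards [conjLp_ae (Lp.compMeasurePreserving (fun x : E ↦ -x) hm ((𝓕 φ).toLp 2)),
      Lp.coeFn_compMeasurePreserving ((𝓕 φ).toLp 2) hm, (𝓕 ψ).coeFn_toLp 2 volume,
      hm.quasiMeasurePreserving.ae_eq_comp ((𝓕 φ).coeFn_toLp 2 volume)] with x a b c e
    rw [a, b, c, e]
    simp only [Function.comp, SchwartzMap.fourier_coe]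
    rw [← fourier_conj_schwartz]
    rw [funext hψ]

theorem fourier_conjLp_ae (u : Lp ℂ 2 (volume : Measure E)) :
    (𝓕 (conjLp u) : Lp ℂ 2 (volume : Measure E)) =ᵐ[volume]
      fun w ↦ starRingEnd ℂ ((𝓕 u : Lp ℂ 2 (volume : Measure E)) (-w)) := by
  rw [fourier_conjLp]
  have hm := Measure.measurePreserving_neg (volume : Measure E)
  filter_upwards [conjLp_ae (Lp.compMeasurePreserving (fun x : E ↦ -x) hm (𝓕 u)),
    Lp.coeFn_compMeasurePreserving (𝓕 u) hm] with x a b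
  rw [a, b]
  rfl

/-- The Fourier transform of real square-integrable functions. -/
def ft : Lp ℝ 2 (volume : Measure E) →L[ℝ] Lp ℂ 2 (volume : Measure E) :=
  (((Lp.fourierTransformₗᵢ E ℂ).toContinuousLinearEquiv :
    Lp ℂ 2 (volume : Measure E) →L[ℂ] Lp ℂ 2 (volume : Measure E)).restrictScalars ℝ) ∘L
    ContinuousLinearMap.compLpL 2 volume Complex.ofRealCLM

theorem ft_def (g : Lp ℝ 2 (volume : Measure E)) : ft g = 𝓕 (Complex.ofRealCLM.compLp g) := rfl

theorem ofReal_compLp_ae (g : Lp ℝ 2 (volume : Measure E)) :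
    Complex.ofRealCLM.compLp g =ᵐ[volume] fun x ↦ (g x : ℂ) :=
  ContinuousLinearMap.coeFn_compLp _ _

theorem enorm_ft (g : Lp ℝ 2 (volume : Measure E)) : ‖ft g‖ₑ = ‖g‖ₑ := by
  have h1 : ‖ft g‖ₑ = ‖Complex.ofRealCLM.compLp g‖ₑ := by
    rw [enorm_eq_iff_norm_eq]
    exact Lp.norm_fourier_eq _
  rw [h1, Lp.enorm_def, Lp.enorm_def, eLpNorm_congr_ae (ofReal_compLp_ae g)]
  exact eLpNorm_congr_norm_ae (Filter.Eventually.of_forall fun x ↦ by simp)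

theorem lintegral_ft_sq (g : Lp ℝ 2 (volume : Measure E)) :
    ∫⁻ w, ‖ft g w‖ₑ ^ 2 = ∫⁻ x, ‖g x‖ₑ ^ 2 := by
  rw [← sq_eLpNorm_two, ← sq_eLpNorm_two, ← Lp.enorm_def, ← Lp.enorm_def, enorm_ft]

theorem ft_neg_ae (g : Lp ℝ 2 (volume : Measure E)) :
    ∀ᵐ w : E, ft g (-w) = starRingEnd ℂ (ft g w) := by
  have h : conjLp (Complex.ofRealCLM.compLp g) = Complex.ofRealCLM.compLp g := by
    apply Lp.ext
    filter_upwards [conjLp_ae (Complex.ofRealCLM.compLp g), ofReal_compLp_ae g] with x a b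
    rw [a, b, Complex.conj_ofReal]
  have := fourier_conjLp_ae (Complex.ofRealCLM.compLp g)
  rw [h] at this
  filter_upwards [this] with w hw
  rw [ft_def, hw, Complex.conj_conj]

/-- If the Fourier transform is integrable, the function is given by the inversion formula. -/
theorem ae_eq_fourierInv_ft {g : Lp ℝ 2 (volume : Measure E)} (h : Integrable (ft g)) :
    g =ᵐ[volume] fun x ↦ (𝓕⁻ (ft g : E → ℂ) x).re := by
  have h1 := fourierInv_toLp_ae h (Lp.memLp (ft g))
  rw [Lp.toLp_coeFn, ft_def, fourierInv_fourier_eq] at h1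
  filter_upwards [h1, ofReal_compLp_ae g] with x a b
  rw [ft_def, ← a, b, Complex.ofReal_re]

/-- The real part of an inverse Fourier transform, with the Fourier side under control for every
even weight. -/
theorem exists_real_of_lp (v : Lp ℂ 2 (volume : Measure E)) :
    ∃ g : Lp ℝ 2 (volume : Measure E),
      g =ᵐ[volume] (fun x ↦ ((𝓕⁻ v : Lp ℂ 2 (volume : Measure E)) x).re) ∧
      (∀ᵐ w : E, ft g w = (1 / 2 : ℂ) * (v w + starRingEnd ℂ (v (-w)))) ∧
      ∀ W : E → ℝ≥0∞, Measurable W → (∀ w, W (-w) = W w) →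
        ∫⁻ w, W w * ‖ft g w‖ₑ ^ 2 ≤ ∫⁻ w, W w * ‖v w‖ₑ ^ 2 := by
  set u : Lp ℂ 2 (volume : Measure E) := 𝓕⁻ v with hu
  have hFu : 𝓕 u = v := fourier_fourierInv_eq v
  have hg : MemLp (fun x ↦ (u x).re) 2 (volume : Measure E) := (Lp.memLp u).re
  set g := hg.toLp _ with hgdef
  have hgx : g =ᵐ[volume] fun x ↦ (u x).re := MemLp.coeFn_toLp _
  have hm := Measure.measurePreserving_neg (volume : Measure E)
  have hsum : Complex.ofRealCLM.compLp g = (1 / 2 : ℂ) • (u + conjLp u) := by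
    apply Lp.ext
    filter_upwards [ofReal_compLp_ae g, hgx, conjLp_ae u, Lp.coeFn_smul (1 / 2 : ℂ) (u + conjLp u),
      Lp.coeFn_add u (conjLp u)] with x a b e f k
    rw [a, b, f, Pi.smul_apply, k, Pi.add_apply, e, Complex.add_conj]
    simp
  have hft : ∀ᵐ w : E, ft g w = (1 / 2 : ℂ) * (v w + starRingEnd ℂ (v (-w))) := by
    have e1 : ft g = (1 / 2 : ℂ) • (v + 𝓕 (conjLp u)) := by
      rw [ft_def, hsum, FourierTransform.fourier_smul, FourierTransform.fourier_add, hFu]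
    rw [e1]
    filter_upwards [Lp.coeFn_smul (1 / 2 : ℂ) (v + 𝓕 (conjLp u)),
      Lp.coeFn_add v (𝓕 (conjLp u)), fourier_conjLp_ae u] with w a b e
    rw [a, Pi.smul_apply, b, Pi.add_apply, e, hFu, smul_eq_mul]
  refine ⟨g, hgx, hft, fun W hW hWe ↦ ?_⟩
  have hmeas : AEMeasurable (fun w ↦ W w * ‖v w‖ₑ ^ 2) volume :=
    hW.aemeasurable.mul ((Lp.aestronglyMeasurable v).enorm.pow_const 2)
  -- The evenness of `W` enters here: after symmetrization the terms at `w` and `-w` carry the same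
  -- weighted mass.
  have hrefl : ∫⁻ w, W w * ‖v (-w)‖ₑ ^ 2 = ∫⁻ w, W w * ‖v w‖ₑ ^ 2 := by
    have := lintegral_map' (μ := (volume : Measure E)) (g := fun x : E ↦ -x)
      (f := fun w ↦ W w * ‖v w‖ₑ ^ 2)
      (by rw [hm.map_eq]; exact hmeas) hm.measurable.aemeasurable
    rw [hm.map_eq] at this
    rw [this]
    simp [hWe]
  calc ∫⁻ w, W w * ‖ft g w‖ₑ ^ 2
      ≤ ∫⁻ w, ((1 / 2 : ℝ≥0∞) * (W w * ‖v w‖ₑ ^ 2) + (1 / 2 : ℝ≥0∞) * (W w * ‖v (-w)‖ₑ ^ 2)) := by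
        refine lintegral_mono_ae ?_
        filter_upwards [hft] with w hw
        have key : ‖ft g w‖ₑ ^ 2 ≤ (1 / 2 : ℝ≥0∞) * ‖v w‖ₑ ^ 2 + (1 / 2 : ℝ≥0∞) * ‖v (-w)‖ₑ ^ 2 := by
          have e : ‖ft g w‖ ^ 2 ≤ (1 / 2) * ‖v w‖ ^ 2 + (1 / 2) * ‖v (-w)‖ ^ 2 := by
            have : ‖ft g w‖ ≤ (1 / 2) * (‖v w‖ + ‖v (-w)‖) := by
              rw [hw, norm_mul]
              have := norm_add_le (v w) (starRingEnd ℂ (v (-w)))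
              rw [RCLike.norm_conj] at this
              norm_num
              linarith
            nlinarith [sq_nonneg (‖v w‖ - ‖v (-w)‖), norm_nonneg (ft g w), norm_nonneg (v w),
              norm_nonneg (v (-w))]
          have := ENNReal.ofReal_le_ofReal e
          rw [ENNReal.ofReal_add (by positivity) (by positivity),
            ENNReal.ofReal_mul (by norm_num), ENNReal.ofReal_mul (by norm_num),
            ENNReal.ofReal_pow (norm_nonneg _), ENNReal.ofReal_pow (norm_nonneg _),
            ENNReal.ofReal_pow (norm_nonneg _), ofReal_norm, ofReal_norm, ofReal_norm] at this
          convert this using 3 <;> simp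
        calc W w * ‖ft g w‖ₑ ^ 2
            ≤ W w * ((1 / 2 : ℝ≥0∞) * ‖v w‖ₑ ^ 2 + (1 / 2 : ℝ≥0∞) * ‖v (-w)‖ₑ ^ 2) := by gcongr
          _ = _ := by ring
    _ = (1 / 2 : ℝ≥0∞) * (∫⁻ w, W w * ‖v w‖ₑ ^ 2) +
          (1 / 2 : ℝ≥0∞) * ∫⁻ w, W w * ‖v (-w)‖ₑ ^ 2 := by
        rw [lintegral_add_left' (hmeas.const_mul _), lintegral_const_mul'' _ hmeas,
          lintegral_const_mul' _ _ (by norm_num)]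
    _ = ∫⁻ w, W w * ‖v w‖ₑ ^ 2 := by
        rw [hrefl, ← add_mul]
        norm_num [ENNReal.inv_two_add_inv_two]

/-- Multiplication of the Fourier transform by an even real bounded function preserves real
functions. -/
theorem exists_real_multiplier (g : Lp ℝ 2 (volume : Measure E)) {m : E → ℝ} (hm : Measurable m)
    (he : ∀ w, m (-w) = m w) {c : ℝ} (hc : ∀ w, |m w| ≤ c) :
    ∃ g' : Lp ℝ 2 (volume : Measure E), ∀ᵐ w : E, ft g' w = m w * ft g w := by
  have hv : MemLp (fun w ↦ (m w : ℂ) * ft g w) 2 (volume : Measure E) :=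
    MemLp.of_le_mul (c := c) (Lp.memLp (ft g))
      ((Complex.measurable_ofReal.comp hm).aestronglyMeasurable.mul (Lp.aestronglyMeasurable _))
      (Filter.Eventually.of_forall fun w ↦ by
        rw [norm_mul, Complex.norm_real]
        gcongr
        exact hc w)
  obtain ⟨g', -, h1, -⟩ := exists_real_of_lp (hv.toLp _)
  refine ⟨g', ?_⟩
  filter_upwards [h1, hv.coeFn_toLp, (Measure.measurePreserving_neg
    (volume : Measure E)).quasiMeasurePreserving.ae_eq_comp hv.coeFn_toLp, ft_neg_ae g]
    with w a b c e
  simp only [Function.comp] at c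
  rw [a, b, c, he, e, map_mul, Complex.conj_conj, Complex.conj_ofReal]
  ring

end FourierL2

/-! ### Cauchy-Schwarz for extended nonnegative integrals -/

section WeightedCauchySchwarz

theorem sq_rpow_half (y : ℝ≥0∞) : (y ^ (1 / 2 : ℝ)) ^ 2 = y := by
  rw [← ENNReal.rpow_natCast, ← ENNReal.rpow_mul]
  simp

theorem sq_lintegral_mul_le {α : Type*} {mα : MeasurableSpace α} {μ : Measure α}
    {f g : α → ℝ≥0∞} (hf : AEMeasurable f μ) (hg : AEMeasurable g μ) :
    (∫⁻ x, f x * g x ∂μ) ^ 2 ≤ (∫⁻ x, f x ^ 2 ∂μ) * ∫⁻ x, g x ^ 2 ∂μ := by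
  have h := ENNReal.lintegral_mul_le_Lp_mul_Lq μ (p := 2) (q := 2)
    Real.HolderConjugate.two_two hf hg
  have h2 := pow_le_pow_left' h 2
  rw [mul_pow, sq_rpow_half, sq_rpow_half] at h2
  simpa only [Pi.mul_apply, ENNReal.rpow_ofNat] using h2

/-- Weighted Cauchy-Schwarz inequality. -/
theorem sq_lintegral_le_weight {α : Type*} {mα : MeasurableSpace α} {μ : Measure α}
    {W h : α → ℝ≥0∞} (hW : Measurable W) (hW0 : ∀ x, W x ≠ 0) (hWt : ∀ x, W x ≠ ∞)
    (hh : AEMeasurable h μ) :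
    (∫⁻ x, h x ∂μ) ^ 2 ≤ (∫⁻ x, (W x)⁻¹ ∂μ) * ∫⁻ x, W x * h x ^ 2 ∂μ := by
  have h0 := sq_lintegral_mul_le (μ := μ) (f := fun x ↦ (W x)⁻¹ ^ (1 / 2 : ℝ))
    (g := fun x ↦ W x ^ (1 / 2 : ℝ) * h x) (by fun_prop) ((hW.pow_const _).aemeasurable.mul hh)
  have e1 : ∀ x, (W x)⁻¹ ^ (1 / 2 : ℝ) * (W x ^ (1 / 2 : ℝ) * h x) = h x := fun x ↦ by
    rw [← mul_assoc, ← ENNReal.mul_rpow_of_nonneg _ _ (by norm_num),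
      ENNReal.inv_mul_cancel (hW0 x) (hWt x)]
    simp
  simpa only [e1, mul_pow, sq_rpow_half] using h0

end WeightedCauchySchwarz

/-! ### Measure and topology of the unit cube -/

section Cube

variable {d : ℕ}

theorem isClosed_cube : IsClosed (cube d) := by
  simp only [cube, ofPred_forall]
  exact isClosed_iInter fun i ↦ isClosed_Icc.preimage (by fun_prop)

theorem measurableSet_cube : MeasurableSet (cube d) := isClosed_cube.measurableSet

theorem cube_eq_preimage :
    cube d = (WithLp.ofLp : EuclideanSpace ℝ (Fin d) → Fin d → ℝ) ⁻¹' (Icc 0 1) := by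
  ext x
  simp [cube, Pi.le_def, forall_and]

theorem isCompact_cube : IsCompact (cube d) := by
  rw [cube_eq_preimage]
  exact ((EuclideanSpace.equiv (Fin d) ℝ).toHomeomorph.isCompact_preimage).2 isCompact_Icc

instance : CompactSpace (cube d) := isCompact_iff_compactSpace.1 isCompact_cube

theorem measurePreserving_cube_val :
    MeasurePreserving (Subtype.val : cube d → EuclideanSpace ℝ (Fin d)) volume
      (volume.restrict (cube d)) :=
  measurePreserving_subtype_coe measurableSet_cube

theorem volume_cube : volume (cube d) = 1 := by
  rw [cube_eq_preimage, (PiLp.volume_preserving_ofLp (Fin d)).measure_preimage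
    measurableSet_Icc.nullMeasurableSet]
  simp [Real.volume_Icc_pi]

instance : IsProbabilityMeasure (volume : Measure (cube d)) := ⟨by
  have := measurePreserving_cube_val (d := d).measure_preimage (s := univ) (by simp)
  simpa [volume_cube] using this⟩

theorem convex_cube : Convex ℝ (cube d) := by
  have : cube d = ⋂ i, (fun x : EuclideanSpace ℝ (Fin d) ↦ x i) ⁻¹' Icc (0 : ℝ) 1 := by
    ext x; simp [cube]
  rw [this]
  exact convex_iInter fun i ↦
    (convex_Icc (0 : ℝ) 1).linear_preimage (EuclideanSpace.proj i : _ →L[ℝ] ℝ).toLinearMap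

theorem interior_cube_nonempty : (interior (cube d)).Nonempty := by
  refine ⟨WithLp.toLp 2 fun _ ↦ 1 / 2, ?_⟩
  rw [mem_interior]
  refine ⟨⋂ i, (fun x : EuclideanSpace ℝ (Fin d) ↦ x i) ⁻¹' Ioo (0 : ℝ) 1, ?_, ?_, ?_⟩
  · intro x hx i
    exact Ioo_subset_Icc_self (mem_iInter.1 hx i)
  · exact isOpen_iInter_of_finite fun i ↦ isOpen_Ioo.preimage (by fun_prop)
  · simp only [mem_iInter, mem_preimage, mem_Ioo]
    intro i
    norm_num

/-- The cube is convex with nonempty interior, hence contained in the closure of its interior, so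
every nonempty relatively open set meets the interior. This is what forces continuous functions on
the cube that agree almost everywhere to agree everywhere. -/
instance : Measure.IsOpenPosMeasure (volume : Measure (cube d)) := ⟨by
  intro U hU ⟨x, hx⟩
  obtain ⟨V, hV, rfl⟩ := isOpen_induced_iff.1 hU
  have h1 : (x : EuclideanSpace ℝ (Fin d)) ∈ closure (interior (cube d)) := by
    rw [convex_cube.closure_interior_eq_closure_of_nonempty_interior interior_cube_nonempty]
    exact subset_closure x.2
  have h2 : (V ∩ interior (cube d)).Nonempty := mem_closure_iff.1 h1 V hV hx
  have h3 := (hV.inter isOpen_interior).measure_pos volume h2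
  rw [measurePreserving_cube_val.measure_preimage hV.measurableSet.nullMeasurableSet,
    Measure.restrict_apply hV.measurableSet]
  exact (h3.trans_le (measure_mono (inter_subset_inter_right _ interior_subset))).ne'⟩

theorem ae_cube_of_ae {p : EuclideanSpace ℝ (Fin d) → Prop} (h : ∀ᵐ x, p x) :
    ∀ᵐ x : cube d, p x :=
  measurePreserving_cube_val.quasiMeasurePreserving.ae (ae_restrict_of_ae h)

theorem memLp_cube {F : Type*} [NormedAddCommGroup F] {f : EuclideanSpace ℝ (Fin d) → F}
    {q : ℝ≥0∞} (h : MemLp f q) : MemLp (fun x : cube d ↦ f x) q :=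
  (h.restrict (cube d)).comp_measurePreserving measurePreserving_cube_val

theorem lintegral_cube_le {f : EuclideanSpace ℝ (Fin d) → ℝ≥0∞} (hf : AEMeasurable f) :
    ∫⁻ x : cube d, f x ≤ ∫⁻ x, f x := by
  have h := lintegral_map' (μ := (volume : Measure (cube d))) (f := f) (g := Subtype.val)
    (by rw [measurePreserving_cube_val.map_eq]; exact hf.restrict)
    measurePreserving_cube_val.measurable.aemeasurable
  rw [← h, measurePreserving_cube_val.map_eq]
  exact setLIntegral_le_lintegral _ _

/-- Extension by zero from the cube. -/
theorem exists_zeroExtension (f : Lp ℝ 2 (volume : Measure (cube d))) :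
    ∃ g : Lp ℝ 2 (volume : Measure (EuclideanSpace ℝ (Fin d))),
      (fun x : cube d ↦ g (x : EuclideanSpace ℝ (Fin d))) =ᵐ[volume] f ∧ ‖g‖ₑ = ‖f‖ₑ ∧
      ∀ᵐ x, x ∉ cube d → g x = 0 := by
  classical
  set F : EuclideanSpace ℝ (Fin d) → ℝ := fun x ↦ if h : x ∈ cube d then f ⟨x, h⟩ else 0 with hF
  have hFf : ∀ x : cube d, F x = f x := fun x ↦ by simp [hF, x.2]
  have hF0 : ∀ x, x ∉ cube d → F x = 0 := fun x hx ↦ by simp [hF, hx]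
  have hFm : Measurable F := by
    have h := (MeasurableEmbedding.subtype_coe (measurableSet_cube (d := d))).measurable_extend
      (Lp.stronglyMeasurable f).measurable (measurable_const (a := (0 : ℝ)))
    convert h using 1
    ext x
    by_cases hx : x ∈ cube d
    · have := (MeasurableEmbedding.subtype_coe (measurableSet_cube (d := d))).injective.extend_apply
        f (fun _ ↦ (0 : ℝ)) ⟨x, hx⟩
      simp only at this
      rw [this]
      exact hFf ⟨x, hx⟩
    · rw [Function.extend_apply' _ _ _ (by simpa using hx)]
      exact hF0 x hx
  have hnorm : eLpNorm F 2 volume = eLpNorm f 2 volume := by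
    have h1 : F = (cube d).indicator F := by
      ext x
      by_cases hx : x ∈ cube d <;> simp [hx, hF0]
    have h2 := eLpNorm_comp_measurePreserving (p := 2) (g := F)
      hFm.aestronglyMeasurable measurePreserving_cube_val
    rw [h1, eLpNorm_indicator_eq_eLpNorm_restrict measurableSet_cube, ← h2]
    congr 1
    ext x
    simp [hFf]
  have hmem : MemLp F 2 := ⟨hFm.aestronglyMeasurable, by
    rw [hnorm]
    exact (Lp.memLp f).2⟩
  refine ⟨hmem.toLp F, ?_, ?_, ?_⟩
  · filter_upwards [ae_cube_of_ae hmem.coeFn_toLp] with x hx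
    rw [hx, hFf]
  · rw [Lp.enorm_def, Lp.enorm_def, eLpNorm_congr_ae hmem.coeFn_toLp, hnorm]
  · filter_upwards [hmem.coeFn_toLp] with x hx hx'
    rw [hx, hF0 x hx']

end Cube

/-! ### Sobolev norms in the normalization of the L² transform -/

section Sobolev

variable {d : ℕ}

/-- The Sobolev weight in the frequency variable of Mathlib's Fourier transform. -/
def sobolevWeight (d : ℕ) (s : ℝ) (w : EuclideanSpace ℝ (Fin d)) : ℝ≥0∞ :=
  ENNReal.ofReal ((1 + (2 * Real.pi * ‖w‖) ^ 2) ^ s)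

theorem measurable_sobolevWeight (s : ℝ) : Measurable (sobolevWeight d s) := by
  unfold sobolevWeight; fun_prop

theorem sobolevWeight_ne_zero (s : ℝ) (w : EuclideanSpace ℝ (Fin d)) : sobolevWeight d s w ≠ 0 := by
  have : 0 < (1 + (2 * Real.pi * ‖w‖) ^ 2) ^ s := by positivity
  simpa [sobolevWeight] using this

theorem sobolevWeight_ne_top (s : ℝ) (w : EuclideanSpace ℝ (Fin d)) : sobolevWeight d s w ≠ ∞ := by
  simp [sobolevWeight]

theorem map_dilate :
    Measure.map (fun x : EuclideanSpace ℝ (Fin d) ↦ (2 * Real.pi)⁻¹ • x) volume =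
      ENNReal.ofReal ((2 * Real.pi) ^ d) • volume := by
  rw [Measure.map_addHaar_smul volume (by positivity)]
  congr 2
  rw [finrank_euclideanSpace_fin, abs_of_nonneg (by positivity), inv_pow, inv_inv]

/-- Substituting ξ = 2πw produces the Jacobian (2π)^d, which cancels the square of the unitary
factor (2π)^(-d/2). -/
theorem sobolevNorm_sq (s : ℝ) (g : Lp ℝ 2 (volume : Measure (EuclideanSpace ℝ (Fin d)))) :
    sobolevNorm s g ^ 2 = ∫⁻ w, sobolevWeight d s w * ‖ft g w‖ₑ ^ 2 := by
  have hm : Measurable fun w ↦ sobolevWeight d s w * ‖ft g w‖ₑ ^ 2 :=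
    (measurable_sobolevWeight s).mul ((Lp.stronglyMeasurable (ft g)).measurable.enorm.pow_const 2)
  have h1 := lintegral_map (μ := volume) hm
    (measurable_const_smul ((2 * Real.pi)⁻¹ : ℝ) : Measurable fun x : EuclideanSpace ℝ (Fin d) ↦ _)
  rw [map_dilate, lintegral_smul_measure, smul_eq_mul] at h1
  have hc : ENNReal.ofReal ((2 * Real.pi) ^ d) ≠ 0 := by
    simp only [ne_eq, ENNReal.ofReal_eq_zero, not_le]; positivity
  rw [sobolevNorm, sq_rpow_half, ← ENNReal.mul_right_inj hc ENNReal.ofReal_ne_top, h1,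
    ← lintegral_const_mul' _ _ ENNReal.ofReal_ne_top]
  refine lintegral_congr fun ξ ↦ ?_
  simp only [fourierL2, enorm_mul, mul_pow ‖_‖ₑ, sobolevWeight]
  have e1 : 2 * Real.pi * ‖(2 * Real.pi)⁻¹ • ξ‖ = ‖ξ‖ := by
    rw [norm_smul, Real.norm_of_nonneg (by positivity), ← mul_assoc, mul_inv_cancel₀ (by positivity),
      one_mul]
  have e2 : ENNReal.ofReal ((2 * Real.pi) ^ d) *
      ‖(((2 * Real.pi) ^ (-(d : ℝ) / 2) : ℝ) : ℂ)‖ₑ ^ 2 = 1 := by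
    rw [← ofReal_norm, Complex.norm_real, Real.norm_of_nonneg (by positivity),
      ← ENNReal.ofReal_pow (by positivity), ← ENNReal.ofReal_mul (by positivity), ← Real.rpow_natCast,
      ← Real.rpow_natCast, ← Real.rpow_mul (by positivity), ← Real.rpow_add (by positivity)]
    simp
  rw [e1]
  calc _ = (ENNReal.ofReal ((2 * Real.pi) ^ d) *
      ‖(((2 * Real.pi) ^ (-(d : ℝ) / 2) : ℝ) : ℂ)‖ₑ ^ 2) * (ENNReal.ofReal ((1 + ‖ξ‖ ^ 2) ^ s) *
        ‖ft g ((2 * Real.pi)⁻¹ • ξ)‖ₑ ^ 2) := by rw [ft_def]; ring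
    _ = _ := by rw [e2, one_mul]

theorem sobolevNorm_zero (g : Lp ℝ 2 (volume : Measure (EuclideanSpace ℝ (Fin d)))) :
    sobolevNorm 0 g = ‖g‖ₑ := by
  have h := sobolevNorm_sq 0 g
  simp only [sobolevWeight, Real.rpow_zero, ENNReal.ofReal_one, one_mul] at h
  rw [← sq_eLpNorm_two, ← Lp.enorm_def, enorm_ft] at h
  exact (ENNReal.pow_right_strictMono (n := 2) (by norm_num)).injective h

theorem sobolevWeight_mono {s t : ℝ} (h : s ≤ t) (w : EuclideanSpace ℝ (Fin d)) :
    sobolevWeight d s w ≤ sobolevWeight d t w :=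
  ENNReal.ofReal_le_ofReal (Real.rpow_le_rpow_of_exponent_le (by nlinarith [sq_nonneg (2 * Real.pi * ‖w‖)]) h)

theorem sobolevNorm_mono {s t : ℝ} (h : s ≤ t)
    (g : Lp ℝ 2 (volume : Measure (EuclideanSpace ℝ (Fin d)))) :
    sobolevNorm s g ≤ sobolevNorm t g := by
  rw [← ENNReal.pow_le_pow_left_iff (n := 2) (by norm_num), sobolevNorm_sq, sobolevNorm_sq]
  gcongr
  exact sobolevWeight_mono h _

theorem lintegral_inv_one_add_norm_lt_top {r : ℝ} (h : (d : ℝ) < r) :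
    ∫⁻ w : EuclideanSpace ℝ (Fin d), ENNReal.ofReal ((1 + ‖w‖) ^ (-r)) < ∞ := by
  have := (integrable_one_add_norm (E := EuclideanSpace ℝ (Fin d)) (μ := volume) (r := r)
    (by simpa using h)).lintegral_lt_top
  exact this

theorem one_add_norm_rpow_le_sobolevWeight {s : ℝ} (hs : 0 ≤ s) (w : EuclideanSpace ℝ (Fin d)) :
    ENNReal.ofReal ((1 + ‖w‖) ^ (2 * s)) ≤ ENNReal.ofReal (2 ^ s) * sobolevWeight d s w := by
  rw [sobolevWeight, ← ENNReal.ofReal_mul (by positivity), ← Real.mul_rpow (by norm_num)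
    (by positivity), Real.rpow_mul (by positivity)]
  refine ENNReal.ofReal_le_ofReal (Real.rpow_le_rpow (by positivity) ?_ hs)
  have hpi := Real.pi_gt_three
  have : 1 ≤ (2 * Real.pi) ^ 2 := by nlinarith
  rw [mul_pow]
  norm_cast
  nlinarith [sq_nonneg (1 - ‖w‖), sq_nonneg ‖w‖, mul_nonneg (sub_nonneg.2 this) (sq_nonneg ‖w‖)]

/-- Cauchy-Schwarz against the inverse Sobolev weight, which is integrable because 2s > d.
Everything about continuous representatives rests on this. -/
theorem integrable_of_weighted {s : ℝ} (hs : (d : ℝ) / 2 < s) {h : EuclideanSpace ℝ (Fin d) → ℂ}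
    (hm : AEStronglyMeasurable h)
    (hfin : ∫⁻ w, sobolevWeight d s w * ‖h w‖ₑ ^ 2 ≠ ∞) : Integrable h := by
  have hs0 : 0 ≤ s := le_trans (by positivity) hs.le
  refine ⟨hm, ?_⟩
  have h1 := sq_lintegral_le_weight (μ := (volume : Measure (EuclideanSpace ℝ (Fin d))))
    (measurable_sobolevWeight s)
    (sobolevWeight_ne_zero s) (sobolevWeight_ne_top s) hm.enorm
  have h2 : ∫⁻ w, (sobolevWeight d s w)⁻¹ < ∞ := by
    refine lt_of_le_of_lt ?_ (ENNReal.mul_lt_top (a := ENNReal.ofReal (2 ^ s)) (by simp)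
      (lintegral_inv_one_add_norm_lt_top (d := d) (r := 2 * s) (by linarith)))
    rw [← lintegral_const_mul' _ _ (by simp)]
    refine lintegral_mono fun w ↦ ?_
    have := one_add_norm_rpow_le_sobolevWeight hs0 w
    have hpos : 0 < (1 + ‖w‖) ^ (2 * s) := by positivity
    rw [Real.rpow_neg (by positivity), ENNReal.ofReal_inv_of_pos hpos]
    rw [← div_eq_mul_inv, ENNReal.le_div_iff_mul_le (Or.inl (by simpa using hpos)) (Or.inl (by simp)),
      mul_comm, ← div_eq_mul_inv]
    exact ENNReal.div_le_of_le_mul this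
  have h3 := lt_of_le_of_lt h1 (ENNReal.mul_lt_top h2 (lt_top_iff_ne_top.2 hfin))
  rw [HasFiniteIntegral]
  by_contra hcon
  simp only [not_lt, top_le_iff] at hcon
  rw [hcon] at h3
  simp at h3

theorem integrable_ft {s : ℝ} (hs : (d : ℝ) / 2 < s)
    {g : Lp ℝ 2 (volume : Measure (EuclideanSpace ℝ (Fin d)))} (hg : sobolevNorm s g ≠ ∞) :
    Integrable (ft g) := by
  refine integrable_of_weighted hs (Lp.aestronglyMeasurable _) ?_
  rw [← sobolevNorm_sq]
  exact ENNReal.pow_ne_top hg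

/-- The same change of normalization: two factors (2π)^(-d/2), one from each transform, cancel the
Jacobian of the dilation. -/
theorem freqTruncate_eq (r : ℝ) (g : Lp ℝ 2 (volume : Measure (EuclideanSpace ℝ (Fin d))))
    (x : cube d) : freqTruncate r g x =
      (𝓕⁻ (fun w ↦ ft g w * (cutoff (r • (2 * Real.pi) • w) : ℂ)) (x : EuclideanSpace ℝ (Fin d))).re := by
  rw [freqTruncate, invFourier]
  congr 1
  set H : EuclideanSpace ℝ (Fin d) → ℂ := fun ξ ↦ fourierL2 g ξ * (cutoff (r • ξ) : ℂ) *
    Complex.exp (Complex.I * ((inner ℝ (x : EuclideanSpace ℝ (Fin d)) ξ : ℝ) : ℂ)) with hH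
  have h1 := Measure.integral_comp_smul (volume : Measure (EuclideanSpace ℝ (Fin d))) H (2 * Real.pi)
  rw [finrank_euclideanSpace_fin, abs_of_nonneg (by positivity)] at h1
  have h2 : ∫ ξ, H ξ = ((2 * Real.pi) ^ d : ℝ) • ∫ w, H ((2 * Real.pi) • w) := by
    rw [h1, smul_smul, mul_inv_cancel₀ (by positivity), one_smul]
  rw [h2, Real.fourierInv_eq, ← integral_smul, ← integral_const_mul]
  congr 1
  ext w
  simp only [hH, fourierL2, smul_smul, Circle.smul_def, Real.fourierChar_apply,
    real_inner_smul_right, real_inner_comm w, ft_def]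
  rw [inv_mul_cancel₀ (by positivity), one_smul]
  have e2 : (((2 * Real.pi) ^ (-(d : ℝ) / 2) : ℝ) : ℂ) * ((((2 * Real.pi) ^ d : ℝ) : ℂ) *
      (((2 * Real.pi) ^ (-(d : ℝ) / 2) : ℝ) : ℂ)) = 1 := by
    rw [← Complex.ofReal_mul, ← Complex.ofReal_mul, ← Real.rpow_natCast (2 * Real.pi) d,
      ← Real.rpow_add (by positivity), ← Real.rpow_add (by positivity)]
    ring_nf
    simp
  have e3 : Complex.exp (Complex.I * ((2 * Real.pi * inner ℝ w (x : EuclideanSpace ℝ (Fin d)) : ℝ) : ℂ))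
    = Complex.exp (((2 * Real.pi * inner ℝ w (x : EuclideanSpace ℝ (Fin d)) : ℝ) : ℂ) * Complex.I) := by
    rw [mul_comm]
  rw [e3, Complex.real_smul]
  linear_combination ((𝓕 (Complex.ofRealCLM.compLp g) : Lp ℂ 2 _) w * (cutoff ((r * (2 * Real.pi)) • w) : ℂ)
    * Complex.exp (((2 * Real.pi * inner ℝ w (x : EuclideanSpace ℝ (Fin d)) : ℝ) : ℂ) * Complex.I)) * e2

end Sobolev

/-! ### Local oscillation of band-weighted functions -/

section Oscillation

variable {d : ℕ}

/-- The weight of the local oscillation at frequency `t`, relative to the size of the balls. -/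
def oscWeight (S t : ℝ) : ℝ := min 1 t ^ 2 * (1 + t) ^ (2 * S)

theorem oscWeight_nonneg {S t : ℝ} (ht : 0 ≤ t) : 0 ≤ oscWeight S t := by
  unfold oscWeight; positivity

/-- A Schwartz function equal to one on the unit ball. -/
theorem exists_schwartz_one_on_ball (d : ℕ) : ∃ ψ : SchwartzMap (EuclideanSpace ℝ (Fin d)) ℂ,
    ∀ u, ‖u‖ ≤ 1 → ψ u = 1 := by
  let f : ContDiffBump (0 : EuclideanSpace ℝ (Fin d)) := ⟨1, 2, by norm_num, by norm_num⟩
  have h1 : HasCompactSupport fun x ↦ (f x : ℂ) :=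
    f.hasCompactSupport.comp_left (g := fun t : ℝ ↦ (t : ℂ)) rfl
  have h2 : ContDiff ℝ (↑(⊤ : ℕ∞)) fun x ↦ (f x : ℂ) := Complex.ofRealCLM.contDiff.comp f.contDiff
  refine ⟨h1.toSchwartzMap h2, fun u hu ↦ ?_⟩
  change (f u : ℂ) = 1
  rw [f.one_of_mem_closedBall (by simpa using hu)]
  simp

theorem one_add_norm_le_mul (ζ η : EuclideanSpace ℝ (Fin d)) :
    1 + ‖ζ‖ ≤ (1 + ‖ζ - η‖) * (1 + ‖η‖) := by
  have := norm_add_le (ζ - η) η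
  rw [sub_add_cancel] at this
  nlinarith [norm_nonneg (ζ - η), norm_nonneg η, mul_nonneg (norm_nonneg (ζ - η)) (norm_nonneg η)]

theorem schwartz_decay (Ψ : SchwartzMap (EuclideanSpace ℝ (Fin d)) ℂ) (k : ℕ) :
    ∃ A : ℝ, 0 ≤ A ∧ (∀ ζ, ‖Ψ ζ‖ ≤ A * (1 + ‖ζ‖) ^ (-(k : ℝ))) ∧
      ∀ ζ, ‖fderiv ℝ Ψ ζ‖ ≤ A * (1 + ‖ζ‖) ^ (-(k : ℝ)) := by
  have key : ∀ n : ℕ, n ≤ 1 → ∀ ζ, ‖iteratedFDeriv ℝ n Ψ ζ‖ ≤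
      (2 ^ k * ((Finset.Iic (k, 1)).sup fun m ↦ SchwartzMap.seminorm ℝ m.1 m.2) Ψ) *
        (1 + ‖ζ‖) ^ (-(k : ℝ)) := fun n hn ζ ↦ by
    have := SchwartzMap.one_add_le_sup_seminorm_apply (𝕜 := ℝ) (m := (k, 1)) le_rfl hn Ψ ζ
    rw [Real.rpow_neg (by positivity), Real.rpow_natCast, ← div_eq_mul_inv,
      le_div_iff₀ (by positivity), mul_comm]
    exact this
  refine ⟨2 ^ k * ((Finset.Iic (k, 1)).sup fun m ↦ SchwartzMap.seminorm ℝ m.1 m.2) Ψ,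
    ?_, fun ζ ↦ ?_, fun ζ ↦ ?_⟩
  · exact mul_nonneg (by positivity) (apply_nonneg _ _)
  · simpa using key 0 (by norm_num) ζ
  · simpa [norm_iteratedFDeriv_one] using key 1 le_rfl ζ

/-- For |η| ≤ 1 the mean value inequality gains a factor |η|, and the rapid decay of the derivative
is stable under shifts of length at most one. For |η| ≥ 1 the two terms are bounded separately, and
the weight is moved from ζ to ζ - η by `one_add_norm_le_mul` at the price (1 + |η|)^(2S). -/
theorem exists_weighted_difference_bound (Ψ : SchwartzMap (EuclideanSpace ℝ (Fin d)) ℂ) (S : ℝ)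
    (hS : 0 ≤ S) : ∃ C : ℝ≥0, ∀ η, ∫⁻ ζ, ENNReal.ofReal ((1 + ‖ζ‖) ^ (2 * S)) *
      ‖Ψ (ζ - η) - Ψ ζ‖ₑ ^ 2 ≤ C * ENNReal.ofReal (oscWeight S ‖η‖) := by
  -- Large enough for 2k - 2S > d, so that the weight times the squared decay is integrable.
  set k : ℕ := ⌈S⌉₊ + d + 1 with hk
  have hk' : S + d + 1 ≤ k := by
    have := Nat.le_ceil S
    push_cast [hk]
    linarith
  obtain ⟨A, hA, hA1, hA2⟩ := schwartz_decay Ψ k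
  set J : ℝ≥0∞ := ∫⁻ ζ : EuclideanSpace ℝ (Fin d),
    ENNReal.ofReal ((1 + ‖ζ‖) ^ (-(2 * k - 2 * S))) with hJ
  have hJt : J < ∞ := lintegral_inv_one_add_norm_lt_top (by
    have : (0 : ℝ) ≤ d := by positivity
    linarith)
  have hmeas : Measurable fun ζ : EuclideanSpace ℝ (Fin d) ↦
      ENNReal.ofReal ((1 + ‖ζ‖) ^ (-(2 * k - 2 * S))) := by fun_prop
  have hcomb : ∀ x : EuclideanSpace ℝ (Fin d), (1 + ‖x‖) ^ (2 * S) * ((1 + ‖x‖) ^ (-(k : ℝ))) ^ 2 =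
      (1 + ‖x‖) ^ (-(2 * k - 2 * S)) := fun x ↦ by
    rw [← Real.rpow_natCast _ 2, ← Real.rpow_mul (by positivity), ← Real.rpow_add (by positivity)]
    congr 1
    push_cast
    ring
  refine ⟨(ENNReal.ofReal (4 * A ^ 2 * 4 ^ k) * J).toNNReal, fun η ↦ ?_⟩
  rw [ENNReal.coe_toNNReal (ENNReal.mul_lt_top (by simp) hJt).ne]
  rcases le_total ‖η‖ 1 with hη | hη
  · have hpt : ∀ ζ, (1 + ‖ζ‖) ^ (2 * S) * ‖Ψ (ζ - η) - Ψ ζ‖ ^ 2 ≤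
        4 * A ^ 2 * 4 ^ k * oscWeight S ‖η‖ * (1 + ‖ζ‖) ^ (-(2 * k - 2 * S)) := fun ζ ↦ by
      have h1 : ‖Ψ (ζ - η) - Ψ ζ‖ ≤ A * 2 ^ k * (1 + ‖ζ‖) ^ (-(k : ℝ)) * ‖η‖ := by
        have := (convex_segment ζ (ζ - η)).norm_image_sub_le_of_norm_fderiv_le (𝕜 := ℝ) (f := Ψ)
          (C := A * 2 ^ k * (1 + ‖ζ‖) ^ (-(k : ℝ))) (x := ζ) (y := ζ - η)
          (fun x _ ↦ Ψ.differentiableAt) (fun x hx ↦ ?_)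
          (left_mem_segment ℝ _ _) (right_mem_segment ℝ _ _)
        · simpa using this
        · refine (hA2 x).trans ?_
          rw [mul_assoc]
          gcongr
          have h3 : ‖ζ - x‖ ≤ 1 := by
            rw [segment_eq_image'] at hx
            obtain ⟨t, ht, rfl⟩ := hx
            simp only [sub_sub_cancel_left, smul_neg]
            rw [← sub_eq_add_neg, sub_sub_cancel, norm_smul, Real.norm_of_nonneg ht.1]
            nlinarith [ht.1, ht.2, norm_nonneg η]
          have h4 : 1 + ‖ζ‖ ≤ 2 * (1 + ‖x‖) := by
            have := norm_add_le (ζ - x) x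
            rw [sub_add_cancel] at this
            linarith [norm_nonneg x]
          rw [Real.rpow_neg (by positivity), Real.rpow_neg (by positivity), Real.rpow_natCast,
            Real.rpow_natCast, inv_le_iff_one_le_mul₀ (by positivity)]
          have h5 := pow_le_pow_left₀ (by positivity) h4 k
          rw [mul_pow] at h5
          rw [mul_right_comm, ← div_eq_mul_inv, le_div_iff₀ (by positivity), one_mul]
          exact h5
      have h2 := pow_le_pow_left₀ (norm_nonneg _) h1 2
      calc (1 + ‖ζ‖) ^ (2 * S) * ‖Ψ (ζ - η) - Ψ ζ‖ ^ 2
          ≤ (1 + ‖ζ‖) ^ (2 * S) * (A * 2 ^ k * (1 + ‖ζ‖) ^ (-(k : ℝ)) * ‖η‖) ^ 2 := by gcongr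
        _ = A ^ 2 * 4 ^ k * ‖η‖ ^ 2 * ((1 + ‖ζ‖) ^ (2 * S) * ((1 + ‖ζ‖) ^ (-(k : ℝ))) ^ 2) := by
            rw [show (4 : ℝ) ^ k = (2 ^ k) ^ 2 by rw [← pow_mul, mul_comm, pow_mul]; norm_num]
            ring
        _ = A ^ 2 * 4 ^ k * ‖η‖ ^ 2 * (1 + ‖ζ‖) ^ (-(2 * k - 2 * S)) := by rw [hcomb]
        _ ≤ _ := by
            refine mul_le_mul_of_nonneg_right ?_ (by positivity)
            rw [oscWeight, min_eq_right hη]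
            have : 1 ≤ (1 + ‖η‖) ^ (2 * S) :=
              Real.one_le_rpow (by linarith [norm_nonneg η]) (by linarith)
            have h6 : 0 ≤ A ^ 2 * 4 ^ k * ‖η‖ ^ 2 := by positivity
            nlinarith [mul_nonneg h6 (sub_nonneg.2 this)]
    calc _ ≤ ∫⁻ ζ : EuclideanSpace ℝ (Fin d),
          ENNReal.ofReal (4 * A ^ 2 * 4 ^ k * oscWeight S ‖η‖) *
            ENNReal.ofReal ((1 + ‖ζ‖) ^ (-(2 * k - 2 * S))) := by
          refine lintegral_mono fun ζ ↦ ?_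
          rw [← ofReal_norm, ← ENNReal.ofReal_pow (norm_nonneg _),
            ← ENNReal.ofReal_mul (by positivity), ← ENNReal.ofReal_mul
              (mul_nonneg (by positivity) (oscWeight_nonneg (norm_nonneg _)))]
          exact ENNReal.ofReal_le_ofReal (hpt ζ)
      _ = _ := by
          rw [lintegral_const_mul _ hmeas, ENNReal.ofReal_mul (by positivity)]
          ring
  · have hpt : ∀ ζ, (1 + ‖ζ‖) ^ (2 * S) * ‖Ψ (ζ - η) - Ψ ζ‖ ^ 2 ≤
        2 * A ^ 2 * (1 + ‖η‖) ^ (2 * S) * (1 + ‖ζ - η‖) ^ (-(2 * k - 2 * S)) +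
        2 * A ^ 2 * (1 + ‖η‖) ^ (2 * S) * (1 + ‖ζ‖) ^ (-(2 * k - 2 * S)) := fun ζ ↦ by
      have h1 : ‖Ψ (ζ - η) - Ψ ζ‖ ^ 2 ≤ 2 * ‖Ψ (ζ - η)‖ ^ 2 + 2 * ‖Ψ ζ‖ ^ 2 := by
        nlinarith [norm_sub_le (Ψ (ζ - η)) (Ψ ζ), norm_nonneg (Ψ (ζ - η) - Ψ ζ),
          sq_nonneg (‖Ψ (ζ - η)‖ - ‖Ψ ζ‖), norm_nonneg (Ψ (ζ - η)), norm_nonneg (Ψ ζ)]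
      have h2 : (1 + ‖ζ‖) ^ (2 * S) ≤ (1 + ‖η‖) ^ (2 * S) * (1 + ‖ζ - η‖) ^ (2 * S) := by
        rw [← Real.mul_rpow (by positivity) (by positivity), mul_comm (1 + ‖η‖)]
        exact Real.rpow_le_rpow (by positivity) (one_add_norm_le_mul ζ η) (by linarith)
      have h3 : 1 ≤ (1 + ‖η‖) ^ (2 * S) :=
        Real.one_le_rpow (by linarith [norm_nonneg η]) (by linarith)
      calc (1 + ‖ζ‖) ^ (2 * S) * ‖Ψ (ζ - η) - Ψ ζ‖ ^ 2
          ≤ (1 + ‖ζ‖) ^ (2 * S) * (2 * ‖Ψ (ζ - η)‖ ^ 2 + 2 * ‖Ψ ζ‖ ^ 2) := by gcongr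
        _ = 2 * ((1 + ‖ζ‖) ^ (2 * S) * ‖Ψ (ζ - η)‖ ^ 2) + 2 * ((1 + ‖ζ‖) ^ (2 * S) * ‖Ψ ζ‖ ^ 2) := by
            ring
        _ ≤ 2 * (((1 + ‖η‖) ^ (2 * S) * (1 + ‖ζ - η‖) ^ (2 * S)) *
              (A * (1 + ‖ζ - η‖) ^ (-(k : ℝ))) ^ 2) +
            2 * (((1 + ‖η‖) ^ (2 * S) * (1 + ‖ζ‖) ^ (2 * S)) * (A * (1 + ‖ζ‖) ^ (-(k : ℝ))) ^ 2) := by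
            gcongr
            · exact hA1 _
            · exact le_mul_of_one_le_left (by positivity) h3
            · exact hA1 _
        _ = _ := by
            rw [← hcomb, ← hcomb]
            ring
    have hw : oscWeight S ‖η‖ = (1 + ‖η‖) ^ (2 * S) := by
      rw [oscWeight, min_eq_left hη]; ring
    calc _ ≤ ∫⁻ ζ : EuclideanSpace ℝ (Fin d),
          (ENNReal.ofReal (2 * A ^ 2 * (1 + ‖η‖) ^ (2 * S)) *
            ENNReal.ofReal ((1 + ‖ζ - η‖) ^ (-(2 * k - 2 * S))) +
          ENNReal.ofReal (2 * A ^ 2 * (1 + ‖η‖) ^ (2 * S)) *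
            ENNReal.ofReal ((1 + ‖ζ‖) ^ (-(2 * k - 2 * S)))) := by
          refine lintegral_mono fun ζ ↦ ?_
          rw [← ofReal_norm, ← ENNReal.ofReal_pow (norm_nonneg _),
            ← ENNReal.ofReal_mul (by positivity), ← ENNReal.ofReal_mul (by positivity),
            ← ENNReal.ofReal_mul (by positivity), ← ENNReal.ofReal_add (by positivity)
              (by positivity)]
          exact ENNReal.ofReal_le_ofReal (hpt ζ)
      _ = ENNReal.ofReal (4 * A ^ 2 * (1 + ‖η‖) ^ (2 * S)) * J := by
          rw [lintegral_add_right _ (hmeas.const_mul _), lintegral_const_mul _ hmeas,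
            lintegral_const_mul _ (by fun_prop), lintegral_sub_right_eq_self (fun ζ ↦
              ENNReal.ofReal ((1 + ‖ζ‖) ^ (-(2 * k - 2 * S)))) η, ← add_mul,
              ← ENNReal.ofReal_add (by positivity) (by positivity)]
          congr 2
          ring
      _ ≤ _ := by
          rw [hw, mul_right_comm (ENNReal.ofReal _), ← ENNReal.ofReal_mul (by positivity)]
          refine mul_le_mul_left (ENNReal.ofReal_le_ofReal ?_) _
          have : (1 : ℝ) ≤ 4 ^ k := one_le_pow₀ (by norm_num)
          have h7 : 0 ≤ 4 * (1 + ‖η‖) ^ (2 * S) * A ^ 2 := by positivity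
          nlinarith [mul_nonneg h7 (sub_nonneg.2 this)]

/-- A modulated plane wave minus one, as a superposition of plane waves on the unit ball. -/
theorem fourierChar_sub_one_eq {ψ : SchwartzMap (EuclideanSpace ℝ (Fin d)) ℂ}
    (hψ : ∀ u, ‖u‖ ≤ 1 → ψ u = 1) {u : EuclideanSpace ℝ (Fin d)} (hu : ‖u‖ ≤ 1)
    (η : EuclideanSpace ℝ (Fin d)) :
    (Real.fourierChar (inner ℝ η u) : ℂ) - 1 =
      ∫ ζ, Real.fourierChar (inner ℝ ζ u) • ((𝓕 ψ) (ζ - η) - (𝓕 ψ) ζ) := by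
  -- Fourier inversion at `u`, where ψ equals one. The shifted transform 𝓕ψ(· - η) inverts to the
  -- plane wave of frequency η times ψ, so the difference gives the claim.
  have h1 : ∫ ζ, Real.fourierChar (inner ℝ ζ u) • (𝓕 ψ) ζ = 1 := by
    rw [← Real.fourierInv_eq, ← SchwartzMap.fourierInv_coe, fourierInv_fourier_eq, hψ u hu]
  have hint : Integrable fun ζ ↦ Real.fourierChar (inner ℝ ζ u) • (𝓕 ψ) ζ := by
    have hF : Integrable (fun ζ ↦ (𝓕 ψ) ζ) := (𝓕 ψ).integrable
    have := (Real.fourierIntegral_convergent_iff (-u)).2 hF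
    simpa using this
  have h2 : ∀ ζ, Real.fourierChar (inner ℝ ζ u) • (𝓕 ψ) (ζ - η) =
      (Real.fourierChar (inner ℝ η u) : ℂ) *
        (Real.fourierChar (inner ℝ (ζ - η) u) • (𝓕 ψ) (ζ - η)) := fun ζ ↦ by
    rw [Circle.smul_def, Circle.smul_def, smul_eq_mul, smul_eq_mul, ← mul_assoc, ← Circle.coe_mul,
      ← AddChar.map_add_eq_mul, inner_sub_left]
    congr 4
    ring
  have hint2 : Integrable fun ζ ↦ Real.fourierChar (inner ℝ ζ u) • (𝓕 ψ) (ζ - η) := by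
    simp_rw [h2]
    exact (hint.comp_sub_right η).const_mul _
  simp_rw [smul_sub]
  rw [integral_sub hint2 hint, h1]
  simp_rw [h2]
  have h3 : ∫ ζ, Real.fourierChar (inner ℝ (ζ - η) u) • (𝓕 ψ) (ζ - η) = 1 :=
    (integral_sub_right_eq_self (fun ζ ↦ Real.fourierChar (inner ℝ ζ u) • (𝓕 ψ) ζ) η).trans h1
  rw [integral_const_mul, h3, mul_one]

/-- The local oscillation of an inverse Fourier integral has a square-integrable majorant,
controlled on the Fourier side. -/
theorem exists_oscillation_majorant {S : ℝ} (hS : (d : ℝ) / 2 < S) :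
    ∃ C : ℝ≥0, ∀ h : EuclideanSpace ℝ (Fin d) → ℂ, StronglyMeasurable h → Integrable h →
      MemLp h 2 → ∀ ρ : ℝ, 0 ≤ ρ → ∃ M : EuclideanSpace ℝ (Fin d) → ℝ≥0∞, Measurable M ∧
        (∀ x y, dist y x ≤ ρ → ‖𝓕⁻ h y - 𝓕⁻ h x‖ₑ ^ 2 ≤ M x) ∧
        ∫⁻ x, M x ≤ C * ∫⁻ w, ENNReal.ofReal (oscWeight S (ρ * ‖w‖)) * ‖h w‖ₑ ^ 2 := by
  have hS0 : 0 ≤ S := le_trans (by positivity) hS.le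
  obtain ⟨ψ, hψ⟩ := exists_schwartz_one_on_ball d
  obtain ⟨C₀, hC₀⟩ := exists_weighted_difference_bound (𝓕 ψ) S hS0
  set Ψ := 𝓕 ψ with hΨ
  set J : ℝ≥0∞ := ∫⁻ w : EuclideanSpace ℝ (Fin d), ENNReal.ofReal ((1 + ‖w‖) ^ (-(2 * S))) with hJ
  have hJt : J < ∞ := lintegral_inv_one_add_norm_lt_top (by linarith)
  refine ⟨J.toNNReal * C₀, fun h hm h1 h2 ρ hρ ↦ ?_⟩
  rw [ENNReal.coe_mul, ENNReal.coe_toNNReal hJt.ne]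
  set W : EuclideanSpace ℝ (Fin d) → ℝ≥0∞ := fun ζ ↦ ENNReal.ofReal ((1 + ‖ζ‖) ^ (2 * S)) with hW
  have hWm : Measurable W := by fun_prop
  have hW0 : ∀ ζ, W ζ ≠ 0 := fun ζ ↦ by
    have : 0 < (1 + ‖ζ‖) ^ (2 * S) := by positivity
    simpa [hW] using this
  have hWinv : ∀ ζ, (W ζ)⁻¹ = ENNReal.ofReal ((1 + ‖ζ‖) ^ (-(2 * S))) := fun ζ ↦ by
    rw [hW, Real.rpow_neg (by positivity), ENNReal.ofReal_inv_of_pos (by positivity)]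
  -- Coefficients of the expansion of the plane wave of frequency `ρ • w`, minus one, on the unit
  -- ball. They do not depend on the displacement `u`.
  set Θ : EuclideanSpace ℝ (Fin d) → EuclideanSpace ℝ (Fin d) → ℂ :=
    fun ζ w ↦ Ψ (ζ - ρ • w) - Ψ ζ with hΘ
  have hΘc : Continuous fun p : EuclideanSpace ℝ (Fin d) × EuclideanSpace ℝ (Fin d) ↦
      Θ p.1 p.2 := by
    have := Ψ.continuous
    fun_prop
  obtain ⟨A, hA⟩ : ∃ A, ∀ ζ, ‖Ψ ζ‖ ≤ A := by
    obtain ⟨A, -, hA, -⟩ := schwartz_decay Ψ 0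
    exact ⟨A, fun ζ ↦ by simpa using hA ζ⟩
  have hΘb : ∀ ζ w, ‖Θ ζ w‖ ≤ A + A := fun ζ w ↦
    (norm_sub_le _ _).trans (add_le_add (hA _) (hA _))
  have hq1 : ∀ ζ, Integrable fun w ↦ h w * Θ ζ w := fun ζ ↦
    h1.mul_bdd (c := A + A) (hΘc.comp (by fun_prop : Continuous fun w ↦ (ζ, w))).aestronglyMeasurable
      (Filter.Eventually.of_forall fun w ↦ hΘb ζ w)
  have hq2 : ∀ ζ, MemLp (fun w ↦ h w * Θ ζ w) 2 := fun ζ ↦ by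
    refine MemLp.of_le_mul (c := A + A) h2 (hq1 ζ).1 (Filter.Eventually.of_forall fun w ↦ ?_)
    rw [norm_mul, mul_comm]
    gcongr
    exact hΘb ζ w
  set G : EuclideanSpace ℝ (Fin d) → EuclideanSpace ℝ (Fin d) → ℂ :=
    fun x ζ ↦ 𝓕⁻ (fun w ↦ h w * Θ ζ w) x with hG
  have hGm : StronglyMeasurable fun p : EuclideanSpace ℝ (Fin d) × EuclideanSpace ℝ (Fin d) ↦
      G p.1 p.2 := by
    simp only [hG, Real.fourierInv_eq]
    refine StronglyMeasurable.integral_prod_right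
      (f := fun (q : EuclideanSpace ℝ (Fin d) × EuclideanSpace ℝ (Fin d)) w ↦
        Real.fourierChar (inner ℝ w q.1) • (h w * Θ q.2 w)) ?_
    simp only [Circle.smul_def, Function.uncurry_def]
    have e1 : StronglyMeasurable fun q : (EuclideanSpace ℝ (Fin d) × EuclideanSpace ℝ (Fin d)) ×
        EuclideanSpace ℝ (Fin d) ↦ (Real.fourierChar (inner ℝ q.2 q.1.1) : ℂ) := by
      refine Continuous.stronglyMeasurable ?_
      have := Real.continuous_fourierChar
      fun_prop
    exact e1.smul ((hm.comp_measurable measurable_snd).mul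
      (hΘc.comp (by fun_prop : Continuous fun q : (EuclideanSpace ℝ (Fin d) ×
        EuclideanSpace ℝ (Fin d)) × EuclideanSpace ℝ (Fin d) ↦ (q.1.2, q.2))).stronglyMeasurable)
  have hGe : Measurable fun p : EuclideanSpace ℝ (Fin d) × EuclideanSpace ℝ (Fin d) ↦
      ‖G p.1 p.2‖ₑ := hGm.enorm
  -- For y = x + ρu the increment is the integral over ζ of a unimodular factor depending on `u`
  -- times `G x ζ`. Taking absolute values inside removes `u`, which turns the supremum over the
  -- ball into this majorant.
  refine ⟨fun x ↦ (∫⁻ ζ, ‖G x ζ‖ₑ) ^ 2, (Measurable.lintegral_prod_right hGe).pow_const 2, ?_, ?_⟩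
  · intro x y hxy
    obtain ⟨u, hu, rfl⟩ : ∃ u : EuclideanSpace ℝ (Fin d), ‖u‖ ≤ 1 ∧ y = x + ρ • u := by
      rcases hρ.eq_or_lt with h0 | h0
      · refine ⟨0, by simp, ?_⟩
        rw [← h0, dist_le_zero] at hxy
        simp [hxy]
      · refine ⟨ρ⁻¹ • (y - x), ?_, ?_⟩
        · rw [norm_smul, norm_inv, Real.norm_of_nonneg hρ, ← dist_eq_norm]
          exact inv_mul_le_one_of_le₀ hxy hρ
        · rw [smul_smul, mul_inv_cancel₀ h0.ne', one_smul, add_sub_cancel]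
    refine pow_le_pow_left' ?_ 2
    have hchar : ∀ z, Integrable fun w ↦ Real.fourierChar (inner ℝ w z) • h w := fun z ↦ by
      have := (Real.fourierIntegral_convergent_iff (f := h) (-z)).2 h1
      simpa using this
    have e1 : 𝓕⁻ h (x + ρ • u) - 𝓕⁻ h x = ∫ w, ∫ ζ,
        Real.fourierChar (inner ℝ w x) • (Real.fourierChar (inner ℝ ζ u) • (h w * Θ ζ w)) := by
      rw [Real.fourierInv_eq, Real.fourierInv_eq, ← integral_sub (hchar _) (hchar _)]
      congr 1
      ext w
      have e2 := fourierChar_sub_one_eq hψ hu (ρ • w)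
      have e3 : ∀ ζ, Real.fourierChar (inner ℝ w x) •
          (Real.fourierChar (inner ℝ ζ u) • (h w * Θ ζ w)) =
          (Real.fourierChar (inner ℝ w x) * h w : ℂ) *
            (Real.fourierChar (inner ℝ ζ u) • (Ψ (ζ - ρ • w) - Ψ ζ)) := fun ζ ↦ by
        simp only [Circle.smul_def, smul_eq_mul, hΘ]
        ring
      simp_rw [e3]
      rw [integral_const_mul, ← e2, inner_add_right, AddChar.map_add_eq_mul, real_inner_smul_right,
        real_inner_smul_left]
      simp only [Circle.smul_def, smul_eq_mul, Circle.coe_mul]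
      ring
    -- Fubini needs joint integrability. It holds since the L¹ norm of `Θ · w` is at most twice that
    -- of Ψ, uniformly in `w`, and `h` is integrable.
    have hprod : Integrable (fun p : EuclideanSpace ℝ (Fin d) × EuclideanSpace ℝ (Fin d) ↦
        Real.fourierChar (inner ℝ p.1 x) •
          (Real.fourierChar (inner ℝ p.2 u) • (h p.1 * Θ p.2 p.1))) (volume.prod volume) := by
      have a1 : Integrable (fun p : EuclideanSpace ℝ (Fin d) × EuclideanSpace ℝ (Fin d) ↦
          h p.1 * Θ p.2 p.1) (volume.prod volume) := by
        have hms : AEStronglyMeasurable (fun p : EuclideanSpace ℝ (Fin d) × EuclideanSpace ℝ (Fin d) ↦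
          h p.1 * Θ p.2 p.1) (volume.prod volume) :=
          ((hm.comp_measurable measurable_fst).mul
            (hΘc.comp (by fun_prop : Continuous fun q : EuclideanSpace ℝ (Fin d) ×
              EuclideanSpace ℝ (Fin d) ↦ (q.2, q.1))).stronglyMeasurable).aestronglyMeasurable
        have hΨi : ∀ η, Integrable fun ζ ↦ Ψ (ζ - η) - Ψ ζ := fun η ↦
          (Ψ.integrable.comp_sub_right η).sub Ψ.integrable
        rw [integrable_prod_iff hms]
        refine ⟨Filter.Eventually.of_forall fun w ↦ (hΨi (ρ • w)).const_mul (h w), ?_⟩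
        refine Integrable.mono' (g := fun w ↦ ‖h w‖ * ((∫ ζ, ‖Ψ ζ‖) + ∫ ζ, ‖Ψ ζ‖))
          (h1.norm.mul_const _) (hms.norm.integral_prod_right') ?_
        refine Filter.Eventually.of_forall fun w ↦ ?_
        simp only [norm_mul]
        rw [integral_const_mul, norm_mul, norm_norm, Real.norm_of_nonneg (by positivity)]
        gcongr
        have b1 : ∫ ζ, ‖Ψ (ζ - ρ • w)‖ = ∫ ζ, ‖Ψ ζ‖ :=
          integral_sub_right_eq_self (fun ζ ↦ ‖Ψ ζ‖) (ρ • w)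
        calc ∫ ζ, ‖Θ ζ w‖ ≤ ∫ ζ, (‖Ψ (ζ - ρ • w)‖ + ‖Ψ ζ‖) :=
              integral_mono (hΨi _).norm ((Ψ.integrable.comp_sub_right _).norm.add Ψ.integrable.norm)
                fun ζ ↦ norm_sub_le _ _
          _ = _ := by
              rw [integral_add (Ψ.integrable.comp_sub_right _).norm Ψ.integrable.norm, b1]
      refine (integrable_norm_iff ?_).1 ?_
      · have e1 : Continuous fun p : EuclideanSpace ℝ (Fin d) × EuclideanSpace ℝ (Fin d) ↦
            (Real.fourierChar (inner ℝ p.1 x) : ℂ) := by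
          have := Real.continuous_fourierChar
          fun_prop
        have e2 : Continuous fun p : EuclideanSpace ℝ (Fin d) × EuclideanSpace ℝ (Fin d) ↦
            (Real.fourierChar (inner ℝ p.2 u) : ℂ) := by
          have := Real.continuous_fourierChar
          fun_prop
        simp only [Circle.smul_def]
        exact e1.aestronglyMeasurable.smul (e2.aestronglyMeasurable.smul a1.1)
      · simpa only [Circle.norm_smul] using a1.norm
    rw [e1, integral_integral_swap hprod]
    refine (enorm_integral_le_lintegral_enorm _).trans (lintegral_mono fun ζ ↦ le_of_eq ?_)
    have e4 : ∀ w, Real.fourierChar (inner ℝ w x) •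
        (Real.fourierChar (inner ℝ ζ u) • (h w * Θ ζ w)) =
        (Real.fourierChar (inner ℝ ζ u) : ℂ) * (Real.fourierChar (inner ℝ w x) • (h w * Θ ζ w)) :=
      fun w ↦ by
        simp only [Circle.smul_def, smul_eq_mul]
        ring
    simp_rw [e4]
    rw [integral_const_mul, ← Real.fourierInv_eq, enorm_mul]
    have e5 : ‖(Real.fourierChar (inner ℝ ζ u) : ℂ)‖ₑ = 1 := by
      rw [← ofReal_norm, Circle.norm_coe, ENNReal.ofReal_one]
    rw [e5, one_mul]
  -- Weighted Cauchy-Schwarz in ζ makes the expression quadratic, Plancherel in `x` for each fixed ζ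
  -- returns to frequencies, and the remaining integral over ζ is the one bounded by
  -- `exists_weighted_difference_bound`.
  · calc ∫⁻ x, (∫⁻ ζ, ‖G x ζ‖ₑ) ^ 2 ≤ ∫⁻ x, J * ∫⁻ ζ, W ζ * ‖G x ζ‖ₑ ^ 2 := by
          refine lintegral_mono fun x ↦ ?_
          have := sq_lintegral_le_weight (μ := (volume : Measure (EuclideanSpace ℝ (Fin d)))) hWm hW0
            (fun ζ ↦ by simp [hW])
            (h := fun ζ ↦ ‖G x ζ‖ₑ) (hGe.comp measurable_prodMk_left).aemeasurable
          simpa only [hWinv] using this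
      _ = J * ∫⁻ x, ∫⁻ ζ, W ζ * ‖G x ζ‖ₑ ^ 2 := lintegral_const_mul' _ _ hJt.ne
      _ = J * ∫⁻ ζ, ∫⁻ x, W ζ * ‖G x ζ‖ₑ ^ 2 := by
          rw [lintegral_lintegral_swap]
          exact ((hWm.comp measurable_snd).mul (hGe.pow_const 2)).aemeasurable
      _ = J * ∫⁻ ζ, ∫⁻ w, W ζ * ‖h w * Θ ζ w‖ₑ ^ 2 := by
          congr 1
          refine lintegral_congr fun ζ ↦ ?_
          rw [lintegral_const_mul' _ _ (by simp [hW]), lintegral_const_mul' _ _ (by simp [hW])]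
          congr 1
          exact lintegral_fourierInv_sq (hq1 ζ) (hq2 ζ)
      _ = J * ∫⁻ w, ∫⁻ ζ, W ζ * ‖h w * Θ ζ w‖ₑ ^ 2 := by
          rw [lintegral_lintegral_swap]
          refine ((hWm.comp measurable_fst).mul (StronglyMeasurable.enorm ?_ |>.pow_const 2)).aemeasurable
          exact (hm.comp_measurable measurable_snd).mul hΘc.stronglyMeasurable
      _ ≤ J * ∫⁻ w, C₀ * (ENNReal.ofReal (oscWeight S (ρ * ‖w‖)) * ‖h w‖ₑ ^ 2) := by
          gcongr with w
          have e5 := hC₀ (ρ • w)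
          rw [norm_smul, Real.norm_of_nonneg hρ] at e5
          calc ∫⁻ ζ, W ζ * ‖h w * Θ ζ w‖ₑ ^ 2 = ∫⁻ ζ, ‖h w‖ₑ ^ 2 * (W ζ * ‖Θ ζ w‖ₑ ^ 2) := by
                refine lintegral_congr fun ζ ↦ ?_
                rw [enorm_mul]
                ring
            _ = ‖h w‖ₑ ^ 2 * ∫⁻ ζ, W ζ * ‖Θ ζ w‖ₑ ^ 2 := lintegral_const_mul' _ _ (by simp)
            _ ≤ ‖h w‖ₑ ^ 2 * (C₀ * ENNReal.ofReal (oscWeight S (ρ * ‖w‖))) := by gcongr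
            _ = _ := by ring
      _ = _ := by
          rw [lintegral_const_mul' _ _ (by simp)]
          ring

end Oscillation

/-! ### Weighted composition operators on L² -/

section WeightedComposition

variable {α 𝕜 : Type*} {mα : MeasurableSpace α} {μ : Measure α} [RCLike 𝕜]

/-- The conditions under which `u ↦ m · (u ∘ σ)` is a bounded operator on `L²`. -/
structure IsWeightedComp (μ : Measure α) (σ : α → α) (m : α → 𝕜) (c C : ℝ≥0) : Prop where
  measurable_map : Measurable σ
  measurable_weight : Measurable m
  map_le : μ.map σ ≤ c • μ
  bound : ∀ x, ‖m x‖ ≤ C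

variable {σ : α → α} {m : α → 𝕜} {c C : ℝ≥0}

theorem IsWeightedComp.quasiMeasurePreserving (h : IsWeightedComp μ σ m c C) :
    Measure.QuasiMeasurePreserving σ μ μ :=
  ⟨h.measurable_map, h.map_le.absolutelyContinuous.trans (Measure.smul_absolutelyContinuous)⟩

theorem IsWeightedComp.lintegral_le (h : IsWeightedComp μ σ m c C) {f : α → ℝ≥0∞}
    (hf : AEMeasurable f μ) : ∫⁻ x, f (σ x) ∂μ ≤ c * ∫⁻ x, f x ∂μ := by
  have h1 : AEMeasurable f (μ.map σ) := hf.mono_ac h.quasiMeasurePreserving.absolutelyContinuous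
  rw [← lintegral_map' h1 h.measurable_map.aemeasurable]
  calc _ ≤ ∫⁻ x, f x ∂(c • μ) := lintegral_mono' h.map_le le_rfl
    _ = _ := by rw [lintegral_smul_measure]; rfl

theorem IsWeightedComp.aestronglyMeasurable (h : IsWeightedComp μ σ m c C) (u : Lp 𝕜 2 μ) :
    AEStronglyMeasurable (fun x ↦ m x * u (σ x)) μ :=
  h.measurable_weight.aestronglyMeasurable.mul
    ((Lp.aestronglyMeasurable u).comp_quasiMeasurePreserving h.quasiMeasurePreserving)

theorem IsWeightedComp.sq_eLpNorm_le (h : IsWeightedComp μ σ m c C) (u : Lp 𝕜 2 μ) :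
    eLpNorm (fun x ↦ m x * u (σ x)) 2 μ ^ 2 ≤ C ^ 2 * c * ‖u‖ₑ ^ 2 := by
  rw [sq_eLpNorm_two, Lp.enorm_def, sq_eLpNorm_two]
  calc ∫⁻ x, ‖m x * u (σ x)‖ₑ ^ 2 ∂μ ≤ ∫⁻ x, C ^ 2 * ‖u (σ x)‖ₑ ^ 2 ∂μ := by
        refine lintegral_mono fun x ↦ ?_
        rw [enorm_mul, mul_pow]
        gcongr
        rw [← ofReal_norm, ← ENNReal.ofReal_coe_nnreal]
        exact ENNReal.ofReal_le_ofReal (h.bound x)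
    _ = C ^ 2 * ∫⁻ x, ‖u (σ x)‖ₑ ^ 2 ∂μ := lintegral_const_mul' _ _ (by simp)
    _ ≤ C ^ 2 * (c * ∫⁻ x, ‖u x‖ₑ ^ 2 ∂μ) := by
        gcongr
        exact h.lintegral_le ((Lp.aestronglyMeasurable u).enorm.pow_const 2)
    _ = _ := by ring

theorem IsWeightedComp.memLp (h : IsWeightedComp μ σ m c C) (u : Lp 𝕜 2 μ) :
    MemLp (fun x ↦ m x * u (σ x)) 2 μ := by
  refine ⟨h.aestronglyMeasurable u, ?_⟩
  have h1 := h.sq_eLpNorm_le u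
  by_contra hcon
  rw [not_lt, top_le_iff] at hcon
  rw [hcon] at h1
  have h2 : (C : ℝ≥0∞) ^ 2 * c * ‖u‖ₑ ^ 2 < ∞ := by finiteness
  simp at h1
  exact h2.ne h1

/-- The operator `u ↦ m · (u ∘ σ)` on `L²`. -/
def wcomp (h : IsWeightedComp μ σ m c C) : Lp 𝕜 2 μ →L[𝕜] Lp 𝕜 2 μ :=
  LinearMap.mkContinuous
    { toFun := fun u ↦ (h.memLp u).toLp _
      map_add' := fun u v ↦ by
        apply Lp.ext
        filter_upwards [(h.memLp (u + v)).coeFn_toLp, (h.memLp u).coeFn_toLp, (h.memLp v).coeFn_toLp,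
          Lp.coeFn_add ((h.memLp u).toLp _) ((h.memLp v).toLp _),
          h.quasiMeasurePreserving.ae (Lp.coeFn_add u v)] with x a b e f k
        rw [a, f, Pi.add_apply, b, e, k, Pi.add_apply, mul_add]
      map_smul' := fun t u ↦ by
        apply Lp.ext
        filter_upwards [(h.memLp (t • u)).coeFn_toLp, (h.memLp u).coeFn_toLp,
          Lp.coeFn_smul t ((h.memLp u).toLp _),
          h.quasiMeasurePreserving.ae (Lp.coeFn_smul t u)] with x a b f k
        rw [a, RingHom.id_apply, f, Pi.smul_apply, b, k, Pi.smul_apply, smul_eq_mul, smul_eq_mul]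
        ring }
    (C * NNReal.sqrt c) fun u ↦ by
      have h1 := h.sq_eLpNorm_le u
      rw [← eLpNorm_congr_ae (h.memLp u).coeFn_toLp, ← Lp.enorm_def] at h1
      have h2 := ENNReal.toReal_mono (by finiteness) h1
      simp only [ENNReal.toReal_pow, toReal_enorm, ENNReal.toReal_mul, ENNReal.coe_toReal] at h2
      refine le_of_sq_le_sq ?_ (by positivity)
      rw [mul_pow, mul_pow, ← NNReal.coe_pow (NNReal.sqrt c), NNReal.sq_sqrt]
      exact h2

theorem wcomp_ae (h : IsWeightedComp μ σ m c C) (u : Lp 𝕜 2 μ) :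
    wcomp h u =ᵐ[μ] fun x ↦ m x * u (σ x) := (h.memLp u).coeFn_toLp

end WeightedComposition

/-! ### Translations, iterated differences and directional derivatives -/

section Shift

variable {E : Type*} [NormedAddCommGroup E] [InnerProductSpace ℝ E] [FiniteDimensional ℝ E]
  [MeasurableSpace E] [BorelSpace E] {𝕜 : Type*} [RCLike 𝕜]

theorem isWeightedComp_shift (a : E) :
    IsWeightedComp (𝕜 := 𝕜) (volume : Measure E) (fun x ↦ x + a) (fun _ ↦ 1) 1 1 where
  measurable_map := by fun_prop
  measurable_weight := by fun_prop
  map_le := by rw [map_add_right_eq_self, one_smul]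
  bound := by simp

/-- Translation on `L²`. -/
def shift (a : E) : Lp 𝕜 2 (volume : Measure E) →L[𝕜] Lp 𝕜 2 (volume : Measure E) :=
  wcomp (isWeightedComp_shift a)

theorem shift_ae (a : E) (u : Lp 𝕜 2 (volume : Measure E)) :
    shift a u =ᵐ[volume] fun x ↦ u (x + a) := by
  filter_upwards [wcomp_ae (isWeightedComp_shift a) u] with x hx
  rw [shift, hx, one_mul]

theorem isWeightedComp_char (a : E) :
    IsWeightedComp (volume : Measure E) id
      (fun w ↦ (Real.fourierChar (inner ℝ a w) : ℂ)) 1 1 where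
  measurable_map := measurable_id
  measurable_weight := by
    refine Continuous.measurable ?_
    have := Real.continuous_fourierChar
    fun_prop
  map_le := by simp
  bound := fun x ↦ by simp only [Circle.norm_coe, NNReal.coe_one, le_refl]

theorem fourier_shift (a : E) (u : Lp ℂ 2 (volume : Measure E)) :
    (𝓕 (shift a u) : Lp ℂ 2 (volume : Measure E)) = wcomp (isWeightedComp_char a) (𝓕 u) := by
  refine DenseRange.induction_on (p := fun u : Lp ℂ 2 (volume : Measure E) ↦
    𝓕 (shift a u) = wcomp (isWeightedComp_char a) (𝓕 u))
    (SchwartzMap.denseRange_toLpCLM (p := 2) (E := E) (F := ℂ) (μ := volume)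
      ENNReal.ofNat_ne_top) u ?_ ?_
  · refine isClosed_eq ?_ ?_
    · exact (Lp.fourierTransformₗᵢ E ℂ).continuous.comp (shift a).continuous
    · exact (wcomp _).continuous.comp (Lp.fourierTransformₗᵢ E ℂ).continuous
  · intro φ
    change 𝓕 (shift a (φ.toLp 2)) = wcomp (isWeightedComp_char a) (𝓕 (φ.toLp 2))
    have h1 : shift a (φ.toLp 2) = (φ.compSubConstCLM ℂ (-a)).toLp 2 := by
      apply Lp.ext
      filter_upwards [shift_ae a (φ.toLp 2), (isWeightedComp_shift (𝕜 := ℂ) a).quasiMeasurePreserving.ae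
        (φ.coeFn_toLp 2 volume), (φ.compSubConstCLM ℂ (-a)).coeFn_toLp 2 volume] with x e f k
      rw [e, f, k, SchwartzMap.compSubConstCLM_apply, sub_neg_eq_add]
    rw [h1, SchwartzMap.toLp_fourier_eq, SchwartzMap.toLp_fourier_eq]
    apply Lp.ext
    filter_upwards [wcomp_ae (isWeightedComp_char a) ((𝓕 φ).toLp 2), (𝓕 φ).coeFn_toLp 2 volume,
      (𝓕 (φ.compSubConstCLM ℂ (-a))).coeFn_toLp 2 volume] with w e f k
    rw [k, e, id, f, SchwartzMap.fourier_coe, SchwartzMap.fourier_coe]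
    have := congrFun (VectorFourier.fourierIntegral_comp_add_right Real.fourierChar (volume : Measure E)
      (innerₗ E) (φ : E → ℂ) a) w
    simp only [Circle.smul_def, smul_eq_mul, innerₗ_apply_apply] at this
    rw [show (𝓕 (φ : E → ℂ) : E → ℂ) = VectorFourier.fourierIntegral Real.fourierChar volume (innerₗ E) φ
      from rfl, ← this]
    change VectorFourier.fourierIntegral Real.fourierChar volume (innerₗ E) _ w = _
    congr 2
    ext x
    simp [SchwartzMap.compSubConstCLM_apply]

theorem ft_shift_ae (a : E) (u : Lp ℝ 2 (volume : Measure E)) :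
    ∀ᵐ w : E, ft (shift a u) w = (Real.fourierChar (inner ℝ a w) : ℂ) * ft u w := by
  have h1 : Complex.ofRealCLM.compLp (shift a u) = shift a (Complex.ofRealCLM.compLp u) := by
    apply Lp.ext
    filter_upwards [ofReal_compLp_ae (shift a u), shift_ae a u,
      shift_ae a (Complex.ofRealCLM.compLp u), (isWeightedComp_shift (𝕜 := ℂ) a).quasiMeasurePreserving.ae
        (ofReal_compLp_ae u)] with x e f k l
    rw [e, f, k, l]
  rw [ft_def, h1, fourier_shift]
  exact wcomp_ae (isWeightedComp_char a) (ft u)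

/-- The forward difference operator on real functions. -/
def diffOp (a : E) : Lp ℝ 2 (volume : Measure E) →L[ℝ] Lp ℝ 2 (volume : Measure E) :=
  shift a - ContinuousLinearMap.id ℝ _

theorem diffOp_apply (a : E) (u : Lp ℝ 2 (volume : Measure E)) : diffOp a u = shift a u - u := rfl

theorem ft_diffOp_pow_ae (a : E) (n : ℕ) (u : Lp ℝ 2 (volume : Measure E)) :
    ∀ᵐ w : E, ft ((diffOp a)^[n] u) w =
      ((Real.fourierChar (inner ℝ a w) : ℂ) - 1) ^ n * ft u w := by
  induction n with
  | zero => exact Filter.Eventually.of_forall fun w ↦ by simp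
  | succ n ih =>
    rw [Function.iterate_succ_apply', diffOp_apply, map_sub]
    filter_upwards [ih, ft_shift_ae a ((diffOp a)^[n] u),
      Lp.coeFn_sub (ft (shift a ((diffOp a)^[n] u))) (ft ((diffOp a)^[n] u))] with w e f k
    rw [k, Pi.sub_apply, f, e]
    ring

theorem sq_enorm_diffOp_pow (a : E) (n : ℕ) (u : Lp ℝ 2 (volume : Measure E)) :
    ‖(diffOp a)^[n] u‖ₑ ^ 2 =
      ∫⁻ w, ‖(Real.fourierChar (inner ℝ a w) : ℂ) - 1‖ₑ ^ (2 * n) * ‖ft u w‖ₑ ^ 2 := by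
  rw [← enorm_ft, Lp.enorm_def, sq_eLpNorm_two]
  refine lintegral_congr_ae ?_
  filter_upwards [ft_diffOp_pow_ae a n u] with w hw
  rw [hw, enorm_mul, mul_pow, enorm_pow, ← pow_mul, mul_comm n]

theorem norm_fourierChar_sub_one_le (t : ℝ) :
    ‖(Real.fourierChar t : ℂ) - 1‖ ≤ 2 * Real.pi * |t| := by
  rw [Real.fourierChar_apply, mul_comm]
  refine (Real.norm_exp_I_mul_ofReal_sub_one_le).trans_eq ?_
  rw [Real.norm_eq_abs, abs_mul, abs_of_nonneg (by positivity)]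

theorem norm_fourierChar_neg_sub_one (t : ℝ) :
    ‖(Real.fourierChar (-t) : ℂ) - 1‖ = ‖(Real.fourierChar t : ℂ) - 1‖ := by
  rw [AddChar.map_neg_eq_inv, Circle.coe_inv_eq_conj, ← RCLike.norm_conj, map_sub, map_one,
    Complex.conj_conj]

/-- The Fourier multipliers of the forward and backward differences have equal modulus. This is
needed for reflections, which exchange the two. -/
theorem enorm_diffOp_neg_pow (a : E) (n : ℕ) (u : Lp ℝ 2 (volume : Measure E)) :
    ‖(diffOp (-a))^[n] u‖ₑ = ‖(diffOp a)^[n] u‖ₑ := by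
  refine (ENNReal.pow_right_strictMono (n := 2) (by norm_num)).injective ?_
  simp only [sq_enorm_diffOp_pow]
  refine lintegral_congr fun w ↦ ?_
  rw [inner_neg_left, ← ofReal_norm, norm_fourierChar_neg_sub_one, ofReal_norm]

/-- The Fourier side of a directional derivative of order `n`. -/
def dirNormSq (e : E) (n : ℕ) (u : Lp ℝ 2 (volume : Measure E)) : ℝ≥0∞ :=
  ∫⁻ w, ENNReal.ofReal ((2 * Real.pi * |inner ℝ e w|) ^ (2 * n)) * ‖ft u w‖ₑ ^ 2

theorem sq_enorm_diffOp_pow_le (e : E) (n : ℕ) {h : ℝ} (hh : 0 ≤ h)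
    (u : Lp ℝ 2 (volume : Measure E)) :
    ‖(diffOp (h • e))^[n] u‖ₑ ^ 2 ≤ ENNReal.ofReal (h ^ (2 * n)) * dirNormSq e n u := by
  rw [sq_enorm_diffOp_pow, dirNormSq, ← lintegral_const_mul' _ _ (by simp)]
  refine lintegral_mono fun w ↦ ?_
  rw [← mul_assoc, ← ENNReal.ofReal_mul (by positivity), ← mul_pow]
  gcongr
  rw [← ofReal_norm, ← ENNReal.ofReal_pow (norm_nonneg _)]
  refine ENNReal.ofReal_le_ofReal (pow_le_pow_left₀ (norm_nonneg _) ?_ _)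
  refine (norm_fourierChar_sub_one_le _).trans_eq ?_
  rw [real_inner_smul_left, abs_mul, abs_of_nonneg hh]
  ring

theorem tendsto_norm_fourierChar_sub_one_div (t : ℝ) :
    Filter.Tendsto (fun h : ℝ ↦ ‖(Real.fourierChar (h * t) : ℂ) - 1‖ / h) (nhdsWithin 0 (Ioi 0))
      (nhds (2 * Real.pi * |t|)) := by
  have h1 : HasDerivAt (fun h : ℝ ↦ (Real.fourierChar (h * t) : ℂ)) (2 * Real.pi * t * Complex.I) 0 := by
    simp only [Real.fourierChar_apply]
    have h2 : HasDerivAt (fun h : ℝ ↦ ((2 * Real.pi * (h * t) : ℝ) : ℂ) * Complex.I)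
        (2 * Real.pi * t * Complex.I) 0 := by
      refine HasDerivAt.mul_const ?_ _
      have := (((hasDerivAt_id (0 : ℝ)).mul_const t).const_mul (2 * Real.pi)).ofReal_comp
      simpa using this
    have := h2.cexp
    simpa using this
  have h3 := (hasDerivAt_iff_tendsto_slope_zero.1 h1).norm
  have h4 := h3.mono_left (nhdsWithin_mono 0 (fun x (hx : 0 < x) ↦ ne_of_gt hx) :
    nhdsWithin (0 : ℝ) (Ioi 0) ≤ nhdsWithin 0 {0}ᶜ)
  have h5 : ‖2 * (Real.pi : ℂ) * t * Complex.I‖ = 2 * Real.pi * |t| := by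
    simp [abs_of_pos Real.pi_pos]
  rw [h5] at h4
  refine h4.congr' ?_
  filter_upwards [self_mem_nhdsWithin] with h hh
  rw [norm_smul, norm_inv, Real.norm_of_nonneg (le_of_lt hh), zero_add, zero_mul,
    AddChar.map_zero_eq_one]
  simp [div_eq_inv_mul]

/-- On the Fourier side the difference quotients converge pointwise to the multiplier of the
derivative, so Fatou's lemma along h = 1/(k+1) applies. Regularity can thus be proved from uniform
bounds on differences, without defining weak derivatives. -/
theorem dirNormSq_le_of_diffOp (e : E) (n : ℕ) (u : Lp ℝ 2 (volume : Measure E)) (K : ℝ≥0∞)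
    (hK : ∀ h : ℝ, 0 < h → ‖(diffOp (h • e))^[n] u‖ₑ ^ 2 ≤ ENNReal.ofReal (h ^ (2 * n)) * K) :
    dirNormSq e n u ≤ K := by
  set a : ℕ → ℝ := fun k ↦ 1 / ((k : ℝ) + 1) with ha
  have ha0 : ∀ k, 0 < a k := fun k ↦ Nat.one_div_pos_of_nat
  have hat : Filter.Tendsto a Filter.atTop (nhdsWithin 0 (Ioi 0)) :=
    tendsto_nhdsWithin_iff.2 ⟨tendsto_one_div_add_atTop_nhds_zero_nat,
      Filter.Eventually.of_forall ha0⟩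
  set F : ℕ → E → ℝ≥0∞ := fun k w ↦
    ENNReal.ofReal ((‖(Real.fourierChar (a k * inner ℝ e w) : ℂ) - 1‖ / a k) ^ (2 * n)) *
      ‖ft u w‖ₑ ^ 2 with hF
  have hFm : ∀ k, Measurable (F k) := fun k ↦ by
    refine Measurable.mul ?_ ((Lp.stronglyMeasurable (ft u)).measurable.enorm.pow_const 2)
    refine ENNReal.measurable_ofReal.comp (Continuous.measurable ?_)
    have := Real.continuous_fourierChar
    fun_prop
  have hlim : ∀ w, Filter.Tendsto (fun k ↦ F k w) Filter.atTop
      (nhds (ENNReal.ofReal ((2 * Real.pi * |inner ℝ e w|) ^ (2 * n)) * ‖ft u w‖ₑ ^ 2)) := fun w ↦ by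
    refine ENNReal.Tendsto.mul_const ?_ (Or.inr (by finiteness))
    exact (ENNReal.continuous_ofReal.tendsto _).comp
      (((tendsto_norm_fourierChar_sub_one_div (inner ℝ e w)).comp hat).pow _)
  have hle : ∀ k, ∫⁻ w, F k w ≤ K := fun k ↦ by
    have h1 := hK (a k) (ha0 k)
    rw [sq_enorm_diffOp_pow] at h1
    have hpos : 0 < a k ^ (2 * n) := pow_pos (ha0 k) _
    have h2 : ∫⁻ w, F k w = (ENNReal.ofReal (a k ^ (2 * n)))⁻¹ *
        ∫⁻ w, ‖(Real.fourierChar (inner ℝ (a k • e) w) : ℂ) - 1‖ₑ ^ (2 * n) * ‖ft u w‖ₑ ^ 2 := by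
      rw [← lintegral_const_mul' _ _ (by simpa using hpos)]
      refine lintegral_congr fun w ↦ ?_
      rw [hF, ← mul_assoc, real_inner_smul_left]
      simp only
      rw [div_pow, div_eq_inv_mul, ENNReal.ofReal_mul (by positivity),
        ENNReal.ofReal_inv_of_pos hpos, ENNReal.ofReal_pow (norm_nonneg _), ofReal_norm]
    rw [h2]
    calc _ ≤ (ENNReal.ofReal (a k ^ (2 * n)))⁻¹ * (ENNReal.ofReal (a k ^ (2 * n)) * K) := by gcongr
      _ = K := by
        rw [← mul_assoc, ENNReal.inv_mul_cancel (by simpa using hpos) (by simp), one_mul]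
  calc dirNormSq e n u = ∫⁻ w, Filter.liminf (fun k ↦ F k w) Filter.atTop := by
        refine lintegral_congr fun w ↦ ?_
        exact (hlim w).liminf_eq.symm
    _ ≤ Filter.liminf (fun k ↦ ∫⁻ w, F k w) Filter.atTop := lintegral_liminf_le hFm
    _ ≤ K := by
        refine (Filter.liminf_le_liminf (Filter.Eventually.of_forall hle)).trans ?_
        simp

end Shift

/-! ### Integer Sobolev norms from pure directional derivatives -/

section DirectionalSobolev

variable {d : ℕ}

theorem dirNormSq_le_sobolevNorm (j : Fin d) {n m : ℕ} (hnm : n ≤ m)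
    (u : Lp ℝ 2 (volume : Measure (EuclideanSpace ℝ (Fin d)))) :
    dirNormSq (EuclideanSpace.single j (1 : ℝ)) n u ≤ sobolevNorm m u ^ 2 := by
  rw [sobolevNorm_sq, dirNormSq]
  refine lintegral_mono fun w ↦ ?_
  gcongr
  rw [sobolevWeight]
  refine ENNReal.ofReal_le_ofReal ?_
  rw [pow_mul, Real.rpow_natCast, EuclideanSpace.inner_single_left]
  have h1 : |w j| ≤ ‖w‖ := PiLp.norm_apply_le w j
  have h2 : (2 * Real.pi * |(starRingEnd ℝ) 1 * w j|) ^ 2 ≤ 1 + (2 * Real.pi * ‖w‖) ^ 2 := by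
    rw [map_one, one_mul]
    have : (2 * Real.pi * |w j|) ^ 2 ≤ (2 * Real.pi * ‖w‖) ^ 2 := by gcongr
    linarith
  calc _ ≤ (1 + (2 * Real.pi * ‖w‖) ^ 2) ^ n := pow_le_pow_left₀ (by positivity) h2 n
    _ ≤ _ := pow_le_pow_right₀ (by nlinarith [sq_nonneg (2 * Real.pi * ‖w‖)]) hnm

/-- With y_j = (2π|w_j|)² and M the larger of 1 and max y_j, the weight (1 + Σ y_j)^m is at most
((d+1)M)^m, while M^m is already one of the terms of 1 + Σ y_j^m. No mixed derivatives are needed.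
-/
theorem sobolevNorm_sq_le_dirNormSq (m : ℕ)
    (u : Lp ℝ 2 (volume : Measure (EuclideanSpace ℝ (Fin d)))) :
    sobolevNorm m u ^ 2 ≤ ENNReal.ofReal ((d + 1) ^ m) *
      (‖u‖ₑ ^ 2 + ∑ j, dirNormSq (EuclideanSpace.single j (1 : ℝ)) m u) := by
  have hm1 : Measurable fun w ↦ ‖ft u w‖ₑ ^ 2 :=
    (Lp.stronglyMeasurable (ft u)).measurable.enorm.pow_const 2
  have hm2 : ∀ j : Fin d, Measurable fun w : EuclideanSpace ℝ (Fin d) ↦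
      ENNReal.ofReal ((2 * Real.pi * |inner ℝ (EuclideanSpace.single j (1 : ℝ)) w|) ^ (2 * m)) *
        ‖ft u w‖ₑ ^ 2 := fun j ↦ by
    refine Measurable.mul ?_ hm1
    fun_prop
  rw [sobolevNorm_sq, ← enorm_ft, Lp.enorm_def, sq_eLpNorm_two]
  simp only [dirNormSq]
  rw [← lintegral_finsetSum _ fun j _ ↦ hm2 j, ← lintegral_add_left hm1,
    ← lintegral_const_mul' _ _ (by simp)]
  refine lintegral_mono fun w ↦ ?_
  simp only
  rw [← Finset.sum_mul, ← one_add_mul, ← mul_assoc]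
  gcongr
  rw [sobolevWeight, ← ENNReal.ofReal_sum_of_nonneg fun i _ ↦ by positivity, ← ENNReal.ofReal_one,
    ← ENNReal.ofReal_add zero_le_one (Finset.sum_nonneg fun i _ ↦ by positivity),
    ← ENNReal.ofReal_mul (by positivity), Real.rpow_natCast]
  refine ENNReal.ofReal_le_ofReal ?_
  set y : Fin d → ℝ := fun j ↦ (2 * Real.pi * |w j|) ^ 2 with hy
  have hy0 : ∀ j, 0 ≤ y j := fun j ↦ by positivity
  have e1 : (2 * Real.pi * ‖w‖) ^ 2 = ∑ j, y j := by
    rw [mul_pow, EuclideanSpace.norm_sq_eq, Finset.mul_sum]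
    simp [hy, mul_pow]
  have e2 : ∀ j : Fin d, (2 * Real.pi * |inner ℝ (EuclideanSpace.single j (1 : ℝ)) w|) ^ (2 * m) =
      y j ^ m := fun j ↦ by
    rw [pow_mul, EuclideanSpace.inner_single_left, map_one, one_mul]
  simp_rw [e1, e2]
  obtain ⟨M, hM1, hM2, hM3⟩ : ∃ M, 1 ≤ M ∧ (∀ j, y j ≤ M) ∧ M ^ m ≤ 1 + ∑ j, y j ^ m := by
    by_cases hall : ∀ j, y j ≤ 1
    · refine ⟨1, le_rfl, hall, ?_⟩
      rw [one_pow]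
      linarith [Finset.sum_nonneg fun (j : Fin d) (_ : j ∈ Finset.univ) ↦ pow_nonneg (hy0 j) m]
    · push Not at hall
      obtain ⟨j₀, hj₀⟩ := hall
      obtain ⟨j, -, hj⟩ := Finset.exists_max_image Finset.univ y ⟨j₀, Finset.mem_univ _⟩
      refine ⟨y j, hj₀.le.trans (hj j₀ (Finset.mem_univ _)), fun i ↦ hj i (Finset.mem_univ _), ?_⟩
      have := Finset.single_le_sum (f := fun j ↦ y j ^ m) (fun i _ ↦ pow_nonneg (hy0 i) m)
        (Finset.mem_univ j)
      linarith
  have e3 : 1 + ∑ j, y j ≤ (d + 1) * M := by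
    have : ∑ j, y j ≤ ∑ _j : Fin d, M := Finset.sum_le_sum fun j _ ↦ hM2 j
    rw [Finset.sum_const, Finset.card_univ, Fintype.card_fin, nsmul_eq_mul] at this
    linarith
  calc (1 + ∑ j, y j) ^ m ≤ ((d + 1) * M) ^ m :=
        pow_le_pow_left₀ (by linarith [Finset.sum_nonneg fun (j : Fin d)
          (_ : j ∈ Finset.univ) ↦ hy0 j]) e3 m
    _ = (d + 1) ^ m * M ^ m := mul_pow _ _ _
    _ ≤ _ := by gcongr

end DirectionalSobolev

/-! ### Higher-order reflection on the line -/

section Reflection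

/-- Reflection coefficients matching `m + 1` moments. -/
theorem exists_reflection_coeff (m : ℕ) : ∃ c : ℕ → ℝ, ∀ i ≤ m,
    ∑ k ∈ Finset.range (m + 1), c k * (-((k : ℝ) + 1)) ^ i = 1 := by
  set v : ℕ → ℝ := fun k ↦ -((k : ℝ) + 1) with hv
  have hinj : Set.InjOn v (Finset.range (m + 1)) := fun a _ b _ h ↦ by
    simp only [hv, neg_inj, add_left_inj, Nat.cast_inj] at h
    exact h
  refine ⟨fun k ↦ (Lagrange.basis (Finset.range (m + 1)) v k).eval 1, fun i hi ↦ ?_⟩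
  -- The coefficients are the Lagrange basis polynomials for the nodes -(k+1), evaluated at 1. Since
  -- X^i with i ≤ m is reproduced by interpolation at m + 1 nodes, its value 1 at the point 1 is the
  -- required moment.
  have h1 := Lagrange.eq_interpolate (s := Finset.range (m + 1)) (f := Polynomial.X ^ i) hinj (by
    rw [Polynomial.degree_X_pow, Finset.card_range]
    exact_mod_cast Nat.lt_succ_of_le hi)
  have h2 := congrArg (Polynomial.eval 1) h1
  rw [Lagrange.interpolate_apply, Polynomial.eval_finsetSum] at h2
  simp only [Polynomial.eval_pow, Polynomial.eval_X, one_pow, Polynomial.eval_mul,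
    Polynomial.eval_C] at h2
  refine Eq.trans ?_ h2.symm
  exact Finset.sum_congr rfl fun k _ ↦ mul_comm _ _

/-- The `i`-th derivative of the extension of `θ` from the right half-line by reflections. -/
def reflDeriv (m : ℕ) (c : ℕ → ℝ) (i : ℕ) (θ : ℝ → ℝ) (t : ℝ) : ℝ :=
  if 0 ≤ t then iteratedDeriv i θ t
  else ∑ k ∈ Finset.range (m + 1), c k * (-((k : ℝ) + 1)) ^ i *
    iteratedDeriv i θ (-((k : ℝ) + 1) * t)

variable {m : ℕ} {c : ℕ → ℝ} {θ : ℝ → ℝ}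

theorem continuous_iteratedDeriv_of_smooth (hθ : ContDiff ℝ (⊤ : ℕ∞) θ) (i : ℕ) :
    Continuous (iteratedDeriv i θ) :=
  hθ.continuous_iteratedDeriv i (by exact_mod_cast le_top)

theorem hasDerivAt_iteratedDeriv_of_smooth (hθ : ContDiff ℝ (⊤ : ℕ∞) θ) (i : ℕ) (t : ℝ) :
    HasDerivAt (iteratedDeriv i θ) (iteratedDeriv (i + 1) θ t) t := by
  rw [iteratedDeriv_succ]
  exact (hθ.differentiable_iteratedDeriv i (by exact_mod_cast WithTop.coe_lt_top i) t).hasDerivAt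

/-- Continuity is only in question at 0, where the left limit is the i-th moment of the coefficients
times the right value; the moment identity makes them equal. -/
theorem continuous_reflDeriv (hc : ∀ i ≤ m, ∑ k ∈ Finset.range (m + 1), c k * (-((k : ℝ) + 1)) ^ i = 1)
    (hθ : ContDiff ℝ (⊤ : ℕ∞) θ) {i : ℕ} (hi : i ≤ m) : Continuous (reflDeriv m c i θ) := by
  have h1 := continuous_iteratedDeriv_of_smooth hθ i
  refine Continuous.if_le h1 (by fun_prop) continuous_const continuous_id ?_
  rintro t rfl
  simp only [mul_zero]
  rw [← Finset.sum_mul, hc i hi, one_mul]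

theorem hasDerivAt_reflDeriv (hθ : ContDiff ℝ (⊤ : ℕ∞) θ) (i : ℕ) {t : ℝ} (ht : t ≠ 0) :
    HasDerivAt (reflDeriv m c i θ) (reflDeriv m c (i + 1) θ t) t := by
  rcases lt_or_gt_of_ne ht with h | h
  · have h1 : HasDerivAt (fun t ↦ ∑ k ∈ Finset.range (m + 1), c k * (-((k : ℝ) + 1)) ^ i *
        iteratedDeriv i θ (-((k : ℝ) + 1) * t)) (reflDeriv m c (i + 1) θ t) t := by
      rw [reflDeriv, if_neg (not_le.2 h)]
      refine HasDerivAt.fun_sum fun k _ ↦ ?_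
      have h2 : HasDerivAt (fun t : ℝ ↦ -((k : ℝ) + 1) * t) (-((k : ℝ) + 1)) t := by
        simpa using (hasDerivAt_id t).const_mul (-((k : ℝ) + 1))
      have h3 := ((hasDerivAt_iteratedDeriv_of_smooth hθ i (-((k : ℝ) + 1) * t)).comp t h2).const_mul
        (c k * (-((k : ℝ) + 1)) ^ i)
      refine h3.congr_deriv ?_
      ring
    refine h1.congr_of_eventuallyEq ?_
    filter_upwards [Iio_mem_nhds h] with s hs
    rw [reflDeriv, if_neg (not_le.2 hs)]
  · have h1 := hasDerivAt_iteratedDeriv_of_smooth hθ i t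
    rw [reflDeriv, if_pos h.le]
    refine h1.congr_of_eventuallyEq ?_
    filter_upwards [Ioi_mem_nhds h] with s hs
    rw [reflDeriv, if_pos (le_of_lt hs)]

/-- Differentiability may fail only at 0, and the fundamental theorem of calculus tolerates a
countable exceptional set for a continuous function. Requiring i < m keeps the next derivative
continuous. -/
theorem reflDeriv_sub_eq_integral
    (hc : ∀ i ≤ m, ∑ k ∈ Finset.range (m + 1), c k * (-((k : ℝ) + 1)) ^ i = 1)
    (hθ : ContDiff ℝ (⊤ : ℕ∞) θ) {i : ℕ} (hi : i < m) (t h : ℝ) :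
    reflDeriv m c i θ (t + h) - reflDeriv m c i θ t =
      ∫ s in (0 : ℝ)..h, reflDeriv m c (i + 1) θ (t + s) := by
  rw [intervalIntegral.integral_comp_add_left (fun s ↦ reflDeriv m c (i + 1) θ s), add_zero]
  refine (integral_eq_of_hasDerivAt_off_countable _ _ (s := {0}) (countable_singleton 0)
    (continuous_reflDeriv hc hθ hi.le).continuousOn (fun x hx ↦ hasDerivAt_reflDeriv hθ i hx.2)
    ((continuous_reflDeriv hc hθ hi).intervalIntegrable _ _)).symm

/-- The cut-off near the left end of the unit interval. -/
def leftCutoff (t : ℝ) : ℝ := Real.smoothTransition (2 - 3 * t)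

theorem contDiff_leftCutoff : ContDiff ℝ (⊤ : ℕ∞) leftCutoff :=
  Real.smoothTransition.contDiff.comp (by fun_prop)

theorem leftCutoff_eq_zero {t : ℝ} (ht : 2 / 3 ≤ t) : leftCutoff t = 0 :=
  Real.smoothTransition.zero_of_nonpos (by linarith)

theorem abs_leftCutoff_le (t : ℝ) : |leftCutoff t| ≤ 1 :=
  abs_le.2 ⟨(by norm_num : (-1 : ℝ) ≤ 0).trans (Real.smoothTransition.nonneg _),
    Real.smoothTransition.le_one _⟩

/-- The arguments of the two transition functions add up to one. The reflections at the two opposite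
faces of the cube therefore recombine to the original function in between. -/
theorem leftCutoff_add (t : ℝ) : leftCutoff t + leftCutoff (1 - t) = 1 := by
  have h1 : 2 - 3 * (1 - t) = 1 - (2 - 3 * t) := by ring
  rw [leftCutoff, leftCutoff, h1]
  set x := 2 - 3 * t
  have h2 := Real.smoothTransition.pos_denom x
  simp only [Real.smoothTransition, sub_sub_cancel]
  rw [add_comm (expNegInvGlue (1 - x)), ← add_div, div_self h2.ne']

theorem exists_bound_iteratedDeriv_leftCutoff (m : ℕ) : ∃ A : ℝ, 0 ≤ A ∧
    ∀ l ≤ m, ∀ t : ℝ, 0 ≤ t → |iteratedDeriv l leftCutoff t| ≤ A := by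
  have h1 : ∀ l : ℕ, ∃ A : ℝ, 0 ≤ A ∧ ∀ t : ℝ, 0 ≤ t → |iteratedDeriv l leftCutoff t| ≤ A := fun l ↦ by
    obtain ⟨A, hA⟩ := (isCompact_Icc (a := (0 : ℝ)) (b := 1)).exists_bound_of_continuousOn
      (continuous_iteratedDeriv_of_smooth contDiff_leftCutoff l).continuousOn
    have hA0 : 0 ≤ A := (norm_nonneg _).trans (hA 0 (by simp))
    refine ⟨A, hA0, fun t ht ↦ ?_⟩
    rcases le_or_gt t 1 with h | h
    · exact hA t ⟨ht, h⟩
    · have h2 : leftCutoff =ᶠ[nhds t] fun _ ↦ (0 : ℝ) := by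
        filter_upwards [Ioi_mem_nhds h] with s hs
        exact leftCutoff_eq_zero (by linarith [mem_Ioi.1 hs])
      rw [h2.iteratedDeriv_eq l]
      simpa [iteratedDeriv_const] using hA0
  choose A hA0 hA using h1
  refine ⟨∑ l ∈ Finset.range (m + 1), A l, Finset.sum_nonneg fun l _ ↦ hA0 l, fun l hl t ht ↦ ?_⟩
  exact (hA l t ht).trans (Finset.single_le_sum (fun i _ ↦ hA0 i)
    (Finset.mem_range.2 (Nat.lt_succ_of_le hl)))

end Reflection

/-! ### Finite differences of functions with integrated line derivatives -/

section FiniteDifference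

variable {d : ℕ}

/-- The forward difference of a function. -/
def fwdDiffBy (a : EuclideanSpace ℝ (Fin d)) (u : EuclideanSpace ℝ (Fin d) → ℝ)
    (x : EuclideanSpace ℝ (Fin d)) : ℝ := u (x + a) - u x

theorem diffOp_pow_ae (a : EuclideanSpace ℝ (Fin d)) (n : ℕ)
    {u : Lp ℝ 2 (volume : Measure (EuclideanSpace ℝ (Fin d)))} {U : EuclideanSpace ℝ (Fin d) → ℝ}
    (h : u =ᵐ[volume] U) : (diffOp a)^[n] u =ᵐ[volume] (fwdDiffBy a)^[n] U := by
  induction n with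
  | zero => exact h
  | succ n ih =>
    rw [Function.iterate_succ_apply', Function.iterate_succ_apply', diffOp_apply]
    filter_upwards [ih, shift_ae a ((diffOp a)^[n] u), Lp.coeFn_sub (shift a ((diffOp a)^[n] u))
      ((diffOp a)^[n] u), (isWeightedComp_shift (𝕜 := ℝ) a).quasiMeasurePreserving.ae ih] with x e f k l
    rw [k, Pi.sub_apply, f, e, l, fwdDiffBy]

/-- `u'` is the derivative of `u` in direction `e`, in integrated form. -/
def IsLinePrimitive (e : EuclideanSpace ℝ (Fin d)) (u u' : EuclideanSpace ℝ (Fin d) → ℝ) : Prop :=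
  (∀ x, Continuous fun s : ℝ ↦ u' (x + s • e)) ∧
    ∀ x (h : ℝ), u (x + h • e) - u x = ∫ s in (0 : ℝ)..h, u' (x + s • e)

theorem IsLinePrimitive.fwdDiffBy {e : EuclideanSpace ℝ (Fin d)}
    {u u' : EuclideanSpace ℝ (Fin d) → ℝ} (h : IsLinePrimitive e u u')
    (a : EuclideanSpace ℝ (Fin d)) : IsLinePrimitive e (fwdDiffBy a u) (fwdDiffBy a u') := by
  have hc : ∀ x, Continuous fun s : ℝ ↦ u' (x + s • e + a) := fun x ↦ by
    simpa only [add_right_comm] using h.1 (x + a)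
  refine ⟨fun x ↦ (hc x).sub (h.1 x), fun x t ↦ ?_⟩
  simp only [AdvKRR.fwdDiffBy]
  rw [intervalIntegral.integral_sub ((hc x).intervalIntegrable _ _) ((h.1 x).intervalIntegrable _ _),
    ← h.2]
  have h1 := h.2 (x + a) t
  simp only [add_right_comm x a] at h1
  rw [← h1]
  ring

/-- Cauchy-Schwarz on the segment of length t, then Tonelli and translation invariance; each of the
two integrations over the segment contributes a factor t. -/
theorem lintegral_fwdDiffBy_le {e : EuclideanSpace ℝ (Fin d)}
    {u u' : EuclideanSpace ℝ (Fin d) → ℝ} (h : IsLinePrimitive e u u') (hm : Measurable u')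
    {t : ℝ} (ht : 0 < t) :
    ∫⁻ x, ‖fwdDiffBy (t • e) u x‖ₑ ^ 2 ≤ ENNReal.ofReal (t ^ 2) * ∫⁻ x, ‖u' x‖ₑ ^ 2 := by
  have hmeas : Measurable fun p : EuclideanSpace ℝ (Fin d) × ℝ ↦ ‖u' (p.1 + p.2 • e)‖ₑ ^ 2 := by
    have : Measurable fun p : EuclideanSpace ℝ (Fin d) × ℝ ↦ p.1 + p.2 • e := by fun_prop
    exact (hm.comp this).enorm.pow_const 2
  have h1 : ∀ x, ‖fwdDiffBy (t • e) u x‖ₑ ^ 2 ≤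
      ENNReal.ofReal t * ∫⁻ s in Ioc 0 t, ‖u' (x + s • e)‖ₑ ^ 2 := fun x ↦ by
    rw [fwdDiffBy, h.2, intervalIntegral.integral_of_le ht.le]
    have h2 := enorm_integral_le_lintegral_enorm (μ := volume.restrict (Ioc 0 t))
      fun s : ℝ ↦ u' (x + s • e)
    have h3 := sq_lintegral_mul_le (μ := volume.restrict (Ioc 0 t)) (f := fun _ ↦ 1)
      (g := fun s : ℝ ↦ ‖u' (x + s • e)‖ₑ) aemeasurable_const
      ((h.1 x).measurable.enorm.aemeasurable)
    simp only [one_mul, one_pow, lintegral_one, Measure.restrict_apply_univ, Real.volume_Ioc,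
      sub_zero] at h3
    exact (pow_le_pow_left' h2 2).trans h3
  calc _ ≤ ∫⁻ x, ENNReal.ofReal t * ∫⁻ s in Ioc 0 t, ‖u' (x + s • e)‖ₑ ^ 2 := lintegral_mono h1
    _ = ENNReal.ofReal t * ∫⁻ x, ∫⁻ s in Ioc 0 t, ‖u' (x + s • e)‖ₑ ^ 2 :=
        lintegral_const_mul' _ _ (by simp)
    _ = ENNReal.ofReal t * ∫⁻ s in Ioc 0 t, ∫⁻ x, ‖u' (x + s • e)‖ₑ ^ 2 := by
        rw [lintegral_lintegral_swap hmeas.aemeasurable]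
    _ = ENNReal.ofReal t * ∫⁻ s in Ioc 0 t, ∫⁻ x, ‖u' x‖ₑ ^ 2 := by
        congr 1
        refine lintegral_congr fun s ↦ ?_
        exact lintegral_add_right_eq_self (fun x ↦ ‖u' x‖ₑ ^ 2) (s • e)
    _ = _ := by
        rw [lintegral_const, Measure.restrict_apply_univ, Real.volume_Ioc, sub_zero,
          mul_comm (∫⁻ x, _), ← mul_assoc, ← ENNReal.ofReal_mul ht.le, sq]

/-- Taking differences preserves the relation between a function and its line derivative, so each of
the m differences can be traded for one derivative and a factor t². -/
theorem lintegral_fwdDiffBy_pow_le {e : EuclideanSpace ℝ (Fin d)} {m : ℕ}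
    {U : ℕ → EuclideanSpace ℝ (Fin d) → ℝ} (hU : ∀ i < m, IsLinePrimitive e (U i) (U (i + 1)))
    (hm : ∀ i ≤ m, Measurable (U i)) {t : ℝ} (ht : 0 < t) :
    ∫⁻ x, ‖(fwdDiffBy (t • e))^[m] (U 0) x‖ₑ ^ 2 ≤
      ENNReal.ofReal (t ^ (2 * m)) * ∫⁻ x, ‖U m x‖ₑ ^ 2 := by
  have hmeas : ∀ n i, i ≤ m → Measurable ((fwdDiffBy (t • e))^[n] (U i)) := fun n ↦ by
    induction n with
    | zero => exact hm
    | succ n ih =>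
      intro i hi
      rw [Function.iterate_succ_apply']
      exact ((ih i hi).comp (measurable_add_const (t • e))).sub (ih i hi)
  have hprim : ∀ n i, i < m →
      IsLinePrimitive e ((fwdDiffBy (t • e))^[n] (U i)) ((fwdDiffBy (t • e))^[n] (U (i + 1))) :=
    fun n ↦ by
      induction n with
      | zero => exact hU
      | succ n ih =>
        intro i hi
        rw [Function.iterate_succ_apply', Function.iterate_succ_apply']
        exact (ih i hi).fwdDiffBy _
  have key : ∀ n i, i + n ≤ m → ∫⁻ x, ‖(fwdDiffBy (t • e))^[n] (U i) x‖ₑ ^ 2 ≤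
      ENNReal.ofReal (t ^ (2 * n)) * ∫⁻ x, ‖U (i + n) x‖ₑ ^ 2 := fun n ↦ by
    induction n with
    | zero => intro i _; simp
    | succ n ih =>
      intro i hi
      rw [Function.iterate_succ_apply']
      refine (lintegral_fwdDiffBy_le (hprim n i (by omega)) (hmeas n (i + 1) (by omega)) ht).trans ?_
      refine (mul_le_mul_right (ih (i + 1) (by omega)) _).trans_eq ?_
      rw [← mul_assoc, ← ENNReal.ofReal_mul (by positivity), show i + 1 + n = i + (n + 1) by ring]
      congr 2
      ring
  simpa using key m 0 (by omega)

/-- Moving a point along the `j`-th axis by a multiple of its `j`-th coordinate. -/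
theorem map_axis_dilation (j : Fin d) {b : ℝ} (hb : 1 + b ≠ 0) :
    Measure.map (fun x : EuclideanSpace ℝ (Fin d) ↦ x + (b * x j) • EuclideanSpace.single j (1 : ℝ))
      volume = ENNReal.ofReal |(1 + b)⁻¹| • volume := by
  set f : Module.Dual ℝ (EuclideanSpace ℝ (Fin d)) :=
    b • (EuclideanSpace.proj j : EuclideanSpace ℝ (Fin d) →L[ℝ] ℝ).toLinearMap with hf
  have hdet : LinearMap.det (LinearMap.transvection f (EuclideanSpace.single j (1 : ℝ))) = 1 + b := by
    rw [LinearMap.transvection.det]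
    simp [hf]
  have h := Measure.map_linearMap_addHaar_eq_smul_addHaar
    (volume : Measure (EuclideanSpace ℝ (Fin d))) (f := LinearMap.transvection f
      (EuclideanSpace.single j (1 : ℝ))) (by rwa [hdet])
  rw [hdet] at h
  rw [← h]
  rfl

end FiniteDifference

/-! ### Band-limited approximation -/

section Synthesis

variable {E : Type*} [NormedAddCommGroup E] [InnerProductSpace ℝ E] [FiniteDimensional ℝ E]
  [MeasurableSpace E] [BorelSpace E]

theorem hasDerivAt_fourierInv_line {H : E → ℂ} (e : E) (h1 : Integrable H)
    (h2 : Integrable fun w ↦ (2 * Real.pi * Complex.I * inner ℝ e w : ℂ) * H w) (x : E) (t : ℝ) :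
    HasDerivAt (fun s : ℝ ↦ 𝓕⁻ H (x + s • e))
      (𝓕⁻ (fun w ↦ (2 * Real.pi * Complex.I * inner ℝ e w : ℂ) * H w) (x + t • e)) t := by
  have hchar : ∀ s : ℝ, ∀ w : E, HasDerivAt
      (fun s : ℝ ↦ (Real.fourierChar (inner ℝ w (x + s • e)) : ℂ) * H w)
      ((Real.fourierChar (inner ℝ w (x + s • e)) : ℂ) *
        ((2 * Real.pi * Complex.I * inner ℝ e w : ℂ) * H w)) s := fun s w ↦ by
    simp only [Real.fourierChar_apply, inner_add_right, real_inner_smul_right]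
    have h3 : HasDerivAt (fun s : ℝ ↦ ((2 * Real.pi * (inner ℝ w x + s * inner ℝ w e) : ℝ) : ℂ) *
        Complex.I) (2 * Real.pi * Complex.I * inner ℝ e w) s := by
      have := ((((hasDerivAt_id s).mul_const (inner ℝ w e)).const_add (inner ℝ w x)).const_mul
        (2 * Real.pi)).ofReal_comp.mul_const Complex.I
      refine this.congr_deriv ?_
      rw [real_inner_comm w e]
      push_cast
      ring
    have := h3.cexp.mul_const (H w)
    refine this.congr_deriv ?_
    ring
  have hc : ∀ s : ℝ, Continuous fun w : E ↦ (Real.fourierChar (inner ℝ w (x + s • e)) : ℂ) :=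
    fun s ↦ by
      have := Real.continuous_fourierChar
      fun_prop
  have key := hasDerivAt_integral_of_dominated_loc_of_deriv_le (μ := (volume : Measure E))
    (F := fun (s : ℝ) w ↦ (Real.fourierChar (inner ℝ w (x + s • e)) : ℂ) * H w)
    (F' := fun (s : ℝ) w ↦ (Real.fourierChar (inner ℝ w (x + s • e)) : ℂ) *
        ((2 * Real.pi * Complex.I * inner ℝ e w : ℂ) * H w))
    (bound := fun w ↦ ‖(2 * Real.pi * Complex.I * inner ℝ e w : ℂ) * H w‖) (x₀ := t) (s := univ)
    Filter.univ_mem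
    (Filter.Eventually.of_forall fun s ↦ (hc s).aestronglyMeasurable.mul h1.1)
    (h1.bdd_mul (c := 1) (hc t).aestronglyMeasurable (Filter.Eventually.of_forall fun w ↦ by
      simp only [Circle.norm_coe, le_refl]))
    ((hc t).aestronglyMeasurable.mul h2.1)
    (Filter.Eventually.of_forall fun w s _ ↦ by
      rw [norm_mul, Circle.norm_coe, one_mul])
    h2.norm (Filter.Eventually.of_forall fun w s _ ↦ hchar s w)
  simp only [Real.fourierInv_eq, Circle.smul_def, smul_eq_mul]
  exact key.2

/-- The Fourier transform restricted to frequencies of size at most `N`. -/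
def lowFreq (g : Lp ℝ 2 (volume : Measure E)) (N : ℝ) : E → ℂ :=
  (Metric.closedBall (0 : E) N).indicator (ft g)

theorem stronglyMeasurable_lowFreq (g : Lp ℝ 2 (volume : Measure E)) (N : ℝ) :
    StronglyMeasurable (lowFreq g N) :=
  (Lp.stronglyMeasurable _).indicator Metric.isClosed_closedBall.measurableSet

theorem memLp_mul_lowFreq (g : Lp ℝ 2 (volume : Measure E)) (N : ℝ) {p : E → ℂ}
    (hp : Continuous p) : MemLp (fun w ↦ p w * lowFreq g N w) 2 := by
  obtain ⟨A, hA⟩ := (isCompact_closedBall (0 : E) N).exists_bound_of_continuousOn hp.continuousOn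
  refine MemLp.of_le_mul (c := max A 0) (Lp.memLp (ft g))
    (hp.aestronglyMeasurable.mul (stronglyMeasurable_lowFreq g N).aestronglyMeasurable)
    (Filter.Eventually.of_forall fun w ↦ ?_)
  by_cases hw : w ∈ Metric.closedBall (0 : E) N
  · rw [lowFreq, indicator_of_mem hw, norm_mul]
    gcongr
    exact (hA w hw).trans (le_max_left _ _)
  · rw [lowFreq, indicator_of_notMem hw, mul_zero, norm_zero]
    positivity

theorem integrable_mul_lowFreq (g : Lp ℝ 2 (volume : Measure E)) (N : ℝ) {p : E → ℂ}
    (hp : Continuous p) : Integrable (fun w ↦ p w * lowFreq g N w) := by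
  have h1 : IntegrableOn (ft g) (Metric.closedBall (0 : E) N) := by
    have : IsFiniteMeasure ((volume : Measure E).restrict (Metric.closedBall (0 : E) N)) :=
      ⟨by simpa using measure_closedBall_lt_top⟩
    exact ((Lp.memLp (ft g)).restrict _).integrable (by norm_num)
  have h2 := (h1.continuousOn_mul hp.continuousOn (isCompact_closedBall 0 N)).integrable_indicator
    Metric.isClosed_closedBall.measurableSet
  refine h2.congr (Filter.Eventually.of_forall fun w ↦ ?_)
  by_cases hw : w ∈ Metric.closedBall (0 : E) N
  · simp [lowFreq, hw]
  · simp [lowFreq, hw]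

/-- The `i`-th derivative in direction `e` of the low-frequency part of `g`. -/
def lowFreqDeriv (g : Lp ℝ 2 (volume : Measure E)) (N : ℝ) (e : E) (i : ℕ) (x : E) : ℝ :=
  (𝓕⁻ (fun w ↦ (2 * Real.pi * Complex.I * inner ℝ e w : ℂ) ^ i * lowFreq g N w) x).re

variable (g : Lp ℝ 2 (volume : Measure E)) (N : ℝ) (e : E)

theorem continuous_lowFreqDeriv (i : ℕ) : Continuous (lowFreqDeriv g N e i) :=
  Complex.continuous_re.comp
    (continuous_fourierInv_integral (integrable_mul_lowFreq g N (by fun_prop)))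

theorem hasDerivAt_lowFreqDeriv (i : ℕ) (x : E) (t : ℝ) :
    HasDerivAt (fun s : ℝ ↦ lowFreqDeriv g N e i (x + s • e))
      (lowFreqDeriv g N e (i + 1) (x + t • e)) t := by
  have h1 := hasDerivAt_fourierInv_line
    (H := fun w ↦ (2 * Real.pi * Complex.I * inner ℝ e w : ℂ) ^ i * lowFreq g N w) e
    (integrable_mul_lowFreq g N (by fun_prop))
    (by simpa only [← mul_assoc, ← pow_succ'] using
      integrable_mul_lowFreq g N (p := fun w ↦
        (2 * Real.pi * Complex.I * inner ℝ e w : ℂ) ^ (i + 1)) (by fun_prop)) x t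
  simp only [← mul_assoc, ← pow_succ'] at h1
  exact
    Complex.reCLM.hasFDerivAt.comp_hasDerivAt t h1

theorem iteratedDeriv_lowFreqDeriv (x : E) (i : ℕ) :
    iteratedDeriv i (fun s : ℝ ↦ lowFreqDeriv g N e 0 (x + s • e)) =
      fun s ↦ lowFreqDeriv g N e i (x + s • e) := by
  induction i with
  | zero => exact iteratedDeriv_zero
  | succ i ih =>
    rw [iteratedDeriv_succ, ih]
    funext t
    exact (hasDerivAt_lowFreqDeriv g N e i x t).deriv

theorem contDiff_lowFreqDeriv (x : E) :
    ContDiff ℝ (⊤ : ℕ∞) fun s : ℝ ↦ lowFreqDeriv g N e 0 (x + s • e) := by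
  refine contDiff_of_differentiable_iteratedDeriv fun i _ ↦ ?_
  rw [iteratedDeriv_lowFreqDeriv]
  exact fun t ↦ (hasDerivAt_lowFreqDeriv g N e i x t).differentiableAt

theorem lintegral_lowFreqDeriv_le (i : ℕ) :
    ∫⁻ x, ‖lowFreqDeriv g N e i x‖ₑ ^ 2 ≤ dirNormSq e i g := by
  have h1 := integrable_mul_lowFreq g N (p := fun w ↦ (2 * Real.pi * Complex.I * inner ℝ e w : ℂ) ^ i)
    (by fun_prop)
  have h2 := memLp_mul_lowFreq g N (p := fun w ↦ (2 * Real.pi * Complex.I * inner ℝ e w : ℂ) ^ i)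
    (by fun_prop)
  calc _ ≤ ∫⁻ x, ‖𝓕⁻ (fun w ↦ (2 * Real.pi * Complex.I * inner ℝ e w : ℂ) ^ i * lowFreq g N w) x‖ₑ
        ^ 2 := by
        refine lintegral_mono fun x ↦ ?_
        gcongr
        rw [enorm_le_iff_norm_le]
        exact Complex.abs_re_le_norm _
    _ = _ := lintegral_fourierInv_sq h1 h2
    _ ≤ _ := by
        refine lintegral_mono fun w ↦ ?_
        rw [enorm_mul, mul_pow, ← ofReal_norm, norm_pow, ← ENNReal.ofReal_pow (by positivity),
          ← pow_mul, mul_comm i]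
        have h3 : ‖(2 * Real.pi * Complex.I * inner ℝ e w : ℂ)‖ = 2 * Real.pi * |inner ℝ e w| := by
          simp [abs_of_pos Real.pi_pos]
        rw [h3]
        gcongr
        rw [lowFreq]
        exact enorm_indicator_le_enorm_self _ _

theorem exists_lowFreq_approx : ∃ gN : Lp ℝ 2 (volume : Measure E),
    gN =ᵐ[volume] lowFreqDeriv g N e 0 ∧ ft gN =ᵐ[volume] lowFreq g N := by
  obtain ⟨gN, hgN⟩ := exists_real_multiplier g
    (m := fun w ↦ (Metric.closedBall (0 : E) N).indicator (fun _ ↦ 1) w)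
    (measurable_const.indicator Metric.isClosed_closedBall.measurableSet)
    (fun w ↦ by simp [indicator]) (c := 1) (fun w ↦ by
      by_cases hw : w ∈ Metric.closedBall (0 : E) N <;> simp [hw])
  have h1 : ft gN =ᵐ[volume] lowFreq g N := by
    filter_upwards [hgN] with w hw
    by_cases h : w ∈ Metric.closedBall (0 : E) N
    · simp [hw, lowFreq, h]
    · simp [hw, lowFreq, h]
  refine ⟨gN, ?_, h1⟩
  have h2 : Integrable (ft gN) := by
    have := integrable_mul_lowFreq g N (p := fun _ ↦ 1) continuous_const
    simp only [one_mul] at this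
    exact this.congr h1.symm
  filter_upwards [ae_eq_fourierInv_ft h2] with x hx
  rw [hx, lowFreqDeriv]
  simp only [pow_zero, one_mul]
  rw [Real.fourierInv_eq, Real.fourierInv_eq]
  congr 1
  refine integral_congr_ae ?_
  filter_upwards [h1] with w hw
  rw [hw]

/-- Band-limited functions are smooth along every line, so classical calculus applies to their
reflections. Estimates on differences that are uniform in `N` then pass to the limit, because
differences and reflections are continuous on L². -/
theorem exists_seq_lowFreq_approx : ∃ u : ℕ → Lp ℝ 2 (volume : Measure E),
    (∀ N : ℕ, u N =ᵐ[volume] lowFreqDeriv g N e 0) ∧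
      Filter.Tendsto u Filter.atTop (nhds g) := by
  choose u hu hu' using fun N : ℕ ↦ exists_lowFreq_approx g N e
  refine ⟨u, hu, ?_⟩
  rw [tendsto_iff_edist_tendsto_0]
  have h1 : ∀ N, edist (u N) g ^ 2 =
      ∫⁻ w, (Metric.closedBall (0 : E) N)ᶜ.indicator (fun w ↦ ‖ft g w‖ₑ ^ 2) w := fun N ↦ by
    rw [edist_eq_enorm_sub, ← enorm_ft, map_sub, Lp.enorm_def, sq_eLpNorm_two]
    refine lintegral_congr_ae ?_
    filter_upwards [Lp.coeFn_sub (ft (u N)) (ft g), hu' N] with w h2 h3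
    rw [h2, Pi.sub_apply, h3, lowFreq]
    by_cases h : w ∈ Metric.closedBall (0 : E) N
    · rw [indicator_of_mem h, sub_self, indicator_of_notMem (by simpa using h)]
      simp
    · rw [indicator_of_notMem h, zero_sub, enorm_neg, indicator_of_mem (by simpa using h)]
  have h2 : Filter.Tendsto (fun N : ℕ ↦ edist (u N) g ^ 2) Filter.atTop (nhds 0) := by
    simp_rw [h1]
    have hm : Measurable fun w ↦ ‖ft g w‖ₑ ^ 2 :=
      (Lp.stronglyMeasurable (ft g)).measurable.enorm.pow_const 2
    rw [← lintegral_zero (μ := (volume : Measure E))]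
    refine tendsto_lintegral_of_dominated_convergence (fun w ↦ ‖ft g w‖ₑ ^ 2)
      (fun N ↦ hm.indicator Metric.isClosed_closedBall.measurableSet.compl)
      (fun N ↦ Filter.Eventually.of_forall fun w ↦ indicator_le_self _ _ _) ?_
      (Filter.Eventually.of_forall fun w ↦ ?_)
    · rw [← sq_eLpNorm_two, ← Lp.enorm_def]
      finiteness
    · obtain ⟨M, hM⟩ := exists_nat_ge ‖w‖
      refine tendsto_const_nhds.congr' ?_
      filter_upwards [Filter.eventually_ge_atTop M] with N hN
      rw [indicator_of_notMem]
      have : (M : ℝ) ≤ N := by exact_mod_cast hN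
      simpa using hM.trans this
  have h3 := (ENNReal.continuous_rpow_const (y := (1 / 2 : ℝ))).tendsto 0 |>.comp h2
  simp only [ENNReal.zero_rpow_of_pos (show (0 : ℝ) < 1 / 2 by norm_num)] at h3
  refine h3.congr fun N ↦ ?_
  rw [Function.comp_apply, ← ENNReal.rpow_natCast, ← ENNReal.rpow_mul]
  simp

end Synthesis

theorem sq_sum_le_card_mul {ι : Type*} (s : Finset ι) (f : ι → ℝ≥0∞) :
    (∑ i ∈ s, f i) ^ 2 ≤ s.card * ∑ i ∈ s, f i ^ 2 := by
  have := ENNReal.rpow_sum_le_const_mul_sum_rpow s f (p := 2) (by norm_num)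
  norm_num at this
  exact_mod_cast this

/-! ### The reflection operator across one face -/

section ReflectionOperator

variable {d : ℕ}

/-- Moving a point along the `j`-th axis so that its `j`-th coordinate is multiplied by
`-(k + 1)`. -/
def reflPoint (j : Fin d) (k : ℕ) (x : EuclideanSpace ℝ (Fin d)) : EuclideanSpace ℝ (Fin d) :=
  x + (-((k : ℝ) + 2) * x j) • EuclideanSpace.single j (1 : ℝ)

theorem reflPoint_self (j : Fin d) (k : ℕ) (x : EuclideanSpace ℝ (Fin d)) :
    reflPoint j k x j = -((k : ℝ) + 1) * x j := by
  simp [reflPoint]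
  ring

theorem reflPoint_of_ne {i j : Fin d} (h : i ≠ j) (k : ℕ) (x : EuclideanSpace ℝ (Fin d)) :
    reflPoint j k x i = x i := by
  simp [reflPoint, h]

theorem reflPoint_add (j : Fin d) (k : ℕ) (x a : EuclideanSpace ℝ (Fin d)) (ha : a j = 0) :
    reflPoint j k (x + a) = reflPoint j k x + a := by
  simp only [reflPoint, PiLp.add_apply, ha, add_zero]
  abel

@[fun_prop]
theorem continuous_reflPoint (j : Fin d) (k : ℕ) : Continuous (reflPoint j k) := by
  unfold reflPoint
  fun_prop

/-- The map stretches one axis by k + 1 ≥ 1, so the pushforward of Lebesgue measure is Lebesgue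
measure divided by k + 1. -/
theorem map_reflPoint_le (j : Fin d) (k : ℕ) :
    (volume : Measure (EuclideanSpace ℝ (Fin d))).map (reflPoint j k) ≤ (1 : ℝ≥0) • volume := by
  have h1 : (1 : ℝ) + -((k : ℝ) + 2) = -((k : ℝ) + 1) := by ring
  have h := map_axis_dilation j (b := -((k : ℝ) + 2)) (by rw [h1]; exact (by linarith : -((k : ℝ) + 1) < 0).ne)
  rw [h1] at h
  unfold reflPoint
  rw [h, one_smul]
  refine Measure.le_iff.2 fun s _ ↦ ?_
  rw [Measure.smul_apply, smul_eq_mul]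
  refine mul_le_of_le_one_left' ?_
  rw [ENNReal.ofReal_le_one, abs_inv, abs_neg, abs_of_pos (by positivity)]
  exact inv_le_one_of_one_le₀ (by linarith)

/-- The extension from the half-space `x j ≥ 0` of the part of `u` near `x j = 0`. -/
def reflFun (m : ℕ) (c : ℕ → ℝ) (j : Fin d) (u : EuclideanSpace ℝ (Fin d) → ℝ)
    (x : EuclideanSpace ℝ (Fin d)) : ℝ :=
  if 0 ≤ x j then leftCutoff (x j) * u x
  else ∑ k ∈ Finset.range (m + 1), c k * leftCutoff (-((k : ℝ) + 1) * x j) * u (reflPoint j k x)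

theorem isWeightedComp_near (j : Fin d) :
    IsWeightedComp (volume : Measure (EuclideanSpace ℝ (Fin d))) id
      (fun x ↦ if 0 ≤ x j then leftCutoff (x j) else 0) 1 1 where
  measurable_map := measurable_id
  measurable_weight := Measurable.ite (measurableSet_le measurable_const (by fun_prop))
    (contDiff_leftCutoff.continuous.measurable.comp (by fun_prop)) measurable_const
  map_le := by simp
  bound := fun x ↦ by
    split_ifs
    · simpa using abs_leftCutoff_le (x j)
    · simp

theorem isWeightedComp_refl (c : ℕ → ℝ) (j : Fin d) (k : ℕ) :
    IsWeightedComp (volume : Measure (EuclideanSpace ℝ (Fin d))) (reflPoint j k)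
      (fun x ↦ if 0 ≤ x j then 0 else c k * leftCutoff (-((k : ℝ) + 1) * x j)) 1 ‖c k‖₊ where
  measurable_map := (continuous_reflPoint j k).measurable
  measurable_weight := Measurable.ite (measurableSet_le measurable_const (by fun_prop))
    measurable_const ((contDiff_leftCutoff.continuous.measurable.comp (by fun_prop)).const_mul _)
  map_le := map_reflPoint_le j k
  bound := fun x ↦ by
    split_ifs
    · simp
    · rw [norm_mul]
      exact mul_le_of_le_one_right (norm_nonneg _) (abs_leftCutoff_le _)

/-- `reflFun` as an operator on `L²`. -/
def reflOp (m : ℕ) (c : ℕ → ℝ) (j : Fin d) :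
    Lp ℝ 2 (volume : Measure (EuclideanSpace ℝ (Fin d))) →L[ℝ]
      Lp ℝ 2 (volume : Measure (EuclideanSpace ℝ (Fin d))) :=
  wcomp (isWeightedComp_near j) + ∑ k ∈ Finset.range (m + 1), wcomp (isWeightedComp_refl c j k)

variable {m : ℕ} {c : ℕ → ℝ} {j : Fin d}

theorem reflOp_ae {u : Lp ℝ 2 (volume : Measure (EuclideanSpace ℝ (Fin d)))}
    {U : EuclideanSpace ℝ (Fin d) → ℝ} (h : u =ᵐ[volume] U) :
    reflOp m c j u =ᵐ[volume] reflFun m c j U := by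
  have h1 : ∀ᵐ x, ∀ k ∈ Finset.range (m + 1), wcomp (isWeightedComp_refl c j k) u x =
      (if 0 ≤ x j then 0 else c k * leftCutoff (-((k : ℝ) + 1) * x j)) * U (reflPoint j k x) := by
    refine (Finset.eventually_all _).2 fun k _ ↦ ?_
    filter_upwards [wcomp_ae (isWeightedComp_refl c j k) u,
      (isWeightedComp_refl c j k).quasiMeasurePreserving.ae h] with x e f
    rw [e, f]
  have h2 := Lp.coeFn_fun_finsetSum (Finset.range (m + 1))
    fun k ↦ wcomp (isWeightedComp_refl c j k) u
  filter_upwards [h1, h2, h, wcomp_ae (isWeightedComp_near j) u, Lp.coeFn_add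
    (wcomp (isWeightedComp_near j) u)
    (∑ k ∈ Finset.range (m + 1), wcomp (isWeightedComp_refl c j k) u)] with x e f k l n
  rw [reflOp, add_apply, sum_apply, n, Pi.add_apply, l, f,
    Finset.sum_congr rfl e, id, k, reflFun]
  split_ifs <;> simp

set_option maxHeartbeats 1600000 in
/-- The derivatives along the `j`-th axis of the reflected function. -/
theorem reflOp_dirNormSq (hc : ∀ i ≤ m, ∑ k ∈ Finset.range (m + 1), c k * (-((k : ℝ) + 1)) ^ i = 1) :
    ∃ K : ℝ≥0, ∀ g : Lp ℝ 2 (volume : Measure (EuclideanSpace ℝ (Fin d))),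
      dirNormSq (EuclideanSpace.single j (1 : ℝ)) m (reflOp m c j g) ≤ K * sobolevNorm m g ^ 2 := by
  set e : EuclideanSpace ℝ (Fin d) := EuclideanSpace.single j (1 : ℝ) with he
  obtain ⟨A, hA0, hA⟩ := exists_bound_iteratedDeriv_leftCutoff m
  set K1 : ℝ≥0∞ := (m + 1 : ℕ) * ∑ l ∈ Finset.range (m + 1), ENNReal.ofReal (m.choose l * A) ^ 2
    with hK1
  set K2 : ℝ≥0∞ := 1 + (m + 1 : ℕ) * ∑ k ∈ Finset.range (m + 1),
    ‖c k * (-((k : ℝ) + 1)) ^ m‖ₑ ^ 2 with hK2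
  have hK1t : K1 ≠ ∞ := ENNReal.mul_ne_top (by simp) (ENNReal.sum_ne_top.2 fun _ _ ↦ by finiteness)
  have hK2t : K2 ≠ ∞ := ENNReal.add_ne_top.2
    ⟨by simp, ENNReal.mul_ne_top (by simp) (ENNReal.sum_ne_top.2 fun _ _ ↦ by finiteness)⟩
  refine ⟨(K2 * K1).toNNReal, fun g ↦ ?_⟩
  rw [ENNReal.coe_toNNReal (ENNReal.mul_ne_top hK2t hK1t)]
  obtain ⟨u, hu, hug⟩ := exists_seq_lowFreq_approx g e
  have key : ∀ N : ℕ, ∀ t : ℝ, 0 < t → ‖(diffOp (t • e))^[m] (reflOp m c j (u N))‖ₑ ^ 2 ≤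
      ENNReal.ofReal (t ^ (2 * m)) * (K2 * K1 * sobolevNorm m g ^ 2) := fun N t ht ↦ by
    set G := lowFreqDeriv g N e with hG
    have hGc : ∀ i, Continuous (G i) := continuous_lowFreqDeriv g N e
    -- The localized function on the line through `x` in direction `e`, parametrized by the j-th
    -- coordinate. It depends only on the line, which reduces the claim to the one-dimensional
    -- reflection.
    set θ : EuclideanSpace ℝ (Fin d) → ℝ → ℝ :=
      fun x s ↦ leftCutoff s * G 0 (x - (x j) • e + s • e) with hθ
    have hej : e j = 1 := by simp [he]
    have hθs : ∀ x, ContDiff ℝ (⊤ : ℕ∞) (θ x) := fun x ↦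
      contDiff_leftCutoff.mul (contDiff_lowFreqDeriv g N e _)
    have hθt : ∀ x (s : ℝ), θ (x + s • e) = θ x := fun x s ↦ by
      funext r
      simp only [hθ, PiLp.add_apply, PiLp.smul_apply, hej, smul_eq_mul, mul_one, add_smul]
      congr 2
      abel
    set H : ℕ → EuclideanSpace ℝ (Fin d) → ℝ := fun i y ↦ ∑ l ∈ Finset.range (i + 1),
      i.choose l * iteratedDeriv l leftCutoff (y j) * G (i - l) y with hH
    have hHc : ∀ i, Continuous (H i) := fun i ↦ by
      refine continuous_finsetSum _ fun l _ ↦ ?_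
      refine Continuous.mul (continuous_const.mul
        ((continuous_iteratedDeriv_of_smooth contDiff_leftCutoff l).comp (by fun_prop))) (hGc _)
    have hθi : ∀ x i s, iteratedDeriv i (θ x) s = H i (x - (x j) • e + s • e) := fun x i s ↦ by
      have h1 := iteratedDeriv_fun_mul (n := i) (x := s) (f := leftCutoff)
        (g := fun s ↦ G 0 (x - (x j) • e + s • e))
        ((contDiff_leftCutoff.contDiffAt).of_le (by exact_mod_cast le_top))
        ((contDiff_lowFreqDeriv g N e _).contDiffAt.of_le (by exact_mod_cast le_top))
      refine h1.trans (Finset.sum_congr rfl fun l _ ↦ ?_)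
      rw [hG, iteratedDeriv_lowFreqDeriv]
      simp [hej]
    -- The i-th derivative along `e` of the reflected function. The chain of line primitives U 0,
    -- ..., U m is what turns the m-fold difference into U m.
    set U : ℕ → EuclideanSpace ℝ (Fin d) → ℝ := fun i x ↦ reflDeriv m c i (θ x) (x j) with hU
    have hUeq : ∀ i x, U i x = if 0 ≤ x j then H i x else
        ∑ k ∈ Finset.range (m + 1), c k * (-((k : ℝ) + 1)) ^ i * H i (reflPoint j k x) := fun i x ↦ by
      simp only [hU, reflDeriv, hθi]
      have h1 : x - (x j) • e + (x j) • e = x := by abel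
      have h2 : ∀ k : ℕ, x - (x j) • e + (-((k : ℝ) + 1) * x j) • e = reflPoint j k x := fun k ↦ by
        rw [reflPoint, ← he, show -((k : ℝ) + 2) * x j = -((k : ℝ) + 1) * x j - x j by ring, sub_smul]
        abel
      rw [h1]
      simp only [h2]
    have hUm : ∀ i, Measurable (U i) := fun i ↦ by
      have : U i = fun x ↦ _ := funext (hUeq i)
      rw [this]
      refine Measurable.ite (measurableSet_le measurable_const (by fun_prop)) (hHc i).measurable ?_
      exact Finset.measurable_fun_sum _ fun k _ ↦
        ((hHc i).comp (continuous_reflPoint j k)).measurable.const_mul _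
    have hUshift : ∀ i x (s : ℝ), U i (x + s • e) = reflDeriv m c i (θ x) (x j + s) := fun i x s ↦ by
      simp only [hU, hθt]
      simp [hej]
    have hprim : ∀ i < m, IsLinePrimitive e (U i) (U (i + 1)) := fun i hi ↦ by
      refine ⟨fun x ↦ ?_, fun x h ↦ ?_⟩
      · simp only [hUshift]
        exact (continuous_reflDeriv hc (hθs x) hi).comp (by fun_prop)
      · simp only [hUshift]
        exact reflDeriv_sub_eq_integral hc (hθs x) hi _ _
    have hU0 : reflOp m c j (u N) =ᵐ[volume] U 0 := by
      refine (reflOp_ae (hu N)).trans (Filter.Eventually.of_forall fun x ↦ ?_)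
      rw [hUeq, reflFun]
      simp [hH, hG, reflPoint_self, mul_assoc]
    -- Leibniz rule. Only the half-space is integrated, because derivatives of the cut-off are
    -- bounded for nonnegative arguments only; all reflected points land there.
    have hHb : ∫⁻ y, (if 0 ≤ y j then ‖H m y‖ₑ ^ 2 else 0) ≤ K1 * sobolevNorm m g ^ 2 := by
      calc _ ≤ ∫⁻ y, (m + 1 : ℕ) * ∑ l ∈ Finset.range (m + 1),
            ENNReal.ofReal (m.choose l * A) ^ 2 * ‖G (m - l) y‖ₑ ^ 2 := by
            refine lintegral_mono fun y ↦ ?_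
            simp only
            split_ifs with hy
            · calc ‖H m y‖ₑ ^ 2 ≤ (∑ l ∈ Finset.range (m + 1),
                    ‖m.choose l * iteratedDeriv l leftCutoff (y j) * G (m - l) y‖ₑ) ^ 2 := by
                    gcongr
                    exact enorm_sum_le _ _
                _ ≤ _ := by
                    refine (sq_sum_le_card_mul _ _).trans ?_
                    rw [Finset.card_range]
                    gcongr with l hl
                    rw [enorm_mul, mul_pow]
                    gcongr
                    rw [← ofReal_norm, norm_mul, Real.norm_of_nonneg (by positivity)]
                    gcongr
                    exact hA l (by simpa [Nat.lt_succ_iff] using hl) _ hy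
            · simp
        _ = (m + 1 : ℕ) * ∑ l ∈ Finset.range (m + 1),
            ENNReal.ofReal (m.choose l * A) ^ 2 * ∫⁻ y, ‖G (m - l) y‖ₑ ^ 2 := by
            rw [lintegral_const_mul' _ _ (by simp), lintegral_finsetSum _ fun l _ ↦
              ((hGc (m - l)).measurable.enorm.pow_const 2).const_mul _]
            congr 1
            exact Finset.sum_congr rfl fun l _ ↦ lintegral_const_mul' _ _ (by finiteness)
        _ ≤ _ := by
            rw [hK1, mul_assoc, Finset.sum_mul]
            gcongr with l hl
            exact (lintegral_lowFreqDeriv_le g N e _).trans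
              (dirNormSq_le_sobolevNorm j (Nat.sub_le _ _) g)
    have hHbm : Measurable fun y : EuclideanSpace ℝ (Fin d) ↦ if 0 ≤ y j then ‖H m y‖ₑ ^ 2 else 0 :=
      Measurable.ite (measurableSet_le measurable_const (by fun_prop))
        ((hHc m).measurable.enorm.pow_const 2) measurable_const
    set Hb : EuclideanSpace ℝ (Fin d) → ℝ≥0∞ := fun y ↦ if 0 ≤ y j then ‖H m y‖ₑ ^ 2 else 0 with hHbdef
    have hHbr : ∀ k, Measurable fun x ↦ Hb (reflPoint j k x) := fun k ↦
      hHbm.comp (continuous_reflPoint j k).measurable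
    have hUb : ∫⁻ x, ‖U m x‖ₑ ^ 2 ≤ K2 * ∫⁻ y, Hb y := by
      calc _ ≤ ∫⁻ x, (Hb x + (m + 1 : ℕ) * ∑ k ∈ Finset.range (m + 1),
            ‖c k * (-((k : ℝ) + 1)) ^ m‖ₑ ^ 2 * Hb (reflPoint j k x)) := by
            refine lintegral_mono fun x ↦ ?_
            simp only [hUeq]
            split_ifs with hx
            · refine le_trans ?_ le_self_add
              simp [hHbdef, hx]
            · refine le_trans ?_ le_add_self
              calc _ ≤ (∑ k ∈ Finset.range (m + 1),
                    ‖c k * (-((k : ℝ) + 1)) ^ m * H m (reflPoint j k x)‖ₑ) ^ 2 := by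
                    gcongr
                    exact enorm_sum_le _ _
                _ ≤ _ := by
                    refine (sq_sum_le_card_mul _ _).trans ?_
                    rw [Finset.card_range]
                    gcongr with k hk
                    rw [enorm_mul, mul_pow]
                    gcongr
                    have : 0 ≤ reflPoint j k x j := by
                      rw [reflPoint_self]
                      have : 0 ≤ (k : ℝ) := k.cast_nonneg
                      nlinarith [not_le.1 hx]
                    simp [hHbdef, this]
        _ = (∫⁻ x, Hb x) + (m + 1 : ℕ) * ∑ k ∈ Finset.range (m + 1),
            ‖c k * (-((k : ℝ) + 1)) ^ m‖ₑ ^ 2 * ∫⁻ x, Hb (reflPoint j k x) := by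
            rw [lintegral_add_left hHbm, lintegral_const_mul' _ _ (by simp),
              lintegral_finsetSum _ fun k _ ↦ (hHbr k).const_mul _]
            congr 2
            exact Finset.sum_congr rfl fun l _ ↦ lintegral_const_mul' _ _ (by finiteness)
        _ ≤ (∫⁻ x, Hb x) + (m + 1 : ℕ) * ∑ k ∈ Finset.range (m + 1),
            ‖c k * (-((k : ℝ) + 1)) ^ m‖ₑ ^ 2 * ∫⁻ x, Hb x := by
            refine add_le_add le_rfl (mul_le_mul_right (Finset.sum_le_sum fun k _ ↦
              mul_le_mul_right ?_ _) _)
            simpa using (isWeightedComp_refl c j k).lintegral_le hHbm.aemeasurable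
        _ = _ := by rw [hK2, ← Finset.sum_mul]; ring
    have h1 := lintegral_fwdDiffBy_pow_le hprim (fun i _ ↦ hUm i) ht
    rw [Lp.enorm_def, sq_eLpNorm_two]
    calc _ = ∫⁻ x, ‖(fwdDiffBy (t • e))^[m] (U 0) x‖ₑ ^ 2 := by
          refine lintegral_congr_ae ?_
          filter_upwards [diffOp_pow_ae (t • e) m hU0] with x hx
          rw [hx]
      _ ≤ _ := h1.trans (by
          gcongr
          refine hUb.trans ?_
          rw [mul_assoc]
          gcongr)
  -- The bound does not depend on the band `N`, so it survives the limit in L² for each fixed step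
  -- `t`.
  refine dirNormSq_le_of_diffOp e m _ _ fun t ht ↦ ?_
  have hcont : Continuous fun v ↦ ‖(diffOp (t • e))^[m] (reflOp m c j v)‖ₑ ^ 2 :=
    (ENNReal.continuous_pow 2).comp (continuous_enorm.comp
      (((diffOp (t • e)).continuous.iterate m).comp (reflOp m c j).continuous))
  exact le_of_tendsto ((hcont.tendsto g).comp hug) (Filter.Eventually.of_forall fun N ↦ key N t ht)

end ReflectionOperator

/-! ### Extension from the cube, axis by axis -/

section ExtensionOperator

variable {d : ℕ}

/-- The reflection of the `j`-th coordinate about `1/2`. -/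
def flipPoint (j : Fin d) (x : EuclideanSpace ℝ (Fin d)) : EuclideanSpace ℝ (Fin d) :=
  x + (1 - 2 * x j) • EuclideanSpace.single j (1 : ℝ)

theorem flipPoint_self (j : Fin d) (x : EuclideanSpace ℝ (Fin d)) :
    flipPoint j x j = 1 - x j := by
  simp [flipPoint]
  ring

theorem flipPoint_of_ne {i j : Fin d} (h : i ≠ j) (x : EuclideanSpace ℝ (Fin d)) :
    flipPoint j x i = x i := by
  simp [flipPoint, h]

theorem flipPoint_flipPoint (j : Fin d) (x : EuclideanSpace ℝ (Fin d)) :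
    flipPoint j (flipPoint j x) = x := by
  ext i
  by_cases h : i = j
  · subst h
    rw [flipPoint_self, flipPoint_self]
    ring
  · rw [flipPoint_of_ne h, flipPoint_of_ne h]

theorem isWeightedComp_flip (j : Fin d) :
    IsWeightedComp (volume : Measure (EuclideanSpace ℝ (Fin d))) (flipPoint j)
      (fun _ ↦ (1 : ℝ)) 1 1 where
  measurable_map := by unfold flipPoint; fun_prop
  measurable_weight := measurable_const
  map_le := by
    have h := map_axis_dilation j (b := -2) (by norm_num)
    norm_num at h
    have h2 : flipPoint j = (fun x ↦ x + EuclideanSpace.single j (1 : ℝ)) ∘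
        fun x : EuclideanSpace ℝ (Fin d) ↦ x + (-2 * x j) • EuclideanSpace.single j (1 : ℝ) := by
      funext x
      simp only [flipPoint, Function.comp_apply, sub_eq_add_neg, add_smul, one_smul, neg_mul]
      abel
    have h3 : (fun x : EuclideanSpace ℝ (Fin d) ↦ x + (-2 * x j) • EuclideanSpace.single j (1 : ℝ)) =
        fun x ↦ x + -((2 * x j) • EuclideanSpace.single j (1 : ℝ)) := by
      funext x
      simp
    rw [h2, ← Measure.map_map (by fun_prop) (by fun_prop), h3]
    rw [h, map_add_right_eq_self, one_smul]
  bound := by simp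

/-- `flipPoint` as an operator on `L²`. -/
def flipOp (j : Fin d) : Lp ℝ 2 (volume : Measure (EuclideanSpace ℝ (Fin d))) →L[ℝ]
      Lp ℝ 2 (volume : Measure (EuclideanSpace ℝ (Fin d))) :=
  wcomp (isWeightedComp_flip j)

theorem flipOp_ae {j : Fin d} {u : Lp ℝ 2 (volume : Measure (EuclideanSpace ℝ (Fin d)))}
    {U : EuclideanSpace ℝ (Fin d) → ℝ} (h : u =ᵐ[volume] U) :
    flipOp j u =ᵐ[volume] fun x ↦ U (flipPoint j x) := by
  filter_upwards [wcomp_ae (isWeightedComp_flip j) u,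
    (isWeightedComp_flip j).quasiMeasurePreserving.ae h] with x e f
  rw [flipOp, e, f, one_mul]

/-- The operator is bounded on the Sobolev space of order `m`. -/
def SobolevBdd (m : ℝ) (B : Lp ℝ 2 (volume : Measure (EuclideanSpace ℝ (Fin d))) →L[ℝ]
      Lp ℝ 2 (volume : Measure (EuclideanSpace ℝ (Fin d)))) : Prop :=
  ∃ K : ℝ≥0, ∀ u, sobolevNorm m (B u) ^ 2 ≤ K * sobolevNorm m u ^ 2

variable {B B' : Lp ℝ 2 (volume : Measure (EuclideanSpace ℝ (Fin d))) →L[ℝ]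
      Lp ℝ 2 (volume : Measure (EuclideanSpace ℝ (Fin d)))} {m : ℕ}

theorem SobolevBdd.comp {s : ℝ} (h : SobolevBdd s B) (h' : SobolevBdd s B') :
    SobolevBdd s (B.comp B') := by
  obtain ⟨K, hK⟩ := h
  obtain ⟨K', hK'⟩ := h'
  refine ⟨K * K', fun u ↦ (hK _).trans ?_⟩
  rw [ENNReal.coe_mul, mul_assoc]
  gcongr
  exact hK' u

theorem sobolevNorm_add_sq_le (s : ℝ) (u v : Lp ℝ 2 (volume : Measure (EuclideanSpace ℝ (Fin d)))) :
    sobolevNorm s (u + v) ^ 2 ≤ 2 * (sobolevNorm s u ^ 2 + sobolevNorm s v ^ 2) := by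
  simp only [sobolevNorm_sq]
  have hm : Measurable fun w ↦ sobolevWeight d s w * ‖ft u w‖ₑ ^ 2 :=
    (measurable_sobolevWeight s).mul
      ((Lp.stronglyMeasurable (ft u)).measurable.enorm.pow_const 2)
  rw [← lintegral_add_left hm, ← lintegral_const_mul' _ _ (by simp)]
  refine lintegral_mono_ae ?_
  rw [map_add]
  filter_upwards [Lp.coeFn_add (ft u) (ft v)] with w hw
  rw [hw, Pi.add_apply, ← mul_add, mul_left_comm]
  gcongr
  refine (pow_le_pow_left' (enorm_add_le _ _) 2).trans ?_
  have := sq_sum_le_card_mul Finset.univ ![‖ft u w‖ₑ, ‖ft v w‖ₑ]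
  simpa using this

theorem SobolevBdd.add {s : ℝ} (h : SobolevBdd s B) (h' : SobolevBdd s B') :
    SobolevBdd s (B + B') := by
  obtain ⟨K, hK⟩ := h
  obtain ⟨K', hK'⟩ := h'
  refine ⟨2 * (K + K'), fun u ↦ (sobolevNorm_add_sq_le s _ _).trans ?_⟩
  rw [ENNReal.coe_mul, ENNReal.coe_ofNat, mul_assoc, ENNReal.coe_add, add_mul]
  gcongr
  · exact hK u
  · exact hK' u

theorem sobolevBdd_of_dir (h : ∀ k : Fin d, ∃ K : ℝ≥0, ∀ u,
    dirNormSq (EuclideanSpace.single k (1 : ℝ)) m (B u) ≤ K * sobolevNorm m u ^ 2) :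
    SobolevBdd m B := by
  choose K hK using h
  refine ⟨(d + 1) ^ m * (‖B‖₊ ^ 2 + ∑ k, K k), fun u ↦ (sobolevNorm_sq_le_dirNormSq m _).trans ?_⟩
  rw [ENNReal.coe_mul, mul_assoc]
  refine mul_le_mul' (le_of_eq ?_) ?_
  · rw [ENNReal.ofReal_pow (by positivity), ENNReal.coe_pow]
    congr 1
    rw [← ENNReal.ofReal_coe_nnreal]
    simp
  · rw [ENNReal.coe_add, add_mul, ENNReal.ofNNReal_finsetSum, Finset.sum_mul]
    refine add_le_add ?_ (Finset.sum_le_sum fun k _ ↦ hK k u)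
    rw [ENNReal.coe_pow, ← mul_pow]
    gcongr
    refine (B.le_opENorm u).trans ?_
    gcongr
    · exact le_rfl
    · rw [← sobolevNorm_zero]
      exact sobolevNorm_mono (Nat.cast_nonneg m) u

theorem iterate_diffOp_of_shift {a b : EuclideanSpace ℝ (Fin d)}
    (h : ∀ u, shift a (B u) = B (shift b u)) (n : ℕ)
    (u : Lp ℝ 2 (volume : Measure (EuclideanSpace ℝ (Fin d)))) :
    (diffOp a)^[n] (B u) = B ((diffOp b)^[n] u) := by
  induction n with
  | zero => rfl
  | succ n ih =>
    rw [Function.iterate_succ_apply', Function.iterate_succ_apply', ih, diffOp_apply, h,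
      diffOp_apply, map_sub]

/-- An operator that intertwines translations along an axis, possibly with a change of sign, also
intertwines the iterated differences. L² boundedness alone then gives the Sobolev bound in that
direction. This covers reflections in transverse directions and flips in every direction. -/
theorem dirNormSq_le_of_shift (k : Fin d)
    (h : ∀ t : ℝ, 0 < t → ∃ b : EuclideanSpace ℝ (Fin d),
      (b = t • EuclideanSpace.single k (1 : ℝ) ∨ b = -(t • EuclideanSpace.single k (1 : ℝ))) ∧
      ∀ u, shift (t • EuclideanSpace.single k (1 : ℝ)) (B u) = B (shift b u)) :
    ∃ K : ℝ≥0, ∀ u,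
      dirNormSq (EuclideanSpace.single k (1 : ℝ)) m (B u) ≤ K * sobolevNorm m u ^ 2 := by
  refine ⟨‖B‖₊ ^ 2, fun u ↦ dirNormSq_le_of_diffOp _ m _ _ fun t ht ↦ ?_⟩
  obtain ⟨b, hb, hB⟩ := h t ht
  rw [iterate_diffOp_of_shift hB]
  have h1 : ‖(diffOp b)^[m] u‖ₑ ^ 2 ≤
      ENNReal.ofReal (t ^ (2 * m)) * sobolevNorm m u ^ 2 := by
    have h2 : ‖(diffOp b)^[m] u‖ₑ = ‖(diffOp (t • EuclideanSpace.single k (1 : ℝ)))^[m] u‖ₑ := by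
      rcases hb with rfl | rfl
      · rfl
      · exact enorm_diffOp_neg_pow _ _ _
    rw [h2]
    refine (sq_enorm_diffOp_pow_le _ m ht.le u).trans ?_
    gcongr
    exact dirNormSq_le_sobolevNorm k le_rfl u
  calc _ ≤ (‖B‖₊ * ‖(diffOp b)^[m] u‖ₑ) ^ 2 := by
        gcongr
        exact B.le_opENorm _
    _ = ‖B‖₊ ^ 2 * ‖(diffOp b)^[m] u‖ₑ ^ 2 := mul_pow _ _ _
    _ ≤ ‖B‖₊ ^ 2 * (ENNReal.ofReal (t ^ (2 * m)) * sobolevNorm m u ^ 2) := by gcongr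
    _ = _ := by push_cast; ring

theorem shift_congr (a : EuclideanSpace ℝ (Fin d))
    {u : Lp ℝ 2 (volume : Measure (EuclideanSpace ℝ (Fin d)))} {U : EuclideanSpace ℝ (Fin d) → ℝ}
    (h : u =ᵐ[volume] U) : shift a u =ᵐ[volume] fun x ↦ U (x + a) := by
  filter_upwards [shift_ae a u, (isWeightedComp_shift (𝕜 := ℝ) a).quasiMeasurePreserving.ae h]
    with x e f
  rw [e, f]

theorem shift_reflOp {c : ℕ → ℝ} {j : Fin d} {a : EuclideanSpace ℝ (Fin d)} (ha : a j = 0)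
    (u : Lp ℝ 2 (volume : Measure (EuclideanSpace ℝ (Fin d)))) :
    shift a (reflOp m c j u) = reflOp m c j (shift a u) := by
  apply Lp.ext
  refine (shift_congr a (reflOp_ae (ae_eq_refl _))).trans
    (Filter.EventuallyEq.trans ?_ (reflOp_ae (shift_ae a u)).symm)
  refine Filter.Eventually.of_forall fun x ↦ ?_
  simp only [reflFun, PiLp.add_apply, ha, add_zero, reflPoint_add j _ x a ha]

theorem sobolevBdd_reflOp {c : ℕ → ℝ} (j : Fin d)
    (hc : ∀ i ≤ m, ∑ k ∈ Finset.range (m + 1), c k * (-((k : ℝ) + 1)) ^ i = 1) :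
    SobolevBdd m (reflOp m c j) := by
  refine sobolevBdd_of_dir fun k ↦ ?_
  by_cases hk : k = j
  · subst hk
    exact reflOp_dirNormSq hc
  · exact dirNormSq_le_of_shift k fun t _ ↦ ⟨_, Or.inl rfl, shift_reflOp (by simp [Ne.symm hk])⟩

theorem shift_flipOp {j : Fin d} {a b : EuclideanSpace ℝ (Fin d)}
    (h : ∀ x, flipPoint j (x + a) = flipPoint j x + b)
    (u : Lp ℝ 2 (volume : Measure (EuclideanSpace ℝ (Fin d)))) :
    shift a (flipOp j u) = flipOp j (shift b u) := by
  apply Lp.ext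
  refine (shift_congr a (flipOp_ae (ae_eq_refl _))).trans
    (Filter.EventuallyEq.trans ?_ (flipOp_ae (shift_ae b u)).symm)
  refine Filter.Eventually.of_forall fun x ↦ ?_
  simp only [h]

theorem sobolevBdd_flipOp (j : Fin d) : SobolevBdd m (flipOp j) := by
  refine sobolevBdd_of_dir fun k ↦ dirNormSq_le_of_shift k fun t _ ↦ ?_
  by_cases hk : k = j
  · subst hk
    refine ⟨_, Or.inr rfl, shift_flipOp fun x ↦ ?_⟩
    ext i
    by_cases hi : i = k
    · subst hi
      simp [flipPoint_self]
      ring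
    · simp [flipPoint_of_ne hi, hi]
  · refine ⟨_, Or.inl rfl, shift_flipOp fun x ↦ ?_⟩
    ext i
    by_cases hi : i = j
    · subst hi
      simp [flipPoint_self, Ne.symm hk]
    · simp [flipPoint_of_ne hi]

/-- Extension across both faces orthogonal to the `j`-th axis. -/
def axisExtension (m : ℕ) (c : ℕ → ℝ) (j : Fin d) :
    Lp ℝ 2 (volume : Measure (EuclideanSpace ℝ (Fin d))) →L[ℝ]
      Lp ℝ 2 (volume : Measure (EuclideanSpace ℝ (Fin d))) :=
  reflOp m c j + (flipOp j).comp ((reflOp m c j).comp (flipOp j))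

theorem axisExtension_ae {c : ℕ → ℝ} {j : Fin d}
    {u : Lp ℝ 2 (volume : Measure (EuclideanSpace ℝ (Fin d)))} {U : EuclideanSpace ℝ (Fin d) → ℝ}
    (h : u =ᵐ[volume] U) : axisExtension m c j u =ᵐ[volume] fun x ↦
      reflFun m c j U x + reflFun m c j (fun y ↦ U (flipPoint j y)) (flipPoint j x) := by
  filter_upwards [Lp.coeFn_add (reflOp m c j u) (flipOp j (reflOp m c j (flipOp j u))),
    reflOp_ae (m := m) (c := c) (j := j) h, flipOp_ae (j := j) (reflOp_ae (m := m) (c := c) (j := j) (flipOp_ae (j := j) h))] with x e f k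
  rw [← f, ← k, ← Pi.add_apply, ← e]
  rfl

theorem axisExtension_eq {c : ℕ → ℝ} {j : Fin d}
    (u : Lp ℝ 2 (volume : Measure (EuclideanSpace ℝ (Fin d)))) :
    ∀ᵐ x, x j ∈ Icc (0 : ℝ) 1 → axisExtension m c j u x = u x := by
  filter_upwards [axisExtension_ae (m := m) (c := c) (j := j) (ae_eq_refl u)] with x hx h
  have h1 : 0 ≤ flipPoint j x j := by
    rw [flipPoint_self]
    linarith [h.2]
  rw [hx, reflFun, if_pos h.1, reflFun, if_pos h1, flipPoint_self, flipPoint_flipPoint, ← add_mul,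
    leftCutoff_add, one_mul]

/-- Each value of the extension uses `u` only at points whose j-th coordinate lies in [0,1], since
the cut-off vanishes beyond 2/3, and the other coordinates are untouched. The constraint on
coordinate j can therefore be dropped, and repeating this over all axes leaves no constraint. -/
theorem axisExtension_eq_zero {c : ℕ → ℝ} {j : Fin d} {I : Finset (Fin d)} (hj : j ∉ I)
    {u : Lp ℝ 2 (volume : Measure (EuclideanSpace ℝ (Fin d)))}
    (hu : ∀ᵐ x, (∀ i ∈ insert j I, x i ∈ Icc (0 : ℝ) 1) → u x = 0) :
    ∀ᵐ x, (∀ i ∈ I, x i ∈ Icc (0 : ℝ) 1) → axisExtension m c j u x = 0 := by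
  classical
  set U : EuclideanSpace ℝ (Fin d) → ℝ :=
    fun x ↦ if ∀ i ∈ insert j I, x i ∈ Icc (0 : ℝ) 1 then 0 else u x with hU
  have hUu : u =ᵐ[volume] U := by
    filter_upwards [hu] with x hx
    simp only [hU]
    split_ifs with h
    · exact hx h
    · rfl
  have hU0 : ∀ x, x j ∈ Icc (0 : ℝ) 1 → (∀ i ∈ I, x i ∈ Icc (0 : ℝ) 1) → U x = 0 := fun x hx h ↦
    if_pos fun i hi ↦ by
      rcases Finset.mem_insert.1 hi with rfl | hi
      · exact hx
      · exact h i hi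
  have hne : ∀ {i}, i ∈ I → i ≠ j := fun hi h ↦ hj (h ▸ hi)
  have hrefl : ∀ V : EuclideanSpace ℝ (Fin d) → ℝ,
      (∀ x, x j ∈ Icc (0 : ℝ) 1 → (∀ i ∈ I, x i ∈ Icc (0 : ℝ) 1) → V x = 0) →
      ∀ x, (∀ i ∈ I, x i ∈ Icc (0 : ℝ) 1) → reflFun m c j V x = 0 := fun V hV x hx ↦ by
    rw [reflFun]
    split_ifs with h
    · rcases le_or_gt (x j) 1 with h1 | h1
      · rw [hV x ⟨h, h1⟩ hx, mul_zero]
      · rw [leftCutoff_eq_zero (by linarith), zero_mul]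
    · refine Finset.sum_eq_zero fun k _ ↦ ?_
      have h2 : 0 ≤ -((k : ℝ) + 1) * x j := by
        have : 0 ≤ (k : ℝ) := k.cast_nonneg
        nlinarith [not_le.1 h]
      rcases le_or_gt (-((k : ℝ) + 1) * x j) 1 with h1 | h1
      · rw [hV _ (by rw [reflPoint_self]; exact ⟨h2, h1⟩)
          (fun i hi ↦ by rw [reflPoint_of_ne (hne hi)]; exact hx i hi), mul_zero]
      · rw [leftCutoff_eq_zero (by linarith), mul_zero, zero_mul]
  filter_upwards [axisExtension_ae (m := m) (c := c) (j := j) hUu] with x hx h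
  rw [hx, hrefl U hU0 x h, hrefl (fun y ↦ U (flipPoint j y)) (fun y hy hyI ↦ hU0 _ ?_ ?_) _ ?_,
    add_zero]
  · intro i hi
    rw [flipPoint_of_ne (hne hi)]
    exact h i hi
  · rw [flipPoint_self]
    exact ⟨by linarith [hy.2], by linarith [hy.1]⟩
  · intro i hi
    rw [flipPoint_of_ne (hne hi)]
    exact hyI i hi

/-- Composition of the axis extensions, the axis added last acting first. The final clause says that
the result depends only on the values on the cube; it is what later replaces one extension of a
function by any other. -/
theorem exists_cubeExtension (d m : ℕ) :
    ∃ A : Lp ℝ 2 (volume : Measure (EuclideanSpace ℝ (Fin d))) →L[ℝ]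
      Lp ℝ 2 (volume : Measure (EuclideanSpace ℝ (Fin d))), SobolevBdd m A ∧
      (∀ u, ∀ᵐ x, x ∈ cube d → A u x = u x) ∧
      ∀ u : Lp ℝ 2 (volume : Measure (EuclideanSpace ℝ (Fin d))),
        (∀ᵐ x, x ∈ cube d → u x = 0) → A u = 0 := by
  classical
  obtain ⟨c, hc⟩ := exists_reflection_coeff m
  have key : ∀ I : Finset (Fin d), ∃ A : Lp ℝ 2 (volume : Measure (EuclideanSpace ℝ (Fin d))) →L[ℝ]
      Lp ℝ 2 (volume : Measure (EuclideanSpace ℝ (Fin d))), SobolevBdd m A ∧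
      (∀ u, ∀ᵐ x, x ∈ cube d → A u x = u x) ∧
      ∀ u : Lp ℝ 2 (volume : Measure (EuclideanSpace ℝ (Fin d))),
        (∀ᵐ x, (∀ i ∈ I, x i ∈ Icc (0 : ℝ) 1) → u x = 0) → A u = 0 := fun I ↦ by
    induction I using Finset.induction_on with
    | empty =>
      refine ⟨ContinuousLinearMap.id ℝ _, ⟨1, fun u ↦ by simp⟩,
        fun u ↦ Filter.Eventually.of_forall fun x _ ↦ rfl, fun u hu ↦ ?_⟩
      apply Lp.ext
      filter_upwards [hu, Lp.coeFn_zero ℝ 2 (volume : Measure (EuclideanSpace ℝ (Fin d)))] with x h h0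
      rw [h0]
      exact h (by simp)
    | insert j I hj ih =>
      obtain ⟨A, hA, hA1, hA2⟩ := ih
      refine ⟨A.comp (axisExtension m c j), hA.comp ?_, fun u ↦ ?_, fun u hu ↦ ?_⟩
      · exact (sobolevBdd_reflOp j hc).add
          ((sobolevBdd_flipOp j).comp ((sobolevBdd_reflOp j hc).comp (sobolevBdd_flipOp j)))
      · filter_upwards [hA1 (axisExtension m c j u), axisExtension_eq (m := m) (c := c) (j := j) u]
          with x h1 h2 hx
        rw [ContinuousLinearMap.comp_apply, h1 hx, h2 (hx j)]
      · exact hA2 _ (axisExtension_eq_zero hj hu)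
  obtain ⟨A, h1, h2, h3⟩ := key Finset.univ
  exact ⟨A, h1, h2, fun u hu ↦ h3 u (by simpa [cube] using hu)⟩

end ExtensionOperator

/-! ### Real interpolation between L² and an integer Sobolev space -/

section Interpolation

/-- The normalizing constant of the real interpolation method. -/
def interpConst (θ : ℝ) : ℝ≥0∞ :=
  ∫⁻ μ in Ioi (0 : ℝ), ENNReal.ofReal (μ ^ (-θ) / (1 + μ))

theorem interpConst_ne_top {θ : ℝ} (h0 : 0 < θ) (h1 : θ < 1) : interpConst θ ≠ ∞ := by
  rw [interpConst, ← Ioc_union_Ioi_eq_Ioi zero_le_one]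
  refine ((lintegral_union_le _ _ _).trans_lt (ENNReal.add_lt_top.2 ⟨?_, ?_⟩)).ne
  · have h2 : IntegrableOn (fun μ : ℝ ↦ μ ^ (-θ)) (Ioc 0 1) :=
      (intervalIntegrable_iff_integrableOn_Ioc_of_le zero_le_one).1
        (intervalIntegral.intervalIntegrable_rpow' (by linarith))
    refine (setLIntegral_mono' measurableSet_Ioc fun μ hμ ↦ ?_).trans_lt h2.lintegral_lt_top
    refine ENNReal.ofReal_le_ofReal (div_le_self (Real.rpow_nonneg hμ.1.le _) (by linarith [hμ.1]))
  · have h2 : IntegrableOn (fun μ : ℝ ↦ μ ^ (-θ - 1)) (Ioi 1) :=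
      integrableOn_Ioi_rpow_of_lt (by linarith) zero_lt_one
    refine (setLIntegral_mono' measurableSet_Ioi fun μ hμ ↦ ?_).trans_lt h2.lintegral_lt_top
    have hμ0 : 0 < μ := zero_lt_one.trans hμ
    rw [Real.rpow_sub_one hμ0.ne']
    gcongr
    linarith

theorem interpConst_ne_zero (θ : ℝ) : interpConst θ ≠ 0 := by
  refine (setLIntegral_pos_iff ?_).2 ?_ |>.ne'
  · fun_prop
  · have h : Ioi (0 : ℝ) ⊆ Function.support (fun μ : ℝ ↦ ENNReal.ofReal (μ ^ (-θ) / (1 + μ))) ∩ Ioi 0 :=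
      fun μ hμ ↦ ⟨by
        have hμ0 : 0 < μ := hμ
        have : 0 < μ ^ (-θ) / (1 + μ) := by positivity
        simpa [Function.mem_support] using this, hμ⟩
    exact (by simp : (0 : ℝ≥0∞) < volume (Ioi (0 : ℝ))).trans_le (measure_mono h)

/-- Scaling by `W` reduces the integral to the one defining the constant. -/
theorem lintegral_interp (θ : ℝ) {W : ℝ} (hW : 0 < W) :
    ∫⁻ l in Ioi (0 : ℝ), ENNReal.ofReal (l ^ (-θ - 1)) * ENNReal.ofReal (l * W / (1 + l * W)) =
      interpConst θ * ENNReal.ofReal (W ^ θ) := by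
  have h1 : interpConst θ = ENNReal.ofReal W *
      ∫⁻ l in Ioi (0 : ℝ), ENNReal.ofReal ((W * l) ^ (-θ) / (1 + W * l)) := by
    rw [interpConst, ← lintegral_indicator measurableSet_Ioi, ← lintegral_indicator measurableSet_Ioi]
    have h2 := Real.smul_map_volume_mul_left hW.ne'
    rw [abs_of_pos hW] at h2
    conv_lhs => rw [← h2]
    rw [lintegral_smul_measure, lintegral_map (by
      refine Measurable.indicator (by fun_prop) measurableSet_Ioi) (by fun_prop), smul_eq_mul]
    congr 1
    refine lintegral_congr fun l ↦ ?_
    by_cases hl : 0 < l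
    · rw [indicator_of_mem (by exact mul_pos hW hl), indicator_of_mem (by exact hl)]
    · rw [indicator_of_notMem (by simpa [hW] using hl), indicator_of_notMem (by exact hl)]
  rw [h1, mul_right_comm, ← ENNReal.ofReal_mul hW.le, ← lintegral_const_mul' _ _ (by simp)]
  refine setLIntegral_congr_fun measurableSet_Ioi fun l hl ↦ ?_
  have hl0 : 0 < l := hl
  rw [← ENNReal.ofReal_mul (by positivity), ← ENNReal.ofReal_mul (by positivity)]
  congr 1
  rw [Real.mul_rpow hW.le hl0.le, Real.rpow_sub_one hl0.ne', Real.rpow_neg hW.le, mul_comm l W]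
  have : W ^ θ ≠ 0 := (Real.rpow_pos_of_pos hW _).ne'
  field_simp

variable {d : ℕ}

/-- The real form of `sobolevWeight`. -/
def realWeight (m : ℝ) (w : EuclideanSpace ℝ (Fin d)) : ℝ := (1 + (2 * Real.pi * ‖w‖) ^ 2) ^ m

theorem realWeight_pos (m : ℝ) (w : EuclideanSpace ℝ (Fin d)) : 0 < realWeight m w := by
  unfold realWeight
  positivity

theorem sobolevWeight_eq (m : ℝ) (w : EuclideanSpace ℝ (Fin d)) :
    sobolevWeight d m w = ENNReal.ofReal (realWeight m w) := rfl

@[fun_prop]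
theorem measurable_realWeight (m : ℝ) :
    Measurable (realWeight m : EuclideanSpace ℝ (Fin d) → ℝ) := by
  unfold realWeight
  fun_prop

/-- The `K`-functional between `L²` and the Sobolev space of order `m`. -/
def kFun (m l : ℝ) (u : Lp ℝ 2 (volume : Measure (EuclideanSpace ℝ (Fin d)))) : ℝ≥0∞ :=
  ∫⁻ w, ENNReal.ofReal (l * realWeight m w / (1 + l * realWeight m w)) * ‖ft u w‖ₑ ^ 2

theorem measurable_enorm_ft_sq (u : Lp ℝ 2 (volume : Measure (EuclideanSpace ℝ (Fin d)))) :
    Measurable fun w ↦ ‖ft u w‖ₑ ^ 2 :=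
  (Lp.stronglyMeasurable (ft u)).measurable.enorm.pow_const 2

/-- Tonelli and the scaling identity applied at each frequency: averaging the multiplier over `l`
produces the weight raised to the power t/m. -/
theorem lintegral_kFun {m t : ℝ} (hm : m ≠ 0)
    (u : Lp ℝ 2 (volume : Measure (EuclideanSpace ℝ (Fin d)))) :
    ∫⁻ l in Ioi (0 : ℝ), ENNReal.ofReal (l ^ (-(t / m) - 1)) * kFun m l u =
      interpConst (t / m) * sobolevNorm t u ^ 2 := by
  simp only [kFun]
  have hmeas := measurable_enorm_ft_sq u
  have hwm : Measurable fun w ↦ sobolevWeight d t w * ‖ft u w‖ₑ ^ 2 :=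
    (measurable_sobolevWeight t).mul hmeas
  have h1 : ∀ l : ℝ, ENNReal.ofReal (l ^ (-(t / m) - 1)) *
      ∫⁻ w, ENNReal.ofReal (l * realWeight m w / (1 + l * realWeight m w)) * ‖ft u w‖ₑ ^ 2 =
      ∫⁻ w, ENNReal.ofReal (l ^ (-(t / m) - 1)) *
        (ENNReal.ofReal (l * realWeight m w / (1 + l * realWeight m w)) * ‖ft u w‖ₑ ^ 2) := fun l ↦
    (lintegral_const_mul' _ _ (by simp)).symm
  simp_rw [h1]
  rw [lintegral_lintegral_swap (by
    refine Measurable.aemeasurable ?_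
    refine Measurable.mul (by fun_prop) (Measurable.mul ?_ (hmeas.comp measurable_snd))
    fun_prop), sobolevNorm_sq, ← lintegral_const_mul _ hwm]
  refine lintegral_congr fun w ↦ ?_
  simp_rw [← mul_assoc]
  rw [lintegral_mul_const _ (by fun_prop), lintegral_interp _ (realWeight_pos m w)]
  congr 3
  rw [realWeight, ← Real.rpow_mul (by positivity), mul_div_cancel₀ _ hm]

theorem enorm_ofReal_mul_sq {a : ℝ} (ha : 0 ≤ a) (z : ℂ) :
    ‖(a : ℂ) * z‖ₑ ^ 2 = ENNReal.ofReal (a ^ 2) * ‖z‖ₑ ^ 2 := by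
  rw [enorm_mul, mul_pow, ← ofReal_norm (a : ℂ), Complex.norm_real, Real.norm_of_nonneg ha,
    ENNReal.ofReal_pow ha]

theorem split_identity {x : ℝ} (hx : 0 < x) :
    (x / (1 + x)) ^ 2 + x * (1 - x / (1 + x)) ^ 2 = x / (1 + x) := by
  field_simp
  ring

set_option maxHeartbeats 800000 in
-- The multiplier p = lW/(1 + lW) splits u into v = pu and z = (1-p)u, and `split_identity` makes
-- ‖v‖² + l‖z‖² equal to the K-functional of u. Conversely p ≤ 1 and p ≤ lW bound the K-functional
-- of any sum by twice such an expression. The operator is applied to the two pieces, one in L² and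
-- one in H^m.
theorem kFun_le_of_sobolevBdd {m : ℝ} {A : Lp ℝ 2 (volume : Measure (EuclideanSpace ℝ (Fin d))) →L[ℝ]
      Lp ℝ 2 (volume : Measure (EuclideanSpace ℝ (Fin d)))} {K : ℝ≥0}
    (h0 : ∀ u, ‖A u‖ₑ ^ 2 ≤ K * ‖u‖ₑ ^ 2)
    (hK : ∀ u, sobolevNorm m (A u) ^ 2 ≤ K * sobolevNorm m u ^ 2) {l : ℝ} (hl : 0 < l)
    (u : Lp ℝ 2 (volume : Measure (EuclideanSpace ℝ (Fin d)))) :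
    kFun m l (A u) ≤ 2 * K * kFun m l u := by
  set p : EuclideanSpace ℝ (Fin d) → ℝ := fun w ↦ l * realWeight m w / (1 + l * realWeight m w)
    with hp
  have hpm : Measurable p := by fun_prop
  have hWp : ∀ w : EuclideanSpace ℝ (Fin d), 0 < l * realWeight m w := fun w ↦
    mul_pos hl (realWeight_pos m w)
  have hp0 : ∀ w, 0 ≤ p w := fun w ↦ by
    have := hWp w
    positivity
  have hp1 : ∀ w, p w ≤ 1 := fun w ↦ by
    have := hWp w
    rw [hp, div_le_one (by positivity)]
    linarith
  have hpW : ∀ w, p w ≤ l * realWeight m w := fun w ↦ div_le_self (hWp w).le (by linarith [hWp w])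
  obtain ⟨v, hv⟩ := exists_real_multiplier u hpm (fun w ↦ by simp [hp, realWeight])
    (c := 1) (fun w ↦ by rw [abs_of_nonneg (hp0 w)]; exact hp1 w)
  set z := u - v with hz
  have huvz : A u = A v + A z := by rw [← map_add, hz, add_sub_cancel]
  have hzf : ∀ᵐ w, ft z w = ((1 - p w : ℝ) : ℂ) * ft u w := by
    rw [hz, map_sub]
    filter_upwards [hv, Lp.coeFn_sub (ft u) (ft v)] with w h1 h2
    rw [h2, Pi.sub_apply, h1]
    push_cast
    ring
  have hbd : ∀ a b : Lp ℝ 2 (volume : Measure (EuclideanSpace ℝ (Fin d))),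
      kFun m l (a + b) ≤ 2 * (‖a‖ₑ ^ 2 + ENNReal.ofReal l * sobolevNorm m b ^ 2) := fun a b ↦ by
    have ha := measurable_enorm_ft_sq a
    rw [kFun, ← enorm_ft, Lp.enorm_def, sq_eLpNorm_two, sobolevNorm_sq,
      ← lintegral_const_mul' _ _ (by simp), ← lintegral_add_left ha,
      ← lintegral_const_mul' _ _ (by simp)]
    refine lintegral_mono_ae ?_
    rw [map_add]
    filter_upwards [Lp.coeFn_add (ft a) (ft b)] with w hw
    rw [hw, Pi.add_apply]
    have h1 : ‖ft a w + ft b w‖ₑ ^ 2 ≤ 2 * (‖ft a w‖ₑ ^ 2 + ‖ft b w‖ₑ ^ 2) := by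
      refine (pow_le_pow_left' (enorm_add_le _ _) 2).trans ?_
      simpa using sq_sum_le_card_mul Finset.univ ![‖ft a w‖ₑ, ‖ft b w‖ₑ]
    have h2 : ENNReal.ofReal (p w) ≤ 1 := ENNReal.ofReal_le_one.2 (hp1 w)
    have h3 : ENNReal.ofReal (p w) ≤ ENNReal.ofReal l * sobolevWeight d m w := by
      rw [sobolevWeight_eq, ← ENNReal.ofReal_mul hl.le]
      exact ENNReal.ofReal_le_ofReal (hpW w)
    calc ENNReal.ofReal (p w) * ‖ft a w + ft b w‖ₑ ^ 2
        ≤ ENNReal.ofReal (p w) * (2 * (‖ft a w‖ₑ ^ 2 + ‖ft b w‖ₑ ^ 2)) := by gcongr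
      _ = 2 * (ENNReal.ofReal (p w) * ‖ft a w‖ₑ ^ 2 + ENNReal.ofReal (p w) * ‖ft b w‖ₑ ^ 2) := by ring
      _ ≤ 2 * (1 * ‖ft a w‖ₑ ^ 2 + ENNReal.ofReal l * sobolevWeight d m w * ‖ft b w‖ₑ ^ 2) := by
        gcongr
      _ = _ := by rw [one_mul, mul_assoc]
  have heq : ‖v‖ₑ ^ 2 + ENNReal.ofReal l * sobolevNorm m z ^ 2 = kFun m l u := by
    have hvm := measurable_enorm_ft_sq v
    rw [kFun, ← enorm_ft, Lp.enorm_def, sq_eLpNorm_two, sobolevNorm_sq,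
      ← lintegral_const_mul' _ _ (by simp), ← lintegral_add_left hvm]
    refine lintegral_congr_ae ?_
    filter_upwards [hv, hzf] with w h1 h2
    rw [h1, h2, enorm_ofReal_mul_sq (hp0 w), enorm_ofReal_mul_sq (sub_nonneg.2 (hp1 w)),
      sobolevWeight_eq, ← mul_assoc, ← mul_assoc, ← ENNReal.ofReal_mul hl.le,
      ← ENNReal.ofReal_mul (hWp w).le, ← add_mul,
      ← ENNReal.ofReal_add (sq_nonneg _) (mul_nonneg (hWp w).le (sq_nonneg _)),
      split_identity (hWp w)]
  rw [huvz, ← heq]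
  refine (hbd _ _).trans ?_
  rw [mul_assoc, mul_add (K : ℝ≥0∞), mul_left_comm (K : ℝ≥0∞)]
  gcongr
  · exact h0 v
  · exact hK z

theorem SobolevBdd.interpolate {m t : ℝ} {A : Lp ℝ 2 (volume : Measure (EuclideanSpace ℝ (Fin d))) →L[ℝ]
      Lp ℝ 2 (volume : Measure (EuclideanSpace ℝ (Fin d)))} (h : SobolevBdd m A) (ht0 : 0 ≤ t)
    (htm : t < m) : SobolevBdd t A := by
  have hA : ∀ u, ‖A u‖ₑ ^ 2 ≤ (‖A‖₊ ^ 2 : ℝ≥0) * ‖u‖ₑ ^ 2 := fun u ↦ by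
    rw [ENNReal.coe_pow, ← mul_pow]
    gcongr
    exact A.le_opENorm u
  -- The endpoint t = 0 is the L² bound itself; the interpolation constant diverges there.
  rcases ht0.eq_or_lt with rfl | ht0
  · exact ⟨‖A‖₊ ^ 2, fun u ↦ by simpa only [sobolevNorm_zero] using hA u⟩
  obtain ⟨K, hK⟩ := h
  have hm : 0 < m := ht0.trans htm
  set K' := max (‖A‖₊ ^ 2) K with hK'
  refine ⟨2 * K', fun u ↦ ?_⟩
  have h1 : ∀ l : ℝ, 0 < l → kFun m l (A u) ≤ 2 * K' * kFun m l u := fun l hl ↦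
    kFun_le_of_sobolevBdd
      (fun u ↦ (hA u).trans (by gcongr; exact le_max_left _ _))
      (fun u ↦ (hK u).trans (by gcongr; exact le_max_right _ _)) hl u
  have h2 := lintegral_kFun (t := t) hm.ne' (A u)
  have h3 := lintegral_kFun (t := t) hm.ne' u
  have h4 : interpConst (t / m) * sobolevNorm t (A u) ^ 2 ≤
      interpConst (t / m) * ((2 * K' : ℝ≥0) * sobolevNorm t u ^ 2) := by
    rw [← h2, mul_left_comm, ← h3, ← lintegral_const_mul' _ _ ENNReal.coe_ne_top]
    refine setLIntegral_mono' measurableSet_Ioi fun l hl ↦ ?_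
    rw [mul_left_comm]
    gcongr
    simpa using h1 l hl
  have hc0 := interpConst_ne_zero (t / m)
  have hct := interpConst_ne_top (θ := t / m) (by positivity) ((div_lt_one hm).2 htm)
  exact (ENNReal.mul_le_mul_iff_right hc0 hct).1 h4

end Interpolation

/-! ### Existence of a Sobolev extension operator -/

section Existence

variable {d : ℕ}

/-- Linearity comes from uniqueness: a class on the whole space is determined by its values on the
cube and its vanishing outside. -/
theorem exists_zeroExtension_linear (d : ℕ) :
    ∃ Z : Lp ℝ 2 (volume : Measure (cube d)) →ₗ[ℝ]
      Lp ℝ 2 (volume : Measure (EuclideanSpace ℝ (Fin d))),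
      ∀ f, (fun x : cube d ↦ Z f (x : EuclideanSpace ℝ (Fin d))) =ᵐ[volume] f := by
  choose Z h1 _ h3 using fun f ↦ exists_zeroExtension (d := d) f
  have huniq : ∀ (f : Lp ℝ 2 (volume : Measure (cube d))) (g : Lp ℝ 2 (volume : Measure (EuclideanSpace ℝ (Fin d)))),
      (fun x : cube d ↦ g (x : EuclideanSpace ℝ (Fin d))) =ᵐ[volume] f →
      (∀ᵐ x, x ∉ cube d → g x = 0) → Z f = g := fun f g hg hg0 ↦ by
    apply Lp.ext
    have h4 : (fun x : cube d ↦ Z f (x : EuclideanSpace ℝ (Fin d))) =ᵐ[volume] fun x ↦ g x :=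
      (h1 f).trans hg.symm
    have h5 : ∀ᵐ x, x ∈ cube d → Z f x = g x := by
      rw [← ae_restrict_iff' measurableSet_cube, ← map_comap_subtype_coe measurableSet_cube]
      exact (MeasurableEmbedding.subtype_coe measurableSet_cube).ae_map_iff.2 h4
    filter_upwards [h5, h3 f, hg0] with x a b c
    by_cases hx : x ∈ cube d
    · exact a hx
    · rw [b hx, c hx]
  refine ⟨{ toFun := Z, map_add' := fun f g ↦ ?_, map_smul' := fun c f ↦ ?_ }, h1⟩
  · refine huniq _ _ ?_ ?_
    · filter_upwards [h1 f, h1 g, Lp.coeFn_add f g, ae_cube_of_ae (Lp.coeFn_add (Z f) (Z g))]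
        with x a b c e
      rw [e, c, Pi.add_apply, Pi.add_apply, a, b]
    · filter_upwards [h3 f, h3 g, Lp.coeFn_add (Z f) (Z g)] with x a b c hx
      rw [c, Pi.add_apply, a hx, b hx, add_zero]
  · refine huniq _ _ ?_ ?_
    · filter_upwards [h1 f, Lp.coeFn_smul c f, ae_cube_of_ae (Lp.coeFn_smul c (Z f))] with x a b e
      rw [RingHom.id_apply, e, b, Pi.smul_apply, Pi.smul_apply, a]
    · filter_upwards [h3 f, Lp.coeFn_smul c (Z f)] with x a b hx
      rw [RingHom.id_apply, b, Pi.smul_apply, a hx, smul_zero]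

theorem ae_cube_iff {p : EuclideanSpace ℝ (Fin d) → Prop} :
    (∀ᵐ x : cube d, p x) ↔ ∀ᵐ x, x ∈ cube d → p x := by
  rw [← ae_restrict_iff' measurableSet_cube, ← map_comap_subtype_coe measurableSet_cube]
  exact (MeasurableEmbedding.subtype_coe measurableSet_cube).ae_map_iff.symm

/-- The extension by zero is in general not in H^t, but the operator on the whole space sees only
the cube. It therefore gives the same result on any H^t extension g, and the bound by the norm of g
is minimized over g. -/
theorem exists_isSobolevExtension (d : ℕ) (S : ℝ) :
    ∃ T : Lp ℝ 2 (volume : Measure (cube d)) →ₗ[ℝ]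
      Lp ℝ 2 (volume : Measure (EuclideanSpace ℝ (Fin d))), IsSobolevExtension S T := by
  -- An integer strictly above `S`, since interpolation reaches only orders below the top one.
  obtain ⟨A, hA, hA1, hA2⟩ := exists_cubeExtension d (⌈S⌉₊ + 1)
  obtain ⟨Z, hZ⟩ := exists_zeroExtension_linear d
  refine ⟨A.toLinearMap.comp Z, fun f ↦ ?_, fun t ht ↦ ?_⟩
  · filter_upwards [hZ f, ae_cube_iff.2 (hA1 (Z f))] with x h1 h2
    rw [← h1, ← h2]
    rfl
  · have htm : t < ((⌈S⌉₊ + 1 : ℕ) : ℝ) := by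
      push_cast
      linarith [ht.2, Nat.le_ceil S]
    obtain ⟨K, hK⟩ := hA.interpolate ht.1 htm
    -- Adding one makes the constant nonzero, so that dividing by it moves it across the infimum
    -- over extensions.
    refine ⟨NNReal.sqrt K + 1, fun f ↦ ?_⟩
    have key : ∀ g : Lp ℝ 2 (volume : Measure (EuclideanSpace ℝ (Fin d))),
        (fun x : cube d ↦ g (x : EuclideanSpace ℝ (Fin d))) =ᵐ[volume] f →
        sobolevNorm t (A (Z f)) ≤ (NNReal.sqrt K + 1 : ℝ≥0) * sobolevNorm t g := fun g hg ↦ by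
      have h1 : A (g - Z f) = 0 := by
        refine hA2 _ (ae_cube_iff.1 ?_)
        filter_upwards [hg, hZ f, ae_cube_of_ae (Lp.coeFn_sub g (Z f))] with x a b c
        rw [c, Pi.sub_apply, a, b, sub_self]
      have h2 : A (Z f) = A g := by
        rw [map_sub, sub_eq_zero] at h1
        exact h1.symm
      rw [h2]
      refine (ENNReal.pow_right_strictMono (n := 2) (by norm_num)).le_iff_le.1 ?_
      refine (hK g).trans ?_
      rw [mul_pow]
      gcongr
      rw [← ENNReal.coe_pow, ENNReal.coe_le_coe]
      calc K = NNReal.sqrt K ^ 2 := (NNReal.sq_sqrt K).symm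
        _ ≤ _ := by gcongr; exact le_self_add
    change sobolevNorm t (A (Z f)) ≤ _
    have hB0 : ((NNReal.sqrt K + 1 : ℝ≥0) : ℝ≥0∞) ≠ 0 := by positivity
    rw [mul_comm, ← ENNReal.div_le_iff hB0 ENNReal.coe_ne_top]
    refine le_iInf₂ fun g hg ↦ ?_
    rw [ENNReal.div_le_iff hB0 ENNReal.coe_ne_top, mul_comm]
    exact key g hg

end Existence

/-- Existence for ridge regression in a Hilbert space. -/
theorem exists_ridge_minimizer {H : Type*} [NormedAddCommGroup H] [InnerProductSpace ℝ H]
    [CompleteSpace H] {n : ℕ} (L : Fin n → H →L[ℝ] ℝ) (Y : Fin n → ℝ) {c l : ℝ} (hc : 0 ≤ c)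
    (hl : 0 < l) : ∃ h₀ : H, ∀ h : H,
      c * ∑ i, (Y i - L i h₀) ^ 2 + l * ‖h₀‖ ^ 2 ≤ c * ∑ i, (Y i - L i h) ^ 2 + l * ‖h‖ ^ 2 := by
  set B : H →L[ℝ] H →L[ℝ] ℝ := c • ∑ i, (L i).smulRight (L i) + l • (innerₗ H).mkContinuous₂ 1
    (fun x y ↦ by simpa using norm_inner_le_norm (𝕜 := ℝ) x y) with hB
  have hBapp : ∀ u v, B u v = c * ∑ i, L i u * L i v + l * inner ℝ u v := fun u v ↦ by
    simp [hB, sum_apply]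
  have hcoer : IsCoercive B := ⟨l, hl, fun u ↦ by
    rw [hBapp, real_inner_self_eq_norm_sq, mul_assoc, ← sq]
    have : 0 ≤ c * ∑ i, L i u * L i u :=
      mul_nonneg hc (Finset.sum_nonneg fun i _ ↦ mul_self_nonneg _)
    linarith⟩
  set ℓ : H →L[ℝ] ℝ := c • ∑ i, Y i • L i with hℓ
  -- The normal equation, solvable by Lax-Milgram because the penalty makes the form coercive.
  obtain ⟨h₀, hh₀⟩ : ∃ h₀, ∀ v, B h₀ v = c * ∑ i, Y i * L i v := by
    refine ⟨hcoer.continuousLinearEquivOfBilin.symm ((InnerProductSpace.toDual ℝ H).symm ℓ),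
      fun v ↦ ?_⟩
    rw [← hcoer.continuousLinearEquivOfBilin_apply, ContinuousLinearEquiv.apply_symm_apply,
      InnerProductSpace.toDual_symm_apply]
    simp [hℓ, sum_apply]
  refine ⟨h₀, fun h ↦ ?_⟩
  have h1 := hh₀ (h - h₀)
  -- By the normal equation, the excess of the objective at `h` over its value at `h₀` is exactly
  -- this quadratic form.
  have h2 : 0 ≤ B (h - h₀) (h - h₀) := by
    rw [hBapp, real_inner_self_eq_norm_sq]
    exact add_nonneg (mul_nonneg hc (Finset.sum_nonneg fun i _ ↦ mul_self_nonneg _)) (by positivity)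
  have h3 : ∑ i, (Y i - L i h) ^ 2 = ∑ i, (Y i - L i h₀) ^ 2 +
      ∑ i, L i (h - h₀) * L i (h - h₀) + 2 * ∑ i, L i h₀ * L i (h - h₀) -
      2 * ∑ i, Y i * L i (h - h₀) := by
    rw [Finset.mul_sum, Finset.mul_sum, ← Finset.sum_add_distrib, ← Finset.sum_add_distrib,
      ← Finset.sum_sub_distrib]
    refine Finset.sum_congr rfl fun i _ ↦ ?_
    rw [map_sub]
    ring
  have h4 : ‖h‖ ^ 2 = ‖h₀‖ ^ 2 + 2 * inner ℝ h₀ (h - h₀) + inner ℝ (h - h₀) (h - h₀) := by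
    rw [real_inner_self_eq_norm_sq, ← norm_add_sq_real, add_sub_cancel]
  rw [hBapp] at h1 h2
  rw [h3, h4]
  nlinarith

/-! ### Continuous representatives and well-posedness of kernel ridge regression -/

section Representation

variable {d : ℕ}

theorem lintegral_inv_sobolevWeight_lt_top {s : ℝ} (hs : (d : ℝ) / 2 < s) :
    ∫⁻ w, (sobolevWeight d s w)⁻¹ < ∞ := by
  have hs0 : 0 ≤ s := le_trans (by positivity) hs.le
  refine lt_of_le_of_lt ?_ (ENNReal.mul_lt_top (a := ENNReal.ofReal (2 ^ s)) (by simp)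
    (lintegral_inv_one_add_norm_lt_top (d := d) (r := 2 * s) (by linarith)))
  rw [← lintegral_const_mul' _ _ (by simp)]
  refine lintegral_mono fun w ↦ ?_
  have := one_add_norm_rpow_le_sobolevWeight hs0 w
  have hpos : 0 < (1 + ‖w‖) ^ (2 * s) := by positivity
  rw [Real.rpow_neg (by positivity), ENNReal.ofReal_inv_of_pos hpos]
  rw [← div_eq_mul_inv, ENNReal.le_div_iff_mul_le (Or.inl (by simpa using hpos)) (Or.inl (by simp)),
    mul_comm, ← div_eq_mul_inv]
  exact ENNReal.div_le_of_le_mul this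

/-- The continuous representative of a function with integrable Fourier transform. -/
def contRep (u : Lp ℝ 2 (volume : Measure (EuclideanSpace ℝ (Fin d))))
    (x : EuclideanSpace ℝ (Fin d)) : ℝ := (𝓕⁻ (ft u : EuclideanSpace ℝ (Fin d) → ℂ) x).re

variable {S : ℝ} {u : Lp ℝ 2 (volume : Measure (EuclideanSpace ℝ (Fin d)))}

theorem continuous_contRep (hu : Integrable (ft u)) : Continuous (contRep u) :=
  Complex.continuous_re.comp (continuous_fourierInv_integral hu)

theorem contRep_mem_rkhs (hS : (d : ℝ) / 2 < S) (hu : sobolevNorm S u ≠ ∞) :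
    (fun x : cube d ↦ contRep u x) ∈ rkhs d S ∧
      cubeSobolevNorm S (fun x : cube d ↦ contRep u x) ≤ sobolevNorm S u := by
  have h1 := integrable_ft hS hu
  have h2 : cubeSobolevNorm S (fun x : cube d ↦ contRep u x) ≤ sobolevNorm S u :=
    iInf₂_le u (ae_cube_of_ae (ae_eq_fourierInv_ft h1))
  exact ⟨⟨(continuous_contRep h1).comp continuous_subtype_val, ne_top_of_le_ne_top hu h2⟩, h2⟩

theorem contRep_eq_of_continuous (hu : Integrable (ft u)) {e : cube d → ℝ} (he : Continuous e)
    (hue : (fun x : cube d ↦ u (x : EuclideanSpace ℝ (Fin d))) =ᵐ[volume] e) (x : cube d) :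
    contRep u x = e x := by
  have h1 : (fun x : cube d ↦ contRep u x) =ᵐ[volume] e :=
    Filter.EventuallyEq.trans (Filter.EventuallyEq.symm (ae_cube_of_ae (ae_eq_fourierInv_ft hu))) hue
  exact congrFun ((Continuous.ae_eq_iff_eq volume
    ((continuous_contRep hu).comp continuous_subtype_val) he).1 h1) x

theorem realWeight_neg_mul (a : ℝ) (w : EuclideanSpace ℝ (Fin d)) :
    realWeight (-a) w * realWeight a w = 1 := by
  rw [realWeight, realWeight, ← Real.rpow_add (by positivity), neg_add_cancel, Real.rpow_zero]

theorem realWeight_half_sq (a : ℝ) (w : EuclideanSpace ℝ (Fin d)) :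
    realWeight (a / 2) w ^ 2 = realWeight a w := by
  rw [realWeight, realWeight, ← Real.rpow_natCast, ← Real.rpow_mul (by positivity)]
  simp

theorem sobolevNorm_sq_of_ae {h : Lp ℝ 2 (volume : Measure (EuclideanSpace ℝ (Fin d)))}
    (H : ∀ᵐ w, ft h w = (realWeight (S / 2) w : ℂ) * ft u w) : ‖h‖ₑ = sobolevNorm S u := by
  refine (ENNReal.pow_right_strictMono (n := 2) (by norm_num)).injective ?_
  rw [sobolevNorm_sq, ← enorm_ft, Lp.enorm_def, sq_eLpNorm_two]
  refine lintegral_congr_ae ?_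
  filter_upwards [H] with w hw
  rw [hw, enorm_ofReal_mul_sq (realWeight_pos _ w).le, realWeight_half_sq, sobolevWeight_eq]

theorem exists_bessel (hS : 0 ≤ S) (h : Lp ℝ 2 (volume : Measure (EuclideanSpace ℝ (Fin d)))) :
    ∃ g : Lp ℝ 2 (volume : Measure (EuclideanSpace ℝ (Fin d))),
      ∀ᵐ w, ft h w = (realWeight (S / 2) w : ℂ) * ft g w := by
  obtain ⟨g, hg⟩ := exists_real_multiplier h (measurable_realWeight (-(S / 2)))
    (fun w ↦ by simp [realWeight]) (c := 1) (fun w ↦ by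
      rw [abs_of_pos (realWeight_pos _ w), realWeight, Real.rpow_neg (by positivity)]
      exact inv_le_one_of_one_le₀ (Real.one_le_rpow
        (by linarith [sq_nonneg (2 * Real.pi * ‖w‖)]) (by linarith)))
  refine ⟨g, ?_⟩
  filter_upwards [hg] with w hw
  rw [hw, ← mul_assoc, ← Complex.ofReal_mul, mul_comm (realWeight _ w), realWeight_neg_mul]
  simp

theorem exists_bessel_inv (hu : sobolevNorm S u ≠ ∞) :
    ∃ h : Lp ℝ 2 (volume : Measure (EuclideanSpace ℝ (Fin d))),
      ∀ᵐ w, ft h w = (realWeight (S / 2) w : ℂ) * ft u w := by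
  have hv : MemLp (fun w ↦ (realWeight (S / 2) w : ℂ) * ft u w) 2
      (volume : Measure (EuclideanSpace ℝ (Fin d))) := by
    refine ⟨((Complex.measurable_ofReal.comp (measurable_realWeight _)).aestronglyMeasurable).mul
      (Lp.aestronglyMeasurable _), ?_⟩
    have h1 : eLpNorm (fun w ↦ (realWeight (S / 2) w : ℂ) * ft u w) 2
        (volume : Measure (EuclideanSpace ℝ (Fin d))) ^ 2 = sobolevNorm S u ^ 2 := by
      rw [sq_eLpNorm_two, sobolevNorm_sq]
      refine lintegral_congr fun w ↦ ?_
      rw [enorm_ofReal_mul_sq (realWeight_pos _ w).le, realWeight_half_sq, sobolevWeight_eq]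
    rw [(ENNReal.pow_right_strictMono (n := 2) (by norm_num)).injective h1]
    exact lt_top_iff_ne_top.2 hu
  obtain ⟨h, -, hh, -⟩ := exists_real_of_lp (hv.toLp _)
  have hneg := (Measure.measurePreserving_neg
    (volume : Measure (EuclideanSpace ℝ (Fin d)))).quasiMeasurePreserving.ae hv.coeFn_toLp
  refine ⟨h, ?_⟩
  filter_upwards [hh, hv.coeFn_toLp, hneg, ft_neg_ae u] with w h1 h2 h3 h4
  rw [h1, h2, h3, h4, map_mul, Complex.conj_conj, Complex.conj_ofReal]
  have : realWeight (S / 2) (-w) = realWeight (S / 2) w := by simp [realWeight]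
  rw [this]
  ring

/-- Point evaluation as a functional on `L²`, after the identification of the Sobolev space
with `L²`. -/
theorem exists_eval (hS : (d : ℝ) / 2 < S) (x : EuclideanSpace ℝ (Fin d)) :
    ∃ L : Lp ℝ 2 (volume : Measure (EuclideanSpace ℝ (Fin d))) →L[ℝ] ℝ,
      ∀ h g : Lp ℝ 2 (volume : Measure (EuclideanSpace ℝ (Fin d))),
        (∀ᵐ w, ft h w = (realWeight (S / 2) w : ℂ) * ft g w) → L h = contRep g x := by
  -- The representer of evaluation at `x` after division by the square root of the Sobolev weight.
  -- It is square integrable because the inverse weight is integrable, which is the condition S >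
  -- d/2.
  set k : EuclideanSpace ℝ (Fin d) → ℂ := fun w ↦
    (realWeight (-S / 2) w : ℂ) * starRingEnd ℂ (Real.fourierChar (inner ℝ w x) : ℂ) with hk
  have hkm : Measurable k := by
    refine Measurable.mul (Complex.measurable_ofReal.comp (measurable_realWeight _)) ?_
    refine Continuous.measurable ?_
    have := Real.continuous_fourierChar
    fun_prop
  have hk2 : MemLp k 2 (volume : Measure (EuclideanSpace ℝ (Fin d))) := by
    refine ⟨hkm.aestronglyMeasurable, ?_⟩
    have h1 : eLpNorm k 2 (volume : Measure (EuclideanSpace ℝ (Fin d))) ^ 2 < ∞ := by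
      rw [sq_eLpNorm_two]
      refine lt_of_eq_of_lt (lintegral_congr fun w ↦ ?_) (lintegral_inv_sobolevWeight_lt_top hS)
      rw [enorm_ofReal_mul_sq (realWeight_pos _ w).le, realWeight_half_sq, sobolevWeight_eq,
        ← ENNReal.ofReal_inv_of_pos (realWeight_pos _ w), ← ofReal_norm, RCLike.norm_conj,
        Circle.norm_coe, ENNReal.ofReal_one, one_pow, mul_one]
      congr 1
      rw [realWeight, realWeight, Real.rpow_neg (by positivity)]
    by_contra hcon
    rw [not_lt, top_le_iff] at hcon
    rw [hcon] at h1
    simp at h1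
  refine ⟨Complex.reCLM ∘L ((innerSL ℂ (hk2.toLp k)).restrictScalars ℝ) ∘L ft, fun h g H ↦ ?_⟩
  simp only [ContinuousLinearMap.comp_apply, ContinuousLinearMap.coe_restrictScalars',
    innerSL_apply_apply, Complex.reCLM_apply, contRep]
  congr 1
  rw [L2.inner_def, Real.fourierInv_eq]
  refine integral_congr_ae ?_
  filter_upwards [hk2.coeFn_toLp, H] with w h1 h2
  rw [h1, h2, RCLike.inner_apply, Circle.smul_def, smul_eq_mul, hk]
  simp only [map_mul, Complex.conj_conj, Complex.conj_ofReal]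
  have h3 : (realWeight (-S / 2) w : ℂ) * (realWeight (S / 2) w : ℂ) = 1 := by
    rw [← Complex.ofReal_mul, neg_div, realWeight_neg_mul, Complex.ofReal_one]
  linear_combination (Real.fourierChar (inner ℝ w x) : ℂ) * ft g w * h3

/-- Kernel ridge regression is well defined. -/
theorem krr_spec (hS : (d : ℝ) / 2 < S) {v : ℝ} (hv : 0 < v) {n : ℕ} (D : Fin n → cube d × ℝ) :
    krr S v D ∈ rkhs d S ∧ IsMinOn (krrObjective S v D) (rkhs d S) (krr S v D) := by
  have hS0 : 0 ≤ S := le_trans (by positivity) hS.le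
  refine Classical.epsilon_spec (p := fun g ↦ g ∈ rkhs d S ∧
    IsMinOn (krrObjective S v D) (rkhs d S) g) ?_
  -- The problem is solved over H^S of the whole space, identified with L² by the Bessel potential,
  -- where point evaluations are continuous functionals. The restriction of the minimizer to the
  -- cube is then optimal for the quotient norm.
  choose L hL using fun i ↦ exists_eval hS ((D i).1 : EuclideanSpace ℝ (Fin d))
  obtain ⟨h₀, hh₀⟩ := exists_ridge_minimizer L (fun i ↦ (D i).2) (c := 1 / (n : ℝ)) (l := 1 / v)
    (by positivity) (by positivity)
  obtain ⟨g₀, hg₀⟩ := exists_bessel hS0 h₀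
  have hn₀ := sobolevNorm_sq_of_ae hg₀
  have hfin : sobolevNorm S g₀ ≠ ∞ := by rw [← hn₀]; finiteness
  obtain ⟨hmem, hle⟩ := contRep_mem_rkhs hS hfin
  refine ⟨_, hmem, fun f hf ↦ ?_⟩
  have hle' : (cubeSobolevNorm S fun x : cube d ↦ contRep g₀ x).toReal ≤ ‖h₀‖ := by
    rw [← toReal_enorm, hn₀]
    exact ENNReal.toReal_mono hfin hle
  set t : ℝ := krrObjective S v D (fun x : cube d ↦ contRep g₀ x) -
    1 / (n : ℝ) * ∑ i, ((D i).2 - f (D i).1) ^ 2 with ht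
  -- Optimality over the whole space bounds v·t by the squared norm of every H^S extension of `f`.
  -- Passing to the infimum gives the quotient norm without knowing that it is attained.
  have key : ENNReal.ofReal (Real.sqrt (v * t)) ≤ cubeSobolevNorm S f := by
    refine le_iInf₂ fun g hg ↦ ?_
    by_cases hgt : sobolevNorm S g = ∞
    · rw [hgt]
      exact le_top
    obtain ⟨h, hh⟩ := exists_bessel_inv hgt
    have hhn := sobolevNorm_sq_of_ae hh
    rw [← hhn, ← ofReal_norm]
    refine ENNReal.ofReal_le_ofReal (Real.sqrt_le_iff.2 ⟨norm_nonneg _, ?_⟩)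
    have h1 := hh₀ h
    simp only [fun i ↦ hL i h₀ g₀ hg₀, fun i ↦ hL i h g hh,
      contRep_eq_of_continuous (integrable_ft hS hgt) hf.1 hg] at h1
    have h2 : t ≤ 1 / v * ‖h‖ ^ 2 := by
      rw [ht, krrObjective]
      have : 1 / v * (cubeSobolevNorm S fun x : cube d ↦ contRep g₀ x).toReal ^ 2 ≤
          1 / v * ‖h₀‖ ^ 2 := by gcongr
      linarith
    calc v * t ≤ v * (1 / v * ‖h‖ ^ 2) := by gcongr
      _ = ‖h‖ ^ 2 := by field_simp
  rw [ENNReal.ofReal_le_iff_le_toReal hf.2] at key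
  have h1 := (Real.sqrt_le_iff.1 key).2
  change krrObjective S v D (fun x : cube d ↦ contRep g₀ x) ≤ krrObjective S v D f
  have h2 : t ≤ 1 / v * (cubeSobolevNorm S f).toReal ^ 2 := by
    rw [one_div, inv_mul_eq_div, le_div_iff₀ hv]
    linarith
  have h3 : krrObjective S v D f = 1 / (n : ℝ) * ∑ i, ((D i).2 - f (D i).1) ^ 2 +
      1 / v * (cubeSobolevNorm S f).toReal ^ 2 := rfl
  rw [h3]
  linarith

end Representation

theorem sq_add_le_two_mul (a b : ℝ≥0∞) : (a + b) ^ 2 ≤ 2 * (a ^ 2 + b ^ 2) := by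
  simpa using sq_sum_le_card_mul Finset.univ ![a, b]

/-! ### Consequences of the extension property -/

section Extension

variable {d : ℕ} {S : ℝ} {T : Lp ℝ 2 (volume : Measure (cube d)) →ₗ[ℝ]
      Lp ℝ 2 (volume : Measure (EuclideanSpace ℝ (Fin d)))}

theorem cubeSobolevNorm_congr {s : ℝ} {f g : cube d → ℝ} (h : f =ᵐ[volume] g) :
    cubeSobolevNorm s f = cubeSobolevNorm s g := by
  unfold cubeSobolevNorm
  refine iInf_congr fun u ↦ ?_
  exact iInf_congr_Prop ⟨fun hu ↦ hu.trans h, fun hu ↦ hu.trans h.symm⟩ fun _ ↦ rfl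

theorem toL2_ae {f : cube d → ℝ} (h : MemLp f 2) : toL2 f =ᵐ[volume] f := by
  rw [toL2, dif_pos h]
  exact h.coeFn_toLp

theorem enorm_toL2 {f : cube d → ℝ} (h : MemLp f 2) : ‖toL2 f‖ₑ = eLpNorm f 2 volume := by
  rw [Lp.enorm_def, eLpNorm_congr_ae (toL2_ae h)]

theorem memLp_of_continuous {f : cube d → ℝ} (h : Continuous f) {q : ℝ≥0∞} : MemLp f q := by
  obtain ⟨A, hA⟩ := isCompact_univ.exists_bound_of_continuousOn h.continuousOn
  exact MemLp.of_bound h.aestronglyMeasurable A (Filter.Eventually.of_forall fun x ↦ hA x (mem_univ _))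

theorem cubeSobolevNorm_zero_le (f : Lp ℝ 2 (volume : Measure (cube d))) :
    cubeSobolevNorm 0 f ≤ ‖f‖ₑ := by
  obtain ⟨g, h1, h2, -⟩ := exists_zeroExtension f
  rw [← h2, ← sobolevNorm_zero]
  exact iInf₂_le g h1

theorem IsSobolevExtension.exists_enorm_le (hT : IsSobolevExtension S T) (hS : 0 ≤ S) :
    ∃ B : ℝ≥0, ∀ f, ‖T f‖ₑ ≤ B * ‖f‖ₑ := by
  obtain ⟨B, hB⟩ := hT.bounded 0 ⟨le_rfl, hS⟩
  refine ⟨B, fun f ↦ ?_⟩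
  rw [← sobolevNorm_zero]
  exact (hB f).trans (by gcongr; exact cubeSobolevNorm_zero_le f)

theorem IsSobolevExtension.exists_sobolevNorm_le (hT : IsSobolevExtension S T) {t : ℝ}
    (ht : t ∈ Icc 0 S) :
    ∃ B : ℝ≥0, ∀ f : cube d → ℝ, MemLp f 2 → sobolevNorm t (T (toL2 f)) ≤ B * cubeSobolevNorm t f := by
  obtain ⟨B, hB⟩ := hT.bounded t ht
  refine ⟨B, fun f hf ↦ ?_⟩
  rw [← cubeSobolevNorm_congr (toL2_ae hf)]
  exact hB _

theorem IsSobolevExtension.extends_toL2 (hT : IsSobolevExtension S T) {f : cube d → ℝ}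
    (hf : MemLp f 2) :
    (fun x : cube d ↦ T (toL2 f) (x : EuclideanSpace ℝ (Fin d))) =ᵐ[volume] f :=
  (hT.extends_self _).trans (toL2_ae hf)

theorem IsSobolevExtension.sobolevNorm_ne_top (hT : IsSobolevExtension S T) (hS : 0 ≤ S)
    {e : cube d → ℝ} (he : e ∈ rkhs d S) : sobolevNorm S (T (toL2 e)) ≠ ∞ := by
  obtain ⟨B, hB⟩ := hT.exists_sobolevNorm_le ⟨hS, le_rfl⟩
  exact ne_top_of_le_ne_top (ENNReal.mul_ne_top ENNReal.coe_ne_top he.2)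
    (hB e (memLp_of_continuous he.1))

theorem IsSobolevExtension.contRep_eq (hT : IsSobolevExtension S T) (hS : (d : ℝ) / 2 < S)
    {e : cube d → ℝ} (he : e ∈ rkhs d S) (x : cube d) : contRep (T (toL2 e)) x = e x :=
  contRep_eq_of_continuous (integrable_ft hS (hT.sobolevNorm_ne_top
    (le_trans (by positivity) hS.le) he)) he.1 (hT.extends_toL2 (memLp_of_continuous he.1)) x

end Extension

/-! ### Cells, and the sampling inequality -/

section Cells

variable {d : ℕ}

/-- The index of the cell of side `1 / M` containing a point. -/
def cellIdx (M : ℕ) (x : cube d) (i : Fin d) : ℕ := ⌊(M : ℝ) * (x : EuclideanSpace ℝ (Fin d)) i⌋₊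

theorem measurable_cellIdx (M : ℕ) : Measurable (cellIdx M : cube d → Fin d → ℕ) := by
  unfold cellIdx
  refine measurable_pi_lambda _ fun i ↦ Nat.measurable_floor.comp ?_
  fun_prop

/-- The half-open box of side `1 / M` with index `k`. -/
def cellBox (M : ℕ) (k : Fin d → ℕ) : Set (EuclideanSpace ℝ (Fin d)) :=
  {x | ∀ i, x i ∈ Ico ((k i : ℝ) / M) ((k i + 1) / M)}

theorem cellBox_eq_preimage (M : ℕ) (k : Fin d → ℕ) : cellBox M k =
    (MeasurableEquiv.toLp 2 (Fin d → ℝ)).symm ⁻¹'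
      (univ.pi fun i ↦ Ico ((k i : ℝ) / M) ((k i + 1) / M)) := by
  ext x
  simp [cellBox]

theorem measurableSet_cellBox (M : ℕ) (k : Fin d → ℕ) : MeasurableSet (cellBox M k) := by
  rw [cellBox_eq_preimage]
  exact (MeasurableEquiv.measurable _) (MeasurableSet.univ_pi fun i ↦ measurableSet_Ico)

theorem volume_cellBox {M : ℕ} (hM : 0 < M) (k : Fin d → ℕ) :
    volume (cellBox M k) = ENNReal.ofReal ((M : ℝ) ^ d)⁻¹ := by
  rw [cellBox_eq_preimage, (EuclideanSpace.volume_preserving_symm_measurableEquiv_toLp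
    (Fin d)).measure_preimage (MeasurableSet.univ_pi fun i ↦ measurableSet_Ico).nullMeasurableSet,
    volume_pi_pi]
  have h1 : ∀ i, volume (Ico ((k i : ℝ) / M) ((k i + 1) / M)) = ENNReal.ofReal (M : ℝ)⁻¹ := fun i ↦ by
    rw [Real.volume_Ico]
    congr 1
    ring
  simp_rw [h1]
  rw [Finset.prod_const, Finset.card_univ, Fintype.card_fin, ← ENNReal.ofReal_pow (by positivity),
    inv_pow]

theorem cellIdx_eq_iff {M : ℕ} (hM : 0 < M) (k : Fin d → ℕ) (x : cube d) :
    cellIdx M x = k ↔ (x : EuclideanSpace ℝ (Fin d)) ∈ cellBox M k := by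
  have hM0 : (0 : ℝ) < M := by exact_mod_cast hM
  rw [funext_iff]
  refine forall_congr' fun i ↦ ?_
  rw [cellIdx, Nat.floor_eq_iff (mul_nonneg hM0.le (x.2 i).1), mem_Ico, div_le_iff₀' hM0,
    lt_div_iff₀' hM0]

theorem volume_cell_le {M : ℕ} (hM : 0 < M) (k : Fin d → ℕ) :
    volume {x : cube d | cellIdx M x = k} ≤ ENNReal.ofReal ((M : ℝ) ^ d)⁻¹ := by
  have h1 : {x : cube d | cellIdx M x = k} = Subtype.val ⁻¹' cellBox M k := by
    ext x
    exact cellIdx_eq_iff hM k x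
  rw [h1, measurePreserving_cube_val.measure_preimage (measurableSet_cellBox M k).nullMeasurableSet,
    ← volume_cellBox hM k]
  exact Measure.restrict_apply_le _ _

theorem volume_cell {M : ℕ} {k : Fin d → ℕ} (hk : ∀ i, k i < M) (hM : 0 < M) :
    volume {x : cube d | cellIdx M x = k} = ENNReal.ofReal ((M : ℝ) ^ d)⁻¹ := by
  have hM0 : (0 : ℝ) < M := by exact_mod_cast hM
  have h1 : {x : cube d | cellIdx M x = k} = Subtype.val ⁻¹' cellBox M k := by
    ext x
    exact cellIdx_eq_iff hM k x
  rw [h1, measurePreserving_cube_val.measure_preimage (measurableSet_cellBox M k).nullMeasurableSet,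
    ← volume_cellBox hM k, Measure.restrict_apply (measurableSet_cellBox M k)]
  congr 1
  refine inter_eq_left.2 fun x hx i ↦ ⟨(by positivity : (0 : ℝ) ≤ k i / M).trans (hx i).1,
    (hx i).2.le.trans ?_⟩
  rw [div_le_one hM0]
  exact_mod_cast hk i

theorem ae_cellIdx_lt {M : ℕ} (hM : 0 < M) : ∀ᵐ x : cube d, ∀ i, cellIdx M x i < M := by
  have hM0 : (0 : ℝ) < M := by exact_mod_cast hM
  rw [ae_all_iff]
  intro i
  have h1 : ∀ᵐ x : EuclideanSpace ℝ (Fin d), x i ≠ 1 := by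
    have h2 : ∀ᵐ x : Fin d → ℝ, x i ≠ 1 := by
      have h3 := (Measure.quasiMeasurePreserving_eval (fun _ : Fin d ↦ (volume : Measure ℝ)) i).ae
        (p := fun t ↦ t ≠ 1) (by simp [ae_iff])
      exact h3
    exact (EuclideanSpace.volume_preserving_symm_measurableEquiv_toLp
      (Fin d)).quasiMeasurePreserving.ae h2
  filter_upwards [ae_cube_of_ae h1] with x hx
  rw [cellIdx, Nat.floor_lt (mul_nonneg hM0.le (x.2 i).1)]
  exact mul_lt_of_lt_one_right hM0 (lt_of_le_of_ne (x.2 i).2 hx)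

theorem dist_le_of_cellIdx_eq {M : ℕ} (hM : 0 < M) {x y : cube d} (h : cellIdx M x = cellIdx M y) :
    dist x y ≤ Real.sqrt d / M := by
  have hM0 : (0 : ℝ) < M := by exact_mod_cast hM
  have hx := (cellIdx_eq_iff hM _ x).1 h
  have hy := (cellIdx_eq_iff hM _ y).1 rfl
  rw [Subtype.dist_eq, EuclideanSpace.dist_eq]
  have h1 : ∀ i, dist ((x : EuclideanSpace ℝ (Fin d)) i) ((y : EuclideanSpace ℝ (Fin d)) i) ^ 2 ≤
      ((1 : ℝ) / M) ^ 2 := fun i ↦ by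
    gcongr
    rw [Real.dist_eq, abs_le]
    have h2 := hx i
    have h3 := hy i
    rw [mem_Ico, add_div] at h2 h3
    constructor <;> linarith [h2.1, h2.2, h3.1, h3.2]
  calc _ ≤ Real.sqrt (∑ _i : Fin d, ((1 : ℝ) / M) ^ 2) :=
        Real.sqrt_le_sqrt (Finset.sum_le_sum fun i _ ↦ h1 i)
    _ = _ := by
      rw [Finset.sum_const, Finset.card_univ, Fintype.card_fin, nsmul_eq_mul,
        Real.sqrt_mul (Nat.cast_nonneg d), Real.sqrt_sq (by positivity)]
      ring

/-- If every cell contains many sample points, then the `L²` norm is controlled by the empirical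
norm and the local oscillation. -/
theorem lintegral_sq_le_of_cells {n M : ℕ} (hM : 0 < M) {c : ℝ} (hc : 0 < c) (hn : 0 < n)
    {X : Fin n → cube d}
    (hX : ∀ k : Fin d → ℕ, (∀ i, k i < M) →
      c * n * ((M : ℝ) ^ d)⁻¹ ≤ (Finset.univ.filter fun i ↦ cellIdx M (X i) = k).card)
    {e : cube d → ℝ} {F : cube d → ℝ≥0∞} (hF : Measurable F)
    (he : ∀ x y, dist y x ≤ Real.sqrt d / M → ‖e y - e x‖ₑ ^ 2 ≤ F x) :
    ∫⁻ x, ‖e x‖ₑ ^ 2 ≤ ENNReal.ofReal (2 / (c * n)) * ∑ i, ‖e (X i)‖ₑ ^ 2 + 2 * ∫⁻ x, F x := by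
  have hM0 : (0 : ℝ) < M := by exact_mod_cast hM
  have hn0 : (0 : ℝ) < n := by exact_mod_cast hn
  set q : ℝ := c * n * ((M : ℝ) ^ d)⁻¹ with hq
  have hq0 : 0 < q := by positivity
  have hpt : ∀ᵐ x : cube d, ‖e x‖ₑ ^ 2 ≤ ENNReal.ofReal (2 / q) *
      (∑ i, {x : cube d | cellIdx M x = cellIdx M (X i)}.indicator
        (fun _ ↦ ‖e (X i)‖ₑ ^ 2) x) + 2 * F x := by
    filter_upwards [ae_cellIdx_lt hM] with x hx
    set I := Finset.univ.filter fun i ↦ cellIdx M (X i) = cellIdx M x with hI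
    have hIq : q ≤ I.card := hX _ hx
    -- Comparison of the value at `x` with the value at each sample point of the same cell.
    -- Averaging over these points divides by their number, which is at least `q`, and integrating
    -- over the cell restores the empirical mean.
    have h1 : ∀ i ∈ I, ‖e x‖ₑ ^ 2 ≤ 2 * (‖e (X i)‖ₑ ^ 2 + F x) := fun i hi ↦ by
      have h2 : ‖e x‖ₑ ≤ ‖e (X i)‖ₑ + ‖e (X i) - e x‖ₑ := by
        rw [← enorm_neg (e (X i) - e x), neg_sub]
        simpa using enorm_add_le (e (X i)) (e x - e (X i))
      refine (pow_le_pow_left' h2 2).trans ?_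
      refine (sq_add_le_two_mul _ _).trans ?_
      gcongr
      exact he x (X i) (dist_le_of_cellIdx_eq hM (Finset.mem_filter.1 hi).2)
    have h4 : (I.card : ℝ≥0∞) * ‖e x‖ₑ ^ 2 ≤ 2 * ∑ i ∈ I, ‖e (X i)‖ₑ ^ 2 + I.card * (2 * F x) := by
      have := Finset.sum_le_sum h1
      rw [Finset.sum_const, nsmul_eq_mul] at this
      refine this.trans_eq ?_
      simp_rw [mul_add]
      rw [Finset.sum_add_distrib, Finset.sum_const, nsmul_eq_mul, Finset.mul_sum]
    have hI0 : (I.card : ℝ≥0∞) ≠ 0 := by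
      have : (0 : ℝ) < I.card := hq0.trans_le hIq
      exact_mod_cast this.ne'
    have h5 : ‖e x‖ₑ ^ 2 ≤ (I.card : ℝ≥0∞)⁻¹ * (2 * ∑ i ∈ I, ‖e (X i)‖ₑ ^ 2) + 2 * F x := by
      rw [← ENNReal.mul_le_mul_iff_right hI0 (ENNReal.natCast_ne_top _), mul_add, ← mul_assoc,
        ENNReal.mul_inv_cancel hI0 (ENNReal.natCast_ne_top _), one_mul]
      exact h4
    refine h5.trans (add_le_add_left ?_ _)
    have h6 : ∑ i ∈ I, ‖e (X i)‖ₑ ^ 2 = ∑ i, {x : cube d | cellIdx M x = cellIdx M (X i)}.indicator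
        (fun _ ↦ ‖e (X i)‖ₑ ^ 2) x := by
      rw [hI, Finset.sum_filter]
      refine Finset.sum_congr rfl fun i _ ↦ ?_
      simp only [indicator_apply, mem_ofPred_eq, eq_comm]
    rw [h6, ← mul_assoc]
    gcongr
    rw [div_eq_inv_mul, ENNReal.ofReal_mul (by positivity), ENNReal.ofReal_inv_of_pos hq0,
      ENNReal.ofReal_ofNat]
    gcongr
    rw [← ENNReal.ofReal_natCast]
    exact ENNReal.ofReal_le_ofReal hIq
  have hcell : ∀ i, MeasurableSet {x : cube d | cellIdx M x = cellIdx M (X i)} := fun i ↦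
    measurable_cellIdx M (measurableSet_singleton _)
  calc _ ≤ ∫⁻ x : cube d, (ENNReal.ofReal (2 / q) *
      (∑ i, {x : cube d | cellIdx M x = cellIdx M (X i)}.indicator
        (fun _ ↦ ‖e (X i)‖ₑ ^ 2) x) + 2 * F x) := lintegral_mono_ae hpt
    _ = ENNReal.ofReal (2 / q) * (∑ i, ‖e (X i)‖ₑ ^ 2 *
        volume {x : cube d | cellIdx M x = cellIdx M (X i)}) + 2 * ∫⁻ x, F x := by
      rw [lintegral_add_right _ (hF.const_mul 2), lintegral_const_mul' _ _ (by simp),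
        lintegral_const_mul' _ _ (by simp), lintegral_finsetSum _ fun i _ ↦
          measurable_const.indicator (hcell i)]
      simp_rw [lintegral_indicator_const (hcell _)]
    _ ≤ ENNReal.ofReal (2 / q) * (∑ i, ‖e (X i)‖ₑ ^ 2 * ENNReal.ofReal ((M : ℝ) ^ d)⁻¹) +
        2 * ∫⁻ x, F x := by
      gcongr with i
      exact volume_cell_le hM _
    _ = _ := by
      rw [← Finset.sum_mul, mul_comm (∑ i, _), ← mul_assoc, ← ENNReal.ofReal_mul (by positivity)]
      congr 3
      rw [hq]
      field_simp

/-- Up to a small τ the factor t² beats a bounded power; beyond τ one has 1 + t ≤ (1 + 1/τ)t. An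
arbitrarily small constant term is essential, because it is later absorbed on the left of an
inequality. -/
theorem oscWeight_le {S ε : ℝ} (hS : 0 < S) (hε : 0 < ε) :
    ∃ C : ℝ, 0 ≤ C ∧ ∀ t, 0 ≤ t → oscWeight S t ≤ ε + C * t ^ (2 * S) := by
  set τ : ℝ := min 1 (Real.sqrt (ε / 2 ^ (2 * S))) with hτ
  have hτ0 : 0 < τ := lt_min one_pos (Real.sqrt_pos.2 (by positivity))
  refine ⟨(1 + 1 / τ) ^ (2 * S), by positivity, fun t ht ↦ ?_⟩
  have hmin : min 1 t ^ 2 ≤ 1 := pow_le_one₀ (le_min zero_le_one ht) (min_le_left _ _)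
  rcases le_or_gt t τ with h | h
  · have h1 : min 1 t ^ 2 ≤ ε / 2 ^ (2 * S) := by
      calc min 1 t ^ 2 ≤ (Real.sqrt (ε / 2 ^ (2 * S))) ^ 2 :=
            pow_le_pow_left₀ (le_min zero_le_one ht)
              ((min_le_right _ _).trans (h.trans (min_le_right _ _))) 2
        _ = _ := Real.sq_sqrt (by positivity)
    have h2 : (1 + t) ^ (2 * S) ≤ 2 ^ (2 * S) :=
      Real.rpow_le_rpow (by positivity) (by linarith [h.trans (min_le_left _ _)]) (by positivity)
    have h3 : oscWeight S t ≤ ε := by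
      calc oscWeight S t ≤ ε / 2 ^ (2 * S) * 2 ^ (2 * S) := by
            unfold oscWeight
            gcongr
        _ = ε := div_mul_cancel₀ _ (by positivity)
    have : 0 ≤ (1 + 1 / τ) ^ (2 * S) * t ^ (2 * S) := by positivity
    linarith
  · have h1 : 1 + t ≤ (1 + 1 / τ) * t := by
      have : 1 ≤ t / τ := (one_le_div hτ0).2 h.le
      rw [add_mul, one_mul, one_div_mul_eq_div]
      linarith
    calc oscWeight S t ≤ 1 * ((1 + 1 / τ) * t) ^ (2 * S) := by
          unfold oscWeight
          gcongr
      _ = (1 + 1 / τ) ^ (2 * S) * t ^ (2 * S) := by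
          rw [one_mul, Real.mul_rpow (by positivity) ht]
      _ ≤ _ := by linarith

variable {S : ℝ} {T : Lp ℝ 2 (volume : Measure (cube d)) →ₗ[ℝ]
      Lp ℝ 2 (volume : Measure (EuclideanSpace ℝ (Fin d)))}

set_option maxHeartbeats 1600000 in
-- The oscillation of `e` at the cell scale √d/M is at most a small multiple of ‖e‖², which moves to
-- the left side, plus a constant times M^(-2S)‖e‖² in H^S, which the penalty dominates. The
-- inequality is deterministic and holds for all `e` at once.
theorem exists_sampling_inequality (hT : IsSobolevExtension S T) (hS : (d : ℝ) / 2 < S) {c : ℝ}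
    (hc : 0 < c) : ∃ C : ℝ, 0 < C ∧ ∀ n M : ℕ, 0 < n → 0 < M → ∀ X : Fin n → cube d,
      (∀ k : Fin d → ℕ, (∀ i, k i < M) →
        c * n * ((M : ℝ) ^ d)⁻¹ ≤ (Finset.univ.filter fun i ↦ cellIdx M (X i) = k).card) →
      ∀ l : ℝ, ((M : ℝ)⁻¹) ^ (2 * S) ≤ l → ∀ e ∈ rkhs d S,
        (eLpNorm e 2 volume).toReal ^ 2 ≤
          C * (1 / (n : ℝ) * ∑ i, e (X i) ^ 2 + l * (cubeSobolevNorm S e).toReal ^ 2) := by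
  have hS0 : 0 < S := lt_of_le_of_lt (by positivity) hS
  obtain ⟨B₀, hB₀⟩ := hT.exists_enorm_le hS0.le
  obtain ⟨B, hB⟩ := hT.exists_sobolevNorm_le (t := S) ⟨hS0.le, le_rfl⟩
  obtain ⟨C₁, hC₁⟩ := exists_oscillation_majorant (d := d) hS
  -- Chosen so that 2·C₁·ε·B₀² ≤ 1/2, which lets half of the squared L² norm remain on the left.
  set ε : ℝ := 1 / (4 * (C₁ * B₀ ^ 2 + 1)) with hε
  have hε0 : 0 < ε := by positivity
  obtain ⟨C₂, hC₂0, hC₂⟩ := oscWeight_le hS0 hε0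
  set A : ℝ := 4 * C₁ * C₂ * (d : ℝ) ^ S * B ^ 2 with hA
  have hA0 : 0 ≤ A := by positivity
  refine ⟨4 / c + A, by positivity, fun n M hn hM X hX l hl e he ↦ ?_⟩
  have hM0 : (0 : ℝ) < M := by exact_mod_cast hM
  have hn0 : (0 : ℝ) < n := by exact_mod_cast hn
  have hl0 : 0 ≤ l := le_trans (by positivity) hl
  set u := T (toL2 e) with hu
  have heL := memLp_of_continuous he.1 (q := 2)
  have hfin := hT.sobolevNorm_ne_top hS0.le he
  have hint := integrable_ft hS hfin
  obtain ⟨F, hFm, hF, hFint⟩ := hC₁ (ft u) (Lp.stronglyMeasurable _) hint (Lp.memLp _)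
    (Real.sqrt d / M) (by positivity)
  have h1 := lintegral_sq_le_of_cells hM hc hn hX (e := e) (F := fun x ↦ F x)
    (hFm.comp measurable_subtype_coe) (fun x y hxy ↦ by
      refine le_trans ?_ (hF x y hxy)
      gcongr
      rw [← hT.contRep_eq hS he x, ← hT.contRep_eq hS he y, enorm_le_iff_norm_le]
      simp only [contRep, ← Complex.sub_re]
      exact Complex.abs_re_le_norm _)
  have h2 : ∫⁻ w, ENNReal.ofReal (oscWeight S (Real.sqrt d / M * ‖w‖)) * ‖ft u w‖ₑ ^ 2 ≤
      ENNReal.ofReal ε * ‖u‖ₑ ^ 2 +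
        ENNReal.ofReal (C₂ * (d : ℝ) ^ S * l) * sobolevNorm S u ^ 2 := by
    have hm := measurable_enorm_ft_sq u
    rw [← enorm_ft, Lp.enorm_def, sq_eLpNorm_two, sobolevNorm_sq,
      ← lintegral_const_mul' _ _ (by simp), ← lintegral_const_mul' _ _ (by simp),
      ← lintegral_add_left (hm.const_mul _)]
    refine lintegral_mono fun w ↦ ?_
    simp only
    rw [← mul_assoc, ← add_mul, sobolevWeight_eq, ← ENNReal.ofReal_mul (by positivity),
      ← ENNReal.ofReal_add hε0.le (mul_nonneg (by positivity) (realWeight_pos _ _).le)]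
    gcongr
    refine (hC₂ _ (by positivity)).trans (add_le_add le_rfl ?_)
    have h3 : (Real.sqrt d / M * ‖w‖) ^ (2 * S) ≤ (d : ℝ) ^ S * l * realWeight S w := by
      rw [div_eq_mul_inv, Real.mul_rpow (by positivity) (by positivity),
        Real.mul_rpow (by positivity) (by positivity), Real.rpow_mul (by positivity) 2 S,
        Real.rpow_mul (norm_nonneg w) 2 S, Real.rpow_two, Real.rpow_two,
        Real.sq_sqrt (Nat.cast_nonneg d), realWeight]
      have hpi := Real.pi_gt_three
      gcongr
      have h4 : 1 ≤ (2 * Real.pi) ^ 2 := by nlinarith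
      rw [mul_pow]
      nlinarith [mul_nonneg (sub_nonneg.2 h4) (sq_nonneg ‖w‖)]
    calc C₂ * (Real.sqrt d / M * ‖w‖) ^ (2 * S) ≤ C₂ * ((d : ℝ) ^ S * l * realWeight S w) := by gcongr
      _ = _ := by ring
  set a : ℝ := (eLpNorm e 2 volume).toReal with ha
  set b : ℝ := (cubeSobolevNorm S e).toReal with hb
  have haE : eLpNorm e 2 volume = ENNReal.ofReal a := (ENNReal.ofReal_toReal heL.2.ne).symm
  have hbE : cubeSobolevNorm S e = ENNReal.ofReal b := (ENNReal.ofReal_toReal he.2).symm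
  have ha0 : 0 ≤ a := ENNReal.toReal_nonneg
  have hb0 : 0 ≤ b := ENNReal.toReal_nonneg
  have h3 : ‖u‖ₑ ≤ ENNReal.ofReal (B₀ * a) := by
    rw [ENNReal.ofReal_mul (by positivity), ENNReal.ofReal_coe_nnreal, ← haE, ← enorm_toL2 heL]
    exact hB₀ _
  have h4 : sobolevNorm S u ≤ ENNReal.ofReal (B * b) := by
    rw [ENNReal.ofReal_mul (by positivity), ENNReal.ofReal_coe_nnreal, ← hbE]
    exact hB e heL
  have h5 : ∑ i, ‖e (X i)‖ₑ ^ 2 = ENNReal.ofReal (∑ i, e (X i) ^ 2) := by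
    rw [ENNReal.ofReal_sum_of_nonneg fun i _ ↦ sq_nonneg _]
    refine Finset.sum_congr rfl fun i _ ↦ ?_
    rw [← ofReal_norm, ← ENNReal.ofReal_pow (norm_nonneg _), Real.norm_eq_abs, sq_abs]
  have h6 : ENNReal.ofReal (a ^ 2) ≤ ENNReal.ofReal (2 / (c * n) * (∑ i, e (X i) ^ 2) +
      2 * (C₁ * (ε * (B₀ * a) ^ 2 + C₂ * (d : ℝ) ^ S * l * (B * b) ^ 2))) := by
    rw [ENNReal.ofReal_pow ha0, ← haE, sq_eLpNorm_two]
    refine h1.trans ?_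
    rw [h5, ← ENNReal.ofReal_mul (by positivity), ENNReal.ofReal_add
      (mul_nonneg (by positivity) (Finset.sum_nonneg fun i _ ↦ sq_nonneg _)) (by positivity)]
    gcongr
    rw [ENNReal.ofReal_mul (by norm_num), ENNReal.ofReal_ofNat]
    gcongr
    refine (lintegral_cube_le hFm.aemeasurable).trans (hFint.trans ?_)
    rw [ENNReal.ofReal_mul (by positivity), ENNReal.ofReal_coe_nnreal]
    gcongr
    refine h2.trans ?_
    rw [ENNReal.ofReal_add (by positivity) (by positivity), ENNReal.ofReal_mul hε0.le,
      ENNReal.ofReal_mul (p := C₂ * (d : ℝ) ^ S * l) (by positivity),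
      ENNReal.ofReal_pow (by positivity), ENNReal.ofReal_pow (by positivity)]
    gcongr
  rw [ENNReal.ofReal_le_ofReal_iff (add_nonneg (mul_nonneg (by positivity)
    (Finset.sum_nonneg fun i _ ↦ sq_nonneg _)) (by positivity))] at h6
  have h7 : 2 * (C₁ * (ε * (B₀ * a) ^ 2)) ≤ a ^ 2 / 2 := by
    have h8 : C₁ * B₀ ^ 2 * ε ≤ 1 / 4 := by
      rw [hε, mul_one_div, div_le_iff₀ (by positivity)]
      linarith
    nlinarith [sq_nonneg a]
  have h8 : 2 / (c * n) * ∑ i, e (X i) ^ 2 = 2 / c * (1 / (n : ℝ) * ∑ i, e (X i) ^ 2) := by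
    field_simp
  set E : ℝ := 1 / (n : ℝ) * ∑ i, e (X i) ^ 2 with hE
  have hE0 : 0 ≤ E := mul_nonneg (by positivity) (Finset.sum_nonneg fun i _ ↦ sq_nonneg _)
  have hlb : 0 ≤ l * b ^ 2 := by positivity
  have h9 : 2 * (C₁ * (C₂ * (d : ℝ) ^ S * l * (B * b) ^ 2)) = A / 2 * (l * b ^ 2) := by
    rw [hA]; ring
  have h10 : 0 ≤ A * E := by positivity
  have h11 : 0 ≤ 4 / c * (l * b ^ 2) := by positivity
  rw [h8] at h6
  have h12 : 4 / c * E = 2 * (2 / c * E) := by ring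
  nlinarith

end Cells

/-! ### Empirical fluctuations as a Fourier pairing -/

section Pairing

variable {d n : ℕ}

/-- The Fourier transform of the difference between a weighted empirical measure and the measure
`b P`. -/
def fluct (P : Measure (cube d)) (b : cube d → ℝ) (a : Fin n → ℝ) (X : Fin n → cube d)
    (w : EuclideanSpace ℝ (Fin d)) : ℂ :=
  1 / (n : ℂ) * ∑ i, (a i : ℂ) * Real.fourierChar (inner ℝ w (X i : EuclideanSpace ℝ (Fin d))) -
    ∫ x, (b x : ℂ) * Real.fourierChar (inner ℝ w (x : EuclideanSpace ℝ (Fin d))) ∂P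

/-- The squared dual norm of the fluctuation. -/
def fluctSq (S δ : ℝ) (P : Measure (cube d)) (b : cube d → ℝ) (a : Fin n → ℝ)
    (X : Fin n → cube d) : ℝ≥0∞ :=
  ∫⁻ w, ENNReal.ofReal ((1 + δ * ‖w‖) ^ (-(2 * S))) * ‖fluct P b a X w‖ₑ ^ 2

theorem continuous_char_cube : Continuous fun p : cube d × EuclideanSpace ℝ (Fin d) ↦
    (Real.fourierChar (inner ℝ p.2 (p.1 : EuclideanSpace ℝ (Fin d))) : ℂ) := by
  have := Real.continuous_fourierChar
  fun_prop

theorem continuous_char (x : EuclideanSpace ℝ (Fin d)) : Continuous fun w ↦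
    (Real.fourierChar (inner ℝ w x) : ℂ) := by
  have := Real.continuous_fourierChar
  fun_prop

theorem contRep_eq_re_integral (u : Lp ℝ 2 (volume : Measure (EuclideanSpace ℝ (Fin d))))
    (x : EuclideanSpace ℝ (Fin d)) :
    contRep u x = (∫ w, (Real.fourierChar (inner ℝ w x) : ℂ) * ft u w).re := by
  rw [contRep, Real.fourierInv_eq]
  rfl

theorem aestronglyMeasurable_fluct {P : Measure (cube d)} [SFinite P] {b : cube d → ℝ}
    (hb : AEStronglyMeasurable b P) (a : Fin n → ℝ) (X : Fin n → cube d) :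
    AEStronglyMeasurable (fluct P b a X) := by
  have hc := continuous_char_cube (d := d)
  refine AEStronglyMeasurable.sub ?_ ?_
  · refine Continuous.aestronglyMeasurable ?_
    refine continuous_const.mul (continuous_finsetSum _ fun i _ ↦ continuous_const.mul ?_)
    exact continuous_char _
  · have h1 : AEStronglyMeasurable (fun p : EuclideanSpace ℝ (Fin d) × cube d ↦ (b p.2 : ℂ) *
        Real.fourierChar (inner ℝ p.1 (p.2 : EuclideanSpace ℝ (Fin d)))) (volume.prod P) :=
      (Complex.continuous_ofReal.comp_aestronglyMeasurable hb.comp_snd).mul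
        (hc.comp continuous_swap).aestronglyMeasurable
    exact h1.integral_prod_right'

/-- Fourier inversion writes each point value as a superposition of plane waves, and Fubini collects
the coefficients into the fluctuation. -/
theorem pairing_eq {P : Measure (cube d)} [IsFiniteMeasure P] {b : cube d → ℝ} (hb : Integrable b P)
    (a : Fin n → ℝ) (X : Fin n → cube d)
    {u : Lp ℝ 2 (volume : Measure (EuclideanSpace ℝ (Fin d)))} (hu : Integrable (ft u)) :
    1 / (n : ℝ) * ∑ i, a i * contRep u (X i) - ∫ x, b x * contRep u x ∂P =
      (∫ w, ft u w * fluct P b a X w).re := by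
  have hc := continuous_char_cube (d := d)
  have hchar : ∀ x : cube d, Integrable fun w ↦
      (Real.fourierChar (inner ℝ w (x : EuclideanSpace ℝ (Fin d))) : ℂ) * ft u w := fun x ↦
    hu.bdd_mul (c := 1) (continuous_char _).aestronglyMeasurable
      (Filter.Eventually.of_forall fun w ↦ by simp only [Circle.norm_coe, le_refl])
  have hprod : Integrable (fun p : cube d × EuclideanSpace ℝ (Fin d) ↦
      (Real.fourierChar (inner ℝ p.2 (p.1 : EuclideanSpace ℝ (Fin d))) : ℂ) *
        ((b p.1 : ℂ) * ft u p.2)) (P.prod volume) :=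
    (hb.ofReal.mul_prod hu).bdd_mul (c := 1) hc.aestronglyMeasurable
      (Filter.Eventually.of_forall fun w ↦ by simp only [Circle.norm_coe, le_refl])
  have h1 : 1 / (n : ℂ) * ∑ i, (a i : ℂ) *
      ∫ w, (Real.fourierChar (inner ℝ w (X i : EuclideanSpace ℝ (Fin d))) : ℂ) * ft u w =
      ∫ w, ft u w * (1 / (n : ℂ) * ∑ i, (a i : ℂ) *
        Real.fourierChar (inner ℝ w (X i : EuclideanSpace ℝ (Fin d)))) := by
    simp_rw [← integral_const_mul]
    rw [← integral_finsetSum _ fun i _ ↦ (hchar (X i)).const_mul _, ← integral_const_mul]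
    refine integral_congr_ae (Filter.Eventually.of_forall fun w ↦ ?_)
    simp only [Finset.mul_sum]
    refine Finset.sum_congr rfl fun i _ ↦ ?_
    ring
  have h2 : ∫ x, (b x : ℂ) *
      (∫ w, (Real.fourierChar (inner ℝ w (x : EuclideanSpace ℝ (Fin d))) : ℂ) * ft u w) ∂P =
      ∫ w, ft u w * ∫ x, (b x : ℂ) *
        Real.fourierChar (inner ℝ w (x : EuclideanSpace ℝ (Fin d))) ∂P := by
    simp_rw [← integral_const_mul]
    have h3 := integral_integral_swap (f := fun (x : cube d) (w : EuclideanSpace ℝ (Fin d)) ↦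
      (Real.fourierChar (inner ℝ w (x : EuclideanSpace ℝ (Fin d))) : ℂ) *
        ((b x : ℂ) * ft u w)) hprod
    refine Eq.trans ?_ (h3.trans ?_)
    · refine integral_congr_ae (Filter.Eventually.of_forall fun x ↦ ?_)
      refine integral_congr_ae (Filter.Eventually.of_forall fun w ↦ ?_)
      simp only
      ring
    · refine integral_congr_ae (Filter.Eventually.of_forall fun w ↦ ?_)
      refine integral_congr_ae (Filter.Eventually.of_forall fun x ↦ ?_)
      simp only
      ring
  have hi1 : Integrable fun w ↦ ft u w * (1 / (n : ℂ) * ∑ i, (a i : ℂ) *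
        Real.fourierChar (inner ℝ w (X i : EuclideanSpace ℝ (Fin d)))) := by
    have := (integrable_finsetSum Finset.univ fun i _ ↦ (hchar (X i)).const_mul (a i : ℂ)).const_mul
      (1 / (n : ℂ))
    refine this.congr (Filter.Eventually.of_forall fun w ↦ ?_)
    simp only [Finset.mul_sum]
    refine Finset.sum_congr rfl fun i _ ↦ ?_
    ring
  have hi2 : Integrable fun w ↦ ft u w * ∫ x, (b x : ℂ) *
        Real.fourierChar (inner ℝ w (x : EuclideanSpace ℝ (Fin d))) ∂P := by
    refine hprod.integral_prod_right.congr (Filter.Eventually.of_forall fun w ↦ ?_)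
    simp only
    rw [← integral_const_mul]
    refine integral_congr_ae (Filter.Eventually.of_forall fun x ↦ ?_)
    simp only
    ring
  have hi3 : Integrable (fun x ↦ (b x : ℂ) *
      ∫ w, (Real.fourierChar (inner ℝ w (x : EuclideanSpace ℝ (Fin d))) : ℂ) * ft u w) P := by
    refine hprod.integral_prod_left.congr (Filter.Eventually.of_forall fun x ↦ ?_)
    simp only
    rw [← integral_const_mul]
    refine integral_congr_ae (Filter.Eventually.of_forall fun w ↦ ?_)
    simp only
    ring
  have h4 : ∫ x, b x * contRep u x ∂P = (∫ x, (b x : ℂ) *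
      (∫ w, (Real.fourierChar (inner ℝ w (x : EuclideanSpace ℝ (Fin d))) : ℂ) * ft u w) ∂P).re := by
    have := integral_re hi3
    simp only [RCLike.re_to_complex, Complex.re_ofReal_mul] at this
    rw [← this]
    simp_rw [contRep_eq_re_integral]
  have h5 : 1 / (n : ℝ) * ∑ i, a i * contRep u (X i) = (1 / (n : ℂ) * ∑ i, (a i : ℂ) *
      ∫ w, (Real.fourierChar (inner ℝ w (X i : EuclideanSpace ℝ (Fin d))) : ℂ) * ft u w).re := by
    have h6 : (1 / (n : ℂ)) = ((1 / (n : ℝ) : ℝ) : ℂ) := by push_cast; rfl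
    rw [h6, Complex.re_ofReal_mul, Complex.re_sum]
    simp_rw [Complex.re_ofReal_mul, contRep_eq_re_integral]
  rw [h4, h5, h1, h2, ← Complex.sub_re, ← integral_sub hi1 hi2]
  congr 2
  funext w
  rw [fluct]
  ring

/-- Cauchy-Schwarz with the weights (1 + δ|w|)^S and (1 + δ|w|)^(-S). The random factor does not
involve `u`, so a data-dependent `u` may be inserted; this replaces a supremum over a ball of
functions. -/
theorem sq_pairing_le {P : Measure (cube d)} [IsFiniteMeasure P] {b : cube d → ℝ} (hb : Integrable b P)
    (a : Fin n → ℝ) (X : Fin n → cube d) {S δ : ℝ} (hδ : 0 ≤ δ)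
    {u : Lp ℝ 2 (volume : Measure (EuclideanSpace ℝ (Fin d)))} (hu : Integrable (ft u)) :
    ‖1 / (n : ℝ) * ∑ i, a i * contRep u (X i) - ∫ x, b x * contRep u x ∂P‖ₑ ^ 2 ≤
      (∫⁻ w, ENNReal.ofReal ((1 + δ * ‖w‖) ^ (2 * S)) * ‖ft u w‖ₑ ^ 2) * fluctSq S δ P b a X := by
  rw [pairing_eq hb a X hu]
  have h1 : ‖(∫ w, ft u w * fluct P b a X w).re‖ₑ ≤
      ∫⁻ w, ‖ft u w‖ₑ * ‖fluct P b a X w‖ₑ := by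
    calc _ ≤ ‖∫ w, ft u w * fluct P b a X w‖ₑ := by
          rw [enorm_le_iff_norm_le]
          exact Complex.abs_re_le_norm _
      _ ≤ ∫⁻ w, ‖ft u w * fluct P b a X w‖ₑ := enorm_integral_le_lintegral_enorm _
      _ = _ := by simp_rw [enorm_mul]
  have hpos : ∀ w : EuclideanSpace ℝ (Fin d), 0 < 1 + δ * ‖w‖ := fun w ↦ by positivity
  have h2 : ∫⁻ w, ‖ft u w‖ₑ * ‖fluct P b a X w‖ₑ =
      ∫⁻ w, (ENNReal.ofReal ((1 + δ * ‖w‖) ^ S) * ‖ft u w‖ₑ) *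
        (ENNReal.ofReal ((1 + δ * ‖w‖) ^ (-S)) * ‖fluct P b a X w‖ₑ) := by
    refine lintegral_congr fun w ↦ ?_
    rw [mul_mul_mul_comm, ← ENNReal.ofReal_mul (Real.rpow_nonneg (hpos w).le _),
      ← Real.rpow_add (hpos w), add_neg_cancel, Real.rpow_zero, ENNReal.ofReal_one, one_mul]
  have hmr : ∀ t : ℝ, Measurable fun w : EuclideanSpace ℝ (Fin d) ↦
      ENNReal.ofReal ((1 + δ * ‖w‖) ^ t) := fun t ↦ by fun_prop
  have h3 := sq_lintegral_mul_le (μ := (volume : Measure (EuclideanSpace ℝ (Fin d))))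
    (f := fun w ↦ ENNReal.ofReal ((1 + δ * ‖w‖) ^ S) * ‖ft u w‖ₑ)
    (g := fun w ↦ ENNReal.ofReal ((1 + δ * ‖w‖) ^ (-S)) * ‖fluct P b a X w‖ₑ)
    ((hmr S).aemeasurable.mul (Lp.aestronglyMeasurable _).enorm)
    ((hmr (-S)).aemeasurable.mul (aestronglyMeasurable_fluct hb.1 a X).enorm)
  have h4 : ∀ (t : ℝ) w, ENNReal.ofReal ((1 + δ * ‖w‖) ^ t) ^ 2 =
      ENNReal.ofReal ((1 + δ * ‖(w : EuclideanSpace ℝ (Fin d))‖) ^ (2 * t)) := fun t w ↦ by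
    rw [← ENNReal.ofReal_pow (Real.rpow_nonneg (hpos w).le _), ← Real.rpow_natCast,
      ← Real.rpow_mul (hpos w).le, mul_comm t]
    rfl
  simp only [mul_pow, h4, mul_neg] at h3
  refine (pow_le_pow_left' h1 2).trans ?_
  rw [h2]
  exact h3

theorem one_add_rpow_le {S t : ℝ} (hS : 0 ≤ S) (ht : 0 ≤ t) :
    (1 + t) ^ (2 * S) ≤ 4 ^ S * (1 + t ^ (2 * S)) := by
  have h4 : (4 : ℝ) ^ S = 2 ^ (2 * S) := by
    rw [Real.rpow_mul (by norm_num)]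
    norm_num
  have ht' : 0 ≤ t ^ (2 * S) := by positivity
  rcases le_or_gt t 1 with h | h
  · calc (1 + t) ^ (2 * S) ≤ 2 ^ (2 * S) :=
          Real.rpow_le_rpow (by positivity) (by linarith) (by positivity)
      _ ≤ _ := by
          rw [h4]
          exact le_mul_of_one_le_right (by positivity) (by linarith)
  · calc (1 + t) ^ (2 * S) ≤ (2 * t) ^ (2 * S) :=
          Real.rpow_le_rpow (by positivity) (by linarith) (by positivity)
      _ = 4 ^ S * t ^ (2 * S) := by rw [Real.mul_rpow (by norm_num) ht, h4]
      _ ≤ _ := by gcongr; linarith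

/-- The primal weight is at most a constant times 1 + δ^(2S)|w|^(2S). With δ^(2S) = 1/v the right
side becomes the norm of ridge regression. -/
theorem lintegral_weight_le {S δ : ℝ} (hS : 0 ≤ S) (hδ : 0 ≤ δ)
    (u : Lp ℝ 2 (volume : Measure (EuclideanSpace ℝ (Fin d)))) :
    ∫⁻ w, ENNReal.ofReal ((1 + δ * ‖w‖) ^ (2 * S)) * ‖ft u w‖ₑ ^ 2 ≤
      ENNReal.ofReal (4 ^ S) * (‖u‖ₑ ^ 2 + ENNReal.ofReal (δ ^ (2 * S)) * sobolevNorm S u ^ 2) := by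
  have hm := measurable_enorm_ft_sq u
  rw [← enorm_ft, Lp.enorm_def, sq_eLpNorm_two, sobolevNorm_sq, ← lintegral_const_mul' _ _ (by simp),
    ← lintegral_add_left hm, ← lintegral_const_mul' _ _ (by simp)]
  refine lintegral_mono fun w ↦ ?_
  simp only
  rw [← mul_assoc (ENNReal.ofReal (δ ^ (2 * S))), ← one_add_mul, ← mul_assoc, sobolevWeight_eq,
    ← ENNReal.ofReal_mul (by positivity), ← ENNReal.ofReal_one,
    ← ENNReal.ofReal_add zero_le_one (mul_nonneg (by positivity) (realWeight_pos _ _).le),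
    ← ENNReal.ofReal_mul (by positivity)]
  gcongr
  refine (one_add_rpow_le hS (by positivity)).trans ?_
  gcongr
  rw [Real.mul_rpow hδ (norm_nonneg w)]
  gcongr
  rw [Real.rpow_mul (norm_nonneg w), Real.rpow_two, realWeight]
  have hpi := Real.pi_gt_three
  gcongr
  have h4 : 1 ≤ (2 * Real.pi) ^ 2 := by nlinarith
  rw [mul_pow]
  nlinarith [mul_nonneg (sub_nonneg.2 h4) (sq_nonneg ‖w‖)]

end Pairing

/-! ### The deterministic error bound for kernel ridge regression -/

section KernelRidge

variable {d n : ℕ} {S : ℝ} {T : Lp ℝ 2 (volume : Measure (cube d)) →ₗ[ℝ]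
      Lp ℝ 2 (volume : Measure (EuclideanSpace ℝ (Fin d)))}

theorem ft_neg_lp (g : Lp ℝ 2 (volume : Measure (EuclideanSpace ℝ (Fin d)))) (s : ℝ) :
    sobolevNorm s (-g) = sobolevNorm s g := by
  refine (ENNReal.pow_right_strictMono (n := 2) (by norm_num)).injective ?_
  rw [sobolevNorm_sq, sobolevNorm_sq, map_neg]
  refine lintegral_congr_ae ?_
  filter_upwards [Lp.coeFn_neg (ft g)] with w hw
  rw [hw, Pi.neg_apply, enorm_neg]

/-- Extensions whose norms are within η of the two infima are subtracted, and η tends to zero, so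
attainment of the quotient norm is not needed. -/
theorem cubeSobolevNorm_sub_sq_le (s : ℝ) (f g : cube d → ℝ) :
    cubeSobolevNorm s (f - g) ^ 2 ≤ 2 * (cubeSobolevNorm s f ^ 2 + cubeSobolevNorm s g ^ 2) := by
  by_cases hf : cubeSobolevNorm s f = ∞
  · simp [hf]
  by_cases hg : cubeSobolevNorm s g = ∞
  · simp [hg]
  refine ENNReal.le_of_forall_pos_le_add fun ε hε _ ↦ ?_
  have hcont : Filter.Tendsto (fun η : ℝ≥0∞ ↦ 2 * ((cubeSobolevNorm s f + η) ^ 2 +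
      (cubeSobolevNorm s g + η) ^ 2)) (nhds 0) (nhds (2 * ((cubeSobolevNorm s f + 0) ^ 2 +
      (cubeSobolevNorm s g + 0) ^ 2))) := by
    refine ENNReal.Tendsto.const_mul (Filter.Tendsto.add ?_ ?_) (Or.inr (by simp))
    · exact (ENNReal.continuous_pow 2).tendsto _ |>.comp (tendsto_const_nhds.add Filter.tendsto_id)
    · exact (ENNReal.continuous_pow 2).tendsto _ |>.comp (tendsto_const_nhds.add Filter.tendsto_id)
  simp only [add_zero] at hcont
  have hfin : 2 * (cubeSobolevNorm s f ^ 2 + cubeSobolevNorm s g ^ 2) ≠ ∞ := by finiteness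
  have hlt : 2 * (cubeSobolevNorm s f ^ 2 + cubeSobolevNorm s g ^ 2) <
      2 * (cubeSobolevNorm s f ^ 2 + cubeSobolevNorm s g ^ 2) + ε :=
    ENNReal.lt_add_right hfin (by exact_mod_cast hε.ne')
  have hev := (hcont.eventually (gt_mem_nhds hlt)).filter_mono
    (nhdsWithin_le_nhds (s := Ioi (0 : ℝ≥0∞)))
  obtain ⟨η, hη, hη0⟩ := (hev.and self_mem_nhdsWithin).exists
  have hη0' : η ≠ 0 := (mem_Ioi.1 hη0).ne'
  obtain ⟨u, hu, hu'⟩ : ∃ u : Lp ℝ 2 (volume : Measure (EuclideanSpace ℝ (Fin d))),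
      (fun x : cube d ↦ u (x : EuclideanSpace ℝ (Fin d))) =ᵐ[volume] f ∧
        sobolevNorm s u < cubeSobolevNorm s f + η := by
    have := ENNReal.lt_add_right hf hη0'
    conv at this => lhs; rw [cubeSobolevNorm]
    simpa only [iInf_lt_iff, exists_prop] using this
  obtain ⟨v, hv, hv'⟩ : ∃ u : Lp ℝ 2 (volume : Measure (EuclideanSpace ℝ (Fin d))),
      (fun x : cube d ↦ u (x : EuclideanSpace ℝ (Fin d))) =ᵐ[volume] g ∧
        sobolevNorm s u < cubeSobolevNorm s g + η := by
    have := ENNReal.lt_add_right hg hη0'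
    conv at this => lhs; rw [cubeSobolevNorm]
    simpa only [iInf_lt_iff, exists_prop] using this
  have h1 : cubeSobolevNorm s (f - g) ≤ sobolevNorm s (u + -v) := by
    refine iInf₂_le (u + -v) ?_
    rw [← sub_eq_add_neg]
    filter_upwards [hu, hv, ae_cube_of_ae (Lp.coeFn_sub u v)] with x a b c
    rw [c, Pi.sub_apply, Pi.sub_apply, a, b]
  refine (pow_le_pow_left' h1 2).trans ((sobolevNorm_add_sq_le s u (-v)).trans ?_)
  rw [ft_neg_lp]
  refine le_trans ?_ hη.le
  gcongr

theorem sub_mem_rkhs {f g : cube d → ℝ} (hf : f ∈ rkhs d S) (hg : g ∈ rkhs d S) :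
    f - g ∈ rkhs d S ∧ (cubeSobolevNorm S (f - g)).toReal ^ 2 ≤
      2 * ((cubeSobolevNorm S f).toReal ^ 2 + (cubeSobolevNorm S g).toReal ^ 2) := by
  have h1 := cubeSobolevNorm_sub_sq_le S f g
  have hf' := hf.2
  have hg' := hg.2
  have hfin : 2 * (cubeSobolevNorm S f ^ 2 + cubeSobolevNorm S g ^ 2) ≠ ∞ := by finiteness
  refine ⟨⟨hf.1.sub hg.1, fun h ↦ ?_⟩, ?_⟩
  · rw [h] at h1
    simp only [ne_eq, OfNat.ofNat_ne_zero, not_false_eq_true, ENNReal.top_pow, top_le_iff] at h1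
    exact hfin h1
  · have h2 := ENNReal.toReal_mono hfin h1
    rw [ENNReal.toReal_mul, ENNReal.toReal_add (by finiteness) (by finiteness)] at h2
    simpa using h2

/-- By the arithmetic-geometric mean inequality, 2CR ≤ 2C√(N2·G) ≤ N2 + C²G, and one copy of N2 is
absorbed. -/
theorem le_of_ridge_inequality {N2 E R G m C : ℝ} (hC : 0 ≤ C) (hG : 0 ≤ G)
    (hN : 0 ≤ N2) (h1 : N2 ≤ C * E) (h2 : E ≤ R + m) (h3 : R ^ 2 ≤ N2 * G) :
    N2 ≤ C ^ 2 * G + 2 * C * m := by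
  have h4 : 2 * (C * R) ≤ N2 + C ^ 2 * G := by
    by_contra hcon
    push Not at hcon
    have h5 : (N2 + C ^ 2 * G) ^ 2 < (2 * (C * R)) ^ 2 := by
      apply pow_lt_pow_left₀ hcon (by positivity) (by norm_num)
    nlinarith [sq_nonneg (N2 - C ^ 2 * G), mul_le_mul_of_nonneg_left h3 (sq_nonneg C)]
  nlinarith [mul_le_mul_of_nonneg_left h2 hC]

theorem toReal_sq_le {x : ℝ} {a b : ℝ≥0∞} (hb : b ≠ ∞) (h : ‖x‖ₑ ^ 2 ≤ a * b) (ha : a ≠ ∞) :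
    x ^ 2 ≤ a.toReal * b.toReal := by
  have := ENNReal.toReal_mono (by finiteness) h
  rw [ENNReal.toReal_mul, ENNReal.toReal_pow, toReal_enorm, Real.norm_eq_abs, sq_abs] at this
  exact this

set_option maxHeartbeats 1600000 in
/-- The error of kernel ridge regression in terms of the fluctuation and the approximation error. -/
theorem exists_krr_error (hT : IsSobolevExtension S T) (hS : (d : ℝ) / 2 < S) (C₀ : ℝ) (hC₀ : 0 ≤ C₀)
    (CX : ℝ≥0) : ∃ C : ℝ, 0 < C ∧ ∀ (n : ℕ) (P : Measure (cube d)), IsProbabilityMeasure P →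
      P ≤ CX • volume → ∀ (D : Fin n → cube d × ℝ) (v : ℝ), 0 < v →
      (∀ e ∈ rkhs d S, (eLpNorm e 2 volume).toReal ^ 2 ≤
          C₀ * (1 / (n : ℝ) * ∑ i, e (D i).1 ^ 2 + 1 / v * (cubeSobolevNorm S e).toReal ^ 2)) →
      ∀ f₀ ∈ rkhs d S, ∀ b : cube d → ℝ, MemLp b 2 volume → ∀ κ : ℝ, 0 ≤ κ →
      fluctSq S (v ^ (-(1 / (2 * S)))) P b (fun i ↦ (D i).2 - f₀ (D i).1) (fun i ↦ (D i).1) ≤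
        ENNReal.ofReal κ →
      (eLpNorm (krr S v D - f₀) 2 volume).toReal ^ 2 ≤
        C * (κ + (eLpNorm b 2 volume).toReal ^ 2 + 1 / v * (cubeSobolevNorm S f₀).toReal ^ 2) := by
  have hS0 : 0 < S := lt_of_le_of_lt (by positivity) hS
  obtain ⟨B₀, hB₀⟩ := hT.exists_enorm_le hS0.le
  obtain ⟨B, hB⟩ := hT.exists_sobolevNorm_le (t := S) ⟨hS0.le, le_rfl⟩
  set Kp : ℝ := 4 ^ S * (B₀ ^ 2 + B ^ 2) with hKp
  have hKp0 : 0 ≤ Kp := by positivity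
  set c : ℝ := 2 * (C₀ + 1) with hc
  have hc0 : 0 < c := by positivity
  refine ⟨4 * c ^ 2 * (2 * Kp + 2 * CX ^ 2) + 4 * c, by positivity,
    fun n P hP hPle D v hv hsamp f₀ hf₀ b hb κ hκ hfluct ↦ ?_⟩
  set l : ℝ := 1 / v with hl
  have hl0 : 0 < l := by positivity
  set δ : ℝ := v ^ (-(1 / (2 * S))) with hδ
  have hδ0 : 0 ≤ δ := by positivity
  -- The scale δ is tied to `v` so that the weighted norm in the pairing is the ridge norm x² +
  -- l·y².
  have hδl : δ ^ (2 * S) = l := by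
    rw [hδ, ← Real.rpow_mul hv.le, neg_mul, one_div_mul_cancel (by positivity),
      Real.rpow_neg_one, hl, one_div]
  obtain ⟨hkrr, hmin⟩ := krr_spec hS hv D
  set F := krr S v D with hF
  obtain ⟨he, hen⟩ := sub_mem_rkhs hkrr hf₀
  set e := F - f₀ with hedef
  have heL := memLp_of_continuous he.1 (q := 2)
  set a : Fin n → ℝ := fun i ↦ (D i).2 - f₀ (D i).1 with ha
  set u := T (toL2 e) with hu
  have hint : Integrable (ft u) := integrable_ft hS (hT.sobolevNorm_ne_top hS0.le he)
  set x : ℝ := (eLpNorm e 2 volume).toReal with hx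
  set y : ℝ := (cubeSobolevNorm S e).toReal with hy
  set z : ℝ := (eLpNorm b 2 volume).toReal with hz
  set y₀ : ℝ := (cubeSobolevNorm S f₀).toReal with hy₀
  have hx0 : 0 ≤ x := ENNReal.toReal_nonneg
  have hy0 : 0 ≤ y := ENNReal.toReal_nonneg
  have hz0 : 0 ≤ z := ENNReal.toReal_nonneg
  have hxE : eLpNorm e 2 volume = ENNReal.ofReal x := (ENNReal.ofReal_toReal heL.2.ne).symm
  have hyE : cubeSobolevNorm S e = ENNReal.ofReal y := (ENNReal.ofReal_toReal he.2).symm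
  have hzE : eLpNorm b 2 volume = ENNReal.ofReal z := (ENNReal.ofReal_toReal hb.2.ne).symm
  have hPac : P ≪ volume := hPle.absolutelyContinuous.trans Measure.smul_absolutelyContinuous
  have hbP : MemLp b 2 P := by
    have h1 : MemLp b 2 (CX • (volume : Measure (cube d))) := hb.smul_measure (by simp)
    exact h1.mono_measure hPle
  -- the pairing
  have hpair : (1 / (n : ℝ) * ∑ i, a i * e (D i).1 - ∫ x, b x * e x ∂P) ^ 2 ≤
      Kp * (x ^ 2 + l * y ^ 2) * κ := by
    have h1 := sq_pairing_le (S := S) (hbP.integrable (by norm_num)) a (fun i ↦ (D i).1) hδ0 hint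
    simp only [hu, hT.contRep_eq hS he] at h1
    have h2 : ∫⁻ w, ENNReal.ofReal ((1 + δ * ‖w‖) ^ (2 * S)) * ‖ft u w‖ₑ ^ 2 ≤
        ENNReal.ofReal (Kp * (x ^ 2 + l * y ^ 2)) := by
      refine (lintegral_weight_le hS0.le hδ0 u).trans ?_
      have h3 : ‖u‖ₑ ≤ ENNReal.ofReal (B₀ * x) := by
        rw [ENNReal.ofReal_mul (by positivity), ENNReal.ofReal_coe_nnreal, ← hxE, ← enorm_toL2 heL]
        exact hB₀ _
      have h4 : sobolevNorm S u ≤ ENNReal.ofReal (B * y) := by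
        rw [ENNReal.ofReal_mul (by positivity), ENNReal.ofReal_coe_nnreal, ← hyE]
        exact hB e heL
      calc _ ≤ ENNReal.ofReal (4 ^ S) * (ENNReal.ofReal (B₀ * x) ^ 2 +
            ENNReal.ofReal (δ ^ (2 * S)) * ENNReal.ofReal (B * y) ^ 2) := by gcongr
        _ = ENNReal.ofReal (4 ^ S * ((B₀ * x) ^ 2 + l * (B * y) ^ 2)) := by
            rw [hδl, ← ENNReal.ofReal_pow (by positivity), ← ENNReal.ofReal_pow (by positivity),
              ← ENNReal.ofReal_mul hl0.le, ← ENNReal.ofReal_add (by positivity) (by positivity),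
              ← ENNReal.ofReal_mul (by positivity)]
        _ ≤ _ := by
            refine ENNReal.ofReal_le_ofReal ?_
            rw [hKp, mul_assoc]
            gcongr
            have h5 : 0 ≤ (B : ℝ) ^ 2 * x ^ 2 := by positivity
            have h6 : 0 ≤ (B₀ : ℝ) ^ 2 * (l * y ^ 2) := by positivity
            nlinarith
    have h3 := toReal_sq_le (by simp) (h1.trans (mul_le_mul' h2 hfluct)) (by simp)
    rwa [ENNReal.toReal_ofReal hκ, ENNReal.toReal_ofReal (by positivity)] at h3
  -- the mean
  have hmean : (∫ x, b x * e x ∂P) ^ 2 ≤ CX ^ 2 * z ^ 2 * x ^ 2 := by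
    have h1 : ‖∫ x, b x * e x ∂P‖ₑ ^ 2 ≤ (CX ^ 2 : ℝ≥0∞) * (eLpNorm b 2 volume ^ 2 * eLpNorm e 2 volume ^ 2) := by
      calc _ ≤ (∫⁻ x, ‖b x * e x‖ₑ ∂P) ^ 2 := by
            gcongr
            exact enorm_integral_le_lintegral_enorm _
        _ ≤ (CX * ∫⁻ x, ‖b x * e x‖ₑ) ^ 2 := by
            gcongr
            refine (lintegral_mono' hPle le_rfl).trans_eq ?_
            rw [lintegral_smul_measure]
            rfl
        _ ≤ _ := by
            rw [mul_pow, sq_eLpNorm_two, sq_eLpNorm_two]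
            gcongr
            simp_rw [enorm_mul]
            exact sq_lintegral_mul_le hb.1.enorm he.1.aestronglyMeasurable.enorm
    have h2 := toReal_sq_le (by finiteness [hb.2.ne, heL.2.ne]) h1 (by finiteness)
    simpa [mul_assoc] using h2
  -- the basic inequality
  have hbasic := hmin hf₀
  simp only [mem_ofPred_eq, krrObjective] at hbasic
  have hexp : 1 / (n : ℝ) * ∑ i, ((D i).2 - F (D i).1) ^ 2 =
      1 / (n : ℝ) * ∑ i, ((D i).2 - f₀ (D i).1) ^ 2 - 2 * (1 / (n : ℝ) * ∑ i, a i * e (D i).1) +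
        1 / (n : ℝ) * ∑ i, e (D i).1 ^ 2 := by
    have h1 : ∀ i, ((D i).2 - F (D i).1) ^ 2 =
        ((D i).2 - f₀ (D i).1) ^ 2 - 2 * (a i * e (D i).1) + e (D i).1 ^ 2 := fun i ↦ by
      simp only [ha, hedef, Pi.sub_apply]
      ring
    rw [Finset.sum_congr rfl fun i _ ↦ h1 i, Finset.sum_add_distrib, Finset.sum_sub_distrib,
      ← Finset.mul_sum]
    ring
  set E : ℝ := 1 / (n : ℝ) * ∑ i, e (D i).1 ^ 2 with hE
  have hE0 : 0 ≤ E := mul_nonneg (by positivity) (Finset.sum_nonneg fun i _ ↦ sq_nonneg _)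
  set R : ℝ := 1 / (n : ℝ) * ∑ i, a i * e (D i).1 with hR
  set I : ℝ := ∫ x, b x * e x ∂P with hI
  have hsam := hsamp e he
  have hly : 0 ≤ l * y ^ 2 := by positivity
  have hR2 : (2 * R) ^ 2 ≤ (x ^ 2 + l * y ^ 2) * (4 * ((2 * Kp) * κ + (2 * CX ^ 2) * z ^ 2)) := by
    have h1 : R ^ 2 ≤ 2 * (R - I) ^ 2 + 2 * I ^ 2 := by nlinarith [sq_nonneg (R - 2 * I)]
    have h2 : 0 ≤ (CX : ℝ) ^ 2 * z ^ 2 * (l * y ^ 2) := by positivity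
    nlinarith
  -- Half of the penalty of `e` is at most the penalty of the estimate plus that of `f₀`. Together
  -- with minimality this gives E + l·y²/2 ≤ 2R + 2l·y₀². The constant c = 2(C₀ + 1) converts the
  -- sampling inequality into a bound of x² + l·y² by the same left side.
  have hfin := le_of_ridge_inequality (N2 := x ^ 2 + l * y ^ 2) (E := E + l * y ^ 2 / 2) (R := 2 * R)
    (G := 4 * ((2 * Kp) * κ + (2 * CX ^ 2) * z ^ 2)) (m := 2 * (l * y₀ ^ 2)) (C := c) hc0.le
    (by positivity) (by positivity) (by
      rw [hc]
      nlinarith [mul_nonneg hC₀ hE0, mul_nonneg hC₀ hly]) (by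
      have h1 := mul_le_mul_of_nonneg_left hen hl0.le
      nlinarith) hR2
  have hly0 : 0 ≤ l * y₀ ^ 2 := by positivity
  have hz2 := sq_nonneg z
  have t1 : 0 ≤ c ^ 2 * Kp * z ^ 2 := by positivity
  have t2 : 0 ≤ c ^ 2 * Kp * (l * y₀ ^ 2) := by positivity
  have t3 : 0 ≤ c ^ 2 * (CX : ℝ) ^ 2 * κ := by positivity
  have t4 : 0 ≤ c ^ 2 * (CX : ℝ) ^ 2 * (l * y₀ ^ 2) := by positivity
  have t5 : 0 ≤ c * κ := by positivity
  have t6 : 0 ≤ c * z ^ 2 := by positivity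
  nlinarith

end KernelRidge

/-! ### Moment inequalities and sub-Gaussian variables -/

/-- Jensen's inequality for powers, with respect to an arbitrary measure. -/
theorem lintegral_pow_le {α : Type*} [MeasurableSpace α] (μ : Measure α) {F : α → ℝ≥0∞}
    (hF : AEMeasurable F μ) {k : ℕ} (hk : 1 ≤ k) :
    (∫⁻ x, F x ∂μ) ^ k ≤ μ univ ^ (k - 1) * ∫⁻ x, F x ^ k ∂μ := by
  rcases hk.eq_or_lt with rfl | hk
  · simp
  have hk' : (1 : ℝ) < k := by exact_mod_cast hk
  have hk0 : (k : ℝ) ≠ 0 := by positivity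
  have hH := ENNReal.lintegral_mul_le_Lp_mul_Lq μ (Real.HolderConjugate.conjExponent hk') hF
    (aemeasurable_const (b := (1 : ℝ≥0∞)))
  simp only [Pi.mul_apply, mul_one, ENNReal.one_rpow, lintegral_const, one_mul,
    ENNReal.rpow_natCast] at hH
  refine (pow_le_pow_left' hH k).trans_eq ?_
  rw [mul_pow, mul_comm, ← ENNReal.rpow_natCast, ← ENNReal.rpow_mul, ← ENNReal.rpow_natCast,
    ← ENNReal.rpow_mul, one_div_mul_cancel hk0, ENNReal.rpow_one, Real.conjExponent,
    ← ENNReal.rpow_natCast _ (k - 1), Nat.cast_sub hk.le, Nat.cast_one]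
  congr 2
  field_simp

/-- The even moments of a sub-Gaussian variable. -/
theorem lintegral_pow_le_of_subgaussian {Ω : Type*} [MeasurableSpace Ω] {μ : Measure Ω}
    {Y : Ω → ℝ} {c : ℝ≥0} (hY : HasSubgaussianMGF Y c μ) {t : ℝ} (ht : 0 < t) (k : ℕ) :
    ∫⁻ ω, ENNReal.ofReal (Y ω ^ (2 * k)) ∂μ ≤
      ENNReal.ofReal ((2 * k).factorial * (t ^ (2 * k))⁻¹ * (2 * Real.exp (c * t ^ 2 / 2))) := by
  have hb : ∀ ω, Y ω ^ (2 * k) ≤ (2 * k).factorial * (t ^ (2 * k))⁻¹ *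
      (Real.exp (t * Y ω) + Real.exp (-t * Y ω)) := fun ω ↦ by
    have h1 := Real.pow_div_factorial_le_exp (x := |t * Y ω|) (abs_nonneg _) (2 * k)
    have h2 : Real.exp |t * Y ω| ≤ Real.exp (t * Y ω) + Real.exp (-t * Y ω) := by
      rcases abs_cases (t * Y ω) with h | h <;> rw [h.1]
      · linarith [Real.exp_pos (-t * Y ω)]
      · rw [← neg_mul]
        linarith [Real.exp_pos (t * Y ω)]
    rw [(even_two_mul k).pow_abs, mul_pow, div_le_iff₀ (by positivity)] at h1
    have h3 : t ^ (2 * k) * Y ω ^ (2 * k) ≤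
        (Real.exp (t * Y ω) + Real.exp (-t * Y ω)) * (2 * k).factorial :=
      h1.trans (mul_le_mul_of_nonneg_right h2 (by positivity))
    calc Y ω ^ (2 * k) = (t ^ (2 * k))⁻¹ * (t ^ (2 * k) * Y ω ^ (2 * k)) := by field_simp
      _ ≤ (t ^ (2 * k))⁻¹ * ((Real.exp (t * Y ω) + Real.exp (-t * Y ω)) * (2 * k).factorial) := by
          gcongr
      _ = _ := by ring
  have hi1 := hY.integrable_exp_mul t
  have hi2 := hY.integrable_exp_mul (-t)
  calc _ ≤ ∫⁻ ω, ENNReal.ofReal ((2 * k).factorial * (t ^ (2 * k))⁻¹ *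
          (Real.exp (t * Y ω) + Real.exp (-t * Y ω))) ∂μ :=
        lintegral_mono fun ω ↦ ENNReal.ofReal_le_ofReal (hb ω)
    _ = ENNReal.ofReal (∫ ω, (2 * k).factorial * (t ^ (2 * k))⁻¹ *
          (Real.exp (t * Y ω) + Real.exp (-t * Y ω)) ∂μ) :=
        (ofReal_integral_eq_lintegral_ofReal ((hi1.add hi2).const_mul _)
          (Filter.Eventually.of_forall fun ω ↦ by
            simp only [Pi.zero_apply, Pi.add_apply]
            positivity)).symm
    _ ≤ _ := by
        refine ENNReal.ofReal_le_ofReal ?_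
        rw [integral_const_mul, integral_add hi1 hi2]
        have h1 := hY.mgf_le t
        have h2 := hY.mgf_le (-t)
        rw [neg_sq] at h2
        rw [mgf] at h1 h2
        gcongr
        linarith

/-- Multiplication by an independent factor bounded by one preserves sub-Gaussianity. -/
theorem HasSubgaussianMGF.mul_snd {α : Type*} [MeasurableSpace α] {P : Measure α}
    [IsProbabilityMeasure P] {ν : Measure ℝ} [IsProbabilityMeasure ν] {c : ℝ≥0}
    (h : HasSubgaussianMGF (fun y : ℝ ↦ y) c ν) {m : α → ℝ} (hm : Measurable m)
    (hm1 : ∀ x, |m x| ≤ 1) :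
    HasSubgaussianMGF (fun p : α × ℝ ↦ m p.1 * p.2) c (P.prod ν) := by
  have hint : ∀ t, Integrable (fun p : α × ℝ ↦ Real.exp (t * (m p.1 * p.2))) (P.prod ν) := by
    intro t
    have h1 : Integrable (fun p : α × ℝ ↦ Real.exp (t * p.2) + Real.exp (-t * p.2)) (P.prod ν) :=
      ((h.integrable_exp_mul t).comp_snd P).add ((h.integrable_exp_mul (-t)).comp_snd P)
    refine h1.mono' (by fun_prop) (Filter.Eventually.of_forall fun p ↦ ?_)
    rw [Real.norm_eq_abs, Real.abs_exp]
    have h2 : t * (m p.1 * p.2) ≤ |t * p.2| := by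
      refine (le_abs_self _).trans ?_
      rw [abs_mul, abs_mul, abs_mul]
      have := hm1 p.1
      have h0 := mul_nonneg (abs_nonneg t) (abs_nonneg p.2)
      nlinarith
    refine (Real.exp_le_exp.2 h2).trans ?_
    rcases abs_cases (t * p.2) with h | h <;> rw [h.1]
    · linarith [Real.exp_pos (-t * p.2)]
    · rw [← neg_mul]
      linarith [Real.exp_pos (t * p.2)]
  refine ⟨hint, fun t ↦ ?_⟩
  rw [mgf, integral_prod _ (hint t)]
  have hb : ∀ x, ∫ y, Real.exp (t * (m x * y)) ∂ν ≤ Real.exp (c * t ^ 2 / 2) := fun x ↦ by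
    have := h.mgf_le (t * m x)
    simp only [mgf, mul_assoc] at this
    refine this.trans (Real.exp_le_exp.2 ?_)
    have h1 : m x ^ 2 ≤ 1 := by
      rw [← sq_abs]
      exact pow_le_one₀ (abs_nonneg _) (hm1 x)
    have h2 : 0 ≤ (c : ℝ) * t ^ 2 := by positivity
    nlinarith
  calc _ ≤ ∫ _, Real.exp (c * t ^ 2 / 2) ∂P :=
        integral_mono (hint t).integral_prod_left (integrable_const _) hb
    _ = _ := by simp

/-! ### Moments of the noise part of the fluctuation -/

section Noise

variable {d : ℕ}

theorem measurePreserving_comp_eval {n : ℕ} {α : Type*} [MeasurableSpace α] (ρ : Measure α)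
    [IsProbabilityMeasure ρ] (i : Fin n) :
    MeasurePreserving (fun ω : Fin n → α ↦ ω i) (Measure.pi fun _ : Fin n ↦ ρ) ρ :=
  measurePreserving_eval (fun _ : Fin n ↦ ρ) i

theorem hasSubgaussianMGF_sum (n : ℕ) {P : Measure (cube d)} [IsProbabilityMeasure P]
    {ν : Measure ℝ} [IsProbabilityMeasure ν] {c : ℝ≥0}
    (h : HasSubgaussianMGF (fun y : ℝ ↦ y) c ν) {m : cube d → ℝ} (hm : Measurable m)
    (hm1 : ∀ x, |m x| ≤ 1) :
    HasSubgaussianMGF (fun ω : Fin n → cube d × ℝ ↦ ∑ i, m (ω i).1 * (ω i).2) (n * c)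
      (Measure.pi fun _ : Fin n ↦ P.prod ν) := by
  have h1 := HasSubgaussianMGF.mul_snd (P := P) h hm hm1
  have hi : iIndepFun (fun (i : Fin n) (ω : Fin n → cube d × ℝ) ↦ m (ω i).1 * (ω i).2)
      (Measure.pi fun _ : Fin n ↦ P.prod ν) :=
    iIndepFun_pi (X := fun _ (p : cube d × ℝ) ↦ m p.1 * p.2) fun i ↦ h1.aemeasurable
  have h2 := HasSubgaussianMGF.sum_of_iIndepFun hi (c := fun _ ↦ c) (s := Finset.univ)
    fun i _ ↦ by
      have hmp := measurePreserving_comp_eval (P.prod ν) i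
      rw [← hmp.map_eq] at h1
      exact HasSubgaussianMGF.of_map hmp.measurable.aemeasurable h1
  simpa using h2

theorem measurable_char_cube (w : EuclideanSpace ℝ (Fin d)) : Measurable fun x : cube d ↦
    (Real.fourierChar (inner ℝ w (x : EuclideanSpace ℝ (Fin d))) : ℂ) :=
  (continuous_char_cube.comp (Continuous.prodMk_left w)).measurable

theorem norm_fluct_sq_zero {n : ℕ} (P : Measure (cube d)) (a : Fin n → ℝ) (X : Fin n → cube d)
    (w : EuclideanSpace ℝ (Fin d)) :
    ‖fluct P 0 a X w‖ ^ 2 = (1 / (n : ℝ)) ^ 2 *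
      ((∑ i, (Real.fourierChar (inner ℝ w (X i : EuclideanSpace ℝ (Fin d))) : ℂ).re * a i) ^ 2 +
       (∑ i, (Real.fourierChar (inner ℝ w (X i : EuclideanSpace ℝ (Fin d))) : ℂ).im * a i) ^ 2) := by
  have h1 : fluct P 0 a X w = ((1 / (n : ℝ) : ℝ) : ℂ) *
      ∑ i, (a i : ℂ) * Real.fourierChar (inner ℝ w (X i : EuclideanSpace ℝ (Fin d))) := by
    simp [fluct]
  rw [h1, norm_mul, mul_pow, Complex.norm_real, Real.norm_eq_abs, sq_abs, Complex.sq_norm,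
    Complex.normSq_apply, Complex.re_sum, Complex.im_sum]
  simp only [Complex.re_ofReal_mul, Complex.im_ofReal_mul, sq, mul_comm (a _)]

/-- For fixed `w` the real and imaginary parts are sums of independent noise variables multiplied by
factors of modulus at most one that depend on the design only. Such sums are sub-Gaussian with
variance proxy nσ², which controls all even moments. -/
theorem noise_moment_le {n k : ℕ} (hn : 0 < n) (hk : 1 ≤ k) {P : Measure (cube d)}
    [IsProbabilityMeasure P] {ν : Measure ℝ} [IsProbabilityMeasure ν] {σ : ℝ≥0}
    (h : HasSubgaussianMGF (fun y : ℝ ↦ y) (σ ^ 2) ν) (w : EuclideanSpace ℝ (Fin d)) :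
    ∫⁻ ω, (‖fluct P 0 (fun i ↦ (ω i).2) (fun i ↦ (ω i).1) w‖ₑ ^ 2) ^ k
      ∂(Measure.pi fun _ : Fin n ↦ P.prod ν) ≤
      ENNReal.ofReal (4 * (8 * k ^ 2 * (σ + 1) ^ 2 / n) ^ k) := by
  have hn' : (0 : ℝ) < n := by exact_mod_cast hn
  set Q := Measure.pi fun _ : Fin n ↦ P.prod ν
  have hc := measurable_char_cube w
  -- The scale at which the exponential moment is bounded by a constant; σ + 1 in place of σ covers
  -- noiseless data.
  set t : ℝ := (Real.sqrt n * (σ + 1))⁻¹ with ht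
  have ht0 : 0 < t := by positivity
  have ht2 : t ^ 2 = (n * ((σ : ℝ) + 1) ^ 2)⁻¹ := by
    rw [ht, inv_pow, mul_pow, Real.sq_sqrt hn'.le]
  have key : ∀ m : cube d → ℝ, Measurable m → (∀ x, |m x| ≤ 1) →
      ∫⁻ ω, ENNReal.ofReal ((∑ i, m (ω i).1 * (ω i).2) ^ (2 * k)) ∂Q ≤
        ENNReal.ofReal (4 * (4 * k ^ 2 * (n * (σ + 1) ^ 2)) ^ k) := by
    intro m hm hm1
    refine (lintegral_pow_le_of_subgaussian (hasSubgaussianMGF_sum n h hm hm1) ht0 k).trans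
      (ENNReal.ofReal_le_ofReal ?_)
    have h1 : ((2 * k).factorial : ℝ) ≤ (4 * k ^ 2) ^ k := by
      have := Nat.factorial_le_pow (2 * k)
      calc ((2 * k).factorial : ℝ) ≤ ((2 * k : ℕ) : ℝ) ^ (2 * k) := by exact_mod_cast this
        _ = _ := by
          rw [pow_mul]
          push_cast
          ring
    have h2 : 2 * Real.exp ((((n : ℝ≥0) * σ ^ 2 : ℝ≥0) : ℝ) * t ^ 2 / 2) ≤ 4 := by
      have h3 : (((n : ℝ≥0) * σ ^ 2 : ℝ≥0) : ℝ) * t ^ 2 / 2 ≤ 1 / 2 := by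
        rw [ht2]
        push_cast
        have : (n : ℝ) * (σ : ℝ) ^ 2 * (n * ((σ : ℝ) + 1) ^ 2)⁻¹ ≤ 1 := by
          rw [← div_eq_mul_inv, div_le_one (by positivity)]
          gcongr
          linarith
        linarith
      have h4 := Real.exp_le_exp.2 h3
      have h5 : Real.exp (1 / 2) ≤ 2 := by
        have := Real.exp_one_lt_d9
        have h6 : Real.exp (1 / 2) ^ 2 = Real.exp 1 := by
          rw [← Real.exp_nat_mul]
          norm_num
        nlinarith [Real.exp_pos (1 / 2)]
      linarith
    calc _ ≤ (4 * (k : ℝ) ^ 2) ^ k * (t ^ (2 * k))⁻¹ * 4 := by gcongr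
      _ = _ := by
        rw [pow_mul t, ht2, ← inv_pow, inv_inv]
        rw [← mul_pow]
        ring
  have hA := key _ (Complex.measurable_re.comp hc) fun x ↦
    (Complex.abs_re_le_norm _).trans (Circle.norm_coe _).le
  have hB := key _ (Complex.measurable_im.comp hc) fun x ↦
    (Complex.abs_im_le_norm _).trans (Circle.norm_coe _).le
  simp only [Function.comp_apply] at hA hB
  set A : (Fin n → cube d × ℝ) → ℝ := fun ω ↦ ∑ i, (Real.fourierChar
    (inner ℝ w ((ω i).1 : EuclideanSpace ℝ (Fin d))) : ℂ).re * (ω i).2 with hAdef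
  set B : (Fin n → cube d × ℝ) → ℝ := fun ω ↦ ∑ i, (Real.fourierChar
    (inner ℝ w ((ω i).1 : EuclideanSpace ℝ (Fin d))) : ℂ).im * (ω i).2 with hBdef
  have hAm : Measurable A := by
    refine Finset.measurable_fun_sum _ fun i _ ↦ ?_
    exact (Complex.measurable_re.comp (hc.comp ((measurable_pi_apply i).fst))).mul
      (measurable_pi_apply i).snd
  set R : ℝ := 2 ^ (k - 1) * (1 / (n : ℝ)) ^ (2 * k) with hR
  calc _ ≤ ∫⁻ ω, ENNReal.ofReal R * (ENNReal.ofReal (A ω ^ (2 * k)) +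
        ENNReal.ofReal (B ω ^ (2 * k))) ∂Q := by
        refine lintegral_mono fun ω ↦ ?_
        have h0 : ∀ z : ℂ, (‖z‖ₑ ^ 2) ^ k = ENNReal.ofReal ((‖z‖ ^ 2) ^ k) := fun z ↦ by
          rw [ENNReal.ofReal_pow (by positivity), ENNReal.ofReal_pow (by positivity),
            ofReal_norm]
        rw [h0, norm_fluct_sq_zero, ← ENNReal.ofReal_add ((even_two_mul k).pow_nonneg _)
          ((even_two_mul k).pow_nonneg _), ← ENNReal.ofReal_mul (by positivity)]
        refine ENNReal.ofReal_le_ofReal ?_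
        have := add_pow_le (sq_nonneg (A ω)) (sq_nonneg (B ω)) k
        rw [mul_pow, ← pow_mul]
        calc (1 / (n : ℝ)) ^ (2 * k) * (A ω ^ 2 + B ω ^ 2) ^ k
            ≤ (1 / (n : ℝ)) ^ (2 * k) * (2 ^ (k - 1) * ((A ω ^ 2) ^ k + (B ω ^ 2) ^ k)) := by
              gcongr
          _ = _ := by
              rw [hR, ← pow_mul, ← pow_mul]
              ring
    _ = ENNReal.ofReal R * ((∫⁻ ω, ENNReal.ofReal (A ω ^ (2 * k)) ∂Q) +
          ∫⁻ ω, ENNReal.ofReal (B ω ^ (2 * k)) ∂Q) := by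
        rw [lintegral_const_mul' _ _ ENNReal.ofReal_ne_top, lintegral_add_left (by fun_prop)]
    _ ≤ ENNReal.ofReal R * (ENNReal.ofReal (4 * (4 * k ^ 2 * (n * (σ + 1) ^ 2)) ^ k) +
          ENNReal.ofReal (4 * (4 * k ^ 2 * (n * (σ + 1) ^ 2)) ^ k)) :=
        mul_le_mul_right (add_le_add hA hB) _
    _ = _ := by
        rw [← ENNReal.ofReal_add (by positivity) (by positivity), ← ENNReal.ofReal_mul (by positivity)]
        congr 1
        obtain ⟨j, rfl⟩ : ∃ j, k = j + 1 := ⟨k - 1, by omega⟩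
        have h2 : (8 * ((j + 1 : ℕ) : ℝ) ^ 2 * ((σ : ℝ) + 1) ^ 2 / n) ^ (j + 1) =
            (2 * (1 / (n : ℝ)) ^ 2 * (4 * ((j + 1 : ℕ) : ℝ) ^ 2 * (n * ((σ : ℝ) + 1) ^ 2))) ^ (j + 1) := by
          congr 1
          field_simp
          ring
        rw [h2, hR, mul_pow (2 * (1 / (n : ℝ)) ^ 2), mul_pow 2, ← pow_mul, add_tsub_cancel_right]
        ring

end Noise

/-! ### Tail bounds for the fluctuation -/

section Fluctuation

variable {d : ℕ}

theorem lintegral_rescaled_weight (S : ℝ) {δ : ℝ} (hδ : 0 < δ) :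
    ∫⁻ w : EuclideanSpace ℝ (Fin d), ENNReal.ofReal ((1 + δ * ‖w‖) ^ (-(2 * S))) =
      ENNReal.ofReal ((δ ^ d)⁻¹) *
        ∫⁻ w : EuclideanSpace ℝ (Fin d), ENNReal.ofReal ((1 + ‖w‖) ^ (-(2 * S))) := by
  have hm : Measurable fun w : EuclideanSpace ℝ (Fin d) ↦
      ENNReal.ofReal ((1 + ‖w‖) ^ (-(2 * S))) := by fun_prop
  have h1 := Measure.map_addHaar_smul (volume : Measure (EuclideanSpace ℝ (Fin d))) hδ.ne'
  rw [finrank_euclideanSpace_fin, abs_of_pos (by positivity)] at h1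
  calc _ = ∫⁻ w : EuclideanSpace ℝ (Fin d), ENNReal.ofReal ((1 + ‖δ • w‖) ^ (-(2 * S))) := by
        simp_rw [norm_smul, Real.norm_eq_abs, abs_of_pos hδ]
    _ = _ := by
        rw [← lintegral_map hm (measurable_const_smul δ), h1, lintegral_smul_measure, smul_eq_mul]

theorem Measurable.fourierChar_inner {α : Type*} [MeasurableSpace α] {w x : α → EuclideanSpace ℝ (Fin d)}
    (hw : Measurable w) (hx : Measurable x) :
    Measurable fun y ↦ (Real.fourierChar (inner ℝ (w y) (x y)) : ℂ) :=
  (continuous_subtype_val.comp Real.continuous_fourierChar).measurable.comp (hw.inner hx)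

theorem measurable_fluct {n : ℕ} {P : Measure (cube d)} [IsProbabilityMeasure P]
    {b : cube d → ℝ} (hb : Measurable b) {α : Type*} [MeasurableSpace α] {a : α → Fin n → ℝ}
    (ha : Measurable a) {X : α → Fin n → cube d} (hX : Measurable X) :
    Measurable fun p : α × EuclideanSpace ℝ (Fin d) ↦ fluct P b (a p.1) (X p.1) p.2 := by
  have h1 : Measurable fun p : EuclideanSpace ℝ (Fin d) × cube d ↦ (b p.2 : ℂ) *
      Real.fourierChar (inner ℝ p.1 (p.2 : EuclideanSpace ℝ (Fin d))) :=
    (Complex.measurable_ofReal.comp (hb.comp measurable_snd)).mul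
      (Measurable.fourierChar_inner measurable_fst (measurable_subtype_coe.comp measurable_snd))
  have h2 : Measurable fun w : EuclideanSpace ℝ (Fin d) ↦
      ∫ x, (b x : ℂ) * Real.fourierChar (inner ℝ w (x : EuclideanSpace ℝ (Fin d))) ∂P :=
    h1.stronglyMeasurable.integral_prod_right'.measurable
  have h3 : ∀ i, Measurable fun p : α × EuclideanSpace ℝ (Fin d) ↦ (a p.1 i : ℂ) *
      Real.fourierChar (inner ℝ p.2 (X p.1 i : EuclideanSpace ℝ (Fin d))) := fun i ↦
    (Complex.measurable_ofReal.comp (((measurable_pi_apply i).comp ha).comp measurable_fst)).mul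
      (Measurable.fourierChar_inner measurable_snd
        (measurable_subtype_coe.comp (((measurable_pi_apply i).comp hX).comp measurable_fst)))
  exact ((Finset.measurable_fun_sum Finset.univ fun i _ ↦ h3 i).const_mul (1 / (n : ℂ))).sub
    (h2.comp measurable_snd)

set_option maxHeartbeats 1600000 in
/-- Tail bound for the noise part of the fluctuation. -/
theorem noise_tail_le {S δ : ℝ} (hδ : 0 < δ) {n k : ℕ} (hn : 0 < n) (hk : 1 ≤ k)
    (hkn : Real.log n ≤ k)
    {I : ℝ} (hI : 0 < I)
    (hIw : ∫⁻ w : EuclideanSpace ℝ (Fin d), ENNReal.ofReal ((1 + ‖w‖) ^ (-(2 * S))) ≤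
      ENNReal.ofReal I) {P : Measure (cube d)}
    [IsProbabilityMeasure P] {ν : Measure ℝ} [IsProbabilityMeasure ν] {σ : ℝ≥0}
    (h : HasSubgaussianMGF (fun y : ℝ ↦ y) (σ ^ 2) ν) :
    (Measure.pi fun _ : Fin n ↦ P.prod ν)
      {ω | ENNReal.ofReal (Real.exp 2 * (I * (δ ^ d)⁻¹ * (8 * k ^ 2 * (σ + 1) ^ 2 / n))) ≤
        fluctSq S δ P 0 (fun i ↦ (ω i).2) (fun i ↦ (ω i).1)} ≤
      ENNReal.ofReal (4 * ((n : ℝ) ^ 2)⁻¹) := by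
  set Q := Measure.pi fun _ : Fin n ↦ P.prod ν
  have hn' : (0 : ℝ) < n := by exact_mod_cast hn
  have hk' : (0 : ℝ) < k := by exact_mod_cast hk
  set J : ℝ := I * (δ ^ d)⁻¹ with hJ
  have hJ0 : 0 < J := by positivity
  set q : ℝ := 8 * k ^ 2 * (σ + 1) ^ 2 / n with hq
  have hq0 : 0 < q := by positivity
  set ω' : EuclideanSpace ℝ (Fin d) → ℝ≥0∞ := fun w ↦
    ENNReal.ofReal ((1 + δ * ‖w‖) ^ (-(2 * S))) with hω'
  have hωm : Measurable ω' := by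
    rw [hω']
    fun_prop
  have hωJ : ∫⁻ w, ω' w ≤ ENNReal.ofReal J := by
    rw [hω', lintegral_rescaled_weight S hδ, hJ, mul_comm I, ENNReal.ofReal_mul (by positivity)]
    exact mul_le_mul_right hIw _
  set Z : (Fin n → cube d × ℝ) → EuclideanSpace ℝ (Fin d) → ℝ≥0∞ := fun ω w ↦
    ‖fluct P 0 (fun i ↦ (ω i).2) (fun i ↦ (ω i).1) w‖ₑ ^ 2 with hZ
  have hm1 : Measurable fun (ω : Fin n → cube d × ℝ) i ↦ (ω i).1 :=
    measurable_pi_lambda _ fun i ↦ (measurable_pi_apply i).fst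
  have hm2 : Measurable fun (ω : Fin n → cube d × ℝ) i ↦ (ω i).2 :=
    measurable_pi_lambda _ fun i ↦ (measurable_pi_apply i).snd
  have hmeas : Measurable fun p : (Fin n → cube d × ℝ) × EuclideanSpace ℝ (Fin d) ↦ Z p.1 p.2 :=
    (measurable_fluct (b := 0) measurable_const
      (a := fun (ω : Fin n → cube d × ℝ) i ↦ (ω i).2) (X := fun ω i ↦ (ω i).1) hm2 hm1).enorm.pow_const 2
  have hV : ∀ ω : Fin n → cube d × ℝ, fluctSq S δ P 0 (fun i ↦ (ω i).2) (fun i ↦ (ω i).1) =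
      ∫⁻ w, Z ω w ∂(volume.withDensity ω') := fun ω ↦ by
    rw [lintegral_withDensity_eq_lintegral_mul _ hωm (by fun_prop)]
    rfl
  set V : (Fin n → cube d × ℝ) → ℝ≥0∞ := fun ω ↦
    ∫⁻ w, Z ω w ∂(volume.withDensity ω') with hVdef
  have hVm : Measurable V := hmeas.lintegral_prod_right'
  simp_rw [hV]
  -- Jensen moves the k-th power inside the integral over frequencies, which has total mass at most
  -- `J`, so moments at single frequencies suffice.
  have hEV : ∫⁻ ω, V ω ^ k ∂Q ≤ ENNReal.ofReal (4 * (J * q) ^ k) := by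
    calc _ ≤ ∫⁻ ω, ENNReal.ofReal J ^ (k - 1) *
          ∫⁻ w, Z ω w ^ k ∂(volume.withDensity ω') ∂Q := by
          refine lintegral_mono fun ω ↦ (lintegral_pow_le _ (by fun_prop) hk).trans ?_
          refine mul_le_mul_left (pow_le_pow_left' ?_ _) _
          rwa [withDensity_apply _ MeasurableSet.univ, Measure.restrict_univ]
      _ = ENNReal.ofReal J ^ (k - 1) *
          ∫⁻ w, (∫⁻ ω, Z ω w ^ k ∂Q) ∂(volume.withDensity ω') := by
          rw [lintegral_const_mul' _ _ (by simp), lintegral_lintegral_swap]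
          exact (hmeas.pow_const k).aemeasurable
      _ ≤ ENNReal.ofReal J ^ (k - 1) *
          ∫⁻ w, ENNReal.ofReal (4 * q ^ k) ∂(volume.withDensity ω') :=
          mul_le_mul_right (lintegral_mono fun w ↦ noise_moment_le hn hk h w) _
      _ ≤ ENNReal.ofReal J ^ (k - 1) * (ENNReal.ofReal (4 * q ^ k) * ENNReal.ofReal J) := by
          rw [lintegral_const, withDensity_apply _ MeasurableSet.univ, Measure.restrict_univ]
          exact mul_le_mul_right (mul_le_mul_right hωJ _) _
      _ = _ := by
          rw [← ENNReal.ofReal_pow hJ0.le, ← ENNReal.ofReal_mul (by positivity),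
            ← ENNReal.ofReal_mul (by positivity)]
          obtain ⟨j, rfl⟩ : ∃ j, k = j + 1 := ⟨k - 1, by omega⟩
          rw [add_tsub_cancel_right]
          congr 1
          ring_nf
  -- Markov for the k-th power at e² times the natural size leaves 4e^(-2k), and k ≥ log n makes
  -- this at most 4/n².
  have hM := meas_ge_le_lintegral_div (μ := Q) (hVm.pow_const k).aemeasurable
    (ε := ENNReal.ofReal ((Real.exp 2 * (J * q)) ^ k)) (by simp; positivity) (by simp)
  calc _ ≤ Q {ω | ENNReal.ofReal ((Real.exp 2 * (J * q)) ^ k) ≤ V ω ^ k} := by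
        refine measure_mono fun ω hω ↦ ?_
        rw [mem_ofPred_eq, ENNReal.ofReal_pow (by positivity)]
        exact pow_le_pow_left' hω k
    _ ≤ _ := hM
    _ ≤ ENNReal.ofReal (4 * (J * q) ^ k) / ENNReal.ofReal ((Real.exp 2 * (J * q)) ^ k) :=
        ENNReal.div_le_div_right hEV _
    _ ≤ _ := by
        rw [← ENNReal.ofReal_div_of_pos (by positivity)]
        refine ENNReal.ofReal_le_ofReal ?_
        have h1 : (n : ℝ) ^ 2 ≤ Real.exp 2 ^ k := by
          calc (n : ℝ) ^ 2 = Real.exp (Real.log n) ^ 2 := by rw [Real.exp_log hn']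
            _ ≤ Real.exp k ^ 2 := by
                gcongr
            _ = _ := by
                rw [← Real.exp_nat_mul, ← Real.exp_nat_mul]
                congr 1
                push_cast
                ring
        rw [mul_pow (Real.exp 2), mul_div_mul_right _ _ (by positivity), div_eq_mul_inv]
        gcongr

/-- The second moment of a centred empirical Fourier coefficient. -/
theorem centred_moment_le {n : ℕ} (hn : 0 < n) {P : Measure (cube d)} [IsProbabilityMeasure P]
    {ν : Measure ℝ} [IsProbabilityMeasure ν] {b : cube d → ℝ} (hb : Measurable b)
    (hb2 : MemLp b 2 P) (w : EuclideanSpace ℝ (Fin d)) :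
    ∫⁻ ω, ‖fluct P b (fun i ↦ b (ω i).1) (fun i ↦ (ω i).1) w‖ₑ ^ 2
      ∂(Measure.pi fun _ : Fin n ↦ P.prod ν) ≤ ENNReal.ofReal (1 / n * ∫ x, b x ^ 2 ∂P) := by
  have hn' : (0 : ℝ) < n := by exact_mod_cast hn
  set Q := Measure.pi fun _ : Fin n ↦ P.prod ν
  have hc := measurable_char_cube w
  set c : cube d → ℂ := fun x ↦ Real.fourierChar (inner ℝ w (x : EuclideanSpace ℝ (Fin d)))
    with hcdef
  have hc1 : ∀ x, ‖c x‖ = 1 := fun x ↦ Circle.norm_coe _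
  have key : ∀ m : cube d → ℝ, Measurable m → (∀ x, |m x| ≤ 1) →
      MemLp (fun x ↦ b x * m x) 2 P ∧ Integrable (fun ω : Fin n → cube d × ℝ ↦
        (1 / (n : ℝ) * ∑ i, b (ω i).1 * m (ω i).1 - ∫ x, b x * m x ∂P) ^ 2) Q ∧
      ∫ ω, (1 / (n : ℝ) * ∑ i, b (ω i).1 * m (ω i).1 - ∫ x, b x * m x ∂P) ^ 2 ∂Q ≤
        1 / n * ∫ x, (b x * m x) ^ 2 ∂P := by
    intro m hm hm1
    have hmem : MemLp (fun x ↦ b x * m x) 2 P := by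
      refine hb2.of_le (hb.mul hm).aestronglyMeasurable (Filter.Eventually.of_forall fun x ↦ ?_)
      rw [norm_mul]
      exact mul_le_of_le_one_right (norm_nonneg _) (hm1 x)
    have hmem' : MemLp (fun p : cube d × ℝ ↦ b p.1 * m p.1) 2 (P.prod ν) :=
      hmem.comp_measurePreserving measurePreserving_fst
    have hmi : ∀ i, MemLp (fun ω : Fin n → cube d × ℝ ↦ b (ω i).1 * m (ω i).1) 2 Q := fun i ↦
      hmem'.comp_measurePreserving (measurePreserving_comp_eval (P.prod ν) i)
    have hsum : MemLp (∑ i, fun ω : Fin n → cube d × ℝ ↦ b (ω i).1 * m (ω i).1) 2 Q :=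
      memLp_finsetSum' _ fun i _ ↦ hmi i
    have hmean : ∫ ω, (∑ i, fun ω : Fin n → cube d × ℝ ↦ b (ω i).1 * m (ω i).1) ω ∂Q =
        n * ∫ x, b x * m x ∂P := by
      simp only [Finset.sum_apply]
      rw [integral_finsetSum _ fun i _ ↦ (hmi i).integrable one_le_two]
      have : ∀ i, ∫ ω : Fin n → cube d × ℝ, b (ω i).1 * m (ω i).1 ∂Q = ∫ x, b x * m x ∂P := by
        intro i
        have h1 := (measurePreserving_fst (μ := P) (ν := ν)).comp
          (measurePreserving_comp_eval (P.prod ν) i)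
        have h2 := integral_map h1.measurable.aemeasurable (f := fun x ↦ b x * m x)
          (by rw [h1.map_eq]; exact (hb.mul hm).aestronglyMeasurable)
        rw [h1.map_eq] at h2
        exact h2.symm
      simp [this]
    have hvar := variance_sum_pi (μ := fun _ : Fin n ↦ P.prod ν)
      (X := fun _ (p : cube d × ℝ) ↦ b p.1 * m p.1) (fun _ ↦ hmem')
    have hvar1 : Var[fun p : cube d × ℝ ↦ b p.1 * m p.1; P.prod ν] ≤ ∫ x, (b x * m x) ^ 2 ∂P := by
      refine (variance_le_expectation_sq hmem'.aestronglyMeasurable).trans_eq ?_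
      have h2 := integral_map (measurePreserving_fst (μ := P) (ν := ν)).measurable.aemeasurable
          (f := fun x ↦ (b x * m x) ^ 2)
          (by rw [(measurePreserving_fst (μ := P) (ν := ν)).map_eq]
              exact ((hb.mul hm).pow_const 2).aestronglyMeasurable)
      rw [(measurePreserving_fst (μ := P) (ν := ν)).map_eq] at h2
      exact h2.symm
    rw [variance_eq_integral hsum.aestronglyMeasurable.aemeasurable, hmean] at hvar
    have hrw : ∀ ω : Fin n → cube d × ℝ,
        (1 / (n : ℝ) * ∑ i, b (ω i).1 * m (ω i).1 - ∫ x, b x * m x ∂P) ^ 2 = (1 / (n : ℝ)) ^ 2 *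
        ((∑ i, fun ω : Fin n → cube d × ℝ ↦ b (ω i).1 * m (ω i).1) ω -
          n * ∫ x, b x * m x ∂P) ^ 2 := by
      intro ω
      rw [Finset.sum_apply, ← mul_pow, mul_sub, ← mul_assoc, one_div_mul_cancel hn'.ne', one_mul]
    refine ⟨hmem, ?_, ?_⟩
    · simp_rw [hrw]
      exact ((hsum.sub (memLp_const _)).integrable_sq).const_mul _
    · simp_rw [hrw]
      rw [integral_const_mul, hvar]
      simp only [Finset.sum_const, Finset.card_univ, Fintype.card_fin, nsmul_eq_mul]
      calc (1 / (n : ℝ)) ^ 2 * (n * Var[fun p : cube d × ℝ ↦ b p.1 * m p.1; P.prod ν])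
          = 1 / n * Var[fun p : cube d × ℝ ↦ b p.1 * m p.1; P.prod ν] := by field_simp
        _ ≤ _ := by gcongr
  obtain ⟨mA, iA, hA⟩ := key (fun x ↦ (c x).re) (Complex.measurable_re.comp hc) fun x ↦
    (Complex.abs_re_le_norm _).trans (hc1 x).le
  obtain ⟨mB, iB, hB⟩ := key (fun x ↦ (c x).im) (Complex.measurable_im.comp hc) fun x ↦
    (Complex.abs_im_le_norm _).trans (hc1 x).le
  have hint : Integrable (fun x ↦ (b x : ℂ) * c x) P := by
    refine (hb2.integrable one_le_two).norm.mono'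
      ((Complex.measurable_ofReal.comp hb).mul hc).aestronglyMeasurable
      (Filter.Eventually.of_forall fun x ↦ ?_)
    rw [norm_mul, hc1, mul_one, Complex.norm_real]
  have hre : (∫ x, (b x : ℂ) * c x ∂P).re = ∫ x, b x * (c x).re ∂P := by
    have := integral_re hint
    simp only [RCLike.re_to_complex, Complex.re_ofReal_mul] at this
    exact this.symm
  have him : (∫ x, (b x : ℂ) * c x ∂P).im = ∫ x, b x * (c x).im ∂P := by
    have := integral_im hint
    simp only [RCLike.im_to_complex, Complex.im_ofReal_mul] at this
    exact this.symm
  have hpt : ∀ ω : Fin n → cube d × ℝ,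
      ‖fluct P b (fun i ↦ b (ω i).1) (fun i ↦ (ω i).1) w‖ₑ ^ 2 = ENNReal.ofReal (
        (1 / (n : ℝ) * ∑ i, b (ω i).1 * (c (ω i).1).re - ∫ x, b x * (c x).re ∂P) ^ 2 +
        (1 / (n : ℝ) * ∑ i, b (ω i).1 * (c (ω i).1).im - ∫ x, b x * (c x).im ∂P) ^ 2) := by
    intro ω
    have h1 : fluct P b (fun i ↦ b (ω i).1) (fun i ↦ (ω i).1) w = ((1 / (n : ℝ) : ℝ) : ℂ) *
        ∑ i, (b (ω i).1 : ℂ) * c (ω i).1 - ∫ x, (b x : ℂ) * c x ∂P := by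
      simp [fluct, hcdef]
    rw [← ofReal_norm, ← ENNReal.ofReal_pow (norm_nonneg _), h1, Complex.sq_norm,
      Complex.normSq_apply, Complex.sub_re, Complex.sub_im, hre, him, Complex.re_ofReal_mul,
      Complex.im_ofReal_mul, Complex.re_sum, Complex.im_sum]
    simp only [Complex.re_ofReal_mul, Complex.im_ofReal_mul, sq]
  simp_rw [hpt]
  have hsum := ofReal_integral_eq_lintegral_ofReal (iA.add iB) (Filter.Eventually.of_forall fun ω ↦ by
    simp only [Pi.zero_apply, Pi.add_apply]
    positivity)
  simp only [Pi.add_apply] at hsum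
  rw [← hsum]
  refine ENNReal.ofReal_le_ofReal ?_
  rw [integral_add iA iB]
  refine (add_le_add hA hB).trans_eq ?_
  rw [← mul_add, ← integral_add mA.integrable_sq mB.integrable_sq]
  congr 1
  refine integral_congr_ae (Filter.Eventually.of_forall fun x ↦ ?_)
  have h1 := Complex.sq_norm (c x)
  rw [hc1, Complex.normSq_apply] at h1
  simp only
  linear_combination -(b x ^ 2) * h1

set_option maxHeartbeats 1600000 in
/-- Tail bound for the centred part of the fluctuation. -/
theorem centred_tail_le {S δ : ℝ} (hδ : 0 < δ) {n : ℕ} (hn : 0 < n)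
    {I : ℝ} (hI : 0 < I)
    (hIw : ∫⁻ w : EuclideanSpace ℝ (Fin d), ENNReal.ofReal ((1 + ‖w‖) ^ (-(2 * S))) ≤
      ENNReal.ofReal I) {P : Measure (cube d)} [IsProbabilityMeasure P]
    {ν : Measure ℝ} [IsProbabilityMeasure ν] {b : cube d → ℝ} (hb : Measurable b)
    (hb2 : MemLp b 2 P) :
    (Measure.pi fun _ : Fin n ↦ P.prod ν)
      {ω | ENNReal.ofReal (I * (δ ^ d)⁻¹ / n) ≤
        fluctSq S δ P b (fun i ↦ b (ω i).1) (fun i ↦ (ω i).1)} ≤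
      ENNReal.ofReal (∫ x, b x ^ 2 ∂P) := by
  set Q := Measure.pi fun _ : Fin n ↦ P.prod ν
  have hn' : (0 : ℝ) < n := by exact_mod_cast hn
  set J : ℝ := I * (δ ^ d)⁻¹ with hJ
  have hJ0 : 0 < J := by positivity
  set ω' : EuclideanSpace ℝ (Fin d) → ℝ≥0∞ := fun w ↦
    ENNReal.ofReal ((1 + δ * ‖w‖) ^ (-(2 * S))) with hω'
  have hωm : Measurable ω' := by
    rw [hω']
    fun_prop
  have hωJ : ∫⁻ w, ω' w ≤ ENNReal.ofReal J := by
    rw [hω', lintegral_rescaled_weight S hδ, hJ, mul_comm I, ENNReal.ofReal_mul (by positivity)]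
    exact mul_le_mul_right hIw _
  have hm1 : Measurable fun (ω : Fin n → cube d × ℝ) i ↦ (ω i).1 :=
    measurable_pi_lambda _ fun i ↦ (measurable_pi_apply i).fst
  have hm2 : Measurable fun (ω : Fin n → cube d × ℝ) i ↦ b (ω i).1 :=
    measurable_pi_lambda _ fun i ↦ hb.comp (measurable_pi_apply i).fst
  have hmeas : Measurable fun p : (Fin n → cube d × ℝ) × EuclideanSpace ℝ (Fin d) ↦
      ω' p.2 * ‖fluct P b (fun i ↦ b (p.1 i).1) (fun i ↦ (p.1 i).1) p.2‖ₑ ^ 2 :=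
    (hωm.comp measurable_snd).mul ((measurable_fluct hb
      (a := fun (ω : Fin n → cube d × ℝ) i ↦ b (ω i).1) (X := fun ω i ↦ (ω i).1) hm2 hm1).enorm.pow_const 2)
  have hb0 : 0 ≤ ∫ x, b x ^ 2 ∂P := integral_nonneg fun x ↦ sq_nonneg _
  have hE : ∫⁻ ω, fluctSq S δ P b (fun i ↦ b (ω i).1) (fun i ↦ (ω i).1) ∂Q ≤
      ENNReal.ofReal (J / n * ∫ x, b x ^ 2 ∂P) := by
    unfold fluctSq
    rw [lintegral_lintegral_swap hmeas.aemeasurable]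
    calc _ ≤ ∫⁻ w, ω' w * ENNReal.ofReal (1 / n * ∫ x, b x ^ 2 ∂P) := by
          refine lintegral_mono fun w ↦ ?_
          simp only
          rw [lintegral_const_mul' _ _ ENNReal.ofReal_ne_top]
          exact mul_le_mul_right (centred_moment_le hn hb hb2 w) _
      _ = (∫⁻ w, ω' w) * ENNReal.ofReal (1 / n * ∫ x, b x ^ 2 ∂P) :=
          lintegral_mul_const' _ _ ENNReal.ofReal_ne_top
      _ ≤ ENNReal.ofReal J * ENNReal.ofReal (1 / n * ∫ x, b x ^ 2 ∂P) := mul_le_mul_left hωJ _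
      _ = _ := by
          rw [← ENNReal.ofReal_mul hJ0.le]
          congr 1
          ring
  -- Markov at the level J/n. The expectation is that level times the integral of b², so the failure
  -- probability is the squared approximation error itself.
  refine (meas_ge_le_lintegral_div (μ := Q) hmeas.lintegral_prod_right'.aemeasurable
    (by simp; positivity) ENNReal.ofReal_ne_top).trans ?_
  refine (ENNReal.div_le_div_right hE _).trans ?_
  rw [← ENNReal.ofReal_div_of_pos (by positivity), mul_div_cancel_left₀ _ (by positivity)]

theorem fluct_add {n : ℕ} (P : Measure (cube d)) (b : cube d → ℝ) (a a' : Fin n → ℝ)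
    (X : Fin n → cube d) (w : EuclideanSpace ℝ (Fin d)) :
    fluct P b (fun i ↦ a i + a' i) X w = fluct P 0 a X w + fluct P b a' X w := by
  simp only [fluct, Complex.ofReal_add, add_mul, Finset.sum_add_distrib, mul_add, Pi.zero_apply,
    Complex.ofReal_zero, zero_mul, integral_zero, sub_zero]
  ring

theorem fluctSq_add_le {n : ℕ} (S δ : ℝ) (P : Measure (cube d)) [IsProbabilityMeasure P]
    (b : cube d → ℝ) (a a' : Fin n → ℝ) (X : Fin n → cube d) :
    fluctSq S δ P b (fun i ↦ a i + a' i) X ≤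
      2 * (fluctSq S δ P 0 a X + fluctSq S δ P b a' X) := by
  have hm : AEMeasurable (fun w : EuclideanSpace ℝ (Fin d) ↦
      ENNReal.ofReal ((1 + δ * ‖w‖) ^ (-(2 * S))) * ‖fluct P 0 a X w‖ₑ ^ 2) :=
    (Measurable.aemeasurable (by fun_prop)).mul
      ((aestronglyMeasurable_fluct (b := 0) aestronglyMeasurable_const a X).enorm.pow_const 2)
  unfold fluctSq
  rw [← lintegral_add_left' hm, ← lintegral_const_mul' _ _ (by simp)]
  refine lintegral_mono fun w ↦ ?_
  simp only
  rw [fluct_add, ← mul_add, mul_left_comm]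
  refine mul_le_mul_right ?_ _
  refine (pow_le_pow_left' (enorm_add_le _ _) 2).trans (sq_add_le_two_mul _ _)

end Fluctuation

/-! ### Number of design points per cell -/

section CellCounts

variable {d : ℕ}

/-- A Chernoff bound for the number of observations falling into a set. -/
theorem count_lower_tail {n : ℕ} {P : Measure (cube d)} [IsProbabilityMeasure P] {ν : Measure ℝ}
    [IsProbabilityMeasure ν] {A : Set (cube d)} (hA : MeasurableSet A) {q : ℝ}
    (hq : q ≤ P.real A) :
    (Measure.pi fun _ : Fin n ↦ P.prod ν).real
      {ω | ∑ i, A.indicator (fun _ ↦ (1 : ℝ)) (ω i).1 ≤ n * q / 4} ≤ Real.exp (-(n * q / 4)) := by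
  set Q := Measure.pi fun _ : Fin n ↦ P.prod ν
  set g : cube d → ℝ := A.indicator fun _ ↦ (1 : ℝ) with hg
  have hgm : Measurable g := measurable_const.indicator hA
  have hg01 : ∀ x, 0 ≤ g x := fun x ↦ indicator_nonneg (fun _ _ ↦ zero_le_one) _
  have hind : iIndepFun (fun (i : Fin n) (ω : Fin n → cube d × ℝ) ↦ g (ω i).1) Q :=
    iIndepFun_pi (X := fun _ (p : cube d × ℝ) ↦ g p.1) fun i ↦
      (hgm.comp measurable_fst).aemeasurable
  -- Since e^(-1) ≤ 1/2, the Laplace transform at -1 is at most 1 - P(A)/2 ≤ 1 - q/2 ≤ e^(-q/2).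
  have hmgf : ∀ i : Fin n, mgf (fun ω : Fin n → cube d × ℝ ↦ g (ω i).1) Q (-1) ≤
      Real.exp (-(q / 2)) := by
    intro i
    have h1 := (measurePreserving_fst (μ := P) (ν := ν)).comp
      (measurePreserving_comp_eval (P.prod ν) i)
    have h2 := integral_map h1.measurable.aemeasurable (f := fun x ↦ Real.exp (-1 * g x))
      (by rw [h1.map_eq]; exact (by fun_prop : Measurable _).aestronglyMeasurable)
    rw [h1.map_eq] at h2
    have h3 : mgf (fun ω : Fin n → cube d × ℝ ↦ g (ω i).1) Q (-1) = ∫ x, Real.exp (-1 * g x) ∂P :=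
      h2.symm
    have h4 : ∀ x, Real.exp (-1 * g x) = 1 + A.indicator (fun _ ↦ Real.exp (-1) - 1) x := fun x ↦ by
      by_cases hx : x ∈ A <;> simp [hg, hx]
    rw [h3]
    simp_rw [h4]
    rw [integral_add (integrable_const _) ((integrable_const _).indicator hA),
      integral_indicator_const _ hA]
    have h5 : Real.exp (-1) ≤ 1 / 2 := by
      rw [Real.exp_neg, one_div]
      exact inv_anti₀ (by norm_num) (by linarith [Real.add_one_le_exp (1 : ℝ)])
    have h6 := Real.add_one_le_exp (-(q / 2))
    have h7 : (0 : ℝ) ≤ P.real A := measureReal_nonneg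
    simp only [integral_const, probReal_univ, smul_eq_mul, mul_one]
    nlinarith
  have hmgfs := hind.mgf_sum (t := -1) (fun i ↦ by fun_prop) Finset.univ
  have hmgfn : mgf (∑ i : Fin n, fun ω : Fin n → cube d × ℝ ↦ g (ω i).1) Q (-1) ≤
      Real.exp (-(n * q / 2)) := by
    rw [hmgfs]
    calc _ ≤ ∏ _i : Fin n, Real.exp (-(q / 2)) :=
          Finset.prod_le_prod (fun i _ ↦ mgf_nonneg) fun i _ ↦ hmgf i
      _ = _ := by
          rw [Finset.prod_const, Finset.card_univ, Fintype.card_fin, ← Real.exp_nat_mul]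
          congr 1
          ring
  have hint : Integrable (fun ω ↦ Real.exp (-1 *
      (∑ i : Fin n, fun ω : Fin n → cube d × ℝ ↦ g (ω i).1) ω)) Q := by
    refine Integrable.mono' (integrable_const 1) (Measurable.aestronglyMeasurable ?_)
      (Filter.Eventually.of_forall fun ω ↦ ?_)
    · simp only [Finset.sum_apply]
      fun_prop
    · rw [Real.norm_eq_abs, Real.abs_exp, Finset.sum_apply, Real.exp_le_one_iff]
      have : 0 ≤ ∑ i, g (ω i).1 := Finset.sum_nonneg fun i _ ↦ hg01 _
      linarith
  have := measure_le_le_exp_mul_mgf (μ := Q) (n * q / 4) (by norm_num : (-1 : ℝ) ≤ 0) hint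
  simp only [Finset.sum_apply] at this
  refine this.trans ?_
  calc _ ≤ Real.exp (- -1 * (n * q / 4)) * Real.exp (-(n * q / 2)) :=
        mul_le_mul_of_nonneg_left hmgfn (Real.exp_pos _).le
    _ = _ := by
        rw [← Real.exp_add]
        congr 1
        ring

/-- With high probability every cell contains its share of observations. -/
theorem cell_counts_tail {n M : ℕ} (hM : 0 < M) {c : ℝ} (hc : 0 ≤ c) {P : Measure (cube d)}
    [IsProbabilityMeasure P] (hP : ENNReal.ofReal c • volume ≤ P) {ν : Measure ℝ}
    [IsProbabilityMeasure ν] :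
    (Measure.pi fun _ : Fin n ↦ P.prod ν)
      {ω | ¬ ∀ k : Fin d → ℕ, (∀ i, k i < M) → c / 4 * n * ((M : ℝ) ^ d)⁻¹ ≤
        ((Finset.univ.filter fun i ↦ cellIdx M (ω i).1 = k).card : ℝ)} ≤
      ENNReal.ofReal ((M : ℝ) ^ d * Real.exp (-(n * (c * ((M : ℝ) ^ d)⁻¹) / 4))) := by
  set Q := Measure.pi fun _ : Fin n ↦ P.prod ν
  set q : ℝ := c * ((M : ℝ) ^ d)⁻¹ with hq
  have hsub : {ω : Fin n → cube d × ℝ | ¬ ∀ k : Fin d → ℕ, (∀ i, k i < M) →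
      c / 4 * n * ((M : ℝ) ^ d)⁻¹ ≤
        ((Finset.univ.filter fun i ↦ cellIdx M (ω i).1 = k).card : ℝ)} ⊆
      ⋃ k : Fin d → Fin M, {ω | ∑ i, {x | cellIdx M x = fun j ↦ (k j : ℕ)}.indicator
        (fun _ ↦ (1 : ℝ)) (ω i).1 ≤ n * q / 4} := by
    intro ω hω
    rw [mem_ofPred_eq] at hω
    push Not at hω
    obtain ⟨k, hk, hlt⟩ := hω
    refine mem_iUnion.2 ⟨fun i ↦ ⟨k i, hk i⟩, ?_⟩
    rw [mem_ofPred_eq]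
    have : ∑ i, {x : cube d | cellIdx M x = fun j ↦ k j}.indicator (fun _ ↦ (1 : ℝ)) (ω i).1 =
        ((Finset.univ.filter fun i ↦ cellIdx M (ω i).1 = k).card : ℝ) := by
      simp [indicator_apply, Finset.sum_boole]
    refine (this.trans_lt hlt).le.trans_eq ?_
    rw [hq]
    ring
  refine (measure_mono hsub).trans ((measure_iUnion_le _).trans ?_)
  rw [tsum_fintype]
  have hone : ∀ k : Fin d → Fin M, Q {ω | ∑ i, {x | cellIdx M x = fun j ↦ (k j : ℕ)}.indicator
        (fun _ ↦ (1 : ℝ)) (ω i).1 ≤ n * q / 4} ≤ ENNReal.ofReal (Real.exp (-(n * q / 4))) := by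
    intro k
    have hAm : MeasurableSet {x : cube d | cellIdx M x = fun j ↦ (k j : ℕ)} :=
      measurable_cellIdx M (measurableSet_singleton _)
    have hqA : q ≤ P.real {x : cube d | cellIdx M x = fun j ↦ (k j : ℕ)} := by
      have h1 := Measure.le_iff'.1 hP {x : cube d | cellIdx M x = fun j ↦ (k j : ℕ)}
      rw [Measure.smul_apply, volume_cell (fun i ↦ (k i).2) hM, smul_eq_mul,
        ← ENNReal.ofReal_mul hc] at h1
      rw [measureReal_def]
      exact (ENNReal.ofReal_le_iff_le_toReal (measure_ne_top _ _)).1 h1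
    have := count_lower_tail (n := n) (ν := ν) hAm hqA
    rw [measureReal_def] at this
    exact (ENNReal.le_ofReal_iff_toReal_le (measure_ne_top _ _) (Real.exp_pos _).le).2 this
  refine (Finset.sum_le_sum fun k _ ↦ hone k).trans_eq ?_
  rw [Finset.sum_const, Finset.card_univ, Fintype.card_fun, Fintype.card_fin, Fintype.card_fin,
    nsmul_eq_mul, ENNReal.ofReal_mul (by positivity), ← Nat.cast_pow, ENNReal.ofReal_natCast]

end CellCounts

/-! ### Low-frequency approximation of Sobolev functions -/

section Approximation

variable {d : ℕ} {S : ℝ}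

theorem rpow_le_realWeight {s a : ℝ} (ha : 0 ≤ a) (has : a ≤ s) (w : EuclideanSpace ℝ (Fin d)) :
    ‖w‖ ^ (2 * a) ≤ realWeight s w := by
  have h1 : (1 : ℝ) ≤ 1 + (2 * Real.pi * ‖w‖) ^ 2 := by linarith [sq_nonneg (2 * Real.pi * ‖w‖)]
  have hpi := Real.pi_gt_three
  calc ‖w‖ ^ (2 * a) = (‖w‖ ^ 2) ^ a := by
        rw [Real.rpow_mul (norm_nonneg _)]
        norm_num
    _ ≤ (1 + (2 * Real.pi * ‖w‖) ^ 2) ^ a := by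
        refine Real.rpow_le_rpow (by positivity) ?_ ha
        have : 1 ≤ (2 * Real.pi) ^ 2 := by nlinarith
        nlinarith [sq_nonneg ‖w‖]
    _ ≤ _ := Real.rpow_le_rpow_of_exponent_le h1 has

theorem sq_eLpNorm_cube_le (u : Lp ℝ 2 (volume : Measure (EuclideanSpace ℝ (Fin d)))) :
    eLpNorm (fun x : cube d ↦ u (x : EuclideanSpace ℝ (Fin d))) 2 volume ^ 2 ≤
      ∫⁻ w, ‖ft u w‖ₑ ^ 2 := by
  rw [sq_eLpNorm_two, lintegral_ft_sq]
  exact lintegral_cube_le (f := fun x ↦ ‖u x‖ₑ ^ 2)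
    ((Lp.aestronglyMeasurable u).enorm.pow_const 2)

theorem exists_extension_of_mem_sobolevBall {s L : ℝ} {f : cube d → ℝ}
    (hf : f ∈ sobolevBall d s L) :
    ∃ g : Lp ℝ 2 (volume : Measure (EuclideanSpace ℝ (Fin d))),
      (fun x : cube d ↦ g (x : EuclideanSpace ℝ (Fin d))) =ᵐ[volume] f ∧
        sobolevNorm s g ≤ ENNReal.ofReal (max L 0 + 1) := by
  have h1 : cubeSobolevNorm s f < ENNReal.ofReal (max L 0 + 1) :=
    lt_of_le_of_lt hf ((ENNReal.ofReal_lt_ofReal_iff (by positivity)).2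
      (by linarith [le_max_left L 0]))
  simp only [cubeSobolevNorm, iInf_lt_iff] at h1
  obtain ⟨g, hg, h2⟩ := h1
  exact ⟨g, hg, h2.le⟩

/-- Approximation of a Sobolev function by its low frequencies. -/
theorem exists_low_frequency_approximation (hS : (d : ℝ) / 2 < S) {s : ℝ} (hs : 0 ≤ s)
    (hsS : s ≤ S) (L : ℝ) : ∃ C : ℝ, 0 < C ∧ ∀ f ∈ sobolevBall d s L, ∀ v : ℝ, 1 ≤ v →
      ∃ f₀ ∈ rkhs d S, eLpNorm (f - f₀) 2 volume ^ 2 ≤ ENNReal.ofReal (C * v ^ (-(s / S))) ∧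
        1 / v * (cubeSobolevNorm S f₀).toReal ^ 2 ≤ C * v ^ (-(s / S)) := by
  have hS0 : 0 < S := lt_of_le_of_lt (by positivity) hS
  set L' : ℝ := max L 0 + 1 with hL'
  have hL'0 : 0 < L' := by positivity
  -- For |w| ≤ ρ with ρ ≥ 1, the bound π² ≤ 10 gives 1 + (2π|w|)² ≤ 41ρ².
  refine ⟨41 ^ (S - s) * L' ^ 2, by positivity, fun f hf v hv ↦ ?_⟩
  have hv0 : 0 < v := by linarith
  obtain ⟨g, hgf, hgL⟩ := exists_extension_of_mem_sobolevBall hf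
  -- The cut frequency with ρ^(2S) = v, at which the squared truncation error ρ^(-2s) and the
  -- penalty ρ^(2(S-s))/v have the same order.
  set ρ : ℝ := v ^ (1 / (2 * S)) with hρ
  have hρ1 : 1 ≤ ρ := Real.one_le_rpow hv (by positivity)
  have hρpow : ∀ t : ℝ, ρ ^ (2 * t) = v ^ (t / S) := fun t ↦ by
    rw [hρ, ← Real.rpow_mul hv0.le]
    congr 1
    field_simp
  have h41 : (1 : ℝ) ≤ 41 ^ (S - s) := Real.one_le_rpow (by norm_num) (by linarith)
  classical
  set m : EuclideanSpace ℝ (Fin d) → ℝ := fun w ↦ if ‖w‖ ≤ ρ then 1 else 0 with hm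
  have hmm : Measurable m := Measurable.ite (measurableSet_le measurable_norm measurable_const)
    measurable_const measurable_const
  obtain ⟨g', hg'⟩ := exists_real_multiplier g hmm (fun w ↦ by simp [hm]) (c := 1)
    (fun w ↦ by by_cases h : ‖w‖ ≤ ρ <;> simp [hm, h])
  have hfin : sobolevNorm S g' ^ 2 ≤ ENNReal.ofReal (41 ^ (S - s) * v ^ ((S - s) / S) * L' ^ 2) := by
    calc sobolevNorm S g' ^ 2 = ∫⁻ w, sobolevWeight d S w * ‖ft g' w‖ₑ ^ 2 := sobolevNorm_sq _ _
      _ ≤ ∫⁻ w, ENNReal.ofReal (41 ^ (S - s) * v ^ ((S - s) / S)) *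
          (sobolevWeight d s w * ‖ft g w‖ₑ ^ 2) := by
          refine lintegral_mono_ae ?_
          filter_upwards [hg'] with w hw
          rw [hw]
          by_cases h : ‖w‖ ≤ ρ
          · simp only [hm, h, if_true, Complex.ofReal_one, one_mul]
            rw [← mul_assoc, sobolevWeight_eq, sobolevWeight_eq, ← ENNReal.ofReal_mul (by positivity)]
            refine mul_le_mul_left (ENNReal.ofReal_le_ofReal ?_) _
            have hb : (0 : ℝ) < 1 + (2 * Real.pi * ‖w‖) ^ 2 := by positivity
            have h1 : realWeight S w = (1 + (2 * Real.pi * ‖w‖) ^ 2) ^ (S - s) * realWeight s w := by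
              rw [realWeight, realWeight, ← Real.rpow_add hb]
              congr 1
              ring
            rw [h1, ← hρpow, Real.rpow_mul (by positivity) 2]
            refine mul_le_mul_of_nonneg_right ?_ (realWeight_pos _ _).le
            rw [← Real.mul_rpow (by norm_num) (by positivity)]
            refine Real.rpow_le_rpow hb.le ?_ (by linarith)
            have hpi := Real.pi_lt_d2
            have hpi0 := Real.pi_pos
            have h2 : ‖w‖ ^ 2 ≤ ρ ^ 2 := by gcongr
            have h3 : Real.pi ^ 2 ≤ 10 := by nlinarith
            have h4 : ρ ^ (2 : ℝ) = ρ ^ 2 := by norm_cast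
            rw [h4]
            have h5 : Real.pi ^ 2 * ‖w‖ ^ 2 ≤ 10 * ρ ^ 2 :=
              mul_le_mul h3 h2 (by positivity) (by norm_num)
            have h6 : (1 : ℝ) ≤ ρ ^ 2 := one_le_pow₀ hρ1
            nlinarith
          · simp [hm, h]
      _ = ENNReal.ofReal (41 ^ (S - s) * v ^ ((S - s) / S)) * sobolevNorm s g ^ 2 := by
          rw [lintegral_const_mul' _ _ ENNReal.ofReal_ne_top, sobolevNorm_sq]
      _ ≤ ENNReal.ofReal (41 ^ (S - s) * v ^ ((S - s) / S)) * ENNReal.ofReal L' ^ 2 :=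
          mul_le_mul_right (pow_le_pow_left' hgL 2) _
      _ = _ := by
          rw [← ENNReal.ofReal_pow hL'0.le, ← ENNReal.ofReal_mul (by positivity)]
  have hne : sobolevNorm S g' ≠ ∞ := fun h ↦ by simp [h] at hfin
  obtain ⟨hmem, hle⟩ := contRep_mem_rkhs hS hne
  refine ⟨_, hmem, ?_, ?_⟩
  · have h1 : (f - fun x : cube d ↦ contRep g' x) =ᵐ[volume] fun x : cube d ↦
        (g - g' : Lp ℝ 2 (volume : Measure (EuclideanSpace ℝ (Fin d)))) (x : EuclideanSpace ℝ (Fin d)) := by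
      filter_upwards [hgf, ae_cube_of_ae (ae_eq_fourierInv_ft (integrable_ft hS hne)),
        ae_cube_of_ae (Lp.coeFn_sub g g')] with x h1 h2 h3
      rw [h3, Pi.sub_apply, Pi.sub_apply, ← h1, h2]
      rfl
    rw [eLpNorm_congr_ae h1]
    refine (sq_eLpNorm_cube_le _).trans ?_
    calc ∫⁻ w, ‖ft (g - g') w‖ₑ ^ 2
        ≤ ∫⁻ w, ENNReal.ofReal (v ^ (-(s / S))) * (sobolevWeight d s w * ‖ft g w‖ₑ ^ 2) := by
          refine lintegral_mono_ae ?_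
          rw [map_sub]
          filter_upwards [hg', Lp.coeFn_sub (ft g) (ft g')] with w hw hw2
          rw [hw2, Pi.sub_apply, hw]
          by_cases h : ‖w‖ ≤ ρ
          · simp [hm, h]
          · simp only [hm, h, if_false, Complex.ofReal_zero, zero_mul, sub_zero]
            rw [← mul_assoc, sobolevWeight_eq, ← ENNReal.ofReal_mul (by positivity)]
            refine le_mul_of_one_le_left' ?_
            rw [ENNReal.one_le_ofReal, Real.rpow_neg hv0.le, ← hρpow, ← div_eq_inv_mul,
              one_le_div (by positivity)]
            exact (Real.rpow_le_rpow (by positivity) (not_le.1 h).le (by positivity)).trans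
              (rpow_le_realWeight hs le_rfl w)
      _ = ENNReal.ofReal (v ^ (-(s / S))) * sobolevNorm s g ^ 2 := by
          rw [lintegral_const_mul' _ _ ENNReal.ofReal_ne_top, sobolevNorm_sq]
      _ ≤ ENNReal.ofReal (v ^ (-(s / S))) * ENNReal.ofReal L' ^ 2 :=
          mul_le_mul_right (pow_le_pow_left' hgL 2) _
      _ ≤ _ := by
          rw [← ENNReal.ofReal_pow hL'0.le, ← ENNReal.ofReal_mul (by positivity)]
          refine ENNReal.ofReal_le_ofReal ?_
          rw [mul_comm]
          gcongr
          exact le_mul_of_one_le_left (by positivity) h41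
  · have h1 : (cubeSobolevNorm S fun x : cube d ↦ contRep g' x).toReal ^ 2 ≤
        41 ^ (S - s) * v ^ ((S - s) / S) * L' ^ 2 := by
      rw [← ENNReal.toReal_pow]
      exact ENNReal.toReal_le_of_le_ofReal (by positivity) ((pow_le_pow_left' hle 2).trans hfin)
    calc _ ≤ 1 / v * (41 ^ (S - s) * v ^ ((S - s) / S) * L' ^ 2) := by gcongr
      _ = 41 ^ (S - s) * L' ^ 2 * (v ^ (-1 : ℝ) * v ^ ((S - s) / S)) := by
          rw [Real.rpow_neg_one]
          ring
      _ = _ := by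
          rw [← Real.rpow_add hv0]
          congr 2
          field_simp
          ring

end Approximation

/-! ### Frequency truncation of the estimate: oscillation and bias -/

section Truncation

variable {d : ℕ} {S : ℝ} {T : Lp ℝ 2 (volume : Measure (cube d)) →ₗ[ℝ]
  Lp ℝ 2 (volume : Measure (EuclideanSpace ℝ (Fin d)))}

theorem cutoff_mem_Icc (x : EuclideanSpace ℝ (Fin d)) : cutoff x ∈ Icc (0 : ℝ) 1 := by
  unfold cutoff
  exact ⟨by linarith [Real.smoothTransition.le_one ((4 * ‖x‖ ^ 2 - 1) / 3)],
    by linarith [Real.smoothTransition.nonneg ((4 * ‖x‖ ^ 2 - 1) / 3)]⟩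

theorem cutoff_eq_zero {x : EuclideanSpace ℝ (Fin d)} (h : 1 ≤ ‖x‖) : cutoff x = 0 := by
  rw [cutoff, Real.smoothTransition.one_of_one_le (by nlinarith), sub_self]

theorem cutoff_eq_one {x : EuclideanSpace ℝ (Fin d)} (h : ‖x‖ ≤ 1 / 2) : cutoff x = 1 := by
  rw [cutoff, Real.smoothTransition.zero_of_nonpos (by nlinarith [norm_nonneg x]), sub_zero]

theorem continuous_cutoff : Continuous (cutoff : EuclideanSpace ℝ (Fin d) → ℝ) := by
  unfold cutoff
  exact continuous_const.sub (Real.smoothTransition.continuous.comp (by fun_prop))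

set_option maxHeartbeats 1600000 in
/-- Stochastic and deterministic errors of the truncated estimator, and its local oscillation. -/
theorem exists_freqTruncate_bounds (hT : IsSobolevExtension S T) (hS : (d : ℝ) / 2 < S) {s : ℝ}
    (hs : 0 < s) (hsS : s ≤ S) (L : ℝ) : ∃ C : ℝ≥0, ∀ f ∈ sobolevBall d s L, MemLp f 2 volume →
      ∀ e ∈ rkhs d S, ∀ r : ℝ, 0 ≤ r →
      (∫⁻ x, ⨆ (x' : cube d) (_ : dist x' x ≤ r), ENNReal.ofReal
        (|freqTruncate r (T (toL2 e)) x' - freqTruncate r (T (toL2 e)) x| ^ 2)) ≤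
          C * (eLpNorm (e - f) 2 volume ^ 2 + ENNReal.ofReal (r ^ (2 * min 1 s))) ∧
      eLpNorm (freqTruncate r (T (toL2 e)) - f) 2 volume ^ 2 ≤
          C * (eLpNorm (e - f) 2 volume ^ 2 + ENNReal.ofReal (r ^ (2 * min 1 s))) ∧
      Measurable (freqTruncate r (T (toL2 e))) := by
  have hS0 : 0 < S := lt_of_le_of_lt (by positivity) hS
  obtain ⟨B₀, hB₀⟩ := hT.exists_enorm_le hS0.le
  obtain ⟨B, hB⟩ := hT.exists_sobolevNorm_le (t := s) ⟨hs.le, hsS⟩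
  obtain ⟨C₁, hC₁⟩ := exists_oscillation_majorant (d := d) hS
  set a : ℝ := min 1 s with ha
  have ha0 : 0 < a := lt_min one_pos hs
  have ha1 : a ≤ 1 := min_le_left _ _
  have has : a ≤ s := min_le_right _ _
  set N : ℝ≥0 := B₀ ^ 2 + (B * Real.toNNReal L) ^ 2 with hN
  set K : ℝ≥0 := Real.toNNReal (4 ^ S) with hK
  set K₂ : ℝ≥0 := Real.toNNReal ((4 * Real.pi) ^ 2) with hK₂
  refine ⟨C₁ * (K * (2 * N)) + 2 * (N + K₂ * N), fun f hf hfL e he r hr ↦ ?_⟩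
  have heL := memLp_of_continuous he.1 (q := 2)
  set u := T (toL2 e) with hu
  set g := T (toL2 f) with hg
  set ε : ℝ≥0∞ := eLpNorm (e - f) 2 volume with hε
  set R : ℝ≥0∞ := ENNReal.ofReal (r ^ (2 * a)) with hR
  have hfin : sobolevNorm S u ≠ ∞ := hT.sobolevNorm_ne_top hS0.le he
  have hint : Integrable (ft u) := integrable_ft hS hfin
  have hgf : (fun x : cube d ↦ g (x : EuclideanSpace ℝ (Fin d))) =ᵐ[volume] f := hT.extends_toL2 hfL
  have hug : ‖u - g‖ₑ ^ 2 ≤ N * ε ^ 2 := by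
    have h1 : ‖u - g‖ₑ ≤ B₀ * ε := by
      rw [hu, hg, ← map_sub]
      refine (hB₀ _).trans (mul_le_mul_right ?_ _)
      have h2 : toL2 e - toL2 f = toL2 (e - f) := by
        refine Lp.ext ?_
        filter_upwards [Lp.coeFn_sub (toL2 e) (toL2 f), toL2_ae heL, toL2_ae hfL,
          toL2_ae (heL.sub hfL)] with x h1 h2 h3 h4
        rw [h1, h4, Pi.sub_apply, Pi.sub_apply, h2, h3]
      rw [h2, enorm_toL2 (heL.sub hfL)]
    refine (pow_le_pow_left' h1 2).trans ?_
    rw [mul_pow]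
    refine mul_le_mul_left ?_ _
    rw [hN]
    push_cast
    exact le_self_add
  have hgs : sobolevNorm s g ^ 2 ≤ N := by
    have h1 : sobolevNorm s g ≤ B * ENNReal.ofReal L :=
      (hB f hfL).trans (mul_le_mul_right hf _)
    refine (pow_le_pow_left' h1 2).trans ?_
    rw [hN]
    push_cast
    exact le_add_self
  have hugft : ∫⁻ w, ‖ft u w - ft g w‖ₑ ^ 2 ≤ N * ε ^ 2 := by
    rw [← enorm_ft, Lp.enorm_def, sq_eLpNorm_two] at hug
    refine le_trans (le_of_eq (lintegral_congr_ae ?_)) hug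
    rw [map_sub]
    filter_upwards [Lp.coeFn_sub (ft u) (ft g)] with w hw
    rw [hw, Pi.sub_apply]
  have hgR : ∫⁻ w, ENNReal.ofReal ((r * ‖w‖) ^ (2 * a)) * ‖ft g w‖ₑ ^ 2 ≤ N * R := by
    calc _ ≤ ∫⁻ w, R * (sobolevWeight d s w * ‖ft g w‖ₑ ^ 2) := by
          refine lintegral_mono fun w ↦ ?_
          simp only
          rw [← mul_assoc, sobolevWeight_eq, hR, ← ENNReal.ofReal_mul (by positivity),
            Real.mul_rpow hr (norm_nonneg _)]
          refine mul_le_mul_left (ENNReal.ofReal_le_ofReal ?_) _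
          exact mul_le_mul_of_nonneg_left (rpow_le_realWeight ha0.le has w) (by positivity)
      _ = R * sobolevNorm s g ^ 2 := by
          rw [lintegral_const_mul' _ _ ENNReal.ofReal_ne_top, sobolevNorm_sq]
      _ ≤ R * N := mul_le_mul_right hgs _
      _ = _ := mul_comm _ _
  set m : EuclideanSpace ℝ (Fin d) → ℝ := fun w ↦ cutoff (r • (2 * Real.pi) • w) with hm
  have hmc : Continuous m := continuous_cutoff.comp (by fun_prop)
  have hm01 : ∀ w, m w ∈ Icc (0 : ℝ) 1 := fun w ↦ cutoff_mem_Icc _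
  have hnorm : ∀ w : EuclideanSpace ℝ (Fin d), ‖r • (2 * Real.pi) • w‖ = 2 * Real.pi * (r * ‖w‖) := by
    intro w
    rw [norm_smul, norm_smul, Real.norm_eq_abs, Real.norm_eq_abs, abs_of_nonneg hr,
      abs_of_pos (by positivity)]
    ring
  have hmn : ∀ w, ‖(m w : ℂ)‖ ≤ 1 := fun w ↦ by
    rw [Complex.norm_real, Real.norm_eq_abs, abs_of_nonneg (hm01 w).1]
    exact (hm01 w).2
  have hpi := Real.pi_gt_three
  set h : EuclideanSpace ℝ (Fin d) → ℂ := fun w ↦ ft u w * (m w : ℂ) with hh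
  have hhm : StronglyMeasurable h := (Lp.stronglyMeasurable (ft u)).mul
    (Complex.continuous_ofReal.comp hmc).stronglyMeasurable
  have hhle : ∀ w, ‖h w‖ ≤ ‖ft u w‖ := fun w ↦ by
    rw [hh, norm_mul]
    exact mul_le_of_le_one_right (norm_nonneg _) (hmn w)
  have hhi : Integrable h :=
    hint.norm.mono' hhm.aestronglyMeasurable (Filter.Eventually.of_forall hhle)
  have hh2 : MemLp h 2 := (Lp.memLp (ft u)).of_le hhm.aestronglyMeasurable
    (Filter.Eventually.of_forall hhle)
  have hF : freqTruncate r u = fun x : cube d ↦ (𝓕⁻ h (x : EuclideanSpace ℝ (Fin d))).re :=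
    funext fun x ↦ freqTruncate_eq r u x
  refine ⟨?_, ?_, ?_⟩
  · obtain ⟨M, hMm, hM1, hM2⟩ := hC₁ h hhm hhi hh2 r hr
    have h1 : ∫⁻ w, ENNReal.ofReal (oscWeight S (r * ‖w‖)) * ‖h w‖ₑ ^ 2 ≤
        K * (2 * N * (ε ^ 2 + R)) := by
      calc _ ≤ ∫⁻ w, K * (2 * (‖ft u w - ft g w‖ₑ ^ 2 +
            ENNReal.ofReal ((r * ‖w‖) ^ (2 * a)) * ‖ft g w‖ₑ ^ 2)) := by
            refine lintegral_mono fun w ↦ ?_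
            simp only
            -- Frequencies in the first case are removed by the cut-off. In the second, t = r|w| is
            -- at most one, so the oscillation weight is at most 4^S t² ≤ 4^S t^(2a). This factor is
            -- dropped on the stochastic part `u - g` and kept on the target `g`.
            rcases le_or_gt 1 (2 * Real.pi * (r * ‖w‖)) with h1 | h1
            · have : h w = 0 := by
                simp [hh, hm, cutoff_eq_zero (x := r • (2 * Real.pi) • w) (by rwa [hnorm])]
              simp [this]
            · have ht0 : 0 ≤ r * ‖w‖ := by positivity
              have ht1 : r * ‖w‖ ≤ 1 := by nlinarith
              set t : ℝ := r * ‖w‖ with ht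
              have h4 : (2 : ℝ) ^ (2 * S) = 4 ^ S := by
                rw [Real.rpow_mul (by norm_num)]
                norm_num
              have hta : t ^ 2 ≤ t ^ (2 * a) := by
                rcases ht0.eq_or_lt with h0 | h0
                · rw [← h0]
                  simp [Real.zero_rpow (by positivity : 2 * a ≠ 0)]
                · rw [← Real.rpow_two]
                  exact Real.rpow_le_rpow_of_exponent_ge h0 ht1 (by linarith)
              have hta1 : t ^ (2 * a) ≤ 1 := Real.rpow_le_one ht0 ht1 (by positivity)
              have ho : oscWeight S t ≤ 4 ^ S * t ^ (2 * a) := by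
                rw [oscWeight, min_eq_right ht1, ← h4, mul_comm]
                refine mul_le_mul (Real.rpow_le_rpow (by positivity) (by linarith) (by positivity))
                  hta (by positivity) (by positivity)
              have hhw : ‖h w‖ₑ ^ 2 ≤ 2 * (‖ft u w - ft g w‖ₑ ^ 2 + ‖ft g w‖ₑ ^ 2) := by
                refine (pow_le_pow_left' ((enorm_le_iff_norm_le.2 (hhle w)).trans ?_) 2).trans
                  (sq_add_le_two_mul _ _)
                calc ‖ft u w‖ₑ = ‖(ft u w - ft g w) + ft g w‖ₑ := by rw [sub_add_cancel]
                  _ ≤ _ := enorm_add_le _ _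
              calc _ ≤ ENNReal.ofReal (4 ^ S * t ^ (2 * a)) *
                    (2 * (‖ft u w - ft g w‖ₑ ^ 2 + ‖ft g w‖ₑ ^ 2)) :=
                    mul_le_mul' (ENNReal.ofReal_le_ofReal ho) hhw
                _ = K * (2 * (ENNReal.ofReal (t ^ (2 * a)) * ‖ft u w - ft g w‖ₑ ^ 2 +
                      ENNReal.ofReal (t ^ (2 * a)) * ‖ft g w‖ₑ ^ 2)) := by
                    rw [ENNReal.ofReal_mul (by positivity), ← mul_add]
                    change ENNReal.ofReal (4 ^ S) * _ * _ = ENNReal.ofReal (4 ^ S) * _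
                    ring
                _ ≤ _ := by
                    refine mul_le_mul_right (mul_le_mul_right (add_le_add ?_ le_rfl) _) _
                    refine mul_le_of_le_one_left' ?_
                    rw [ENNReal.ofReal_le_one]
                    exact hta1
        _ = K * (2 * ((∫⁻ w, ‖ft u w - ft g w‖ₑ ^ 2) +
              ∫⁻ w, ENNReal.ofReal ((r * ‖w‖) ^ (2 * a)) * ‖ft g w‖ₑ ^ 2)) := by
            rw [lintegral_const_mul' _ _ ENNReal.coe_ne_top, lintegral_const_mul' _ _ (by simp),
              lintegral_add_left]
            exact ((Lp.stronglyMeasurable (ft u)).sub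
              (Lp.stronglyMeasurable (ft g))).measurable.enorm.pow_const 2
        _ ≤ K * (2 * (N * ε ^ 2 + N * R)) :=
            mul_le_mul_right (mul_le_mul_right (add_le_add hugft hgR) _) _
        _ = _ := by ring
    calc _ ≤ ∫⁻ x : cube d, M x := by
          refine lintegral_mono fun x ↦ iSup₂_le fun x' hx' ↦ ?_
          refine le_trans ?_ (hM1 x x' hx')
          rw [hF, ← ofReal_norm, ← ENNReal.ofReal_pow (norm_nonneg _)]
          refine ENNReal.ofReal_le_ofReal (pow_le_pow_left₀ (abs_nonneg _) ?_ 2)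
          rw [← Complex.sub_re]
          exact Complex.abs_re_le_norm _
      _ ≤ ∫⁻ x, M x := lintegral_cube_le hMm.aemeasurable
      _ ≤ C₁ * (K * (2 * N * (ε ^ 2 + R))) := hM2.trans (mul_le_mul_right h1 _)
      _ = ((C₁ * (K * (2 * N)) : ℝ≥0) : ℝ≥0∞) * (ε ^ 2 + R) := by
          push_cast
          ring
      _ ≤ _ := by
          refine mul_le_mul_left ?_ _
          exact_mod_cast le_self_add
  · obtain ⟨u', hu'⟩ := exists_real_multiplier u hmc.measurable
      (fun w ↦ by simp [hm, cutoff, norm_smul]) (c := 1) (fun w ↦ by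
        rw [abs_of_nonneg (hm01 w).1]
        exact (hm01 w).2)
    have hu'h : (ft u' : EuclideanSpace ℝ (Fin d) → ℂ) =ᵐ[volume] h := by
      filter_upwards [hu'] with w hw
      rw [hw, hh, mul_comm]
    have hinv : 𝓕⁻ (ft u' : EuclideanSpace ℝ (Fin d) → ℂ) = 𝓕⁻ h := by
      ext x
      rw [Real.fourierInv_eq, Real.fourierInv_eq]
      refine integral_congr_ae ?_
      filter_upwards [hu'h] with w hw
      rw [hw]
    have hFae : (freqTruncate r u - f) =ᵐ[volume] fun x : cube d ↦
        (u' - g : Lp ℝ 2 (volume : Measure (EuclideanSpace ℝ (Fin d))))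
          (x : EuclideanSpace ℝ (Fin d)) := by
      filter_upwards [hgf, ae_cube_of_ae (ae_eq_fourierInv_ft (hhi.congr hu'h.symm)),
        ae_cube_of_ae (Lp.coeFn_sub u' g)] with x h1 h2 h3
      rw [h3, Pi.sub_apply, Pi.sub_apply, ← h1, h2, hF, hinv]
    rw [eLpNorm_congr_ae hFae]
    refine (sq_eLpNorm_cube_le _).trans ?_
    calc ∫⁻ w, ‖ft (u' - g) w‖ₑ ^ 2
        ≤ ∫⁻ w, 2 * (‖ft u w - ft g w‖ₑ ^ 2 +
            K₂ * (ENNReal.ofReal ((r * ‖w‖) ^ (2 * a)) * ‖ft g w‖ₑ ^ 2)) := by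
          refine lintegral_mono_ae ?_
          rw [map_sub]
          filter_upwards [hu', Lp.coeFn_sub (ft u') (ft g)] with w hw hw2
          rw [hw2, Pi.sub_apply, hw]
          have h1 : (m w : ℂ) * ft u w - ft g w =
              m w * (ft u w - ft g w) + ((m w - 1 : ℝ) : ℂ) * ft g w := by
            push_cast
            ring
          rw [h1]
          refine (pow_le_pow_left' (enorm_add_le _ _) 2).trans ((sq_add_le_two_mul _ _).trans ?_)
          refine mul_le_mul_right (add_le_add ?_ ?_) _
          · refine pow_le_pow_left' ?_ 2
            rw [enorm_mul]
            refine mul_le_of_le_one_left' ?_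
            rw [← ofReal_norm, ENNReal.ofReal_le_one]
            exact hmn w
          · rw [enorm_mul, mul_pow, ← mul_assoc]
            refine mul_le_mul_left ?_ _
            -- The cut-off has no bias where it equals one. Elsewhere 4πr|w| > 1, so the bias
            -- factor, at most one, is dominated by (4πr|w|)^(2a).
            rcases le_or_gt (2 * Real.pi * (r * ‖w‖)) (1 / 2) with h2 | h2
            · have : m w = 1 := cutoff_eq_one (by rwa [hnorm])
              simp [this]
            · have h3 : ‖((m w - 1 : ℝ) : ℂ)‖ₑ ^ 2 ≤ 1 := by
                refine pow_le_one' ?_ 2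
                rw [← ofReal_norm, ENNReal.ofReal_le_one, Complex.norm_real, Real.norm_eq_abs,
                  abs_le]
                constructor <;> linarith [(hm01 w).1, (hm01 w).2]
              refine h3.trans ?_
              change 1 ≤ ENNReal.ofReal ((4 * Real.pi) ^ 2) * _
              rw [← ENNReal.ofReal_mul (by positivity), ENNReal.one_le_ofReal]
              have h4 : (4 * Real.pi) ^ (2 * a) ≤ (4 * Real.pi) ^ 2 := by
                rw [← Real.rpow_two]
                exact Real.rpow_le_rpow_of_exponent_le (by linarith) (by linarith)
              calc (1 : ℝ) ≤ (4 * Real.pi * (r * ‖w‖)) ^ (2 * a) :=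
                    Real.one_le_rpow (by linarith) (by positivity)
                _ = (4 * Real.pi) ^ (2 * a) * (r * ‖w‖) ^ (2 * a) :=
                    Real.mul_rpow (by positivity) (by positivity)
                _ ≤ _ := by gcongr
      _ = 2 * ((∫⁻ w, ‖ft u w - ft g w‖ₑ ^ 2) +
            K₂ * ∫⁻ w, ENNReal.ofReal ((r * ‖w‖) ^ (2 * a)) * ‖ft g w‖ₑ ^ 2) := by
          rw [lintegral_const_mul' _ _ (by simp), lintegral_add_left,
            lintegral_const_mul' _ _ ENNReal.coe_ne_top]
          exact ((Lp.stronglyMeasurable (ft u)).sub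
            (Lp.stronglyMeasurable (ft g))).measurable.enorm.pow_const 2
      _ ≤ 2 * (N * ε ^ 2 + K₂ * (N * R)) :=
          mul_le_mul_right (add_le_add hugft (mul_le_mul_right hgR _)) _
      _ ≤ 2 * ((N + K₂ * N) * (ε ^ 2 + R)) := by
          refine mul_le_mul_right ?_ _
          rw [add_mul, mul_add, mul_add]
          calc (N : ℝ≥0∞) * ε ^ 2 + K₂ * (N * R) ≤ (N * ε ^ 2 + N * R) + (K₂ * N * ε ^ 2 + K₂ * N * R) := by
                refine add_le_add le_self_add ?_
                rw [mul_assoc _ _ R]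
                exact le_add_self
            _ = _ := rfl
      _ = ((2 * (N + K₂ * N) : ℝ≥0) : ℝ≥0∞) * (ε ^ 2 + R) := by
          push_cast
          ring
      _ ≤ _ := by
          refine mul_le_mul_left ?_ _
          exact_mod_cast le_add_self
  · rw [hF]
    exact Complex.measurable_re.comp
      ((continuous_fourierInv_integral hhi).measurable.comp measurable_subtype_coe)

end Truncation

theorem one_le_three_mul_log {n : ℕ} (hn : 2 ≤ n) : 1 ≤ 3 * Real.log n := by
  have h1 : Real.log 2 ≤ Real.log n := Real.log_le_log (by norm_num) (by exact_mod_cast hn)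
  linarith [Real.log_two_gt_d9]

/-- The observations built from design points and noise. -/
def observe {d n : ℕ} (f : cube d → ℝ) (ω : Fin n → cube d × ℝ) : Fin n → cube d × ℝ :=
  fun i ↦ ((ω i).1, f (ω i).1 + (ω i).2)

/-! ### Probability bounds for a fixed regularization parameter -/

section Tail

variable {d : ℕ} {S : ℝ} {T : Lp ℝ 2 (volume : Measure (cube d)) →ₗ[ℝ]
  Lp ℝ 2 (volume : Measure (EuclideanSpace ℝ (Fin d)))}

theorem integral_sq_le_of_le {P : Measure (cube d)} {CX : ℝ≥0} (hP : P ≤ CX • volume)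
    {b : cube d → ℝ} (hb : MemLp b 2 volume) {K : ℝ} (hK : 0 ≤ K)
    (h : eLpNorm b 2 volume ^ 2 ≤ ENNReal.ofReal K) :
    MemLp b 2 P ∧ ∫ x, b x ^ 2 ∂P ≤ CX * K := by
  have hb' : MemLp b 2 P := (hb.smul_measure (c := (CX : ℝ≥0∞)) ENNReal.coe_ne_top).mono_measure hP
  refine ⟨hb', ?_⟩
  have h1 : ∫ x, b x ^ 2 ∂P = (∫⁻ x, ‖b x‖ₑ ^ 2 ∂P).toReal := by
    rw [integral_eq_lintegral_of_nonneg_ae (Filter.Eventually.of_forall fun x ↦ sq_nonneg _)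
      (hb'.aestronglyMeasurable.pow 2)]
    congr 1
    refine lintegral_congr fun x ↦ ?_
    rw [← ofReal_norm, ← ENNReal.ofReal_pow (norm_nonneg _), Real.norm_eq_abs, sq_abs]
  rw [h1]
  refine ENNReal.toReal_le_of_le_ofReal (by positivity) ?_
  calc _ ≤ ∫⁻ x, ‖b x‖ₑ ^ 2 ∂(CX • volume : Measure (cube d)) := lintegral_mono' hP le_rfl
    _ = CX * eLpNorm b 2 volume ^ 2 := by
        rw [sq_eLpNorm_two, lintegral_smul_measure]
        rfl
    _ ≤ CX * ENNReal.ofReal K := mul_le_mul_right h _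
    _ = _ := by
        rw [ENNReal.ofReal_mul (by positivity), ENNReal.ofReal_coe_nnreal]

set_option maxHeartbeats 1600000 in
/-- Tail bound for the error of kernel ridge regression with a fixed parameter, on the event that
the design points resolve the Sobolev functions. -/
theorem exists_krr_tail (hT : IsSobolevExtension S T) (hS : (d : ℝ) / 2 < S) {s : ℝ} (hs : 0 ≤ s)
    (hsS : s ≤ S) (L : ℝ) (σ CX : ℝ≥0) {C₀ : ℝ} (hC₀ : 0 ≤ C₀) : ∃ C : ℝ, 0 < C ∧
      ∀ n : ℕ, 2 ≤ n → ∀ P : Measure (cube d), IsProbabilityMeasure P → P ≤ CX • volume →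
      ∀ ν : Measure ℝ, IsProbabilityMeasure ν → HasSubgaussianMGF (fun y : ℝ ↦ y) (σ ^ 2) ν →
      ∀ f ∈ sobolevBall d s L, Measurable f → MemLp f 2 volume → ∀ v : ℝ, 1 ≤ v →
      (Measure.pi fun _ : Fin n ↦ P.prod ν)
        {ω | (∀ e ∈ rkhs d S, (eLpNorm e 2 volume).toReal ^ 2 ≤ C₀ *
            (1 / (n : ℝ) * ∑ i, e (ω i).1 ^ 2 + 1 / v * (cubeSobolevNorm S e).toReal ^ 2)) ∧
          ENNReal.ofReal (C * (Real.log n ^ 2 * v ^ (d / (2 * S)) / n + v ^ (-(s / S)))) <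
            eLpNorm (krr S v (observe f ω) - f) 2 volume ^ 2} ≤
        ENNReal.ofReal (C * (((n : ℝ) ^ 2)⁻¹ + v ^ (-(s / S)))) := by
  have hS0 : 0 < S := lt_of_le_of_lt (by positivity) hS
  obtain ⟨C₁, hC₁0, hC₁⟩ := exists_krr_error hT hS C₀ hC₀ CX
  obtain ⟨C₂, hC₂0, hC₂⟩ := exists_low_frequency_approximation hS hs hsS L
  have hIfin := lintegral_inv_one_add_norm_lt_top (d := d) (r := 2 * S) (by linarith)
  set I : ℝ := (∫⁻ w : EuclideanSpace ℝ (Fin d), ENNReal.ofReal ((1 + ‖w‖) ^ (-(2 * S)))).toReal + 1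
    with hI
  have hI0 : 0 < I := by positivity
  have hIw : ∫⁻ w : EuclideanSpace ℝ (Fin d), ENNReal.ofReal ((1 + ‖w‖) ^ (-(2 * S))) ≤
      ENNReal.ofReal I := by
    rw [← ENNReal.ofReal_toReal hIfin.ne]
    exact ENNReal.ofReal_le_ofReal (by rw [hI]; linarith)
  set A : ℝ := 2 * (Real.exp 2 * I * (128 * (σ + 1) ^ 2) + 9 * I) with hA
  have hA0 : 0 < A := by positivity
  refine ⟨4 * C₁ * A + (4 * C₁ * C₂ + 2 * C₂) + 4 + CX * C₂, by positivity,
    fun n hn P hP hPle ν hν hsub f hf hfm hfL v hv ↦ ?_⟩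
  have hn0 : 0 < n := by omega
  have hn' : (0 : ℝ) < n := by exact_mod_cast hn0
  have hv0 : 0 < v := by linarith
  have hlog := one_le_three_mul_log hn
  obtain ⟨f₀, hf₀, hb1, hb2⟩ := hC₂ f hf v hv
  set τ : ℝ := v ^ (-(s / S)) with hτ
  have hτ0 : 0 < τ := by positivity
  set b : cube d → ℝ := f - f₀ with hb
  have hbm : Measurable b := hfm.sub hf₀.1.measurable
  have hbL : MemLp b 2 volume := hfL.sub (memLp_of_continuous hf₀.1)
  obtain ⟨hbP, hbint⟩ := integral_sq_le_of_le hPle hbL (by positivity) hb1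
  have hbreal : (eLpNorm b 2 volume).toReal ^ 2 ≤ C₂ * τ := by
    rw [← ENNReal.toReal_pow]
    exact ENNReal.toReal_le_of_le_ofReal (by positivity) hb1
  set δ : ℝ := v ^ (-(1 / (2 * S))) with hδ
  have hδ0 : 0 < δ := by positivity
  have hδd : (δ ^ d)⁻¹ = v ^ (d / (2 * S)) := by
    rw [hδ, ← Real.rpow_natCast, ← Real.rpow_mul hv0.le, ← Real.rpow_neg hv0.le]
    congr 1
    ring
  -- The moment order. Its square is the source of the factor log² n in the stochastic error.
  set k : ℕ := ⌈Real.log n⌉₊ with hk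
  have hk1 : 1 ≤ k := Nat.one_le_ceil_iff.2 (by linarith)
  have hkn : Real.log n ≤ k := Nat.le_ceil _
  have hk3 : (k : ℝ) ≤ 4 * Real.log n := by
    have := Nat.ceil_lt_add_one (a := Real.log n) (by linarith)
    linarith
  set W : ℝ := Real.log n ^ 2 * v ^ (d / (2 * S)) / n with hW
  have hW0 : 0 < W := by
    have : 0 < Real.log n := by linarith
    positivity
  set uξ : ℝ := Real.exp 2 * (I * (δ ^ d)⁻¹ * (8 * k ^ 2 * (σ + 1) ^ 2 / n)) with huξ
  set ub : ℝ := I * (δ ^ d)⁻¹ / n with hub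
  have hu : 2 * (uξ + ub) ≤ 2 * A * W := by
    have h1 : (k : ℝ) ^ 2 ≤ 16 * Real.log n ^ 2 := by
      have : (k : ℝ) ^ 2 ≤ (4 * Real.log n) ^ 2 := by gcongr
      linarith
    have h2 : (1 : ℝ) ≤ 9 * Real.log n ^ 2 := by nlinarith
    have h3 : uξ ≤ Real.exp 2 * I * (128 * (σ + 1) ^ 2) * W := by
      rw [huξ, hδd, hW]
      calc _ = Real.exp 2 * I * (8 * (σ + 1) ^ 2) * (v ^ (d / (2 * S)) / n) * (k : ℝ) ^ 2 := by ring
        _ ≤ Real.exp 2 * I * (8 * (σ + 1) ^ 2) * (v ^ (d / (2 * S)) / n) *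
            (16 * Real.log n ^ 2) := by gcongr
        _ = _ := by ring
    have h4 : ub ≤ 9 * I * W := by
      rw [hub, hδd, hW]
      calc _ = I * (v ^ (d / (2 * S)) / n) * 1 := by ring
        _ ≤ I * (v ^ (d / (2 * S)) / n) * (9 * Real.log n ^ 2) := by gcongr
        _ = _ := by ring
    have h5 : 0 ≤ Real.exp 2 * I * (σ + 1) ^ 2 * W := by positivity
    rw [hA]
    nlinarith [mul_pos hI0 hW0]
  set Q := Measure.pi fun _ : Fin n ↦ P.prod ν
  have hsubset : {ω : Fin n → cube d × ℝ | (∀ e ∈ rkhs d S, (eLpNorm e 2 volume).toReal ^ 2 ≤ C₀ *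
            (1 / (n : ℝ) * ∑ i, e (ω i).1 ^ 2 + 1 / v * (cubeSobolevNorm S e).toReal ^ 2)) ∧
          ENNReal.ofReal ((4 * C₁ * A + (4 * C₁ * C₂ + 2 * C₂) + 4 + CX * C₂) * (W + τ)) <
            eLpNorm (krr S v (observe f ω) - f) 2 volume ^ 2} ⊆
      {ω | ENNReal.ofReal uξ ≤ fluctSq S δ P 0 (fun i ↦ (ω i).2) (fun i ↦ (ω i).1)} ∪
      {ω | ENNReal.ofReal ub ≤ fluctSq S δ P b (fun i ↦ b (ω i).1) (fun i ↦ (ω i).1)} := by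
    rintro ω ⟨hsamp, hlt⟩
    by_contra hcon
    simp only [mem_union, mem_ofPred_eq, not_or, not_le] at hcon
    refine absurd hlt (not_lt.2 ?_)
    have hfl : fluctSq S δ P b (fun i ↦ (observe f ω i).2 - f₀ (observe f ω i).1)
        (fun i ↦ (observe f ω i).1) ≤ ENNReal.ofReal (2 * A * W) := by
      -- The residual with respect to `f₀` is noise plus approximation error; only the second part
      -- needs centring.
      have h1 : (fun i ↦ (observe f ω i).2 - f₀ (observe f ω i).1) =
          fun i ↦ (ω i).2 + b (ω i).1 := by
        funext i
        simp only [observe, hb, Pi.sub_apply]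
        ring
      rw [h1]
      refine (fluctSq_add_le S δ P b (fun i ↦ (ω i).2) (fun i ↦ b (ω i).1) _).trans ?_
      calc _ ≤ 2 * (ENNReal.ofReal uξ + ENNReal.ofReal ub) :=
            mul_le_mul_right (add_le_add hcon.1.le hcon.2.le) _
        _ = ENNReal.ofReal (2 * (uξ + ub)) := by
            rw [ENNReal.ofReal_mul zero_le_two, ENNReal.ofReal_add (by positivity) (by positivity),
              ENNReal.ofReal_ofNat]
        _ ≤ _ := ENNReal.ofReal_le_ofReal hu
    have herr := hC₁ n P hP hPle (observe f ω) v hv0 hsamp f₀ hf₀ b hbL (2 * A * W) (by positivity) hfl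
    have hkrr := (krr_spec hS hv0 (observe f ω)).1
    have heL : MemLp (krr S v (observe f ω) - f₀) 2 volume :=
      (memLp_of_continuous hkrr.1).sub (memLp_of_continuous hf₀.1)
    have h2 : eLpNorm (krr S v (observe f ω) - f₀) 2 volume ^ 2 ≤
        ENNReal.ofReal (C₁ * (2 * A * W + C₂ * τ + C₂ * τ)) := by
      rw [← ENNReal.ofReal_toReal (ENNReal.pow_ne_top heL.eLpNorm_ne_top), ENNReal.toReal_pow]
      refine ENNReal.ofReal_le_ofReal (herr.trans ?_)
      gcongr
    have h3 : eLpNorm (krr S v (observe f ω) - f) 2 volume ≤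
        eLpNorm (krr S v (observe f ω) - f₀) 2 volume + eLpNorm b 2 volume := by
      have : krr S v (observe f ω) - f = (krr S v (observe f ω) - f₀) - b := by
        rw [hb]
        abel
      rw [this]
      exact eLpNorm_sub_le heL.aestronglyMeasurable hbL.aestronglyMeasurable (by norm_num)
    calc _ ≤ (eLpNorm (krr S v (observe f ω) - f₀) 2 volume + eLpNorm b 2 volume) ^ 2 :=
          pow_le_pow_left' h3 2
      _ ≤ 2 * (eLpNorm (krr S v (observe f ω) - f₀) 2 volume ^ 2 + eLpNorm b 2 volume ^ 2) :=
          sq_add_le_two_mul _ _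
      _ ≤ 2 * (ENNReal.ofReal (C₁ * (2 * A * W + C₂ * τ + C₂ * τ)) + ENNReal.ofReal (C₂ * τ)) :=
          mul_le_mul_right (add_le_add h2 hb1) _
      _ = ENNReal.ofReal (2 * (C₁ * (2 * A * W + C₂ * τ + C₂ * τ) + C₂ * τ)) := by
          rw [ENNReal.ofReal_mul zero_le_two, ENNReal.ofReal_add (by positivity) (by positivity),
            ENNReal.ofReal_ofNat]
      _ ≤ _ := by
          refine ENNReal.ofReal_le_ofReal ?_
          have hCX : (0 : ℝ) ≤ CX * C₂ := by positivity
          have h5 : 0 ≤ C₁ * A * W := by positivity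
          have h6 : 0 ≤ C₁ * A * τ := by positivity
          have h7 : 0 ≤ (C₁ * C₂) * W := by positivity
          have h8 : 0 ≤ C₂ * W := by positivity
          have h9 : 0 ≤ (CX * C₂ : ℝ) * W := by positivity
          have h10 : 0 ≤ (CX * C₂ : ℝ) * τ := by positivity
          nlinarith
  refine (measure_mono hsubset).trans ((measure_union_le _ _).trans ?_)
  refine (add_le_add (noise_tail_le hδ0 hn0 hk1 hkn hI0 hIw hsub)
    (centred_tail_le hδ0 hn0 hI0 hIw hbm hbP)).trans ?_
  rw [← ENNReal.ofReal_add (by positivity) (integral_nonneg fun x ↦ sq_nonneg _)]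
  refine ENNReal.ofReal_le_ofReal ?_
  set N : ℝ := ((n : ℝ) ^ 2)⁻¹ with hN
  have hN0 : 0 < N := by positivity
  have hCX : (0 : ℝ) ≤ CX * C₂ := by positivity
  have e1 : 0 ≤ (4 * C₁ * A + (4 * C₁ * C₂ + 2 * C₂)) * (N + τ) := by positivity
  have e2 : 0 ≤ (CX * C₂ : ℝ) * N := by positivity
  nlinarith

/-- With high probability the design points resolve the Sobolev functions. -/
theorem exists_sampling_tail (hT : IsSobolevExtension S T) (hS : (d : ℝ) / 2 < S) {smin : ℝ}
    (hmin : 0 < smin) {cX : ℝ} (hcX : 0 < cX) : ∃ C₀ C : ℝ, 0 < C₀ ∧ 0 < C ∧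
      ∀ n : ℕ, 2 ≤ n → ∀ P : Measure (cube d), IsProbabilityMeasure P →
      ENNReal.ofReal cX • volume ≤ P → ∀ ν : Measure ℝ, IsProbabilityMeasure ν →
      (Measure.pi fun _ : Fin n ↦ P.prod ν)
        {ω | ¬ ∀ v : ℝ, 0 < v → v ≤ 2 * (n : ℝ) ^ (2 * S / (2 * smin + d)) → ∀ e ∈ rkhs d S,
          (eLpNorm e 2 volume).toReal ^ 2 ≤ C₀ * (1 / (n : ℝ) * ∑ i, e (ω i).1 ^ 2 +
            1 / v * (cubeSobolevNorm S e).toReal ^ 2)} ≤ ENNReal.ofReal (C * (n : ℝ)⁻¹) := by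
  have hS0 : 0 < S := lt_of_le_of_lt (by positivity) hS
  obtain ⟨C₀, hC₀0, hC₀⟩ := exists_sampling_inequality hT hS (c := cX / 4) (by positivity)
  have hD : (0 : ℝ) < 2 * smin + d := by positivity
  set β : ℝ := 1 / (2 * smin + d) with hβ
  set κ : ℝ := 2 * smin / (2 * smin + d) with hκ
  have hκ0 : 0 < κ := by positivity
  have hκβ : β * d = 1 - κ := by
    rw [hβ, hκ]
    field_simp
    ring
  set c₁ : ℝ := 2 ^ (1 / (2 * S)) + 1 with hc₁
  have hc₁0 : 0 < c₁ := by positivity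
  set c₂ : ℝ := cX / (4 * c₁ ^ d) with hc₂
  have hc₂0 : 0 < c₂ := by positivity
  -- A cell receives at least of the order of n^κ points. The exponential e^(-c n^κ) is bounded by
  -- the inverse of one term of the exponential series, and κj ≥ 2 makes that term at least of order
  -- n², which beats the number of cells.
  obtain ⟨j, hj⟩ := exists_nat_ge (2 / κ)
  have hjκ : 2 ≤ κ * j := by
    rw [div_le_iff₀ hκ0] at hj
    linarith
  refine ⟨C₀, c₁ ^ d * (j.factorial / c₂ ^ j), hC₀0, by positivity, fun n hn P hP hPle ν hν ↦ ?_⟩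
  have hn0 : 0 < n := by omega
  have hn' : (0 : ℝ) < n := by exact_mod_cast hn0
  have hn1 : (1 : ℝ) ≤ n := by exact_mod_cast hn0
  set V : ℝ := 2 * (n : ℝ) ^ (2 * S / (2 * smin + d)) with hV
  have hV0 : 0 < V := by positivity
  have hVβ : V ^ (1 / (2 * S)) = 2 ^ (1 / (2 * S)) * (n : ℝ) ^ β := by
    rw [hV, Real.mul_rpow zero_le_two (by positivity), ← Real.rpow_mul hn'.le]
    congr 2
    rw [hβ]
    field_simp
  -- Cells fine enough that M^(-2S) ≤ 1/V. A single partition then serves all v ≤ V, hence the whole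
  -- grid, on one event.
  set M : ℕ := ⌈V ^ (1 / (2 * S))⌉₊ with hM
  have hM0 : 0 < M := Nat.ceil_pos.2 (by positivity)
  have hM' : (0 : ℝ) < M := by exact_mod_cast hM0
  have hMle : (M : ℝ) ≤ c₁ * (n : ℝ) ^ β := by
    have h1 : (M : ℝ) ≤ 2 ^ (1 / (2 * S)) * (n : ℝ) ^ β + 1 := by
      rw [← hVβ]
      exact (Nat.ceil_lt_add_one (by positivity)).le
    have h2 : 1 ≤ (n : ℝ) ^ β := Real.one_le_rpow hn1 (by positivity)
    rw [hc₁, add_mul, one_mul]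
    linarith
  have hMd : (M : ℝ) ^ d ≤ c₁ ^ d * (n : ℝ) ^ (1 - κ) := by
    calc (M : ℝ) ^ d ≤ (c₁ * (n : ℝ) ^ β) ^ d := by gcongr
      _ = _ := by rw [mul_pow, ← Real.rpow_natCast (_ ^ β), ← Real.rpow_mul hn'.le, hκβ]
  have hnn : (n : ℝ) ^ (1 - κ) * (n : ℝ) ^ κ = n := by
    rw [← Real.rpow_add hn', sub_add_cancel, Real.rpow_one]
  refine (measure_mono ?_).trans ((cell_counts_tail (n := n) (ν := ν) hM0 hcX.le hPle).trans
    (ENNReal.ofReal_le_ofReal ?_))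
  · intro ω hω hgood
    refine hω fun v hv hvV e he ↦ hC₀ n M hn0 hM0 (fun i ↦ (ω i).1) hgood (1 / v) ?_ e he
    rw [one_div, inv_eq_one_div, Real.div_rpow zero_le_one hM'.le, Real.one_rpow, one_div]
    refine inv_anti₀ hv (hvV.trans ?_)
    calc V = (V ^ (1 / (2 * S))) ^ (2 * S) := by
          rw [← Real.rpow_mul hV0.le, one_div_mul_cancel (by positivity), Real.rpow_one]
      _ ≤ _ := Real.rpow_le_rpow (by positivity) (Nat.le_ceil _) (by positivity)
  · have hexp : c₂ * (n : ℝ) ^ κ ≤ n * (cX * ((M : ℝ) ^ d)⁻¹) / 4 := by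
      calc c₂ * (n : ℝ) ^ κ = n * (cX * (c₁ ^ d * (n : ℝ) ^ (1 - κ))⁻¹) / 4 := by
            rw [hc₂]
            nth_rw 2 [← hnn]
            have : (0 : ℝ) < (n : ℝ) ^ (1 - κ) := by positivity
            field_simp
        _ ≤ _ := by gcongr
    set x : ℝ := c₂ * (n : ℝ) ^ κ with hx
    have hx0 : 0 < x := by positivity
    have h1 : Real.exp (-(n * (cX * ((M : ℝ) ^ d)⁻¹) / 4)) ≤ j.factorial / x ^ j := by
      refine (Real.exp_le_exp.2 (neg_le_neg hexp)).trans ?_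
      have h2 := Real.pow_div_factorial_le_exp x hx0.le j
      rw [Real.exp_neg, ← inv_div]
      exact inv_anti₀ (by positivity) h2
    have h2 : (n : ℝ) ^ 2 ≤ ((n : ℝ) ^ κ) ^ j := by
      rw [← Real.rpow_natCast (_ ^ κ), ← Real.rpow_mul hn'.le, ← Real.rpow_two]
      exact Real.rpow_le_rpow_of_exponent_le hn1 hjκ
    have h3 : (n : ℝ) ^ (1 - κ) ≤ n := by
      calc (n : ℝ) ^ (1 - κ) ≤ (n : ℝ) ^ (1 : ℝ) :=
            Real.rpow_le_rpow_of_exponent_le hn1 (by linarith)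
        _ = n := Real.rpow_one _
    calc (M : ℝ) ^ d * Real.exp (-(n * (cX * ((M : ℝ) ^ d)⁻¹) / 4))
        ≤ (c₁ ^ d * n) * (j.factorial / x ^ j) := by
          refine mul_le_mul (hMd.trans ?_) h1 (by positivity) (by positivity)
          gcongr
      _ ≤ (c₁ ^ d * n) * (j.factorial / (c₂ ^ j * (n : ℝ) ^ 2)) := by
          rw [hx, mul_pow]
          gcongr
      _ = _ := by
          field_simp

end Tail

/-! ### The dyadic grid of regularization parameters -/

section Grid

theorem two_pow_ceil_logb {x : ℝ} (hx : 1 ≤ x) :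
    x ≤ 2 ^ ⌈Real.logb 2 x⌉₊ ∧ (2 : ℝ) ^ ⌈Real.logb 2 x⌉₊ ≤ 2 * x := by
  have hx0 : 0 < x := by linarith
  have h0 : 0 ≤ Real.logb 2 x := Real.logb_nonneg one_lt_two hx
  have h1 : (2 : ℝ) ^ Real.logb 2 x = x := Real.rpow_logb two_pos (by norm_num) hx0
  constructor
  · calc x = (2 : ℝ) ^ Real.logb 2 x := h1.symm
      _ ≤ (2 : ℝ) ^ (⌈Real.logb 2 x⌉₊ : ℝ) :=
        Real.rpow_le_rpow_of_exponent_le one_le_two (Nat.le_ceil _)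
      _ = _ := Real.rpow_natCast _ _
  · calc (2 : ℝ) ^ ⌈Real.logb 2 x⌉₊ = (2 : ℝ) ^ (⌈Real.logb 2 x⌉₊ : ℝ) := (Real.rpow_natCast _ _).symm
      _ ≤ (2 : ℝ) ^ (1 + Real.logb 2 x) := Real.rpow_le_rpow_of_exponent_le one_le_two
        (by linarith [Nat.ceil_lt_add_one h0])
      _ = _ := by rw [Real.rpow_add two_pos, Real.rpow_one, h1]

variable {d n : ℕ} {smin S : ℝ}

theorem gridValue_pos (hn : 0 < n) (i : ℕ) : 0 < gridValue d n S i := by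
  unfold gridValue
  have : (0 : ℝ) < n := by exact_mod_cast hn
  positivity

theorem one_le_gridValue (hn : 0 < n) (hS : 0 ≤ S) (i : ℕ) : 1 ≤ gridValue d n S i := by
  unfold gridValue
  have h1 : (1 : ℝ) ≤ n := by exact_mod_cast hn
  exact one_le_mul_of_one_le_of_one_le (one_le_pow₀ one_le_two) (Real.one_le_rpow h1 (by positivity))

theorem gridValue_mono (hn : 0 < n) {i j : ℕ} (h : i ≤ j) : gridValue d n S i ≤ gridValue d n S j := by
  unfold gridValue
  gcongr
  · exact one_le_two

theorem gridValue_lt (hn : 0 < n) {i j : ℕ} (hi : 1 ≤ i) (h : i < j) :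
    gridValue d n S i < gridValue d n S j := by
  unfold gridValue
  have : (0 : ℝ) < n := by exact_mod_cast hn
  refine mul_lt_mul_of_pos_right (pow_lt_pow_right₀ one_lt_two (by omega)) (by positivity)

variable {s : ℝ}

theorem one_le_grid_ratio (hn : 0 < n) (hs : 0 < s) (hsS : s ≤ S) :
    1 ≤ (n : ℝ) ^ (2 * S / (2 * s + d)) / (n : ℝ) ^ (2 * S / (2 * S + d)) := by
  have h1 : (1 : ℝ) ≤ n := by exact_mod_cast hn
  have h0 : (0 : ℝ) < n := by exact_mod_cast hn
  rw [one_le_div (by positivity)]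
  refine Real.rpow_le_rpow_of_exponent_le h1 ?_
  exact div_le_div_of_nonneg_left (by linarith) (by positivity) (by linarith)

/-- The size formula evaluated at the true smoothness `s` gives the index of the oracle: rounding
the logarithm up puts a grid point within a factor two above n^(2S/(2s+d)). -/
theorem gridValue_gridSize_mem_Icc (hn : 0 < n) (hs : 0 < s) (hsS : s ≤ S) :
    gridValue d n S (gridSize d n s S) ∈
      Icc ((n : ℝ) ^ (2 * S / (2 * s + d))) (2 * (n : ℝ) ^ (2 * S / (2 * s + d))) := by
  have h0 : (0 : ℝ) < n := by exact_mod_cast hn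
  obtain ⟨h1, h2⟩ := two_pow_ceil_logb (one_le_grid_ratio (d := d) hn hs hsS)
  have h3 : (0 : ℝ) < (n : ℝ) ^ (2 * S / (2 * S + d)) := by positivity
  rw [gridValue, gridSize, add_tsub_cancel_right]
  rw [div_le_iff₀ h3] at h1
  refine ⟨h1, ?_⟩
  refine (mul_le_mul_of_nonneg_right h2 h3.le).trans_eq ?_
  field_simp

theorem gridSize_anti (hn : 0 < n) (hmin : 0 < smin) (hs : smin ≤ s) (hsS : s ≤ S) :
    gridSize d n s S ≤ gridSize d n smin S := by
  have h0 : (0 : ℝ) < n := by exact_mod_cast hn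
  have h1 : (1 : ℝ) ≤ n := by exact_mod_cast hn
  unfold gridSize
  refine Nat.add_le_add_right (Nat.ceil_mono ?_) 1
  refine Real.logb_le_logb_of_le one_lt_two (by positivity) ?_
  gcongr
  linarith

theorem gridSize_le (hn : 2 ≤ n) (hmin : 0 < smin) (hs : smin ≤ S) (hd : 1 ≤ d) :
    (gridSize d n smin S : ℝ) ≤ (6 + 4 * S) * Real.log n := by
  have hlog := one_le_three_mul_log hn
  have h0 : (0 : ℝ) < n := by
    have : 0 < n := by omega
    exact_mod_cast this
  have h1 : (1 : ℝ) ≤ n := by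
    have : 1 ≤ n := by omega
    exact_mod_cast this
  have hd' : (1 : ℝ) ≤ d := by exact_mod_cast hd
  have hr := one_le_grid_ratio (d := d) (show 0 < n by omega) hmin hs
  have h2 := Nat.ceil_lt_add_one (Real.logb_nonneg one_lt_two hr)
  have h3 : Real.logb 2 ((n : ℝ) ^ (2 * S / (2 * smin + d)) / (n : ℝ) ^ (2 * S / (2 * S + d))) ≤
      4 * S * Real.log n := by
    have hS : 0 < S := by linarith
    rw [Real.logb, div_le_iff₀ (Real.log_pos one_lt_two)]
    have h4 : (n : ℝ) ^ (2 * S / (2 * smin + d)) / (n : ℝ) ^ (2 * S / (2 * S + d)) ≤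
        (n : ℝ) ^ (2 * S) := by
      refine (div_le_self (by positivity) (Real.one_le_rpow h1 (by positivity))).trans ?_
      refine Real.rpow_le_rpow_of_exponent_le h1 (div_le_self (by positivity) (by linarith))
    have h5 := Real.log_le_log (by linarith) h4
    rw [Real.log_rpow h0] at h5
    have h6 := Real.log_two_gt_d9
    have h7 : 0 ≤ S * Real.log n := mul_nonneg hS.le (by linarith)
    nlinarith
  rw [gridSize]
  push_cast
  linarith

end Grid

/-! ### The balancing principle -/

section Balancing

variable {d n : ℕ} {smin S : ℝ}

/-- The set of grid values over which the balancing principle minimizes. -/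
def admissibleValues (smin S : ℝ) (D : Fin n → cube d × ℝ) : Set ℝ :=
  {v | ∃ i ∈ Finset.Icc 1 (gridSize d n smin S), v = gridValue d n S i ∧
    ∀ j ∈ Finset.Icc 1 (gridSize d n smin S), i < j →
      eLpNorm (fun x ↦ krr S (gridValue d n S i) D x - krr S (gridValue d n S j) D x) 2 volume ≤
        ENNReal.ofReal (Real.log n ^ 2 * (gridValue d n S j ^ ((d : ℝ) / (4 * S)) / Real.sqrt n))}

theorem finite_admissibleValues (D : Fin n → cube d × ℝ) : (admissibleValues smin S D).Finite := by
  refine ((Finset.Icc 1 (gridSize d n smin S)).finite_toSet.image (gridValue d n S)).subset ?_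
  rintro v ⟨i, hi, rfl, -⟩
  exact ⟨i, hi, rfl⟩

theorem lepskiValue_mem (D : Fin n → cube d × ℝ) :
    lepskiValue smin S D ∈ admissibleValues smin S D := by
  refine Set.Nonempty.csInf_mem ?_ (finite_admissibleValues D)
  -- The largest index has no competitors above it, so its condition is vacuous and the admissible
  -- set is nonempty.
  refine ⟨_, gridSize d n smin S, Finset.mem_Icc.2 ⟨?_, le_rfl⟩, rfl, fun j hj hlt ↦ ?_⟩
  · unfold gridSize
    omega
  · exact absurd (Finset.mem_Icc.1 hj).2 (not_le.2 hlt)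

theorem lepskiValue_pos (hn : 0 < n) (D : Fin n → cube d × ℝ) : 0 < lepskiValue smin S D := by
  obtain ⟨i, -, hi, -⟩ := lepskiValue_mem (smin := smin) (S := S) D
  rw [hi]
  exact gridValue_pos hn i

/-- The balancing principle performs as well as any index beyond which the errors are bounded by
the noise level. -/
theorem lepski_error_le (hS : (d : ℝ) / 2 < S) (hn : 0 < n) (D : Fin n → cube d × ℝ)
    {f : cube d → ℝ} (hf : MemLp f 2 volume) {i₀ : ℕ} (h1 : 1 ≤ i₀) (hi₀ : i₀ ≤ gridSize d n smin S)
    (herr : ∀ i, i₀ ≤ i → i ≤ gridSize d n smin S →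
      eLpNorm (krr S (gridValue d n S i) D - f) 2 volume ≤ ENNReal.ofReal
        (1 / 2 * (Real.log n ^ 2 * (gridValue d n S i ^ ((d : ℝ) / (4 * S)) / Real.sqrt n)))) :
    eLpNorm (krr S (lepskiValue smin S D) D - f) 2 volume ≤ ENNReal.ofReal
        (2 * (Real.log n ^ 2 * (gridValue d n S i₀ ^ ((d : ℝ) / (4 * S)) / Real.sqrt n))) := by
  have hS0 : 0 < S := lt_of_le_of_lt (by positivity) hS
  set u : ℕ → ℝ := fun i ↦ Real.log n ^ 2 * (gridValue d n S i ^ ((d : ℝ) / (4 * S)) / Real.sqrt n)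
    with hu
  have hu0 : ∀ i, 0 ≤ u i := fun i ↦ by
    have := gridValue_pos (d := d) (S := S) hn i
    positivity
  have hmono : ∀ i j, i ≤ j → u i ≤ u j := fun i j hij ↦ by
    have h2 := gridValue_pos (d := d) (S := S) hn i
    have h3 := gridValue_mono (d := d) (S := S) hn hij
    simp only [hu]
    gcongr
  have hkL : ∀ i, MemLp (krr S (gridValue d n S i) D) 2 volume := fun i ↦
    memLp_of_continuous (krr_spec hS (gridValue_pos hn i) D).1.1
  -- Two errors of at most half of a threshold, the thresholds being increasing, so the index `i₀`
  -- passes every comparison.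
  have hadm : gridValue d n S i₀ ∈ admissibleValues smin S D := by
    refine ⟨i₀, Finset.mem_Icc.2 ⟨h1, hi₀⟩, rfl, fun j hj hlt ↦ ?_⟩
    have hjK := (Finset.mem_Icc.1 hj).2
    have h2 : (fun x ↦ krr S (gridValue d n S i₀) D x - krr S (gridValue d n S j) D x) =
        (krr S (gridValue d n S i₀) D - f) - (krr S (gridValue d n S j) D - f) := by
      funext x
      simp only [Pi.sub_apply]
      ring
    rw [h2]
    refine (eLpNorm_sub_le ((hkL _).sub hf).aestronglyMeasurable
      ((hkL _).sub hf).aestronglyMeasurable (by norm_num)).trans ?_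
    refine (add_le_add (herr i₀ le_rfl hi₀) (herr j hlt.le hjK)).trans ?_
    rw [← ENNReal.ofReal_add (by have := hu0 i₀; positivity) (by have := hu0 j; positivity)]
    refine ENNReal.ofReal_le_ofReal ?_
    have := hmono i₀ j hlt.le
    simp only [hu] at this
    linarith
  have hle : lepskiValue smin S D ≤ gridValue d n S i₀ :=
    csInf_le (finite_admissibleValues D).bddBelow hadm
  obtain ⟨i, hi, hiv, hcmp⟩ := lepskiValue_mem (smin := smin) (S := S) D
  have hii : i ≤ i₀ := by
    by_contra hcon
    push Not at hcon
    rw [hiv] at hle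
    exact absurd (gridValue_lt (d := d) (S := S) hn h1 hcon) (not_lt.2 hle)
  rw [hiv]
  rcases hii.eq_or_lt with rfl | hlt
  · refine (herr i le_rfl hi₀).trans (ENNReal.ofReal_le_ofReal ?_)
    have := hu0 i
    simp only [hu] at this
    linarith
  -- The selected index lies below `i₀`, hence it was itself compared with `i₀`: the error is at
  -- most one threshold for that comparison plus half a threshold for the error at `i₀`.
  · have h2 : krr S (gridValue d n S i) D - f =
        (fun x ↦ krr S (gridValue d n S i) D x - krr S (gridValue d n S i₀) D x) +
          (krr S (gridValue d n S i₀) D - f) := by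
      funext x
      simp only [Pi.sub_apply, Pi.add_apply]
      ring
    rw [h2]
    refine (eLpNorm_add_le ((hkL _).sub (hkL _)).aestronglyMeasurable
      ((hkL _).sub hf).aestronglyMeasurable (by norm_num)).trans ?_
    refine (add_le_add (hcmp i₀ (Finset.mem_Icc.2 ⟨h1, hi₀⟩) hlt) (herr i₀ le_rfl hi₀)).trans ?_
    rw [← ENNReal.ofReal_add (hu0 i₀) (by have := hu0 i₀; positivity)]
    refine ENNReal.ofReal_le_ofReal ?_
    have := hu0 i₀
    simp only [hu] at this
    linarith

end Balancing

/-! ### The error at the selected parameter -/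

section Selection

variable {d : ℕ} {S : ℝ} {T : Lp ℝ 2 (volume : Measure (cube d)) →ₗ[ℝ]
  Lp ℝ 2 (volume : Measure (EuclideanSpace ℝ (Fin d)))}

/-- Powers of the oracle parameter, in terms of the minimax rate. -/
theorem rate_identities {n : ℕ} (hn : 0 < n) {s : ℝ} (hs : 0 < s) (hS : 0 < S) :
    ((n : ℝ) ^ (2 * S / (2 * s + d))) ^ (-(s / S)) = (n : ℝ) ^ (-(2 * s) / (2 * s + d)) ∧
    ((n : ℝ) ^ (2 * S / (2 * s + d))) ^ (d / (2 * S)) = n * (n : ℝ) ^ (-(2 * s) / (2 * s + d)) := by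
  have h0 : (0 : ℝ) < n := by exact_mod_cast hn
  have hD : (0 : ℝ) < 2 * s + d := by positivity
  constructor
  · rw [← Real.rpow_mul h0.le]
    congr 1
    field_simp
  · rw [← Real.rpow_mul h0.le]
    nth_rw 2 [← Real.rpow_one (n : ℝ)]
    rw [← Real.rpow_add h0]
    congr 1
    field_simp
    ring

set_option maxHeartbeats 1600000 in
/-- With high probability the parameter chosen by the balancing principle attains the minimax rate
up to logarithmic factors. -/
theorem exists_lepski_tail (hT : IsSobolevExtension S T) (hd : 1 ≤ d) (hS : (d : ℝ) / 2 < S)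
    {smin s : ℝ} (hmin : 0 < smin) (hs : smin ≤ s) (hsS : s ≤ S) (L : ℝ) (σ CX : ℝ≥0) {cX : ℝ}
    (hcX : 0 < cX) : ∃ C : ℝ, 0 < C ∧ ∃ n₀ : ℕ,
      ∀ n : ℕ, 2 ≤ n → n₀ ≤ n → ∀ P : Measure (cube d), IsProbabilityMeasure P → P ≤ CX • volume →
      ENNReal.ofReal cX • volume ≤ P →
      ∀ ν : Measure ℝ, IsProbabilityMeasure ν → HasSubgaussianMGF (fun y : ℝ ↦ y) (σ ^ 2) ν →
      ∀ f ∈ sobolevBall d s L, Measurable f → MemLp f 2 volume →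
      (Measure.pi fun _ : Fin n ↦ P.prod ν)
        {ω | ENNReal.ofReal (C * (Real.log n ^ 4 * (n : ℝ) ^ (-(2 * s) / (2 * s + d)))) <
            eLpNorm (krr S (lepskiValue smin S (observe f ω)) (observe f ω) - f) 2 volume ^ 2} ≤
        ENNReal.ofReal (C * (Real.log n * (n : ℝ) ^ (-(2 * s) / (2 * s + d)))) := by
  have hS0 : 0 < S := lt_of_le_of_lt (by positivity) hS
  have hs0 : 0 < s := by linarith
  obtain ⟨C₀, Cs, hC₀, hCs0, hCs⟩ := exists_sampling_tail hT hS hmin hcX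
  obtain ⟨C₁, hC₁0, hC₁⟩ := exists_krr_tail hT hS hs0.le hsS L σ CX hC₀.le
  -- The index n₀ ensures log² n ≥ 40·C₁. The squared error is at most 10·C₁·log² n times the
  -- variance term, so this makes it at most a quarter of the squared threshold.
  refine ⟨8 + 3 * Cs + (6 + 4 * S) * (2 * C₁), by positivity, ⌈Real.exp (40 * C₁ + 1)⌉₊,
    fun n hn hn₀ P hP hPCX hPcX ν hν hsub f hf hfm hfL ↦ ?_⟩
  have hn0 : 0 < n := by omega
  have hn' : (0 : ℝ) < n := by exact_mod_cast hn0
  have hn1 : (1 : ℝ) ≤ n := by exact_mod_cast hn0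
  have hlog3 := one_le_three_mul_log hn
  have hlog : 40 * C₁ + 1 ≤ Real.log n := by
    rw [Real.le_log_iff_exp_le hn']
    exact (Nat.le_ceil _).trans (by exact_mod_cast hn₀)
  have hlogsq : 40 * C₁ ≤ Real.log n ^ 2 := by nlinarith
  set ρ : ℝ := (n : ℝ) ^ (-(2 * s) / (2 * s + d)) with hρ
  have hρ0 : 0 < ρ := by positivity
  have hD : (0 : ℝ) < 2 * s + d := by positivity
  have hinvρ : (n : ℝ)⁻¹ ≤ ρ := by
    rw [hρ, ← Real.rpow_neg_one]
    refine Real.rpow_le_rpow_of_exponent_le hn1 ?_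
    rw [neg_div, neg_le_neg_iff, div_le_one hD]
    have : (0 : ℝ) ≤ d := by positivity
    linarith
  have hinv2 : ((n : ℝ) ^ 2)⁻¹ ≤ ρ :=
    (inv_anti₀ hn' (by nlinarith)).trans hinvρ
  set i₀ := gridSize d n s S with hi₀
  set K := gridSize d n smin S with hK
  have hi₀1 : 1 ≤ i₀ := by
    rw [hi₀, gridSize]
    omega
  have hi₀K : i₀ ≤ K := gridSize_anti hn0 hmin hs hsS
  obtain ⟨hv1, hv2⟩ := gridValue_gridSize_mem_Icc (d := d) hn0 hs0 hsS
  rw [← hi₀] at hv1 hv2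
  obtain ⟨hr1, hr2⟩ := rate_identities (d := d) hn0 hs0 hS0
  rw [← hρ] at hr1 hr2
  have hvK : gridValue d n S K ≤ 2 * (n : ℝ) ^ (2 * S / (2 * smin + d)) :=
    (gridValue_gridSize_mem_Icc (d := d) hn0 hmin (hs.trans hsS)).2
  have hvoracle : (0 : ℝ) < (n : ℝ) ^ (2 * S / (2 * s + d)) := by positivity
  have hτρ : ∀ i, i₀ ≤ i → gridValue d n S i ^ (-(s / S)) ≤ ρ := fun i hi ↦ by
    rw [← hr1]
    refine Real.rpow_le_rpow_of_nonpos hvoracle (hv1.trans (gridValue_mono hn0 hi)) ?_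
    rw [neg_nonpos]
    positivity
  -- Beyond the oracle the bias term is below the rate and the variance term above it, so the bias
  -- is absorbed.
  have hρv : ∀ i, i₀ ≤ i → ρ ≤ gridValue d n S i ^ (d / (2 * S)) / n := fun i hi ↦ by
    rw [le_div_iff₀ hn', mul_comm, ← hr2]
    exact Real.rpow_le_rpow hvoracle.le (hv1.trans (gridValue_mono hn0 hi)) (by positivity)
  set Q := Measure.pi fun _ : Fin n ↦ P.prod ν
  set B₀ : Set (Fin n → cube d × ℝ) := {ω | ¬ ∀ v : ℝ, 0 < v →
      v ≤ 2 * (n : ℝ) ^ (2 * S / (2 * smin + d)) → ∀ e ∈ rkhs d S,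
      (eLpNorm e 2 volume).toReal ^ 2 ≤ C₀ * (1 / (n : ℝ) * ∑ i, e (ω i).1 ^ 2 +
        1 / v * (cubeSobolevNorm S e).toReal ^ 2)} with hB₀
  set B : ℕ → Set (Fin n → cube d × ℝ) := fun i ↦
    {ω | (∀ e ∈ rkhs d S, (eLpNorm e 2 volume).toReal ^ 2 ≤ C₀ * (1 / (n : ℝ) *
        ∑ j, e (ω j).1 ^ 2 + 1 / gridValue d n S i * (cubeSobolevNorm S e).toReal ^ 2)) ∧
      ENNReal.ofReal (C₁ * (Real.log n ^ 2 * gridValue d n S i ^ (d / (2 * S)) / n +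
        gridValue d n S i ^ (-(s / S)))) <
        eLpNorm (krr S (gridValue d n S i) (observe f ω) - f) 2 volume ^ 2} with hB
  have hsubset : {ω : Fin n → cube d × ℝ | ENNReal.ofReal
      ((8 + 3 * Cs + (6 + 4 * S) * (2 * C₁)) * (Real.log n ^ 4 * ρ)) <
      eLpNorm (krr S (lepskiValue smin S (observe f ω)) (observe f ω) - f) 2 volume ^ 2} ⊆
      B₀ ∪ ⋃ i ∈ Finset.Icc i₀ K, B i := by
    intro ω hω
    by_contra hcon
    simp only [mem_union, mem_iUnion, not_or, not_exists] at hcon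
    obtain ⟨hc0, hcB⟩ := hcon
    rw [hB₀, mem_ofPred_eq, not_not] at hc0
    have herr : ∀ i, i₀ ≤ i → i ≤ K →
        eLpNorm (krr S (gridValue d n S i) (observe f ω) - f) 2 volume ≤ ENNReal.ofReal
        (1 / 2 * (Real.log n ^ 2 * (gridValue d n S i ^ ((d : ℝ) / (4 * S)) / Real.sqrt n))) := by
      intro i hi hiK
      have hvi := gridValue_pos (d := d) (S := S) hn0 i
      have h1 := hcB i (Finset.mem_Icc.2 ⟨hi, hiK⟩)
      rw [hB] at h1
      simp only [mem_ofPred_eq, not_and, not_lt] at h1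
      have h2 := h1 (hc0 _ hvi ((gridValue_mono hn0 hiK).trans hvK))
      refine (ENNReal.pow_le_pow_left_iff two_ne_zero).1 (h2.trans ?_)
      rw [← ENNReal.ofReal_pow (by positivity)]
      refine ENNReal.ofReal_le_ofReal ?_
      have h3 : (gridValue d n S i ^ ((d : ℝ) / (4 * S))) ^ 2 = gridValue d n S i ^ (d / (2 * S)) := by
        rw [← Real.rpow_natCast, ← Real.rpow_mul hvi.le]
        congr 1
        push_cast
        field_simp
        ring
      rw [mul_pow, mul_pow, div_pow _ (Real.sqrt n), h3, Real.sq_sqrt hn'.le, mul_div_assoc]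
      set W := gridValue d n S i ^ (d / (2 * S)) / n with hW
      have h4 : gridValue d n S i ^ (-(s / S)) ≤ W := (hτρ i hi).trans (hρv i hi)
      have hW0 : 0 ≤ W := by positivity
      have h5 : (1 : ℝ) ≤ 9 * Real.log n ^ 2 := by nlinarith
      calc C₁ * (Real.log n ^ 2 * W + gridValue d n S i ^ (-(s / S)))
          ≤ C₁ * (Real.log n ^ 2 * W + 9 * Real.log n ^ 2 * W) := by
            refine mul_le_mul_of_nonneg_left (add_le_add le_rfl (h4.trans ?_)) hC₁0.le
            exact le_mul_of_one_le_left hW0 h5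
        _ = 1 / 4 * (40 * C₁) * (Real.log n ^ 2 * W) := by ring
        _ ≤ 1 / 4 * Real.log n ^ 2 * (Real.log n ^ 2 * W) := by gcongr
        _ = _ := by ring
    have hfinal := lepski_error_le hS hn0 (observe f ω) hfL hi₀1 hi₀K herr
    rw [mem_ofPred_eq] at hω
    refine absurd hω (not_lt.2 ?_)
    refine (pow_le_pow_left' hfinal 2).trans ?_
    have hvi := gridValue_pos (d := d) (S := S) hn0 i₀
    rw [← ENNReal.ofReal_pow (by positivity)]
    refine ENNReal.ofReal_le_ofReal ?_
    have h3 : (gridValue d n S i₀ ^ ((d : ℝ) / (4 * S))) ^ 2 = gridValue d n S i₀ ^ (d / (2 * S)) := by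
      rw [← Real.rpow_natCast, ← Real.rpow_mul hvi.le]
      congr 1
      push_cast
      field_simp
      ring
    rw [mul_pow, mul_pow, div_pow, h3, Real.sq_sqrt hn'.le]
    have h4 : gridValue d n S i₀ ^ (d / (2 * S)) / n ≤ 2 * ρ := by
      rw [div_le_iff₀ hn']
      -- Because 2S > d, rounding the oracle up to the grid costs at most a factor two.
      have hexp : d / (2 * S) ≤ 1 := by
        rw [div_le_one (by positivity)]
        linarith
      calc gridValue d n S i₀ ^ (d / (2 * S))
          ≤ (2 * (n : ℝ) ^ (2 * S / (2 * s + d))) ^ (d / (2 * S)) :=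
            Real.rpow_le_rpow hvi.le hv2 (by positivity)
        _ = 2 ^ (d / (2 * S)) * (n * ρ) := by
            rw [Real.mul_rpow zero_le_two hvoracle.le, hr2]
        _ ≤ 2 ^ (1 : ℝ) * (n * ρ) := by
            refine mul_le_mul_of_nonneg_right ?_ (by positivity)
            exact Real.rpow_le_rpow_of_exponent_le one_le_two hexp
        _ = _ := by
            rw [Real.rpow_one]
            ring
    calc 2 ^ 2 * ((Real.log n ^ 2) ^ 2 * (gridValue d n S i₀ ^ (d / (2 * S)) / n))
        ≤ 2 ^ 2 * ((Real.log n ^ 2) ^ 2 * (2 * ρ)) := by gcongr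
      _ = 8 * (Real.log n ^ 4 * ρ) := by ring
      _ ≤ _ := by
          refine mul_le_mul_of_nonneg_right ?_ (by positivity)
          have : 0 ≤ 3 * Cs + (6 + 4 * S) * (2 * C₁) := by positivity
          linarith
  have hQB : ∀ i ∈ Finset.Icc i₀ K, Q (B i) ≤ ENNReal.ofReal (C₁ * (ρ + ρ)) := fun i hi ↦ by
    refine (hC₁ n hn P hP hPCX ν hν hsub f hf hfm hfL _ (one_le_gridValue hn0 hS0.le i)).trans ?_
    refine ENNReal.ofReal_le_ofReal ?_
    have := hτρ i (Finset.mem_Icc.1 hi).1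
    gcongr
  calc _ ≤ Q (B₀ ∪ ⋃ i ∈ Finset.Icc i₀ K, B i) := measure_mono hsubset
    _ ≤ Q B₀ + ∑ i ∈ Finset.Icc i₀ K, Q (B i) :=
        (measure_union_le _ _).trans (add_le_add le_rfl (measure_biUnion_finset_le _ _))
    _ ≤ ENNReal.ofReal (Cs * (n : ℝ)⁻¹) + ∑ _i ∈ Finset.Icc i₀ K, ENNReal.ofReal (C₁ * (ρ + ρ)) :=
        add_le_add (hCs n hn P hP hPcX ν hν) (Finset.sum_le_sum hQB)
    _ = ENNReal.ofReal (Cs * (n : ℝ)⁻¹ + (Finset.Icc i₀ K).card * (C₁ * (ρ + ρ))) := by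
        rw [Finset.sum_const, nsmul_eq_mul, ← ENNReal.ofReal_natCast,
          ← ENNReal.ofReal_mul (by positivity), ENNReal.ofReal_add (by positivity) (by positivity)]
    _ ≤ _ := by
        refine ENNReal.ofReal_le_ofReal ?_
        have hcard : ((Finset.Icc i₀ K).card : ℝ) ≤ (6 + 4 * S) * Real.log n := by
          refine le_trans ?_ (gridSize_le hn hmin (hs.trans hsS) hd)
          rw [Nat.card_Icc]
          exact_mod_cast (by omega : K + 1 - i₀ ≤ K)
        have h1 : Cs * (n : ℝ)⁻¹ ≤ 3 * Cs * (Real.log n * ρ) := by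
          have h2 : ρ ≤ 3 * Real.log n * ρ := le_mul_of_one_le_left hρ0.le hlog3
          calc Cs * (n : ℝ)⁻¹ ≤ Cs * (3 * Real.log n * ρ) := by
                gcongr
                exact hinvρ.trans h2
            _ = _ := by ring
        have h2 : ((Finset.Icc i₀ K).card : ℝ) * (C₁ * (ρ + ρ)) ≤
            (6 + 4 * S) * (2 * C₁) * (Real.log n * ρ) := by
          calc _ ≤ (6 + 4 * S) * Real.log n * (C₁ * (ρ + ρ)) := by gcongr
            _ = _ := by ring
        have h3 : 0 ≤ 8 * (Real.log n * ρ) := by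
          have : 0 ≤ Real.log n := by linarith
          positivity
        linarith

end Selection

/-! ### From the adversarial risk to oscillation and mean square error -/

section Risk

variable {d : ℕ}

/-- The adversarial error is controlled by the local oscillation and the mean square error. -/
theorem lintegral_sup_le {P : Measure (cube d)} {CX : ℝ≥0} (hP : P ≤ CX • volume) {F f : cube d → ℝ}
    (hF : Measurable F) (hf : Measurable f) (r : ℝ) :
    ∫⁻ x, (⨆ (x' : cube d) (_ : dist x' x ≤ r), ENNReal.ofReal (|F x' - f x| ^ 2)) ∂P ≤
      2 * CX * ((∫⁻ x, ⨆ (x' : cube d) (_ : dist x' x ≤ r), ENNReal.ofReal (|F x' - F x| ^ 2)) +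
        eLpNorm (F - f) 2 volume ^ 2) := by
  calc _ ≤ ∫⁻ x, (⨆ (x' : cube d) (_ : dist x' x ≤ r), ENNReal.ofReal (|F x' - f x| ^ 2))
          ∂(CX • volume : Measure (cube d)) := lintegral_mono' hP le_rfl
    _ = CX * ∫⁻ x, (⨆ (x' : cube d) (_ : dist x' x ≤ r), ENNReal.ofReal (|F x' - f x| ^ 2)) := by
        rw [lintegral_smul_measure]
        rfl
    _ ≤ CX * ∫⁻ x, 2 * ((⨆ (x' : cube d) (_ : dist x' x ≤ r), ENNReal.ofReal (|F x' - F x| ^ 2)) +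
          ‖(F - f) x‖ₑ ^ 2) := by
        refine mul_le_mul_right (lintegral_mono fun x ↦ iSup₂_le fun x' hx' ↦ ?_) _
        have h0 : ∀ z : ℝ, ENNReal.ofReal (|z| ^ 2) = ‖z‖ₑ ^ 2 := fun z ↦ by
          rw [← ofReal_norm, ← ENNReal.ofReal_pow (norm_nonneg _), Real.norm_eq_abs]
        have h1 : F x' - f x = (F x' - F x) + (F - f) x := by
          rw [Pi.sub_apply]
          ring
        rw [h0, h1]
        refine (pow_le_pow_left' (enorm_add_le _ _) 2).trans ((sq_add_le_two_mul _ _).trans ?_)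
        refine mul_le_mul_right (add_le_add ?_ le_rfl) _
        rw [← h0]
        exact le_iSup₂ (f := fun (x' : cube d) (_ : dist x' x ≤ r) ↦
          ENNReal.ofReal (|F x' - F x| ^ 2)) x' hx'
    _ = _ := by
        rw [lintegral_const_mul' _ _ (by simp), lintegral_add_right _
          ((hF.sub hf).enorm.pow_const 2), sq_eLpNorm_two]
        ring

theorem eLpNorm_le_of_mem_sobolevBall {s L : ℝ} (hs : 0 ≤ s) {f : cube d → ℝ}
    (hf : f ∈ sobolevBall d s L) : MemLp f 2 volume ∧
      eLpNorm f 2 volume ≤ ENNReal.ofReal (max L 0 + 1) := by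
  obtain ⟨g, hg, hgL⟩ := exists_extension_of_mem_sobolevBall hf
  refine ⟨(memLp_congr_ae hg).1 (memLp_cube (Lp.memLp g)), ?_⟩
  rw [← eLpNorm_congr_ae hg]
  refine le_trans ?_ ((sobolevNorm_mono hs g).trans hgL)
  rw [sobolevNorm_zero]
  refine (ENNReal.pow_le_pow_left_iff two_ne_zero).1 ((sq_eLpNorm_cube_le g).trans_eq ?_)
  rw [← sq_eLpNorm_two, ← Lp.enorm_def, enorm_ft]

/-- An estimate that passes the final check has a risk of at most logarithmic order. -/
theorem boundCheck_bound (n : ℕ) (r : ℝ) (F : cube d → ℝ) :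
    (∫⁻ x, ⨆ (x' : cube d) (_ : dist x' x ≤ r),
        ENNReal.ofReal (|boundCheck n r F x' - boundCheck n r F x| ^ 2)) +
      eLpNorm (boundCheck n r F) 2 volume ≤ ENNReal.ofReal (Real.log n) := by
  unfold boundCheck
  split_ifs with h
  · exact h
  · simp

end Risk

/-! ### The risk bound -/

section Main

variable {d : ℕ} {S : ℝ} {T : Lp ℝ 2 (volume : Measure (cube d)) →ₗ[ℝ]
  Lp ℝ 2 (volume : Measure (EuclideanSpace ℝ (Fin d)))}

theorem log_pow_four_mul_rpow_le {x γ : ℝ} (hx : 1 ≤ x) (hγ : 0 < γ) :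
    Real.log x ^ 4 * x ^ (-γ) ≤ (4 / γ) ^ 4 := by
  have hx0 : 0 < x := by linarith
  have h1 := Real.log_le_rpow_div hx0.le (show 0 < γ / 4 by positivity)
  have h2 : Real.log x ^ 4 ≤ (x ^ (γ / 4) / (γ / 4)) ^ 4 :=
    pow_le_pow_left₀ (Real.log_nonneg hx) h1 4
  have h3 : (x ^ (γ / 4)) ^ 4 = x ^ γ := by
    rw [← Real.rpow_natCast, ← Real.rpow_mul hx0.le]
    congr 1
    push_cast
    ring
  rw [div_pow, h3] at h2
  rw [Real.rpow_neg hx0.le, ← div_eq_mul_inv, div_le_iff₀ (by positivity)]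
  refine h2.trans_eq ?_
  field_simp

theorem ennreal_le_one_add_sq (x : ℝ≥0∞) : x ≤ 1 + x ^ 2 := by
  rcases le_total x 1 with h | h
  · exact h.trans le_self_add
  · exact (le_self_pow₀ h two_ne_zero).trans le_add_self

theorem measurable_adaptiveEstimator {smin r : ℝ} {n : ℕ} (D : Fin n → cube d × ℝ)
    (hm : Measurable (freqTruncate r (T (toL2 (krr S (lepskiValue smin S D) D))))) :
    Measurable (adaptiveEstimator smin S r T D) := by
  unfold adaptiveEstimator boundCheck
  split_ifs
  · exact hm
  · exact measurable_const

set_option maxHeartbeats 1600000 in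
/-- The risk bound for a measurable regression function, on the space of designs and noises. -/
theorem exists_risk_bound (hT : IsSobolevExtension S T) (hd : 1 ≤ d) (hS : (d : ℝ) / 2 < S)
    {smin s : ℝ} (hmin : 0 < smin) (hs : smin ≤ s) (hsS : s ≤ S) (L : ℝ) (σ CX : ℝ≥0) {cX : ℝ}
    (hcX : 0 < cX) : ∃ C : ℝ, 0 < C ∧
      ∀ n : ℕ, 2 ≤ n → ∀ P : Measure (cube d), IsProbabilityMeasure P → P ≤ CX • volume →
      ENNReal.ofReal cX • volume ≤ P →
      ∀ ν : Measure ℝ, IsProbabilityMeasure ν → HasSubgaussianMGF (fun y : ℝ ↦ y) (σ ^ 2) ν →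
      ∀ f ∈ sobolevBall d s L, Measurable f → ∀ r : ℝ, 0 ≤ r →
      ∫⁻ ω, ∫⁻ x, (⨆ (x' : cube d) (_ : dist x' x ≤ r), ENNReal.ofReal
          (|adaptiveEstimator smin S r T (observe f ω) x' - f x| ^ 2)) ∂P
        ∂(Measure.pi fun _ : Fin n ↦ P.prod ν) ≤
      ENNReal.ofReal (C * (r ^ (2 * min 1 s) + (n : ℝ) ^ (-(2 * s) / (2 * s + d))) *
        Real.log n ^ 5) := by
  have hS0 : 0 < S := lt_of_le_of_lt (by positivity) hS
  have hs0 : 0 < s := by linarith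
  have hD : (0 : ℝ) < 2 * s + d := by positivity
  obtain ⟨Ct, hCt⟩ := exists_freqTruncate_bounds hT hS hs0 hsS L
  obtain ⟨C₁, hC₁0, n₀, hC₁⟩ := exists_lepski_tail hT hd hS hmin hs hsS L σ CX hcX
  set γ : ℝ := 2 * s / (2 * s + d) with hγ
  have hγ0 : 0 < γ := by positivity
  set L' : ℝ := max L 0 + 1 with hL'
  have hL'0 : 0 < L' := by positivity
  -- A bound, uniform in `n` and in r ≤ 1, for the oscillation and the squared error on the good
  -- event. The threshold n₂ makes log n exceed what the final check then needs.
  set N₁ : ℝ := Ct * (C₁ * (4 / γ) ^ 4 + 1) with hN₁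
  have hN₁0 : 0 ≤ N₁ := by positivity
  set n₂ : ℕ := max n₀ ⌈Real.exp (2 * N₁ + 1 + L')⌉₊ with hn₂
  set U : ℝ := 2 * CX * (3 + (1 + 3 * L') ^ 2) with hU
  have hU0 : 0 ≤ U := by positivity
  set G : ℝ := 4 * CX * Ct * (C₁ + 1) with hG
  have hG0 : 0 ≤ G := by positivity
  refine ⟨243 * G + 243 * U * C₁ + 243 * U + 243 * U * (n₂ : ℝ) ^ γ + 1, by positivity,
    fun n hn P hP hPCX hPcX ν hν hsub f hf hfm r hr ↦ ?_⟩
  have hn0 : 0 < n := by omega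
  have hn' : (0 : ℝ) < n := by exact_mod_cast hn0
  have hn1 : (1 : ℝ) ≤ n := by exact_mod_cast hn0
  have hlog3 := one_le_three_mul_log hn
  set l : ℝ := Real.log n with hl
  have hl0 : 0 < l := by linarith
  -- Since 3 log n ≥ 1 for n ≥ 2, lower powers of the logarithm are bounded by the fifth; 243 = 3⁵
  -- serves for all of them.
  have hp1 : l ^ 2 ≤ 243 * l ^ 5 := by
    have : 1 ≤ (3 * l) ^ 3 := one_le_pow₀ hlog3
    nlinarith [mul_le_mul_of_nonneg_left this (sq_nonneg l), pow_pos hl0 5]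
  have hp2 : l ^ 3 ≤ 243 * l ^ 5 := by
    have : 1 ≤ (3 * l) ^ 2 := one_le_pow₀ hlog3
    nlinarith [mul_le_mul_of_nonneg_left this (pow_pos hl0 3).le, pow_pos hl0 5]
  have hp3 : l ^ 4 ≤ 243 * l ^ 5 := by
    nlinarith [mul_le_mul_of_nonneg_left hlog3 (pow_pos hl0 4).le, pow_pos hl0 5]
  have hp4 : 1 ≤ 243 * l ^ 5 := by
    have : 1 ≤ (3 * l) ^ 5 := one_le_pow₀ hlog3
    linarith [mul_pow 3 l 5]
  obtain ⟨hfL, hfnorm⟩ := eLpNorm_le_of_mem_sobolevBall hs0.le hf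
  set a : ℝ := 2 * min 1 s with ha
  set ρ : ℝ := (n : ℝ) ^ (-(2 * s) / (2 * s + d)) with hρ
  have hργ : ρ = (n : ℝ) ^ (-γ) := by rw [hρ, hγ, neg_div]
  have hρ0 : 0 < ρ := by positivity
  have ha0 : 0 < a := by
    rw [ha]
    have := lt_min one_pos hs0
    linarith
  set Q := Measure.pi fun _ : Fin n ↦ P.prod ν
  set R : (Fin n → cube d × ℝ) → ℝ≥0∞ := fun ω ↦ ∫⁻ x, (⨆ (x' : cube d) (_ : dist x' x ≤ r),
    ENNReal.ofReal (|adaptiveEstimator smin S r T (observe f ω) x' - f x| ^ 2)) ∂P with hR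
  have hmem : ∀ ω : Fin n → cube d × ℝ,
      krr S (lepskiValue smin S (observe f ω)) (observe f ω) ∈ rkhs d S := fun ω ↦
    (krr_spec hS (lepskiValue_pos hn0 _) _).1
  -- A deterministic bound from the final check. It pays for large `r`, for small `n`, and for the
  -- exceptional event.
  have hRU : ∀ ω, R ω ≤ ENNReal.ofReal (U * l ^ 2) := by
    intro ω
    obtain ⟨-, -, hFm⟩ := hCt f hf hfL _ (hmem ω) r hr
    have hm := measurable_adaptiveEstimator (observe f ω) hFm
    refine (lintegral_sup_le hPCX hm hfm r).trans ?_
    have hb := boundCheck_bound n r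
      (freqTruncate r (T (toL2 (krr S (lepskiValue smin S (observe f ω)) (observe f ω)))))
    change (∫⁻ x, ⨆ (x' : cube d) (_ : dist x' x ≤ r), ENNReal.ofReal
      (|adaptiveEstimator smin S r T (observe f ω) x' -
        adaptiveEstimator smin S r T (observe f ω) x| ^ 2)) +
      eLpNorm (adaptiveEstimator smin S r T (observe f ω)) 2 volume ≤ ENNReal.ofReal l at hb
    have h1 := le_self_add.trans hb
    have h2 := le_add_self.trans hb
    have h3 : eLpNorm (adaptiveEstimator smin S r T (observe f ω) - f) 2 volume ≤
        ENNReal.ofReal (l + L') := by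
      rw [ENNReal.ofReal_add hl0.le hL'0.le]
      exact (eLpNorm_sub_le hm.aestronglyMeasurable hfm.aestronglyMeasurable (by norm_num)).trans
        (add_le_add h2 hfnorm)
    calc _ ≤ 2 * (CX : ℝ≥0∞) * (ENNReal.ofReal l + ENNReal.ofReal (l + L') ^ 2) :=
          mul_le_mul_right (add_le_add h1 (pow_le_pow_left' h3 2)) _
      _ = ENNReal.ofReal (2 * CX * (l + (l + L') ^ 2)) := by
          rw [← ENNReal.ofReal_pow (by positivity), ← ENNReal.ofReal_add hl0.le (by positivity),
            ENNReal.ofReal_mul (by positivity), ENNReal.ofReal_mul zero_le_two,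
            ENNReal.ofReal_ofNat, ENNReal.ofReal_coe_nnreal]
      _ ≤ _ := by
          refine ENNReal.ofReal_le_ofReal ?_
          rw [hU, mul_assoc (2 * (CX : ℝ))]
          refine mul_le_mul_of_nonneg_left ?_ (by positivity)
          have h4 : l ≤ 3 * l ^ 2 := by nlinarith
          have h5 : (l + L') ^ 2 ≤ ((1 + 3 * L') * l) ^ 2 := by
            refine pow_le_pow_left₀ (by positivity) ?_ 2
            nlinarith
          rw [mul_pow] at h5
          linarith
  have hconst : 0 ≤ 243 * G + 243 * U * C₁ + 243 * U + 243 * U * (n₂ : ℝ) ^ γ + 1 := by positivity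
  have hcrude : l ^ 2 * U ≤ (243 * U) * l ^ 5 := by nlinarith
  have htrivial : ∫⁻ ω, R ω ∂Q ≤ ENNReal.ofReal (U * l ^ 2) := by
    calc _ ≤ ∫⁻ _, ENNReal.ofReal (U * l ^ 2) ∂Q := lintegral_mono hRU
      _ = _ := by simp
  have hra : 0 ≤ r ^ a := by positivity
  have hUn : 0 ≤ 243 * U * (n₂ : ℝ) ^ γ := by positivity
  have hl5 : 0 < l ^ 5 := by positivity
  rcases lt_or_ge 1 r with hr1 | hr1
  · refine htrivial.trans (ENNReal.ofReal_le_ofReal ?_)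
    have h1 : 1 ≤ r ^ a + ρ := by
      have := Real.one_le_rpow hr1.le ha0.le
      linarith
    calc U * l ^ 2 ≤ (243 * U) * 1 * l ^ 5 := by linarith
      _ ≤ (243 * G + 243 * U * C₁ + 243 * U + 243 * U * (n₂ : ℝ) ^ γ + 1) * (r ^ a + ρ) * l ^ 5 := by
          refine mul_le_mul_of_nonneg_right (mul_le_mul ?_ h1 zero_le_one hconst) hl5.le
          have : 0 ≤ 243 * G + 243 * U * C₁ := by positivity
          linarith
  rcases lt_or_ge n n₂ with hnn | hnn
  · refine htrivial.trans (ENNReal.ofReal_le_ofReal ?_)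
    have h1 : 1 ≤ (n₂ : ℝ) ^ γ * ρ := by
      rw [hργ, Real.rpow_neg hn'.le, ← div_eq_mul_inv, one_le_div (by positivity)]
      exact Real.rpow_le_rpow hn'.le (by exact_mod_cast hnn.le) hγ0.le
    calc U * l ^ 2 ≤ (243 * U) * 1 * l ^ 5 := by linarith
      _ ≤ (243 * U) * ((n₂ : ℝ) ^ γ * (r ^ a + ρ)) * l ^ 5 := by
          refine mul_le_mul_of_nonneg_right (mul_le_mul_of_nonneg_left ?_ (by positivity)) hl5.le
          refine h1.trans (mul_le_mul_of_nonneg_left (by linarith) (by positivity))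
      _ = 243 * U * (n₂ : ℝ) ^ γ * (r ^ a + ρ) * l ^ 5 := by ring
      _ ≤ _ := by
          refine mul_le_mul_of_nonneg_right (mul_le_mul_of_nonneg_right ?_ (by positivity)) hl5.le
          have : 0 ≤ 243 * G + 243 * U * C₁ + 243 * U := by positivity
          linarith
  have hra1 : r ^ a ≤ 1 := Real.rpow_le_one hr hr1 ha0.le
  have hlogn : 2 * N₁ + 1 + L' ≤ l := by
    rw [hl, Real.le_log_iff_exp_le hn']
    exact (Nat.le_ceil _).trans (by exact_mod_cast (le_max_right _ _).trans hnn)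
  set B : Set (Fin n → cube d × ℝ) := {ω | ENNReal.ofReal (C₁ * (l ^ 4 * ρ)) <
    eLpNorm (krr S (lepskiValue smin S (observe f ω)) (observe f ω) - f) 2 volume ^ 2} with hB
  have hQB : Q B ≤ ENNReal.ofReal (C₁ * (l * ρ)) :=
    hC₁ n hn ((le_max_left _ _).trans hnn) P hP hPCX hPcX ν hν hsub f hf hfm hfL
  have hl4ρ : l ^ 4 * ρ ≤ (4 / γ) ^ 4 := by
    rw [hργ, hl]
    exact log_pow_four_mul_rpow_le hn1 hγ0
  have hgood : ∀ ω, ω ∉ B → R ω ≤ ENNReal.ofReal (G * (l ^ 4 * ρ + r ^ a)) := by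
    intro ω hω
    rw [hB, mem_ofPred_eq, not_lt] at hω
    obtain ⟨hosc, hbias, hFm⟩ := hCt f hf hfL _ (hmem ω) r hr
    set F := freqTruncate r (T (toL2 (krr S (lepskiValue smin S (observe f ω)) (observe f ω)))) with hF
    have hX : (Ct : ℝ≥0∞) * (eLpNorm (krr S (lepskiValue smin S (observe f ω)) (observe f ω) - f)
        2 volume ^ 2 + ENNReal.ofReal (r ^ a)) ≤
        ENNReal.ofReal (Ct * (C₁ * (l ^ 4 * ρ) + r ^ a)) := by
      rw [ENNReal.ofReal_mul (by positivity), ENNReal.ofReal_coe_nnreal,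
        ENNReal.ofReal_add (by positivity) hra]
      exact mul_le_mul_right (add_le_add hω le_rfl) _
    set X : ℝ := Ct * (C₁ * (l ^ 4 * ρ) + r ^ a) with hXdef
    have hX0 : 0 ≤ X := by positivity
    have hXN : X ≤ N₁ := by
      rw [hXdef, hN₁]
      gcongr
    have hosc' := hosc.trans hX
    have hbias' := hbias.trans hX
    -- On the good event and for large `n` the check passes, so the truncated estimate is not
    -- replaced by zero and its sharp bound applies.
    have hcheck : (∫⁻ x, ⨆ (x' : cube d) (_ : dist x' x ≤ r), ENNReal.ofReal (|F x' - F x| ^ 2)) +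
        eLpNorm F 2 volume ≤ ENNReal.ofReal (Real.log n) := by
      have h1 : eLpNorm F 2 volume ≤ ENNReal.ofReal (1 + X + L') := by
        have h2 : F = (F - f) + f := by
          rw [sub_add_cancel]
        rw [h2, ENNReal.ofReal_add (by positivity) hL'0.le, ENNReal.ofReal_add zero_le_one hX0,
          ENNReal.ofReal_one]
        refine (eLpNorm_add_le (hFm.sub hfm).aestronglyMeasurable hfm.aestronglyMeasurable
          (by norm_num)).trans (add_le_add ?_ hfnorm)
        exact (ennreal_le_one_add_sq _).trans (add_le_add le_rfl hbias')
      refine (add_le_add hosc' h1).trans ?_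
      rw [← ENNReal.ofReal_add hX0 (by positivity)]
      exact ENNReal.ofReal_le_ofReal (by linarith)
    have hest : adaptiveEstimator smin S r T (observe f ω) = F := if_pos hcheck
    have h5 := lintegral_sup_le hPCX hFm hfm r
    simp only [hR, hest]
    refine h5.trans ((mul_le_mul_right (add_le_add hosc' hbias') _).trans ?_)
    rw [← ENNReal.ofReal_add hX0 hX0, ← ENNReal.ofReal_coe_nnreal (p := CX),
      ← ENNReal.ofReal_ofNat 2, ← ENNReal.ofReal_mul zero_le_two, ← ENNReal.ofReal_mul (by positivity)]
    refine ENNReal.ofReal_le_ofReal ?_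
    rw [hXdef, hG]
    have h6 : C₁ * (l ^ 4 * ρ) + r ^ a ≤ (C₁ + 1) * (l ^ 4 * ρ + r ^ a) := by
      have h7 : 0 ≤ l ^ 4 * ρ := by positivity
      have h8 : 0 ≤ C₁ * r ^ a := by positivity
      nlinarith
    calc 2 * (CX : ℝ) * (Ct * (C₁ * (l ^ 4 * ρ) + r ^ a) + Ct * (C₁ * (l ^ 4 * ρ) + r ^ a))
        = 4 * CX * Ct * (C₁ * (l ^ 4 * ρ) + r ^ a) := by ring
      _ ≤ 4 * CX * Ct * ((C₁ + 1) * (l ^ 4 * ρ + r ^ a)) := by gcongr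
      _ = _ := by ring
  -- The bad event is defined through the selected minimizer, whose measurability is not
  -- established. It is enlarged to a measurable hull of the same measure, which an upper bound
  -- permits.
  calc ∫⁻ ω, R ω ∂Q ≤ ∫⁻ ω, (ENNReal.ofReal (G * (l ^ 4 * ρ + r ^ a)) +
        (toMeasurable Q B).indicator (fun _ ↦ ENNReal.ofReal (U * l ^ 2)) ω) ∂Q := by
        refine lintegral_mono fun ω ↦ ?_
        by_cases hω : ω ∈ toMeasurable Q B
        · simp only [indicator_of_mem hω]
          exact (hRU ω).trans le_add_self
        · exact (hgood ω fun h ↦ hω (subset_toMeasurable Q B h)).trans le_self_add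
    _ = ENNReal.ofReal (G * (l ^ 4 * ρ + r ^ a)) + ENNReal.ofReal (U * l ^ 2) * Q B := by
        rw [lintegral_add_left measurable_const, lintegral_const, measure_univ, mul_one,
          lintegral_indicator_const (measurableSet_toMeasurable Q B), measure_toMeasurable]
    _ ≤ ENNReal.ofReal (G * (l ^ 4 * ρ + r ^ a)) +
          ENNReal.ofReal (U * l ^ 2) * ENNReal.ofReal (C₁ * (l * ρ)) :=
        add_le_add le_rfl (mul_le_mul_right hQB _)
    _ = ENNReal.ofReal (G * (l ^ 4 * ρ + r ^ a) + U * l ^ 2 * (C₁ * (l * ρ))) := by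
        rw [← ENNReal.ofReal_mul (by positivity), ← ENNReal.ofReal_add (by positivity) (by positivity)]
    _ ≤ _ := by
        refine ENNReal.ofReal_le_ofReal ?_
        have h1 : l ^ 4 * ρ + r ^ a ≤ 243 * l ^ 5 * (r ^ a + ρ) := by
          have h2 := mul_le_mul_of_nonneg_right hp3 hρ0.le
          have h3 := mul_le_mul_of_nonneg_right hp4 hra
          linarith
        have h4 : l ^ 2 * (l * ρ) ≤ 243 * l ^ 5 * (r ^ a + ρ) := by
          have h2 := mul_le_mul_of_nonneg_right hp2 hρ0.le
          have h3 : 0 ≤ 243 * l ^ 5 * r ^ a := by positivity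
          linarith [mul_assoc (l ^ 2) l ρ, pow_succ l 2]
        calc G * (l ^ 4 * ρ + r ^ a) + U * l ^ 2 * (C₁ * (l * ρ))
            = G * (l ^ 4 * ρ + r ^ a) + U * C₁ * (l ^ 2 * (l * ρ)) := by ring
          _ ≤ G * (243 * l ^ 5 * (r ^ a + ρ)) + U * C₁ * (243 * l ^ 5 * (r ^ a + ρ)) := by
              gcongr
          _ = (243 * G + 243 * U * C₁) * (r ^ a + ρ) * l ^ 5 := by ring
          _ ≤ _ := by
              refine mul_le_mul_of_nonneg_right (mul_le_mul_of_nonneg_right ?_ (by positivity)) hl5.le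
              have : 0 ≤ 243 * U := by positivity
              linarith

end Main

/-! ### The law of the sample -/

section SampleLaw

variable {d : ℕ}

/-- Elements of the Sobolev ball are arbitrary functions on the cube, not necessarily measurable.
Since the law depends only on the class modulo null sets, a measurable representative can be
substituted. -/
theorem sampleLaw_congr {P : Measure (cube d)} {ν : Measure ℝ} [SFinite ν]
    [IsProbabilityMeasure P] {f f' : cube d → ℝ} (h : f =ᵐ[P] f') :
    sampleLaw P ν f = sampleLaw P ν f' := by
  refine Measure.map_congr ?_
  filter_upwards [Measure.quasiMeasurePreserving_fst.ae h] with p hp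
  rw [hp]

theorem pi_sampleLaw (n : ℕ) {P : Measure (cube d)} [IsProbabilityMeasure P] {ν : Measure ℝ}
    [IsProbabilityMeasure ν] {f : cube d → ℝ} (hf : Measurable f) :
    (Measure.pi fun _ : Fin n ↦ sampleLaw P ν f) =
      (Measure.pi fun _ : Fin n ↦ P.prod ν).map (observe f) := by
  let φ : cube d × ℝ → cube d × ℝ := fun p ↦ (p.1, f p.1 + p.2)
  have hm : Measurable φ :=
    measurable_fst.prodMk ((hf.comp measurable_fst).add measurable_snd)
  have hσ : ∀ _ : Fin n, SigmaFinite ((P.prod ν).map φ) := by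
    intro _
    exact IsFiniteMeasure.toSigmaFinite _
  exact (Measure.pi_map_pi (μ := fun _ : Fin n ↦ P.prod ν) (f := fun _ ↦ φ) (hμ := hσ)
    fun _ ↦ hm.aemeasurable).symm

end SampleLaw

end AdvKRR

end

theorem theorem3p5 (d : ℕ) (hd : 1 ≤ d) (smin smax : ℝ) (hmin : 0 < smin) (hle : smin ≤ smax)
    (hmax : (d : ℝ) / 2 < smax) :
    (∃ T : Lp ℝ 2 (volume : Measure (AdvKRR.cube d)) →ₗ[ℝ]
        Lp ℝ 2 (volume : Measure (EuclideanSpace ℝ (Fin d))), AdvKRR.IsSobolevExtension smax T) ∧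
    ∀ T : Lp ℝ 2 (volume : Measure (AdvKRR.cube d)) →ₗ[ℝ]
        Lp ℝ 2 (volume : Measure (EuclideanSpace ℝ (Fin d))), AdvKRR.IsSobolevExtension smax T →
      ∀ s ∈ Icc smin smax, ∀ L : ℝ, 0 < L → ∀ σ : ℝ≥0, ∀ cX CX : ℝ, 0 < cX →
        ∃ C : ℝ, 0 < C ∧
          ∀ p : AdvKRR.cube d → ℝ, Measurable p → (∀ x, cX ≤ p x ∧ p x ≤ CX) →
          ∀ P : Measure (AdvKRR.cube d), IsProbabilityMeasure P →
            P = volume.withDensity (fun x ↦ ENNReal.ofReal (p x)) →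
          ∀ ν : Measure ℝ, IsProbabilityMeasure ν → ∫ y, y ∂ν = 0 →
            HasSubgaussianMGF (fun y : ℝ ↦ y) (σ ^ 2) ν →
          ∀ n : ℕ, 2 ≤ n → ∀ r : ℝ, 0 ≤ r →
            (⨆ f ∈ AdvKRR.sobolevBall d s L,
                AdvKRR.advRisk (n := n) P ν r (AdvKRR.adaptiveEstimator smin smax r T) f) ≤
              ENNReal.ofReal (C * (r ^ (2 * min 1 s) + (n : ℝ) ^ (-(2 * s) / (2 * s + d))) *
                Real.log n ^ 5) := by
  refine ⟨AdvKRR.exists_isSobolevExtension d smax, fun T hT s hs L _ σ cX CX hcX ↦ ?_⟩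
  obtain ⟨C, hC0, hC⟩ := AdvKRR.exists_risk_bound hT hd hmax hmin hs.1 hs.2 L σ CX.toNNReal hcX
  refine ⟨C, hC0, fun p hp hpb P hP hPp ν hν _ hsub n hn r hr ↦ iSup₂_le fun f hf ↦ ?_⟩
  have hPCX : P ≤ CX.toNNReal • volume := by
    rw [hPp]
    calc volume.withDensity (fun x ↦ ENNReal.ofReal (p x))
        ≤ volume.withDensity (fun _ ↦ (CX.toNNReal : ℝ≥0∞)) :=
          withDensity_mono (Filter.Eventually.of_forall fun x ↦ ENNReal.ofReal_le_ofReal (hpb x).2)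
      _ = _ := by
          rw [withDensity_const]
          rfl
  have hPcX : ENNReal.ofReal cX • volume ≤ P := by
    rw [hPp, ← withDensity_const]
    exact withDensity_mono
      (Filter.Eventually.of_forall fun x ↦ ENNReal.ofReal_le_ofReal (hpb x).1)
  have hac : P ≪ volume := by
    rw [hPp]
    exact withDensity_absolutelyContinuous _ _
  -- The restriction of an L² extension is a measurable representative of `f`. It lies in the same
  -- Sobolev ball and agrees with `f` almost surely under the design law, as `P` has a density.
  obtain ⟨g, hgf, -⟩ := AdvKRR.exists_extension_of_mem_sobolevBall hf
  set f' : AdvKRR.cube d → ℝ := fun x ↦ g (x : EuclideanSpace ℝ (Fin d)) with hf'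
  have hf'm : Measurable f' :=
    (Lp.stronglyMeasurable g).measurable.comp measurable_subtype_coe
  have hff' : f =ᵐ[volume] f' := hgf.symm
  have hf'b : f' ∈ AdvKRR.sobolevBall d s L := by
    change AdvKRR.cubeSobolevNorm s f' ≤ _
    rw [← AdvKRR.cubeSobolevNorm_congr hff']
    exact hf
  have hffP : f =ᵐ[P] f' := hac.ae_eq hff'
  rw [AdvKRR.advRisk, AdvKRR.sampleLaw_congr hffP, AdvKRR.pi_sampleLaw n hf'm]
  -- For an upper bound, the change of variables requires no measurability of the risk as a function
  -- of the data.
  refine (lintegral_map_le _ _).trans (le_trans (le_of_eq ?_)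
    (hC n hn P hP hPCX hPcX ν hν hsub f' hf'b hf'm r hr))
  refine lintegral_congr fun ω ↦ lintegral_congr_ae ?_
  filter_upwards [hffP] with x hx
  rw [hx]
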